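/- Let $M$ be a smooth manifold with local coordinates $x^i$, and let $E\to M$ be a smooth real vector bundle of finite rank. Let $\mathcal M=T^*[3]E[1]$, with canonical coordinates $(x^i,q^a,p_a,\xi_i)$ of degrees $0,1,2,3$. Here a local frame $e_a$ of $E$ is fixed, $p_a$ corresponds to $e_a$ and $q^a$ to the dual frame, and $\xi_i$ is conjugate to $x^i$. If $e_b=t^a{}_b e'_a$ and $e'_a=u^b{}_a e_b$, the coordinates change by $$q'^a=t^a{}_b q^b,\qquad p'_a=u^b{}_a p_b,\qquad \xi'_i=\frac{\partial x^j}{\partial x'^i}\xi_j+\frac{\partial u^b{}_a}{\partial x'^i}t^a{}_c\,p_b q^c .$$ The Poisson bracket is $$\{F,G\}=F\tfrac{\overleftarrow\partial}{\partial x^i}\tfrac{\overrightarrow\partial}{\partial \xi_i}G-F\tfrac{\overleftarrow\partial}{\partial \xi_i}\tfrac{\overrightarrow\partial}{\partial x^i}G+F\tfrac{\overleftarrow\partial}{\partial q^a}\tfrac{\overrightarrow\partial}{\partial p_a}G-F\tfrac{\overleftarrow\partial}{\partial p_a}\tfrac{\overrightarrow\partial}{\partial q^a}G .$$ The monomial $\xi^ip^jq^k$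 has degree $3i+2j+k$ and bidegree $(2(i+j),i+k)$. In this way $\Gamma E=C^{2,0}(\mathcal M)$ and $\Gamma E^*=C^{0,1}(\mathcal M)$. (1) The functions of degree $4$ are exactly the sums $\Theta=\theta_2+\theta_{13}+\theta_4$ of functions of bidegrees $(4,0)$, $(2,2)$, $(0,4)$, and these components are unique. In canonical coordinates $$\theta_2=\tfrac12 f_2{}^{ab}p_ap_b,\quad \theta_{13}=f_1{}^i{}_a\xi_iq^a+\tfrac12 f_3{}^a{}_{bc}p_aq^bq^c,\quad \theta_4=\tfrac1{4!}f_{4\,abcd}q^aq^bq^cq^d,$$ for unique smooth $f_1,\dots,f_4$ on the coordinate domain such that $f_2$ is symmetric, $f_3$ is skew in $b,c$, and $f_4$ is totally skew. (2) $\{\Theta,\Theta\}=0$ holds if and only if (tc1) $\{\theta_{13},\theta_2\}=0$, (tc2) $\tfrac12\{\theta_{13},\theta_{13}\}+\{\theta_2,\theta_4\}=0$ and (tc3) $\{\theta_{13},\theta_4\}=0$, hence if and only if the following hold in all canonical coordinates: (fc1) $f_1{}^i{}_bf_2{}^{ba}=0$; (fc2) $f_1{}^k{}_c\partial_kf_2{}^{ab}+f_2{}^{da}f_3{}^b{}_{cd}+f_2{}^{db}f_3{}^a{}_{cd}=0$;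 (fc3) $f_1{}^k{}_b\partial_kf_1{}^i{}_a-f_1{}^k{}_a\partial_kf_1{}^i{}_b+f_1{}^i{}_cf_3{}^c{}_{ab}=0$; (fc4) $f_1{}^k{}_{[d}\partial_kf_3{}^a{}_{bc]}+f_2{}^{ae}f_{4\,bcde}-f_3{}^a{}_{e[b}f_3{}^e{}_{cd]}=0$; (fc5) $f_1{}^k{}_{[a}\partial_kf_{4\,bcde]}+f_3{}^f{}_{[ab}f_{4\,cde]f}=0$. Here $[\cdots]$ is the signed sum over the essentially different permutations of the enclosed free indices (those not related by the skew-symmetries of $f_3$, $f_4$). In each coordinate system (tc1) $\Leftrightarrow$ (fc1), (fc2); (tc2) $\Leftrightarrow$ (fc3), (fc4); and (tc3) $\Leftrightarrow$ (fc5). (3) There are unique operations on $E$, namely a skew-symmetric $\mathbb R$-bilinear bracket on $\Gamma E$, a smooth bundle map $\rho:E\to TM$, a smooth symmetric bundle map $\partial:E^*\to E$ and a smooth $4$-form $\Omega$ on $E$, with $$[e_1,e_2]=\{\{\theta_{13},e_1\},e_2\},\qquad \rho(e)(f)=\{\{\theta_{13},e\},f\},$$ $$(\alpha_1,\alpha_2):=\langle\partial\alpha_1,\alpha_2\rangle=\{\{\theta_2,\alpha_1\},\alpha_2\},\qquad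 \Omega(e_1,\dots,e_4)=\{\{\{\{\theta_4,e_1\},e_2\},e_3\},e_4\}.$$ Put $\langle\mathcal L_e\alpha,e'\rangle=\rho(e)\langle\alpha,e'\rangle-\langle\alpha,[e,e']\rangle$ and $$-\delta\Omega(e_0,\dots,e_4)=\sum_i(-1)^i\rho(e_i)\big(\Omega(\dots,\widehat{e_i},\dots)\big)+\sum_{i<j}(-1)^{i+j}\Omega([e_i,e_j],\dots,\widehat{e_i},\dots,\widehat{e_j},\dots).$$ For the operations derived from $(\theta_2,\theta_{13},\theta_4)$ these are the derived operations $\mathcal L_e\alpha=\{\{\theta_{13},e\},\alpha\}$ and $\delta\Omega=\{\theta_{13},\theta_4\}$ (evaluated on $e_0,\dots,e_4$ by successive brackets). Consider the axioms (A1) $[e_1,fe_2]=f[e_1,e_2]+\rho(e_1)(f)e_2$; (A2) $[[e_1,e_2],e_3]+(\text{cyclic permutations})=\partial\Omega(e_1,e_2,e_3)$; (A3) $\rho\,\partial=0$; (A4) $\rho(e)(\alpha_1,\alpha_2)=(\mathcal L_e\alpha_1,\alpha_2)+(\alpha_1,\mathcal L_e\alpha_2)$; (A5) $\delta\Omega=0$.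 The derived operations always satisfy (A1), and (tc1) $\Leftrightarrow$ (A3) and (A4), (tc2) $\Leftrightarrow$ (A2), (tc3) $\Leftrightarrow$ (A5). Hence $\{\Theta,\Theta\}=0$ if and only if (A1)-(A5) hold, and in that case also $\rho[e_1,e_2]=[\rho(e_1),\rho(e_2)]$. (4) $\Theta\mapsto([\cdot,\cdot],\rho,\partial,\Omega)$ is a bijection from the set of functions $\Theta$ of degree $4$ on $\mathcal M$ with $\{\Theta,\Theta\}=0$ onto the set of operations on $E$ (of the kinds listed in (3)) that satisfy (A1)-(A5). -/

import Mathlib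

open scoped Manifold ContDiff TensorProduct
open Bundle Module

noncomputable section

namespace QP3

/-! ### The fibre algebra `S(V)` -/

/-- Polynomials in the even generators `p_a` tensored with the exterior algebra on the odd
generators `ξ_i` (indices `Sum.inl i`) and `q^a` (indices `Sum.inr a`). -/
abbrev FibTensor (d r : ℕ) : Type :=
  MvPolynomial (Fin r) ℝ ⊗[ℝ] ExteriorAlgebra ℝ (Fin d ⊕ Fin r → ℝ)

/-- The graded commutative algebra `S(V)` on even generators `p_a` (degree 2) and odd generators
`ξ_i` (degree 3) and `q^a` (degree 1). -/
def FibAlg (d r : ℕ) : Type := FibTensor d r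

instance (d r : ℕ) : Ring (FibAlg d r) := inferInstanceAs (Ring (FibTensor d r))

instance (d r : ℕ) : Algebra ℝ (FibAlg d r) := inferInstanceAs (Algebra ℝ (FibTensor d r))

section FibreAlgebra

variable {d r : ℕ}

/-- The linear inclusion of `ℝ[p] ⊗ span (ξ, q)`, the elements linear in the odd generators. -/
def oddIncl (d r : ℕ) :
    MvPolynomial (Fin r) ℝ ⊗[ℝ] (Fin d ⊕ Fin r → ℝ) →ₗ[ℝ] FibTensor d r :=
  LinearMap.lTensor _ (ExteriorAlgebra.ι ℝ)

lemma oddIncl_anticomm (y z : MvPolynomial (Fin r) ℝ ⊗[ℝ] (Fin d ⊕ Fin r → ℝ)) :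
    oddIncl d r y * oddIncl d r z + oddIncl d r z * oddIncl d r y = 0 := by
  induction y using TensorProduct.induction_on with
  | zero => simp
  | add y₁ y₂ h₁ h₂ =>
    rw [map_add, add_mul, mul_add, add_add_add_comm, h₁, h₂, add_zero]
  | tmul P v =>
    induction z using TensorProduct.induction_on with
    | zero => simp
    | add z₁ z₂ h₁ h₂ =>
      rw [map_add, add_mul, mul_add, add_add_add_comm, h₁, h₂, add_zero]
    | tmul P' w =>
      simp only [oddIncl, LinearMap.lTensor_tmul, Algebra.TensorProduct.tmul_mul_tmul]
      rw [mul_comm P' P, ← TensorProduct.tmul_add, ExteriorAlgebra.ι_add_mul_swap,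
        TensorProduct.tmul_zero]

lemma oddIncl_sq (y : MvPolynomial (Fin r) ℝ ⊗[ℝ] (Fin d ⊕ Fin r → ℝ)) :
    oddIncl d r y * oddIncl d r y = 0 := by
  have h := oddIncl_anticomm y y
  rw [← two_smul ℝ] at h
  exact (smul_eq_zero.mp h).resolve_left two_ne_zero

lemma commute_even (P : MvPolynomial (Fin r) ℝ) (W : FibTensor d r) :
    Commute (P ⊗ₜ[ℝ] (1 : ExteriorAlgebra ℝ (Fin d ⊕ Fin r → ℝ))) W := by
  induction W using TensorProduct.induction_on with
  | zero => exact Commute.zero_right _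
  | add a b ha hb => exact ha.add_right hb
  | tmul P' w => simp [Commute, SemiconjBy, Algebra.TensorProduct.tmul_mul_tmul, mul_comm]

/-- The algebra endomorphism of `S(V)` with `p_a ↦ ∑ b, u b a p_b`,
`q^a ↦ ∑ b, t a b q^b` and `ξ_i ↦ ∑ j, J i j ξ_j + ∑ b c, B i b c p_b q^c`. -/
def substTensor (u t : Fin r → Fin r → ℝ) (J : Fin d → Fin d → ℝ)
    (B : Fin d → Fin r → Fin r → ℝ) : FibTensor d r →ₐ[ℝ] FibTensor d r :=
  Algebra.TensorProduct.lift
    (Algebra.TensorProduct.includeLeft.comp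
      (MvPolynomial.aeval fun a => ∑ b, u b a • (MvPolynomial.X b : MvPolynomial (Fin r) ℝ)))
    (ExteriorAlgebra.lift ℝ ⟨oddIncl d r ∘ₗ Fintype.linearCombination ℝ
      (Sum.elim
        (fun i => ∑ j, J i j • ((1 : MvPolynomial (Fin r) ℝ) ⊗ₜ[ℝ]
              (Pi.single (Sum.inl j) 1 : Fin d ⊕ Fin r → ℝ))
          + ∑ b, ∑ c, B i b c • ((MvPolynomial.X b : MvPolynomial (Fin r) ℝ) ⊗ₜ[ℝ]
              (Pi.single (Sum.inr c) 1 : Fin d ⊕ Fin r → ℝ)))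
        (fun a => ∑ b, t a b • ((1 : MvPolynomial (Fin r) ℝ) ⊗ₜ[ℝ]
              (Pi.single (Sum.inr b) 1 : Fin d ⊕ Fin r → ℝ)))),
      fun _ => oddIncl_sq _⟩)
    (fun _ _ => commute_even _ _)

/-- The same substitution, as an endomorphism of `S(V)`. -/
def subst (u t : Fin r → Fin r → ℝ) (J : Fin d → Fin d → ℝ)
    (B : Fin d → Fin r → Fin r → ℝ) : FibAlg d r →ₐ[ℝ] FibAlg d r :=
  substTensor u t J B

/-- The even generator `p_a`. -/
def pFib (a : Fin r) : FibAlg d r := (MvPolynomial.X a ⊗ₜ 1 : FibTensor d r)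

/-- The odd generators: `oddFib (Sum.inl i) = ξ_i` and `oddFib (Sum.inr a) = q^a`. -/
def oddFib (k : Fin d ⊕ Fin r) : FibAlg d r :=
  (1 ⊗ₜ ExteriorAlgebra.ι ℝ (Pi.single k 1) : FibTensor d r)

/-- The derivative with respect to `p_a` on `S(V)`. -/
def dPFib (a : Fin r) : FibAlg d r →ₗ[ℝ] FibAlg d r :=
  (LinearMap.rTensor _ (MvPolynomial.pderiv a).toLinearMap : FibTensor d r →ₗ[ℝ] FibTensor d r)

/-- The left derivative with respect to an odd generator on `S(V)`. -/
def dLeftFib (k : Fin d ⊕ Fin r) : FibAlg d r →ₗ[ℝ] FibAlg d r :=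
  (LinearMap.lTensor _ (CliffordAlgebra.contractLeft (LinearMap.proj k)) :
    FibTensor d r →ₗ[ℝ] FibTensor d r)

/-- The right derivative with respect to an odd generator on `S(V)`. -/
def dRightFib (k : Fin d ⊕ Fin r) : FibAlg d r →ₗ[ℝ] FibAlg d r :=
  (LinearMap.lTensor _ ((CliffordAlgebra.contractRight (R := ℝ)).flip (LinearMap.proj k)) :
    FibTensor d r →ₗ[ℝ] FibTensor d r)

end FibreAlgebra

/-! ### Natural coordinates on `T*[3]E[1]` -/

/-- The coordinate vector `∂/∂x^i` of `ℝ^d`. -/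
abbrev stdVec {d : ℕ} (i : Fin d) : EuclideanSpace ℝ (Fin d) := EuclideanSpace.single i 1

variable {d : ℕ} {M : Type*} [TopologicalSpace M] [ChartedSpace (EuclideanSpace ℝ (Fin d)) M]
variable (F : Type*) [NormedAddCommGroup F] [NormedSpace ℝ F]
variable (E : M → Type*) [TopologicalSpace (TotalSpace F E)] [∀ x, TopologicalSpace (E x)]
  [∀ x, AddCommGroup (E x)] [∀ x, Module ℝ (E x)] [FiberBundle F E]

/-- The section `s` of `E`, not necessarily smooth elsewhere, is smooth on `U`. -/
def SmoothSecOn (s : ∀ x, E x) (U : Set M) : Prop :=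
  ContMDiffOn (𝓡 d) ((𝓡 d).prod 𝓘(ℝ, F)) ∞ (fun x => TotalSpace.mk' F x (s x)) U

/-- Data defining natural coordinates `(x, q, p, ξ)` on `T*[3]E[1]`: a smooth chart of `M` together
with a smooth local frame `e_a` of `E` over its domain. Then `p_a` is the fibre coordinate of
`E*[2]` defined by `e_a`, and `q^a` the one of `E[1]` defined by the dual frame. -/
structure NatChart where
  /-- the chart `x` of `M` -/
  chart : OpenPartialHomeomorph M (EuclideanSpace ℝ (Fin d))
  mem_atlas : chart ∈ IsManifold.maximalAtlas (𝓡 d) ∞ M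
  /-- the local frame `e_a` of `E` -/
  frame : Fin (finrank ℝ F) → ∀ x, E x
  isFrame : IsLocalFrameOn (𝓡 d) F ∞ frame chart.source

variable {F E}

namespace NatChart

variable (c : NatChart (d := d) F E)

/-- The domain of the coordinates, as an open subset of `M`. -/
def dom : TopologicalSpace.Opens M := ⟨c.chart.source, c.chart.open_source⟩

/-- `C^∞(U)`, where `U` is the domain of the coordinates. -/
abbrev Coeff : Type _ := C^∞⟮𝓡 d, c.dom; 𝓘(ℝ, ℝ), ℝ⟯

/-- The local functions on `T*[3]E[1]` over the domain `U` of the coordinates: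
`C^∞(U) ⊗ S(V)`. -/
abbrev Loc : Type _ := c.Coeff ⊗[ℝ] FibAlg d (finrank ℝ F)

variable {c} in
/-- The extension by zero to `M` of a function on `U`. -/
def ext (f : c.Coeff) : M → ℝ := Function.extend Subtype.val f 0

variable {c} in
lemma ext_apply (f : c.Coeff) (x : c.dom) : ext f x = f x :=
  Subtype.val_injective.extend_apply _ _ _

variable {c} in
lemma ext_contMDiffOn (f : c.Coeff) : ContMDiffOn (𝓡 d) 𝓘(ℝ, ℝ) ∞ (ext f) c.chart.source := by
  intro x hx
  have h : ContMDiffAt (𝓡 d) 𝓘(ℝ, ℝ) ∞ (fun y : c.dom => ext f y) ⟨x, hx⟩ := by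
    have e : (fun y : c.dom => ext f y) = f := funext fun y => ext_apply f y
    rw [e]
    exact f.contMDiff _
  exact (contMDiffAt_subtype_iff.mp h).contMDiffWithinAt

variable {c} in
lemma ext_contDiffOn [IsManifold (𝓡 d) ∞ M] (f : c.Coeff) :
    ContDiffOn ℝ ∞ (ext f ∘ c.chart.symm) c.chart.target := by
  rw [← contMDiffOn_iff_contDiffOn]
  exact (ext_contMDiffOn f).comp (contMDiffOn_symm_of_mem_maximalAtlas c.mem_atlas)
    (fun y hy => c.chart.map_target hy)

/-- The restriction to `U` of a function on `M` that is smooth on `U`. -/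
def restr (g : M → ℝ) (hg : ContMDiffOn (𝓡 d) 𝓘(ℝ, ℝ) ∞ g c.chart.source) : c.Coeff :=
  ⟨fun x => g x, fun x => contMDiffAt_subtype_iff.mpr
    (hg.contMDiffAt (c.chart.open_source.mem_nhds x.2))⟩

/-- The partial derivative `∂/∂x^i` on `C^∞(U)` in the chart. -/
def pd [IsManifold (𝓡 d) ∞ M] (i : Fin d) : c.Coeff →ₗ[ℝ] c.Coeff where
  toFun f := c.restr (fun x => fderiv ℝ (ext f ∘ c.chart.symm) (c.chart x) (stdVec i)) (by
    have h : ContDiffOn ℝ ∞ (fun y => fderiv ℝ (ext f ∘ c.chart.symm) y (stdVec i))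
        c.chart.target :=
      ((ext_contDiffOn f).fderiv_of_isOpen c.chart.open_target (by simp)).clm_apply
        contDiffOn_const
    exact (contMDiffOn_iff_contDiffOn.mpr h).comp
      (contMDiffOn_of_mem_maximalAtlas c.mem_atlas) (fun y hy => c.chart.map_source hy))
  map_add' f g := by
    ext x
    have hd : ∀ f : c.Coeff, DifferentiableAt ℝ (ext f ∘ c.chart.symm) (c.chart x) := fun f =>
      ((ext_contDiffOn f).differentiableOn (by simp)).differentiableAt
        (c.chart.open_target.mem_nhds (c.chart.map_source x.2))
    have e : ext (f + g) ∘ c.chart.symm = ext f ∘ c.chart.symm + ext g ∘ c.chart.symm := by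
      have : ext (f + g) = ext f + ext g := by
        funext y
        by_cases hy : y ∈ c.dom
        · exact (ext_apply (f + g) ⟨y, hy⟩).trans
            (congrArg₂ (· + ·) (ext_apply f ⟨y, hy⟩).symm (ext_apply g ⟨y, hy⟩).symm)
        · have hn : ¬ ∃ a : c.dom, (a : M) = y := by rintro ⟨a, rfl⟩; exact hy a.2
          simp [ext, Function.extend_apply' _ _ _ hn]
      rw [this]; rfl
    change fderiv ℝ (ext (f + g) ∘ c.chart.symm) (c.chart x) (stdVec i) =
      fderiv ℝ (ext f ∘ c.chart.symm) (c.chart x) (stdVec i) +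
      fderiv ℝ (ext g ∘ c.chart.symm) (c.chart x) (stdVec i)
    rw [e, fderiv_add (hd f) (hd g)]
    rfl
  map_smul' k f := by
    ext x
    have e : ext (k • f) ∘ c.chart.symm = k • (ext f ∘ c.chart.symm) := by
      have : ext (k • f) = k • ext f := by
        funext y
        by_cases hy : y ∈ c.dom
        · exact (ext_apply (k • f) ⟨y, hy⟩).trans
            (congrArg (k • ·) (ext_apply f ⟨y, hy⟩).symm)
        · have hn : ¬ ∃ a : c.dom, (a : M) = y := by rintro ⟨a, rfl⟩; exact hy a.2
          simp [ext, Function.extend_apply' _ _ _ hn]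
      rw [this]; rfl
    change fderiv ℝ (ext (k • f) ∘ c.chart.symm) (c.chart x) (stdVec i) =
      k • fderiv ℝ (ext f ∘ c.chart.symm) (c.chart x) (stdVec i)
    rw [e, fderiv_const_smul_field]
    rfl

/-- A coefficient function, as a local function on `T*[3]E[1]`. -/
def coef (f : c.Coeff) : c.Loc := f ⊗ₜ 1

/-- The coordinate function `p_a`. -/
def p (a : Fin (finrank ℝ F)) : c.Loc := 1 ⊗ₜ pFib a

/-- The coordinate function `q^a`. -/
def q (a : Fin (finrank ℝ F)) : c.Loc := 1 ⊗ₜ oddFib (Sum.inr a)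

/-- The coordinate function `ξ_i`. -/
def xi (i : Fin d) : c.Loc := 1 ⊗ₜ oddFib (Sum.inl i)

section Derivatives

/-- The derivative with respect to `x^i` (left and right agree). -/
def dX [IsManifold (𝓡 d) ∞ M] (i : Fin d) : c.Loc →ₗ[ℝ] c.Loc :=
  LinearMap.rTensor _ (c.pd i)

/-- The derivative with respect to `p_a` (left and right agree). -/
def dP (a : Fin (finrank ℝ F)) : c.Loc →ₗ[ℝ] c.Loc :=
  LinearMap.lTensor _ (dPFib a)

/-- The left derivative with respect to an odd coordinate (`ξ_i` or `q^a`). -/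
def dLeft (k : Fin d ⊕ Fin (finrank ℝ F)) : c.Loc →ₗ[ℝ] c.Loc :=
  LinearMap.lTensor _ (dLeftFib k)

/-- The right derivative with respect to an odd coordinate (`ξ_i` or `q^a`). -/
def dRight (k : Fin d ⊕ Fin (finrank ℝ F)) : c.Loc →ₗ[ℝ] c.Loc :=
  LinearMap.lTensor _ (dRightFib k)

/-- The Poisson bracket of the symplectic structure `δx^i δξ_i + δq^a δp_a`. -/
def bracket [IsManifold (𝓡 d) ∞ M] (G H : c.Loc) : c.Loc :=
  ∑ i, (c.dX i G * c.dLeft (Sum.inl i) H - c.dRight (Sum.inl i) G * c.dX i H) +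
  ∑ a, (c.dRight (Sum.inr a) G * c.dP a H - c.dP a G * c.dLeft (Sum.inr a) H)

end Derivatives

/-- The monomials `f ξ^i p^j q^k` with `i`, `j`, `k` the numbers of factors. -/
def monomials (i j k : ℕ) : Set c.Loc :=
  {G | ∃ (f : c.Coeff) (l : Fin i → Fin d) (m : Fin j → Fin (finrank ℝ F))
      (n : Fin k → Fin (finrank ℝ F)),
    G = c.coef f * (List.ofFn fun s => c.xi (l s)).prod *
      (List.ofFn fun s => c.p (m s)).prod * (List.ofFn fun s => c.q (n s)).prod}

/-- The evaluation of coefficient functions at `x ∈ U`. -/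
def evalCoeff (x : c.dom) : c.Coeff →ₐ[ℝ] ℝ where
  toFun f := f x
  map_one' := rfl
  map_mul' _ _ := rfl
  map_zero' := rfl
  map_add' _ _ := rfl
  commutes' _ := rfl

/-- The value at `x ∈ U` of a local function, an element of `S(V)`: `f ⊗ P ↦ f(x) P`. -/
def eval (x : c.dom) : c.Loc →ₐ[ℝ] FibAlg d (finrank ℝ F) :=
  Algebra.TensorProduct.lift ((Algebra.ofId ℝ _).comp (c.evalCoeff x)) (AlgHom.id ℝ _)
    (fun f P => Algebra.commutes (c.evalCoeff x f) P)

lemma eval_tmul (x : c.dom) (f : c.Coeff) (P : FibAlg d (finrank ℝ F)) :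
    c.eval x (f ⊗ₜ P) = f x • P := by
  rw [Algebra.smul_def]
  rfl

/-- The local functions of bidegree `(m, n)`, a monomial `ξ^i p^j q^k` having bidegree
`(2 (i + j), i + k)`. -/
def bidegree (m n : ℕ) : Submodule ℝ c.Loc :=
  Submodule.span ℝ {G | ∃ i j k, 2 * (i + j) = m ∧ i + k = n ∧ G ∈ c.monomials i j k}

/-- The local functions of degree `n`, a monomial `ξ^i p^j q^k` having degree `3 i + 2 j + k`. -/
def degree (n : ℕ) : Submodule ℝ c.Loc :=
  Submodule.span ℝ {G | ∃ i j k, 3 * i + 2 * j + k = n ∧ G ∈ c.monomials i j k}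

/-- The change of coordinates at `x ∈ U ∩ U'`: the algebra map expressing the fibre coordinates
`(q', p', ξ')` of `c'` through those of `c`. If `e_b = ∑ a, t a b e'_a` and `e'_a = ∑ b, u b a e_b`
then `q'^a = ∑ b, t a b q^b`, `p'_a = ∑ b, u b a p_b` and
`ξ'_i = ∑ j, (∂x^j/∂x'^i) ξ_j + ∑ a b c, (∂(u b a)/∂x'^i) (t a c) p_b q^c`,
which is the lift of a linear change of coordinates on `E[1]` to the cotangent bundle. -/
def transition (c c' : NatChart (d := d) F E) (x : M) :
    FibAlg d (finrank ℝ F) →ₐ[ℝ] FibAlg d (finrank ℝ F) :=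
  subst
    (fun b a => c.isFrame.coeff b x (c'.frame a x))
    (fun a b => c'.isFrame.coeff a x (c.frame b x))
    (fun i j => fderiv ℝ (c.chart ∘ c'.chart.symm) (c'.chart x) (stdVec i) j)
    (fun i b k => ∑ a,
      fderiv ℝ (fun y => c.isFrame.coeff b (c'.chart.symm y) (c'.frame a (c'.chart.symm y)))
        (c'.chart x) (stdVec i) * c'.isFrame.coeff a x (c.frame k x))

end NatChart

/-! ### Functions on `T*[3]E[1]` -/

variable (F E) in
/-- Families of local functions, one for each system of natural coordinates. -/
abbrev Families : Type _ := ∀ c : NatChart (d := d) F E, c.Loc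

variable (F E) in
/-- `C^∞(T*[3]E[1])`: the families of local functions that agree on overlaps. -/
def functions : Subalgebra ℝ (Families (d := d) F E) where
  carrier := {G | ∀ (c c' : NatChart (d := d) F E) (x : M) (h : x ∈ c.dom) (h' : x ∈ c'.dom),
    c.transition c' x (c'.eval ⟨x, h'⟩ (G c')) = c.eval ⟨x, h⟩ (G c)}
  mul_mem' hG hH c c' x h h' := by
    simp only [Pi.mul_apply, map_mul, hG c c' x h h', hH c c' x h h']
  add_mem' hG hH c c' x h h' := by
    simp only [Pi.add_apply, map_add, hG c c' x h h', hH c c' x h h']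
  algebraMap_mem' k c c' x h h' := by
    simp only [Pi.algebraMap_apply, AlgHom.commutes]

variable (F E) in
/-- `C^{m,n}`: the functions on `T*[3]E[1]` of bidegree `(m, n)`. -/
def bidegreePart (m n : ℕ) : Submodule ℝ (Families (d := d) F E) :=
  Subalgebra.toSubmodule (functions F E) ⊓ Submodule.pi Set.univ fun c => c.bidegree m n

variable (F E) in
/-- `C^n`: the functions on `T*[3]E[1]` of degree `n`. -/
def degreePart (n : ℕ) : Submodule ℝ (Families (d := d) F E) :=
  Subalgebra.toSubmodule (functions F E) ⊓ Submodule.pi Set.univ fun c => c.degree n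

/-- The Poisson bracket, computed in all natural coordinates. -/
def poisson [IsManifold (𝓡 d) ∞ M] (G H : Families (d := d) F E) : Families (d := d) F E :=
  fun c => c.bracket (G c) (H c)

/-- The family `G` is the function `g` on `M`, regarded as a function of degree `0`. -/
def HasValue (G : Families (d := d) F E) (g : M → ℝ) : Prop :=
  ∀ (c : NatChart (d := d) F E) (x : c.dom), c.eval x (G c) = algebraMap ℝ _ (g x)

/-- The function of degree `0` given by a smooth function on `M`. -/
def ofFun (f : C^∞⟮𝓡 d, M; 𝓘(ℝ, ℝ), ℝ⟯) : Families (d := d) F E :=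
  fun c => c.coef (c.restr f f.contMDiff.contMDiffOn)

/-! ### Sections, forms and bundle maps -/

variable (F E) in
/-- A smooth section of the dual bundle `E*`. -/
structure DualSec where
  /-- the underlying family of functionals -/
  toFun : ∀ x, Module.Dual ℝ (E x)
  smooth : ∀ (U : Set M) (s : ∀ x, E x), IsOpen U → SmoothSecOn (d := d) F E s U →
    ContMDiffOn (𝓡 d) 𝓘(ℝ, ℝ) ∞ (fun x => toFun x (s x)) U

/-- The section `α = ∑ a, α(e_a) q^a` of `E*` as a function of degree `1`. -/
def ofDual (α : DualSec (d := d) F E) : Families (d := d) F E :=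
  fun c => ∑ a, c.coef (c.restr (fun x => α.toFun x (c.frame a x))
    (α.smooth _ _ c.chart.open_source (c.isFrame.contMDiffOn a))) * c.q a

section VectorBundle

variable [VectorBundle ℝ F E]

/-- The product of a smooth function and a smooth section. -/
def smulSec (f : C^∞⟮𝓡 d, M; 𝓘(ℝ, ℝ), ℝ⟯) (e : Cₛ^∞⟮𝓡 d; F, E⟯) : Cₛ^∞⟮𝓡 d; F, E⟯ :=
  ⟨fun x => f x • e x, ContMDiff.smul_section f.contMDiff e.contMDiff⟩

variable [FiniteDimensional ℝ F] [ContMDiffVectorBundle ∞ F E (𝓡 d)]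

/-- The coefficients of a smooth section in a smooth local frame are smooth. -/
lemma NatChart.coeff_smooth (c : NatChart (d := d) F E) (s : ∀ x, E x)
    (hs : SmoothSecOn (d := d) F E s c.chart.source) (a : Fin (finrank ℝ F)) :
    ContMDiffOn (𝓡 d) 𝓘(ℝ, ℝ) ∞ (fun x => c.isFrame.coeff a x (s x)) c.chart.source := by
  intro x₀ hx₀
  have : ContMDiffVectorBundle 1 F E (𝓡 d) := ContMDiffVectorBundle.of_le (n := ∞) (by simp)
  have hU : c.chart.source ∈ nhds x₀ := c.chart.open_source.mem_nhds hx₀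
  let e := trivializationAt F E x₀
  let b := finBasis ℝ F
  have hx₀e : x₀ ∈ e.baseSet := FiberBundle.mem_baseSet_trivializationAt' x₀
  let G : M → Matrix (Fin (finrank ℝ F)) (Fin (finrank ℝ F)) ℝ := fun x =>
    Matrix.of fun i j => e.localFrameCoeff (𝓡 d) b i x (c.frame j x)
  let w : M → Fin (finrank ℝ F) → ℝ := fun x i => e.localFrameCoeff (𝓡 d) b i x (s x)
  have hG : ∀ i j, ContMDiffAt (𝓡 d) 𝓘(ℝ, ℝ) ∞ (fun x => G x i j) x₀ := fun i j =>
    contMDiffAt_localFrameCoeff b hx₀e ((c.isFrame.contMDiffOn j).contMDiffAt hU) i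
  have hw : ∀ i, ContMDiffAt (𝓡 d) 𝓘(ℝ, ℝ) ∞ (fun x => w x i) x₀ := fun i =>
    contMDiffAt_localFrameCoeff b hx₀e (hs.contMDiffAt hU) i
  have hdet : ∀ A : M → Matrix (Fin (finrank ℝ F)) (Fin (finrank ℝ F)) ℝ,
      (∀ i j, ContMDiffAt (𝓡 d) 𝓘(ℝ, ℝ) ∞ (fun x => A x i j) x₀) →
      ContMDiffAt (𝓡 d) 𝓘(ℝ, ℝ) ∞ (fun x => (A x).det) x₀ := by
    intro A hA
    simp only [Matrix.det_apply']
    exact contMDiffAt_finsetSum fun σ _ =>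
      contMDiffAt_const.mul (contMDiffAt_finsetProd fun i _ => hA _ _)
  have hcr : ContMDiffAt (𝓡 d) 𝓘(ℝ, ℝ) ∞ (fun x => (G x).cramer (w x) a) x₀ := by
    simp only [Matrix.cramer_apply]
    refine hdet _ fun i j => ?_
    by_cases h : j = a
    · subst h; simpa using hw i
    · simpa [Matrix.updateCol_ne h] using hG i j
  have hmul : ∀ x ∈ c.chart.source, x ∈ e.baseSet →
      (G x).mulVec (fun j => c.isFrame.coeff j x (s x)) = w x := by
    intro x hx hxe
    funext i
    simp only [w]
    conv_rhs => rw [c.isFrame.coeff_sum_eq s hx]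
    simp [G, Matrix.mulVec, dotProduct, mul_comm]
  have hne : ∀ x ∈ c.chart.source, x ∈ e.baseSet → (G x).det ≠ 0 := by
    intro x hx hxe
    have : G x = (e.basisAt b hxe).toMatrix (c.isFrame.toBasisAt hx) := by
      ext i j
      simp only [G, Matrix.of_apply, Basis.toMatrix_apply, IsLocalFrameOn.toBasisAt_coe]
      exact e.localFrameCoeff_apply_of_mem_baseSet b hxe (c.frame j) i
    rw [this]
    have hu : IsUnit ((e.basisAt b hxe).toMatrix (c.isFrame.toBasisAt hx)).det := by
      rw [← Basis.det_apply]; exact Basis.isUnit_det _ _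
    exact hu.ne_zero
  have key : (fun x => c.isFrame.coeff a x (s x)) =ᶠ[nhds x₀]
      fun x => ((G x).det)⁻¹ * (G x).cramer (w x) a := by
    filter_upwards [hU, e.open_baseSet.mem_nhds hx₀e] with x hx hxe
    rw [← hmul x hx hxe, Matrix.cramer_eq_adjugate_mulVec, Matrix.mulVec_mulVec,
      Matrix.adjugate_mul, Matrix.smul_mulVec, Matrix.one_mulVec, Pi.smul_apply, smul_eq_mul,
      inv_mul_cancel_left₀ (hne x hx hxe)]
  exact ((((hdet G hG).inv₀ (hne x₀ hx₀ hx₀e)).mul hcr).congr_of_eventuallyEq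
    key).contMDiffWithinAt

/-- The section `e = ∑ a, e^a e_a` of `E` as the function `∑ a, e^a p_a` of bidegree `(2, 0)`. -/
def ofSec (e : Cₛ^∞⟮𝓡 d; F, E⟯) : Families (d := d) F E :=
  fun c => ∑ a, c.coef (c.restr (fun x => c.isFrame.coeff a x (e x))
    (c.coeff_smooth e e.contMDiff.contMDiffOn a)) * c.p a

/-! ### Operations on the sections of `E` -/

variable [IsManifold (𝓡 d) ∞ M]

variable (F E) in
/-- Operations `([·,·], ρ, ∂, Ω)`: a skew-symmetric bracket on `Γ E`, a smooth bundle map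
`ρ : E → TM`, a smooth symmetric bundle map `∂ : E* → E` and a smooth 4-form `Ω` on `E`. -/
structure Operations where
  /-- the bracket of sections -/
  brk : Cₛ^∞⟮𝓡 d; F, E⟯ →ₗ[ℝ] Cₛ^∞⟮𝓡 d; F, E⟯ →ₗ[ℝ] Cₛ^∞⟮𝓡 d; F, E⟯
  brk_skew : ∀ e₁ e₂, brk e₁ e₂ = -brk e₂ e₁
  /-- the anchor -/
  anchor : ∀ x : M, E x →ₗ[ℝ] TangentSpace (𝓡 d) x
  anchor_smooth : ∀ (U : Set M) (s : ∀ x, E x), IsOpen U → SmoothSecOn (d := d) F E s U →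
    SmoothSecOn (d := d) (EuclideanSpace ℝ (Fin d)) (fun x : M => TangentSpace (𝓡 d) x)
      (fun x => anchor x (s x)) U
  /-- the bundle map from the dual bundle -/
  del : ∀ x : M, Module.Dual ℝ (E x) →ₗ[ℝ] E x
  del_symm : ∀ (x : M) (α β : Module.Dual ℝ (E x)), β (del x α) = α (del x β)
  del_smooth : ∀ α : DualSec (d := d) F E,
    SmoothSecOn (d := d) F E (fun x => del x (α.toFun x)) Set.univ
  /-- the 4-form -/
  Om : ∀ x : M, E x [⋀^Fin 4]→ₗ[ℝ] ℝ
  Om_smooth : ∀ (U : Set M) (s : Fin 4 → ∀ x, E x), IsOpen U →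
    (∀ i, SmoothSecOn (d := d) F E (s i) U) →
    ContMDiffOn (𝓡 d) 𝓘(ℝ, ℝ) ∞ (fun x => Om x fun i => s i x) U

namespace Operations

variable (D : Operations (d := d) F E)

/-- `ρ(e)(g)`: the derivative of a function on `M` along the anchor of a section. -/
def act (e : Cₛ^∞⟮𝓡 d; F, E⟯) (g : M → ℝ) : M → ℝ :=
  fun x => mfderiv (𝓡 d) 𝓘(ℝ, ℝ) g x (D.anchor x (e x))

/-- The section `∂α` of `E`. -/
def delSec (α : DualSec (d := d) F E) : Cₛ^∞⟮𝓡 d; F, E⟯ :=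
  ⟨fun x => D.del x (α.toFun x), contMDiffOn_univ.mp (D.del_smooth α)⟩

/-- The symmetric pairing `(α, β) = ⟨∂α, β⟩`. -/
def pairing (α β : DualSec (d := d) F E) : M → ℝ :=
  fun x => β.toFun x (D.del x (α.toFun x))

/-- The Lie derivative `L_e α`, evaluated on a section `e'`:
`⟨L_e α, e'⟩ = ρ(e)⟨α, e'⟩ - ⟨α, [e, e']⟩`. -/
def lieDeriv (e : Cₛ^∞⟮𝓡 d; F, E⟯) (α : DualSec (d := d) F E) (e' : Cₛ^∞⟮𝓡 d; F, E⟯) : M → ℝ :=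
  fun x => D.act e (fun y => α.toFun y (e' y)) x - α.toFun x (D.brk e e' x)

/-- `Ω(e₁, e₂, e₃, -)` at the point `x`, a functional on `E x`. -/
def contraction (e₁ e₂ e₃ : Cₛ^∞⟮𝓡 d; F, E⟯) (x : M) : Module.Dual ℝ (E x) :=
  (D.Om x).toMultilinearMap.toLinearMap ![e₁ x, e₂ x, e₃ x, 0] 3

/-- The differential `δΩ`, evaluated on five sections. In the normalization `δ = {θ₁₃, -}` it is
minus the Chevalley-Eilenberg (Koszul) formula: with `e₀, …, e₄` the sections,
`-δΩ = ∑ i, (-1)^i ρ(e_i)(Ω(…, ê_i, …)) + ∑ i < j, (-1)^(i+j) Ω([e_i, e_j], …, ê_i, …, ê_j, …)`;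
the second sum is over `i` and `j + 1` with `i ≤ j`. -/
def deltaOm (e : Fin 5 → Cₛ^∞⟮𝓡 d; F, E⟯) : M → ℝ := fun x =>
  -(∑ i : Fin 5, (-1) ^ (i : ℕ) * D.act (e i) (fun y => D.Om y fun k => e (i.succAbove k) y) x +
    ∑ i : Fin 5, ∑ j : Fin 4, if (i : ℕ) ≤ j then
      (-1) ^ ((i : ℕ) + (j + 1)) * D.Om x (Matrix.vecCons (D.brk (e i) (e j.succ) x)
        fun k => e (i.succAbove (j.succAbove k)) x) else 0)

/-- (A0): the anchor is compatible with the brackets. -/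
def A0 : Prop := ∀ (e₁ e₂ : Cₛ^∞⟮𝓡 d; F, E⟯) (x : M),
  D.anchor x (D.brk e₁ e₂ x) = VectorField.mlieBracket (𝓡 d)
    (fun y => D.anchor y (e₁ y)) (fun y => D.anchor y (e₂ y)) x

/-- (A1): `[e₁, f e₂] = f [e₁, e₂] + ρ(e₁)(f) e₂`. -/
def A1 : Prop := ∀ (f : C^∞⟮𝓡 d, M; 𝓘(ℝ, ℝ), ℝ⟯) (e₁ e₂ : Cₛ^∞⟮𝓡 d; F, E⟯) (x : M),
  D.brk e₁ (smulSec f e₂) x = f x • D.brk e₁ e₂ x + D.act e₁ f x • e₂ x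

/-- (A2): `[[e₁, e₂], e₃] + (cyclic permutations) = ∂Ω(e₁, e₂, e₃)`. -/
def A2 : Prop := ∀ (e₁ e₂ e₃ : Cₛ^∞⟮𝓡 d; F, E⟯) (x : M),
  D.brk (D.brk e₁ e₂) e₃ x + D.brk (D.brk e₂ e₃) e₁ x + D.brk (D.brk e₃ e₁) e₂ x =
    D.del x (D.contraction e₁ e₂ e₃ x)

/-- (A3): `ρ ∂ = 0`. -/
def A3 : Prop := ∀ x : M, D.anchor x ∘ₗ D.del x = 0

/-- (A4): `ρ(e)(α, β) = (L_e α, β) + (α, L_e β)`, where `(γ, β) = ⟨γ, ∂β⟩` by symmetry. -/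
def A4 : Prop := ∀ (e : Cₛ^∞⟮𝓡 d; F, E⟯) (α β : DualSec (d := d) F E) (x : M),
  D.act e (D.pairing α β) x = D.lieDeriv e α (D.delSec β) x + D.lieDeriv e β (D.delSec α) x

/-- (A5): `δΩ = 0`. -/
def A5 : Prop := ∀ (e : Fin 5 → Cₛ^∞⟮𝓡 d; F, E⟯) (x : M), D.deltaOm e x = 0

/-- The axioms (A1)-(A5). -/
def Axioms : Prop := D.A1 ∧ D.A2 ∧ D.A3 ∧ D.A4 ∧ D.A5

/-- The operations are the derived brackets of the functions `θ₂`, `θ₁₃`, `θ₄`. -/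
structure DerivedFrom (θ₂ θ₁₃ θ₄ : Families (d := d) F E) : Prop where
  brk_eq : ∀ e₁ e₂, poisson (poisson θ₁₃ (ofSec e₁)) (ofSec e₂) = ofSec (D.brk e₁ e₂)
  anchor_eq : ∀ e f, HasValue (poisson (poisson θ₁₃ (ofSec e)) (ofFun f)) (D.act e f)
  pairing_eq : ∀ α β, HasValue (poisson (poisson θ₂ (ofDual α)) (ofDual β)) (D.pairing α β)
  Om_eq : ∀ e : Fin 4 → Cₛ^∞⟮𝓡 d; F, E⟯,
    HasValue (poisson (poisson (poisson (poisson θ₄ (ofSec (e 0))) (ofSec (e 1)))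
      (ofSec (e 2))) (ofSec (e 3))) (fun x => D.Om x fun i => e i x)

end Operations

end VectorBundle

/-! ### Structure functions -/

section StructureFunctions

/-- Structure functions `f₁^i_a`, `f₂^{ab}`, `f₃^a_{bc}`, `f₄_{abcd}` on a coordinate domain, with
the symmetries that make them unique: `f₂` is symmetric, `f₃` is skew in its lower indices and
`f₄` is totally skew. -/
structure StrFun (c : NatChart (d := d) F E) where
  /-- `f₁^i_a` -/
  f₁ : Fin d → Fin (finrank ℝ F) → c.Coeff
  /-- `f₂^{ab}` -/
  f₂ : Fin (finrank ℝ F) → Fin (finrank ℝ F) → c.Coeff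
  /-- `f₃^a_{bc}` -/
  f₃ : Fin (finrank ℝ F) → Fin (finrank ℝ F) → Fin (finrank ℝ F) → c.Coeff
  /-- `f₄_{abcd}` -/
  f₄ : Fin (finrank ℝ F) → Fin (finrank ℝ F) → Fin (finrank ℝ F) → Fin (finrank ℝ F) → c.Coeff
  f₂_symm : ∀ a b, f₂ a b = f₂ b a
  f₃_skew : ∀ a b b', f₃ a b b' = -f₃ a b' b
  f₄_skew₁ : ∀ a b a' b', f₄ a b a' b' = -f₄ b a a' b'
  f₄_skew₂ : ∀ a b a' b', f₄ a b a' b' = -f₄ a a' b b'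
  f₄_skew₃ : ∀ a b a' b', f₄ a b a' b' = -f₄ a b b' a'

/-- Full alternating sum `∑ σ, sgn(σ) T(i_σ(0), …, i_σ(n-1))` over the permutations of the
indices. -/
def altSum {ι R : Type*} [AddCommGroup R] [Module ℝ R] {n : ℕ} (T : (Fin n → ι) → R)
    (i : Fin n → ι) : R :=
  ∑ σ : Equiv.Perm (Fin n), ((Equiv.Perm.sign σ : ℤ) : ℝ) • T (i ∘ σ)

namespace StrFun

variable {c : NatChart (d := d) F E} (f : StrFun c)

/-- `θ₂ = ½ f₂^{ab} p_a p_b`. -/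
def theta2 : c.Loc := (1 / 2 : ℝ) • ∑ a, ∑ b, c.coef (f.f₂ a b) * c.p a * c.p b

/-- `θ₁₃ = f₁^i_a ξ_i q^a + ½ f₃^a_{bc} p_a q^b q^c`. -/
def theta13 : c.Loc :=
  ∑ i, ∑ a, c.coef (f.f₁ i a) * c.xi i * c.q a +
    (1 / 2 : ℝ) • ∑ a, ∑ b, ∑ b', c.coef (f.f₃ a b b') * c.p a * c.q b * c.q b'

/-- `θ₄ = (1/4!) f₄_{abcd} q^a q^b q^c q^d`. -/
def theta4 : c.Loc :=
  (1 / 24 : ℝ) • ∑ a, ∑ b, ∑ a', ∑ b',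
    c.coef (f.f₄ a b a' b') * c.q a * c.q b * c.q a' * c.q b'

variable [IsManifold (𝓡 d) ∞ M]

/-- `f₁^i_b f₂^{ba} = 0`. -/
def FC1 : Prop := ∀ i a, ∑ b, f.f₁ i b * f.f₂ b a = 0

/-- `f₁^k_c ∂_k f₂^{ab} + f₂^{da} f₃^b_{cd} + f₂^{db} f₃^a_{cd} = 0`. -/
def FC2 : Prop := ∀ a b m,
  ∑ k, f.f₁ k m * c.pd k (f.f₂ a b) +
    ∑ n, (f.f₂ n a * f.f₃ b m n + f.f₂ n b * f.f₃ a m n) = 0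

/-- `f₁^k_b ∂_k f₁^i_a - f₁^k_a ∂_k f₁^i_b + f₁^i_c f₃^c_{ab} = 0`. -/
def FC3 : Prop := ∀ i a b,
  ∑ k, (f.f₁ k b * c.pd k (f.f₁ i a) - f.f₁ k a * c.pd k (f.f₁ i b)) +
    ∑ m, f.f₁ i m * f.f₃ m a b = 0

/-- `f₁^k_[d ∂_k f₃^a_{bc]} + f₂^{ae} f₄_{bcde} - f₃^a_{e[b} f₃^e_{cd]} = 0`. The brackets denote
the signed sum over the three essentially different terms, that is, one half of the full
alternating sum. -/
def FC4 : Prop := ∀ (a : Fin (finrank ℝ F)) (l : Fin 3 → Fin (finrank ℝ F)),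
  (1 / 2 : ℝ) • altSum (fun l => ∑ k, f.f₁ k (l 2) * c.pd k (f.f₃ a (l 0) (l 1))) l +
    ∑ m, f.f₂ a m * f.f₄ (l 0) (l 1) (l 2) m -
    (1 / 2 : ℝ) • altSum (fun l => ∑ m, f.f₃ a m (l 0) * f.f₃ m (l 1) (l 2)) l = 0

/-- `f₁^k_[a ∂_k f₄_{bcde]} + f₃^f_{[ab} f₄_{cde]f} = 0`. The brackets denote the signed sums over
the five, respectively ten, essentially different terms. -/
def FC5 : Prop := ∀ l : Fin 5 → Fin (finrank ℝ F),
  (1 / 24 : ℝ) • altSum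
      (fun l => ∑ k, f.f₁ k (l 0) * c.pd k (f.f₄ (l 1) (l 2) (l 3) (l 4))) l +
    (1 / 12 : ℝ) • altSum
      (fun l => ∑ m, f.f₃ m (l 0) (l 1) * f.f₄ (l 2) (l 3) (l 4) m) l = 0

end StrFun

end StructureFunctions

end QP3

end

open QP3

/-! Everything is reduced to structure functions in canonical coordinates. A local function is a
combination of fibre monomials with smooth coefficients, and it vanishes as soon as all its values
in `S(V)` do (`eval_injective`). In `S(V)` the derivatives in `p` and `ξ` and the contractions in
`q` read off coefficients; in particular a form `∑ w(l) q^l` vanishes exactly when the alternating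
sums of `w` do (`sum_smul_qm_eq_zero_iff`). Hence the three components have unique structure
functions with the required symmetries (`existsUnique_strFun`). Once their brackets are written out,
the vanishing of these brackets becomes `FC1`-`FC5`.

The decomposition by bidegree is a decomposition by weight. Scaling `p` and `ξ` by `s` while fixing
`q` gives `θ₂`, `θ₁₃`, `θ₄` the weights `2`, `1`, `0`, and this scaling commutes with all changes of
coordinates (`subst_scale`). The components of a global function are therefore obtained from its
rescalings by interpolation, so they are global too. The three parts of `{Θ, Θ}` also have weights
`2`, `1`, `0` and vanish separately (`bracket_self_eq_zero_iff`).

Iterated brackets with sections express the derived operations through the structure functions: the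
anchor has components `-f₁`, the map `∂` has components `f₂`, the form `Ω` has components `f₄`, and
`f₃` is the part of the bracket bilinear over functions. The predicate `Rep` records this. The
relation `Agree` between structure functions in two coordinate systems is at once the patching
condition for the `θ`'s (`agree_iff`) and the condition under which the local operations glue
(`ofStrFun`); conversely, the components of given operations satisfy it (`Rep.agree`). Operations
that satisfy (A1) have such components: the bracket is local, and its difference from the coordinate
expression is bilinear over functions and zero on the frame (`exists_rep`). Bump functions provide
enough global sections, functions and covectors to recover all structure functions from the
operations.

Finally, the defect of each of (A2)-(A5) is computed in terms of the left-hand sides of `FC1`-`FC5`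
(`vcoord_anchor_del`, `act_pairing_sub`, `coeff_jacobi`, `sum_fc5_mul_det`). Testing on sections
with prescribed values and first derivatives at a point shows that the axioms hold exactly when the
structure equations do. `FC3` also yields the compatibility of the anchor with the brackets. -/

noncomputable section

namespace QP3

/-! ### Derivatives and monomials in the fibre algebra -/

section Fibre

variable {d r : ℕ}

/-- The element `P ⊗ w` of the fibre algebra. -/
def mk (P : MvPolynomial (Fin r) ℝ) (w : ExteriorAlgebra ℝ (Fin d ⊕ Fin r → ℝ)) : FibAlg d r :=
  (P ⊗ₜ w : FibTensor d r)

lemma fib_induction {C : FibAlg d r → Prop} (A : FibAlg d r) (zero : C 0)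
    (tmul : ∀ P w, C (mk P w)) (add : ∀ A B, C A → C B → C (A + B)) : C A :=
  TensorProduct.induction_on (motive := fun A : FibTensor d r => C A) A zero tmul add

lemma mk_mul_mk (P Q : MvPolynomial (Fin r) ℝ)
    (v w : ExteriorAlgebra ℝ (Fin d ⊕ Fin r → ℝ)) :
    mk P v * mk Q w = mk (P * Q) (v * w) :=
  Algebra.TensorProduct.tmul_mul_tmul P Q v w

lemma mk_add (P : MvPolynomial (Fin r) ℝ) (v w : ExteriorAlgebra ℝ (Fin d ⊕ Fin r → ℝ)) :
    mk P (v + w) = mk P v + mk P w := TensorProduct.tmul_add P v w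

lemma add_mk (P Q : MvPolynomial (Fin r) ℝ) (v : ExteriorAlgebra ℝ (Fin d ⊕ Fin r → ℝ)) :
    mk (P + Q) v = mk P v + mk Q v := TensorProduct.add_tmul P Q v

lemma mk_smul (k : ℝ) (P : MvPolynomial (Fin r) ℝ) (v : ExteriorAlgebra ℝ (Fin d ⊕ Fin r → ℝ)) :
    mk P (k • v) = k • mk P v := TensorProduct.tmul_smul k P v

lemma mk_sub (P : MvPolynomial (Fin r) ℝ) (v w : ExteriorAlgebra ℝ (Fin d ⊕ Fin r → ℝ)) :
    mk P (v - w) = mk P v - mk P w := TensorProduct.tmul_sub P v w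

lemma mk_zero (P : MvPolynomial (Fin r) ℝ) :
    mk P (0 : ExteriorAlgebra ℝ (Fin d ⊕ Fin r → ℝ)) = 0 := TensorProduct.tmul_zero _ P

lemma zero_mk (v : ExteriorAlgebra ℝ (Fin d ⊕ Fin r → ℝ)) :
    mk (0 : MvPolynomial (Fin r) ℝ) v = 0 := TensorProduct.zero_tmul _ v

lemma mk_one : mk (1 : MvPolynomial (Fin r) ℝ) (1 : ExteriorAlgebra ℝ (Fin d ⊕ Fin r → ℝ)) = 1 :=
  rfl

lemma pFib_eq (a : Fin r) : (pFib a : FibAlg d r) = mk (MvPolynomial.X a) 1 := rfl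

lemma oddFib_eq (k : Fin d ⊕ Fin r) :
    oddFib k = mk 1 (ExteriorAlgebra.ι ℝ (Pi.single k 1)) := rfl

lemma dPFib_mk (a : Fin r) (P : MvPolynomial (Fin r) ℝ)
    (w : ExteriorAlgebra ℝ (Fin d ⊕ Fin r → ℝ)) :
    dPFib a (mk P w) = mk (MvPolynomial.pderiv a P) w := rfl

lemma dLeftFib_mk (k : Fin d ⊕ Fin r) (P : MvPolynomial (Fin r) ℝ)
    (w : ExteriorAlgebra ℝ (Fin d ⊕ Fin r → ℝ)) :
    dLeftFib k (mk P w) = mk P (CliffordAlgebra.contractLeft (LinearMap.proj k) w) := rfl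

lemma dRightFib_mk (k : Fin d ⊕ Fin r) (P : MvPolynomial (Fin r) ℝ)
    (w : ExteriorAlgebra ℝ (Fin d ⊕ Fin r → ℝ)) :
    dRightFib k (mk P w) = mk P (CliffordAlgebra.contractRight w (LinearMap.proj k)) := rfl

/-- `∂/∂p_a` is an even derivation, so the Leibniz rule carries no sign. -/
lemma dPFib_mul (a : Fin r) (A B : FibAlg d r) :
    dPFib a (A * B) = dPFib a A * B + A * dPFib a B := by
  induction A using fib_induction with
  | zero => simp
  | add A A' h h' => simp only [add_mul, map_add, h, h']; abel
  | tmul P v =>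
    induction B using fib_induction with
    | zero => simp
    | add A A' h h' => simp only [mul_add, map_add, h, h']; abel
    | tmul Q w =>
      simp only [mk_mul_mk, dPFib_mk, Derivation.leibniz, smul_eq_mul, add_mk]
      rw [mul_comm Q, add_comm]

@[simp] lemma dPFib_pFib (a b : Fin r) :
    dPFib a (pFib b : FibAlg d r) = if a = b then 1 else 0 := by
  rw [pFib_eq, dPFib_mk, MvPolynomial.pderiv_X]
  by_cases h : a = b
  · subst h; simp [mk_one]
  · simp [h, zero_mk, Ne.symm h]

lemma dPFib_mk_one (a : Fin r) (w : ExteriorAlgebra ℝ (Fin d ⊕ Fin r → ℝ)) :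
    dPFib a (mk 1 w) = 0 := by
  rw [dPFib_mk, MvPolynomial.pderiv_one, zero_mk]

@[simp] lemma dPFib_oddFib (a : Fin r) (k : Fin d ⊕ Fin r) : dPFib a (oddFib k) = 0 :=
  dPFib_mk_one _ _

@[simp] lemma dPFib_one (a : Fin r) : dPFib a (1 : FibAlg d r) = 0 := dPFib_mk_one a 1

lemma dLeftFib_pFib_mul (k : Fin d ⊕ Fin r) (a : Fin r) (A : FibAlg d r) :
    dLeftFib k (pFib a * A) = pFib a * dLeftFib k A := by
  induction A using fib_induction with
  | zero => simp
  | add A A' h h' => simp only [mul_add, map_add, h, h']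
  | tmul P v => simp [pFib_eq, mk_mul_mk, dLeftFib_mk]

lemma dRightFib_pFib_mul (k : Fin d ⊕ Fin r) (a : Fin r) (A : FibAlg d r) :
    dRightFib k (pFib a * A) = pFib a * dRightFib k A := by
  induction A using fib_induction with
  | zero => simp
  | add A A' h h' => simp only [mul_add, map_add, h, h']
  | tmul P v => simp [pFib_eq, mk_mul_mk, dRightFib_mk]

@[simp] lemma dLeftFib_one (k : Fin d ⊕ Fin r) : dLeftFib k (1 : FibAlg d r) = 0 := by
  rw [← mk_one, dLeftFib_mk, CliffordAlgebra.contractLeft_one, mk_zero]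

@[simp] lemma dRightFib_one (k : Fin d ⊕ Fin r) : dRightFib k (1 : FibAlg d r) = 0 := by
  rw [← mk_one, dRightFib_mk, CliffordAlgebra.contractRight_one, mk_zero]

@[simp] lemma dLeftFib_pFib (k : Fin d ⊕ Fin r) (a : Fin r) :
    dLeftFib k (pFib a : FibAlg d r) = 0 := by
  simpa using dLeftFib_pFib_mul k a 1

@[simp] lemma dRightFib_pFib (k : Fin d ⊕ Fin r) (a : Fin r) :
    dRightFib k (pFib a : FibAlg d r) = 0 := by
  simpa using dRightFib_pFib_mul k a 1

/-- Left contraction is an antiderivation: passing the odd generator `m` costs a sign. The mirror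
image `dRightFib_mul_oddFib` peels off the last factor instead. -/
lemma dLeftFib_oddFib_mul (k m : Fin d ⊕ Fin r) (A : FibAlg d r) :
    dLeftFib k (oddFib m * A) = (if k = m then A else 0) - oddFib m * dLeftFib k A := by
  induction A using fib_induction with
  | zero => simp
  | add A A' h h' =>
    simp only [mul_add, map_add, h, h']
    split_ifs <;> abel
  | tmul P v =>
    have := CliffordAlgebra.contractLeft_ι_mul (Q := (0 : QuadraticForm ℝ (Fin d ⊕ Fin r → ℝ)))
      (d := LinearMap.proj k) (Pi.single m 1) v
    simp only [oddFib_eq, mk_mul_mk, dLeftFib_mk, one_mul]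
    -- The exterior algebra is by definition the Clifford algebra of the zero form; the rewrite has
    -- to see through this.
    erw [this]
    rw [mk_sub, mk_smul]
    simp [Pi.single_apply]

lemma dRightFib_mul_oddFib (k m : Fin d ⊕ Fin r) (A : FibAlg d r) :
    dRightFib k (A * oddFib m) = (if k = m then A else 0) - dRightFib k A * oddFib m := by
  induction A using fib_induction with
  | zero => simp
  | add A A' h h' =>
    simp only [add_mul, map_add, h, h']
    split_ifs <;> abel
  | tmul P v =>
    have := CliffordAlgebra.contractRight_mul_ι (Q := (0 : QuadraticForm ℝ (Fin d ⊕ Fin r → ℝ)))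
      (d := LinearMap.proj k) (Pi.single m 1) v
    simp only [oddFib_eq, mk_mul_mk, dRightFib_mk, mul_one]
    erw [this]
    rw [mk_sub, mk_smul]
    simp [Pi.single_apply]

@[simp] lemma dLeftFib_oddFib (k m : Fin d ⊕ Fin r) :
    dLeftFib k (oddFib m) = if k = m then 1 else 0 := by
  simpa using dLeftFib_oddFib_mul k m 1

@[simp] lemma dRightFib_oddFib (k m : Fin d ⊕ Fin r) :
    dRightFib k (oddFib m) = if k = m then 1 else 0 := by
  simpa using dRightFib_mul_oddFib k m 1

lemma pFib_mul_comm (a : Fin r) (A : FibAlg d r) : pFib a * A = A * pFib a :=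
  (commute_even (MvPolynomial.X a) A)

lemma oddFib_anticomm (k m : Fin d ⊕ Fin r) :
    oddFib k * oddFib m = -(oddFib m * oddFib k) := by
  rw [eq_neg_iff_add_eq_zero]
  simp only [oddFib_eq, mk_mul_mk, ← mk_add, ExteriorAlgebra.ι_add_mul_swap, mk_zero]

instance : Nontrivial (FibAlg d r) :=
  inferInstanceAs (Nontrivial (FibTensor d r))

lemma algebraMap_fib_injective : Function.Injective (algebraMap ℝ (FibAlg d r)) :=
  (algebraMap ℝ (FibAlg d r)).injective

/-! ### Products of the odd generators `q` -/

/-- The monomial `q^{l 0} ⋯ q^{l (n-1)}`. -/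
def qm {n : ℕ} (l : Fin n → Fin r) : FibAlg d r :=
  mk 1 (ExteriorAlgebra.ιMulti ℝ n fun s => Pi.single (Sum.inr (l s)) 1)

lemma qm_zero (l : Fin 0 → Fin r) : (qm l : FibAlg d r) = 1 := by
  rw [qm, ExteriorAlgebra.ιMulti_zero_apply, mk_one]

lemma qm_succ {n : ℕ} (l : Fin (n + 1) → Fin r) :
    (qm l : FibAlg d r) = oddFib (Sum.inr (l 0)) * qm (Fin.tail l) := by
  rw [qm, ExteriorAlgebra.ιMulti_succ_apply, oddFib_eq, qm, mk_mul_mk, one_mul]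
  rfl

lemma qm_last {n : ℕ} (l : Fin (n + 1) → Fin r) :
    (qm l : FibAlg d r) = qm (l ∘ Fin.castSucc) * oddFib (Sum.inr (l (Fin.last n))) := by
  rw [qm, ExteriorAlgebra.ιMulti_apply, List.ofFn_succ', List.concat_eq_append, List.prod_append,
    List.prod_singleton, oddFib_eq, qm, mk_mul_mk, one_mul, ExteriorAlgebra.ιMulti_apply]
  rfl

lemma qm_perm {n : ℕ} (l : Fin n → Fin r) (σ : Equiv.Perm (Fin n)) :
    (qm (l ∘ σ) : FibAlg d r) = ((Equiv.Perm.sign σ : ℤ) : ℝ) • qm l := by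
  have := (ExteriorAlgebra.ιMulti ℝ n).map_perm
    (fun s => (Pi.single (Sum.inr (l s)) 1 : Fin d ⊕ Fin r → ℝ)) σ
  rw [qm, qm, ← mk_smul]
  congr 1

@[simp] lemma dPFib_qm (a : Fin r) {n : ℕ} (l : Fin n → Fin r) :
    dPFib a (qm l : FibAlg d r) = 0 := dPFib_mk_one _ _

@[simp] lemma dLeftFib_xi_qm (i : Fin d) {n : ℕ} (l : Fin n → Fin r) :
    dLeftFib (Sum.inl i) (qm l : FibAlg d r) = 0 := by
  induction n with
  | zero => simp [qm_zero]
  | succ n ih => rw [qm_succ, dLeftFib_oddFib_mul, ih]; simp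

@[simp] lemma dRightFib_xi_qm (i : Fin d) {n : ℕ} (l : Fin n → Fin r) :
    dRightFib (Sum.inl i) (qm l : FibAlg d r) = 0 := by
  induction n with
  | zero => simp [qm_zero]
  | succ n ih => rw [qm_last, dRightFib_mul_oddFib, ih]; simp

/-- The factor `q^{l j}` has `n - j` factors to its right, so moving it to the end costs
`(-1)^(n-j)`, written `(-1)^(n+j)` to avoid subtraction. The induction splits off the last factor,
the one a right derivative meets first. -/
lemma dRightFib_qm (k : Fin r) {n : ℕ} (l : Fin (n + 1) → Fin r) :
    dRightFib (Sum.inr k) (qm l : FibAlg d r) =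
      ∑ j : Fin (n + 1), (if k = l j then (-1 : ℝ) ^ (n + (j : ℕ)) else 0) • qm (l ∘ j.succAbove) := by
  induction n with
  | zero =>
    rw [qm_succ, qm_zero, mul_one, dRightFib_oddFib, Fin.sum_univ_one]
    simp [qm_zero]
  | succ n ih =>
    rw [qm_last, dRightFib_mul_oddFib, ih, Fin.sum_univ_castSucc (n := n + 1), Finset.sum_mul,
      sub_eq_add_neg, ← Finset.sum_neg_distrib,
      add_comm (if Sum.inr k = Sum.inr (l (Fin.last (n + 1))) then _ else _)]
    congr 1
    · refine Finset.sum_congr rfl fun j _ => ?_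
      have hl : (l ∘ (Fin.castSucc j).succAbove) (Fin.last n) = l (Fin.last (n + 1)) := by
        simp [Fin.le_last, Fin.succAbove_of_le_castSucc]
      have hc : (l ∘ (Fin.castSucc j).succAbove) ∘ Fin.castSucc
          = (l ∘ Fin.castSucc) ∘ j.succAbove := by
        funext s
        simp [Fin.castSucc_succAbove_castSucc]
      rw [qm_last (l ∘ (Fin.castSucc j).succAbove), hl, hc, smul_mul_assoc, ← neg_smul]
      congr 1
      simp only [Function.comp_apply, Fin.val_castSucc]
      split_ifs
      · ring
      · simp
    · have : (-1 : ℝ) ^ (n + 1 + (n + 1)) = 1 := Even.neg_one_pow ⟨n + 1, rfl⟩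
      simp [this, Function.comp_def]

lemma oddFib_mul_qm (k : Fin d ⊕ Fin r) {n : ℕ} (l : Fin n → Fin r) :
    oddFib k * qm l = (-1 : ℝ) ^ n • (qm l * oddFib k) := by
  induction n with
  | zero => simp [qm_zero]
  | succ n ih =>
    rw [qm_succ, ← mul_assoc, oddFib_anticomm, neg_mul, mul_assoc, ih, mul_smul_comm, pow_succ,
      mul_neg_one, neg_smul, mul_assoc]

/-- The derivative is a combination of monomials of length `n - 1`, which gives the sign; the
exponent `n + 1` also covers `n = 0`, where both sides vanish. -/
lemma oddFib_mul_dRightFib_qm (k : Fin d ⊕ Fin r) (m : Fin r) {n : ℕ} (l : Fin n → Fin r) :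
    oddFib k * dRightFib (Sum.inr m) (qm l) =
      (-1 : ℝ) ^ (n + 1) • (dRightFib (Sum.inr m) (qm l) * oddFib k) := by
  cases n with
  | zero => simp [qm_zero]
  | succ n =>
    simp only [dRightFib_qm, Finset.mul_sum, Finset.sum_mul, Finset.smul_sum, mul_smul_comm,
      smul_mul_assoc, oddFib_mul_qm k]
    refine Finset.sum_congr rfl fun j _ => ?_
    rw [smul_comm, pow_add _ (n + 1), pow_succ _ n]
    simp

/-- Left and right derivatives in `q^k` differ by the sign of moving `q^k` past the other `n - 1`
factors. -/
lemma dLeftFib_qm (k : Fin r) {n : ℕ} (l : Fin n → Fin r) :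
    dLeftFib (Sum.inr k) (qm l : FibAlg d r) =
      (-1 : ℝ) ^ (n + 1) • dRightFib (Sum.inr k) (qm l) := by
  induction n with
  | zero => simp [qm_zero]
  | succ n ih =>
    have h1 : (qm l : FibAlg d r) =
        (-1 : ℝ) ^ n • (oddFib (Sum.inr (l (Fin.last n))) * qm (l ∘ Fin.castSucc)) := by
      rw [oddFib_mul_qm, smul_smul, ← mul_pow, qm_last]; simp
    rw [qm_last l, dRightFib_mul_oddFib, ← qm_last, h1, map_smul, dLeftFib_oddFib_mul, ih,
      mul_smul_comm, oddFib_mul_dRightFib_qm, smul_smul, ← mul_pow]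
    simp [pow_succ]

/-! ### Contraction with vectors -/

/-- The right contraction with the vector `v`. -/
def contr (v : Fin r → ℝ) : FibAlg d r →ₗ[ℝ] FibAlg d r := ∑ a, v a • dRightFib (Sum.inr a)

lemma contr_apply (v : Fin r → ℝ) (A : FibAlg d r) :
    contr v A = ∑ a, v a • dRightFib (Sum.inr a) A := by
  simp [contr]

lemma contr_qm (v : Fin r → ℝ) {n : ℕ} (l : Fin (n + 1) → Fin r) :
    contr v (qm l : FibAlg d r) =
      (-1 : ℝ) ^ n • ∑ j : Fin (n + 1), ((-1) ^ (j : ℕ) * v (l j)) • qm (l ∘ j.succAbove) := by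
  simp only [contr_apply, dRightFib_qm, Finset.smul_sum]
  rw [Finset.sum_comm]
  refine Finset.sum_congr rfl fun j _ => ?_
  rw [Finset.sum_eq_single (l j)]
  · simp only [if_true, smul_smul, pow_add]
    congr 1; ring
  · intro b _ hb; simp [hb]
  · simp

/-- Successive right contractions, first with `v 0`. -/
def contrs : (n : ℕ) → (Fin n → Fin r → ℝ) → FibAlg d r →ₗ[ℝ] FibAlg d r
  | 0, _ => LinearMap.id
  | n + 1, v => contrs n (Fin.tail v) ∘ₗ contr (v 0)

/-- Contracting with `v 0` strips one factor with alternating signs, which is the Laplace expansion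
along the first row. The prefactor is the sign of reversing `n` factors: contractions act from the
right end, whereas the determinant pairs vectors and factors in order. -/
lemma contrs_qm {n : ℕ} (v : Fin n → Fin r → ℝ) (l : Fin n → Fin r) :
    contrs n v (qm l : FibAlg d r) =
      ((-1) ^ (n * (n - 1) / 2) * (Matrix.of fun i j => v i (l j)).det) • 1 := by
  induction n with
  | zero => simp [contrs, qm_zero]
  | succ n ih =>
    rw [contrs, LinearMap.comp_apply, contr_qm, map_smul, map_sum]
    simp only [map_smul, ih, smul_smul, ← Finset.sum_smul]
    rw [Matrix.det_succ_row_zero, Finset.mul_sum, Finset.mul_sum]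
    congr 1
    refine Finset.sum_congr rfl fun j _ => ?_
    -- Recursion for the triangular exponent; the truncated subtraction makes `n = 0` a separate
    -- case.
    have : (n + 1) * (n + 1 - 1) / 2 = n + n * (n - 1) / 2 := by
      cases n with
      | zero => rfl
      | succ n =>
        simp only [Nat.add_sub_cancel]
        rw [show (n + 1 + 1) * (n + 1) = 2 * (n + 1) + (n + 1) * n by ring,
          Nat.mul_add_div two_pos]
    rw [this, pow_add]
    have h2 : (Matrix.of fun i j => v i (l j)).submatrix Fin.succ j.succAbove
      = Matrix.of fun i s => Fin.tail v i ((l ∘ j.succAbove) s) := rfl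
    rw [h2, Matrix.of_apply]
    ring

/-! ### Independence of monomials -/

/-- Reindexing by a permutation `σ` turns `w` into `sgn(σ) w(· ∘ σ)` without changing the form;
adding the `n!` copies gives the alternating sum. -/
lemma altSum_smul_qm {n : ℕ} (w : (Fin n → Fin r) → ℝ) :
    (n.factorial : ℝ) • ∑ l, w l • (qm l : FibAlg d r) = ∑ l, altSum w l • qm l := by
  have h : ∀ σ : Equiv.Perm (Fin n), ∑ l, w l • (qm l : FibAlg d r) =
      ∑ l, (((Equiv.Perm.sign σ : ℤ) : ℝ) • w (l ∘ σ)) • qm l := by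
    intro σ
    rw [← (Equiv.arrowCongr σ.symm (Equiv.refl (Fin r))).sum_comp]
    refine Finset.sum_congr rfl fun l _ => ?_
    have : (Equiv.arrowCongr σ.symm (Equiv.refl (Fin r))) l = l ∘ σ := by
      funext s; simp
    rw [this, qm_perm, smul_smul, smul_eq_mul, mul_comm]
  simp only [altSum, Finset.sum_smul]
  rw [Finset.sum_comm]
  rw [Finset.sum_congr rfl fun σ _ => (h σ).symm, Finset.sum_const, Finset.card_univ,
    Fintype.card_perm, Fintype.card_fin, Nat.cast_smul_eq_nsmul]

/-- Against standard basis vectors the term `σ` of the determinant survives only for `l = m ∘ σ`. -/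
lemma sum_mul_det {n : ℕ} (w : (Fin n → Fin r) → ℝ) (m : Fin n → Fin r) :
    ∑ l, w l * (Matrix.of fun i j => (Pi.single (m i) 1 : Fin r → ℝ) (l j)).det = altSum w m := by
  simp only [Matrix.det_apply', Finset.mul_sum, altSum, smul_eq_mul]
  rw [Finset.sum_comm]
  refine Finset.sum_congr rfl fun σ _ => ?_
  rw [Finset.sum_eq_single (m ∘ σ)]
  · simp [mul_comm]
  · intro l _ hl
    obtain ⟨i, hi⟩ := Function.ne_iff.mp hl
    rw [Finset.prod_eq_zero (Finset.mem_univ i)]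
    · simp
    · simp only [Matrix.of_apply]
      exact Pi.single_eq_of_ne hi 1
  · simp

/-- The only relations between the `q`-monomials come from skew-symmetry: contraction with basis
vectors extracts an alternating sum, and conversely `n!` times the form has the alternating sums as
coefficients. -/
lemma sum_smul_qm_eq_zero_iff {n : ℕ} (w : (Fin n → Fin r) → ℝ) :
    ∑ l, w l • (qm l : FibAlg d r) = 0 ↔ ∀ l, altSum w l = 0 := by
  constructor
  · intro h m
    have h1 := congrArg (contrs n fun i => Pi.single (m i) 1) h
    simp only [map_sum, map_smul, map_zero, contrs_qm, smul_smul, ← Finset.sum_smul] at h1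
    rw [smul_eq_zero_iff_left one_ne_zero, Finset.sum_congr rfl fun l _ => mul_left_comm _ _ _,
      ← Finset.mul_sum, sum_mul_det] at h1
    exact (mul_eq_zero.mp h1).resolve_left (pow_ne_zero _ (by norm_num))
  · intro h
    have h1 := altSum_smul_qm (d := d) w
    simp only [h, zero_smul, Finset.sum_const_zero] at h1
    exact (smul_eq_zero.mp h1).resolve_left (Nat.cast_ne_zero.mpr n.factorial_ne_zero)

/-- `∂/∂ξ_i` and `∂/∂p_a` each annihilate the other sum and isolate a single `q`-form. -/
lemma sum_xi_add_sum_p_eq_zero_iff {n m : ℕ} (A : Fin d → (Fin n → Fin r) → ℝ)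
    (B : Fin r → (Fin m → Fin r) → ℝ) :
    ∑ i, ∑ l, A i l • (oddFib (Sum.inl i) * qm l) + ∑ a, ∑ l, B a l • (pFib a * qm l) =
      (0 : FibAlg d r) ↔ (∀ i l, altSum (A i) l = 0) ∧ (∀ a l, altSum (B a) l = 0) := by
  simp only [← mul_smul_comm, ← Finset.mul_sum]
  constructor
  · intro h
    refine ⟨fun i => ?_, fun a => ?_⟩
    · rw [← sum_smul_qm_eq_zero_iff (d := d)]
      have h1 := congrArg (dLeftFib (Sum.inl i)) h
      have h2 : ∀ (m : ℕ) (B : (Fin m → Fin r) → ℝ),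
          dLeftFib (Sum.inl i) (∑ l, B l • (qm l : FibAlg d r)) = 0 := by
        intro m B; simp
      rw [map_add, map_sum, map_sum] at h1
      simpa only [dLeftFib_oddFib_mul, dLeftFib_pFib_mul, h2, mul_zero, sub_zero,
        Finset.sum_const_zero, add_zero, Sum.inl.injEq, Finset.sum_ite_eq, Finset.mem_univ,
        if_true, map_zero] using h1
    · rw [← sum_smul_qm_eq_zero_iff (d := d)]
      have h1 := congrArg (dPFib a) h
      simpa [dPFib_mul] using h1
  · rintro ⟨hA, hB⟩
    have h1 := fun i => (sum_smul_qm_eq_zero_iff (d := d) (A i)).mpr (hA i)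
    have h2 := fun a => (sum_smul_qm_eq_zero_iff (d := d) (B a)).mpr (hB a)
    simp [h1, h2]

lemma sum_p_eq_zero_iff (g : Fin r → ℝ) :
    ∑ a, g a • (pFib a : FibAlg d r) = 0 ↔ ∀ a, g a = 0 := by
  refine ⟨fun h a => ?_, fun h => by simp [h]⟩
  have h1 := congrArg (dPFib a) h
  simpa using h1

/-- The `p_a` commute, so only the symmetric part of `g` is visible; `∂/∂p_a` recovers it. -/
lemma sum_pp_eq_zero_iff (g : Fin r → Fin r → ℝ) :
    ∑ a, ∑ b, g a b • (pFib a * pFib b : FibAlg d r) = 0 ↔ ∀ a b, g a b + g b a = 0 := by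
  constructor
  · intro h a b
    have h1 := congrArg (dPFib a) h
    simp only [← mul_smul_comm, ← Finset.mul_sum] at h1
    simp only [map_sum, dPFib_mul, dPFib_pFib, Finset.sum_add_distrib, ite_mul, one_mul, zero_mul,
      Finset.sum_ite_eq, Finset.mem_univ, if_true, map_smul, smul_ite, smul_zero, map_zero,
      mul_smul_comm, mul_one] at h1
    rw [← Finset.sum_add_distrib] at h1
    simp only [← add_smul] at h1
    exact (sum_p_eq_zero_iff (d := d) _).mp h1 b
  · intro h
    have h1 : ∑ a, ∑ b, g a b • (pFib a * pFib b : FibAlg d r) =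
        ∑ a, ∑ b, g b a • (pFib a * pFib b : FibAlg d r) := by
      rw [Finset.sum_comm]
      exact Finset.sum_congr rfl fun a _ => Finset.sum_congr rfl fun b _ => by rw [pFib_mul_comm]
    have h2 : (2 : ℝ) • ∑ a, ∑ b, g a b • (pFib a * pFib b : FibAlg d r) = 0 := by
      rw [two_smul]
      nth_rw 2 [h1]
      simp only [← Finset.sum_add_distrib, ← add_smul, h]
      simp
    exact (smul_eq_zero.mp h2).resolve_left two_ne_zero

/-- With the odd generators moved to the right, right derivatives in `ξ_i` and `q^m` isolate a
linear and a quadratic form in `p`. -/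
lemma sum_xip_add_sum_ppq_eq_zero_iff (A : Fin d → Fin r → ℝ) (B : Fin r → Fin r → Fin r → ℝ) :
    ∑ i, ∑ a, A i a • (oddFib (Sum.inl i) * pFib a) +
      ∑ a, ∑ b, ∑ m, B a b m • (pFib a * pFib b * oddFib (Sum.inr m)) = (0 : FibAlg d r) ↔
      (∀ i a, A i a = 0) ∧ (∀ a b m, B a b m + B b a m = 0) := by
  have hB : ∑ a, ∑ b, ∑ m, B a b m • (pFib a * pFib b * oddFib (Sum.inr m) : FibAlg d r) =
      ∑ m, (∑ a, ∑ b, B a b m • (pFib a * pFib b)) * oddFib (Sum.inr m) := by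
    simp only [Finset.sum_mul, smul_mul_assoc]
    rw [Finset.sum_comm]
    rw [Finset.sum_congr rfl fun b _ => Finset.sum_comm, Finset.sum_comm]
    exact Finset.sum_congr rfl fun m _ => Finset.sum_comm
  have hA : ∑ i, ∑ a, A i a • (oddFib (Sum.inl i) * pFib a : FibAlg d r) =
      ∑ i, (∑ a, A i a • pFib a) * oddFib (Sum.inl i) := by
    simp only [Finset.sum_mul, smul_mul_assoc, ← pFib_mul_comm]
  have h0 : ∀ k (g : Fin r → ℝ), dRightFib k (∑ a, g a • (pFib a : FibAlg d r)) = 0 := by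
    intro k g; simp
  have h0' : ∀ k (g : Fin r → Fin r → ℝ),
      dRightFib k (∑ a, ∑ b, g a b • (pFib a * pFib b : FibAlg d r)) = 0 := by
    intro k g; simp [dRightFib_pFib_mul]
  rw [hA, hB]
  constructor
  · intro h
    refine ⟨fun i => ?_, fun a b m => ?_⟩
    · rw [← sum_p_eq_zero_iff (d := d)]
      have h1 := congrArg (dRightFib (Sum.inl i)) h
      rw [map_add, map_sum, map_sum] at h1
      simpa [dRightFib_mul_oddFib, h0, h0', -map_sum] using h1
    · refine (sum_pp_eq_zero_iff (d := d) fun a b => B a b m).mp ?_ a b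
      have h1 := congrArg (dRightFib (Sum.inr m)) h
      rw [map_add, map_sum, map_sum] at h1
      simpa [dRightFib_mul_oddFib, h0, h0', -map_sum] using h1
  · rintro ⟨hA, hB⟩
    have h2 := fun m => (sum_pp_eq_zero_iff (d := d) (B · · m)).mpr fun a b => hB a b m
    simp [h2, hA]

end Fibre
end QP3
end

noncomputable section

namespace QP3

/-! ### Sums over multi-indices and total skew-symmetry -/

section SumLemmas

lemma sum_cons {r n : ℕ} {N : Type*} [AddCommMonoid N] (g : (Fin (n + 1) → Fin r) → N) :
    ∑ l, g l = ∑ a, ∑ l, g (Fin.cons a l) := by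
  rw [← (Fin.consEquiv fun _ => Fin r).sum_comp, Fintype.sum_prod_type]
  rfl

lemma sum_insertNth {r n : ℕ} {N : Type*} [AddCommMonoid N] (j : Fin (n + 1))
    (g : (Fin (n + 1) → Fin r) → N) :
    ∑ l, g l = ∑ a, ∑ l, g (Fin.insertNth j a l) := by
  rw [← (Fin.insertNthEquiv (fun _ => Fin r) j).sum_comp, Fintype.sum_prod_type]
  rfl

lemma sum_append {r n m : ℕ} {N : Type*} [AddCommMonoid N] (g : (Fin (n + m) → Fin r) → N) :
    ∑ l, g l = ∑ l : Fin n → Fin r, ∑ l' : Fin m → Fin r, g (Fin.append l l') := by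
  rw [← (Fin.appendEquiv n m).sum_comp, Fintype.sum_prod_type]
  rfl

lemma sum_fun_one {r : ℕ} {N : Type*} [AddCommMonoid N] (g : (Fin 1 → Fin r) → N) :
    ∑ l, g l = ∑ a, g ![a] := by
  rw [sum_cons]
  refine Finset.sum_congr rfl fun a _ => ?_
  rw [Fintype.sum_unique]
  congr 1

lemma sum_fun_zero {r : ℕ} {N : Type*} [AddCommMonoid N] (g : (Fin 0 → Fin r) → N) :
    ∑ l, g l = g ![] := by
  rw [Fintype.sum_unique]
  congr 1

/-- Total skew-symmetry. -/
def IsSkew {ι R : Type*} [AddCommGroup R] [Module ℝ R] {n : ℕ} (w : (Fin n → ι) → R) : Prop :=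
  ∀ l (σ : Equiv.Perm (Fin n)), w (l ∘ σ) = ((Equiv.Perm.sign σ : ℤ) : ℝ) • w l

/-- Adjacent transpositions generate the symmetric group, so the adjacent symmetries listed in
`StrFun` suffice. -/
lemma IsSkew.of_adjacent {ι R : Type*} [AddCommGroup R] [Module ℝ R] {n : ℕ}
    {w : (Fin (n + 1) → ι) → R}
    (h : ∀ l (i : Fin n), w (l ∘ Equiv.swap i.castSucc i.succ) = -w l) : IsSkew w := by
  intro l σ
  have hσ : σ ∈ Submonoid.closure (Set.range fun i : Fin n => Equiv.swap i.castSucc i.succ) := by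
    rw [Equiv.Perm.mclosure_swap_castSucc_succ]; trivial
  induction hσ using Submonoid.closure_induction generalizing l with
  | mem x hx =>
    obtain ⟨i, rfl⟩ := hx
    rw [h, Equiv.Perm.sign_swap (Fin.castSucc_lt_succ).ne]
    simp
  | one => simp
  | mul x y _ _ hx hy =>
    rw [Equiv.Perm.coe_mul, ← Function.comp_assoc, hy, hx, smul_smul, Equiv.Perm.sign_mul]
    push_cast
    rw [mul_comm]

lemma IsSkew.altSum {ι R : Type*} [AddCommGroup R] [Module ℝ R] {n : ℕ} {w : (Fin n → ι) → R}
    (h : IsSkew w) (l : Fin n → ι) : altSum w l = (n.factorial : ℝ) • w l := by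
  have h1 : ∀ σ : Equiv.Perm (Fin n),
      (((Equiv.Perm.sign σ : ℤ) : ℝ) * ((Equiv.Perm.sign σ : ℤ) : ℝ)) = 1 := by
    intro σ
    norm_cast
    simp
  simp only [QP3.altSum, h l, smul_smul, h1, one_smul, Finset.sum_const, Finset.card_univ,
    Fintype.card_perm, Fintype.card_fin, Nat.cast_smul_eq_nsmul]

/-- Moving the inserted entry to the front is the cycle `j.cycleRange`, of sign `(-1)^j`. -/
lemma IsSkew.insertNth {ι R : Type*} [AddCommGroup R] [Module ℝ R] {n : ℕ}
    {w : (Fin (n + 1) → ι) → R} (h : IsSkew w) (j : Fin (n + 1)) (a : ι) (l : Fin n → ι) :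
    w (Fin.insertNth j a l) = (-1 : ℝ) ^ (j : ℕ) • w (Fin.cons a l) := by
  have : (Fin.insertNth j a l : Fin (n + 1) → ι) = (Fin.cons a l : Fin (n + 1) → ι) ∘ j.cycleRange := by
    funext s
    refine Fin.succAboveCases j ?_ (fun s => ?_) s
    · simp
    · simp
  rw [this, h, Fin.sign_cycleRange]
  simp

end SumLemmas

section Loc

variable {d r : ℕ}

lemma qm_append {n m : ℕ} (l : Fin n → Fin r) (l' : Fin m → Fin r) :
    (qm (Fin.append l l') : FibAlg d r) = qm l * qm l' := by
  rw [qm, qm, qm, mk_mul_mk, one_mul, ExteriorAlgebra.ιMulti_mul_ιMulti]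
  congr 2
  funext s
  refine Fin.addCases (fun i => ?_) (fun i => ?_) s <;> simp

lemma qm_one (l : Fin 1 → Fin r) : (qm l : FibAlg d r) = oddFib (Sum.inr (l 0)) := by
  rw [qm_succ, qm_zero, mul_one]

end Loc

variable {d : ℕ} {M : Type*} [TopologicalSpace M] [ChartedSpace (EuclideanSpace ℝ (Fin d)) M]
variable {F : Type*} [NormedAddCommGroup F] [NormedSpace ℝ F]
variable {E : M → Type*} [TopologicalSpace (TotalSpace F E)] [∀ x, TopologicalSpace (E x)]
  [∀ x, AddCommGroup (E x)] [∀ x, Module ℝ (E x)] [FiberBundle F E]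

/-! ### Local functions: evaluation, standard forms and their derivatives -/

namespace NatChart

variable (c : NatChart (d := d) F E)

/-- `C^∞(U) ⊗ S(V)` is free over `C^∞(U)` on a real basis of `S(V)`, and evaluation at `x` evaluates
the coordinates of `G` in that basis. Identities of local functions may thus be checked pointwise.
-/
lemma eval_injective {G : c.Loc} (h : ∀ x, c.eval x G = 0) : G = 0 := by
  let b := Basis.ofVectorSpace ℝ (FibAlg d (finrank ℝ F))
  let B := b.baseChange c.Coeff
  have hG := B.linearCombination_repr G
  rw [Finsupp.linearCombination_apply, Finsupp.sum] at hG
  refine B.ext_elem fun j => ?_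
  rw [map_zero, Finsupp.zero_apply]
  ext x
  have h1 : ∑ j ∈ (B.repr G).support, (B.repr G j) x • b j = 0 := by
    rw [← h x]
    conv_rhs => rw [← hG]
    rw [map_sum]
    refine Finset.sum_congr rfl fun j _ => ?_
    rw [Basis.baseChange_apply, TensorProduct.smul_tmul', smul_eq_mul, mul_one, eval_tmul]
  by_cases hj : j ∈ (B.repr G).support
  · exact linearIndependent_iff'.mp b.linearIndependent _ _ h1 j hj
  · rw [Finsupp.notMem_support_iff.mp hj]

lemma eval_ext {G H : c.Loc} (h : ∀ x, c.eval x G = c.eval x H) : G = H := by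
  rw [← sub_eq_zero]
  exact c.eval_injective fun x => by rw [map_sub, h x, sub_self]

lemma eq_zero_iff_eval {G : c.Loc} : G = 0 ↔ ∀ x, c.eval x G = 0 :=
  ⟨fun h x => by rw [h, map_zero], c.eval_injective⟩

lemma tmul_mul_tmul (f g : c.Coeff) (A B : FibAlg d (finrank ℝ F)) :
    (f ⊗ₜ[ℝ] A : c.Loc) * (g ⊗ₜ B) = (f * g) ⊗ₜ (A * B) :=
  Algebra.TensorProduct.tmul_mul_tmul f g A B

/-! ### The forms `∑ A_k(l) g_k q^l` -/

/-- The form `∑ A_k(l) g_k q^l` for a family `g` of elements of the fibre algebra. -/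
def gForm {κ : Type*} [Fintype κ] {n : ℕ} (g : κ → FibAlg d (finrank ℝ F))
    (A : κ → (Fin n → Fin (finrank ℝ F)) → c.Coeff) : c.Loc :=
  ∑ k, ∑ l, A k l ⊗ₜ (g k * qm l)

/-- The form `∑ A_i(l) ξ_i q^l`. -/
def xiForm {n : ℕ} (A : Fin d → (Fin n → Fin (finrank ℝ F)) → c.Coeff) : c.Loc :=
  c.gForm (fun i => oddFib (Sum.inl i)) A

/-- The form `∑ B_a(l) p_a q^l`. -/
def pForm {n : ℕ} (B : Fin (finrank ℝ F) → (Fin n → Fin (finrank ℝ F)) → c.Coeff) : c.Loc :=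
  c.gForm pFib B

/-- The form `∑ w(l) q^l`. -/
def qForm {n : ℕ} (w : (Fin n → Fin (finrank ℝ F)) → c.Coeff) : c.Loc :=
  ∑ l, w l ⊗ₜ qm l

section Forms

variable {κ : Type*} [Fintype κ] {n m : ℕ} (g : κ → FibAlg d (finrank ℝ F))

lemma gForm_add (A B : κ → (Fin n → Fin (finrank ℝ F)) → c.Coeff) :
    c.gForm g (A + B) = c.gForm g A + c.gForm g B := by
  simp [gForm, TensorProduct.add_tmul, Finset.sum_add_distrib]

lemma gForm_smul (k : ℝ) (A : κ → (Fin n → Fin (finrank ℝ F)) → c.Coeff) :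
    c.gForm g (k • A) = k • c.gForm g A := by
  simp [gForm, TensorProduct.smul_tmul', Finset.smul_sum]

lemma gForm_neg (A : κ → (Fin n → Fin (finrank ℝ F)) → c.Coeff) :
    c.gForm g (-A) = -c.gForm g A := by
  simp [gForm, TensorProduct.neg_tmul]

lemma gForm_sum {ι : Type*} (s : Finset ι)
    (A : ι → κ → (Fin n → Fin (finrank ℝ F)) → c.Coeff) :
    c.gForm g (∑ i ∈ s, A i) = ∑ i ∈ s, c.gForm g (A i) := by
  simp only [gForm, Finset.sum_apply, TensorProduct.sum_tmul]
  rw [Finset.sum_comm, Finset.sum_congr rfl fun k _ => Finset.sum_comm]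
  rw [Finset.sum_comm]
  exact Finset.sum_congr rfl fun _ _ => Finset.sum_comm

lemma qForm_eq_gForm (w : (Fin n → Fin (finrank ℝ F)) → c.Coeff) :
    c.qForm w = c.gForm (fun _ : Unit => 1) fun _ => w := by
  simp [gForm, qForm]

lemma gForm_mul_qForm (A : κ → (Fin n → Fin (finrank ℝ F)) → c.Coeff)
    (w : (Fin m → Fin (finrank ℝ F)) → c.Coeff) :
    c.gForm g A * c.qForm w =
      c.gForm g fun k l => A k (l ∘ Fin.castAdd m) * w (l ∘ Fin.natAdd n) := by
  rw [gForm, gForm, Finset.sum_mul]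
  refine Finset.sum_congr rfl fun k _ => ?_
  rw [sum_append (N := c.Loc), qForm, Finset.sum_mul_sum]
  refine Finset.sum_congr rfl fun l _ => Finset.sum_congr rfl fun l' _ => ?_
  rw [qm_append, tmul_mul_tmul, mul_assoc]
  have h1 : Fin.append l l' ∘ Fin.castAdd m = l := by funext s; simp
  have h2 : Fin.append l l' ∘ Fin.natAdd n = l' := by funext s; simp
  rw [h1, h2]

/-- `s` is the sign of moving the `n` factors `q` past `g k`: it is `(-1)^n` for `ξ` and `1` for
`p`. -/
lemma qForm_mul_gForm (s : ℝ)
    (hg : ∀ k (l : Fin n → Fin (finrank ℝ F)), qm l * g k = s • (g k * qm l))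
    (w : (Fin n → Fin (finrank ℝ F)) → c.Coeff)
    (A : κ → (Fin m → Fin (finrank ℝ F)) → c.Coeff) :
    c.qForm w * c.gForm g A =
      s • c.gForm g fun k l => w (l ∘ Fin.castAdd m) * A k (l ∘ Fin.natAdd n) := by
  rw [gForm, gForm, Finset.mul_sum, Finset.smul_sum]
  refine Finset.sum_congr rfl fun k _ => ?_
  rw [sum_append (N := c.Loc), qForm, Finset.sum_mul_sum, Finset.smul_sum]
  refine Finset.sum_congr rfl fun l _ => ?_
  rw [Finset.smul_sum]
  refine Finset.sum_congr rfl fun l' _ => ?_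
  rw [qm_append, tmul_mul_tmul, ← mul_assoc, hg, smul_mul_assoc, mul_assoc, TensorProduct.tmul_smul]
  have h1 : Fin.append l l' ∘ Fin.castAdd m = l := by funext s; simp
  have h2 : Fin.append l l' ∘ Fin.natAdd n = l' := by funext s; simp
  rw [h1, h2]

lemma qForm_mul_xiForm (w : (Fin n → Fin (finrank ℝ F)) → c.Coeff)
    (A : Fin d → (Fin m → Fin (finrank ℝ F)) → c.Coeff) :
    c.qForm w * c.xiForm A = (-1 : ℝ) ^ n •
      c.xiForm fun k l => w (l ∘ Fin.castAdd m) * A k (l ∘ Fin.natAdd n) :=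
  c.qForm_mul_gForm _ _ (fun k l => by
    rw [oddFib_mul_qm, smul_smul, ← mul_pow]; simp) w A

lemma qForm_mul_pForm (w : (Fin n → Fin (finrank ℝ F)) → c.Coeff)
    (A : Fin (finrank ℝ F) → (Fin m → Fin (finrank ℝ F)) → c.Coeff) :
    c.qForm w * c.pForm A =
      c.pForm fun k l => w (l ∘ Fin.castAdd m) * A k (l ∘ Fin.natAdd n) := by
  rw [pForm, c.qForm_mul_gForm _ 1 (fun k l => by rw [pFib_mul_comm, one_smul]) w A, one_smul]
  rfl

lemma qForm_mul_qForm (w : (Fin n → Fin (finrank ℝ F)) → c.Coeff)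
    (w' : (Fin m → Fin (finrank ℝ F)) → c.Coeff) :
    c.qForm w * c.qForm w' =
      c.qForm fun l => w (l ∘ Fin.castAdd m) * w' (l ∘ Fin.natAdd n) := by
  rw [qForm_eq_gForm, gForm_mul_qForm, ← qForm_eq_gForm]

/-! ### Derivatives of the forms -/

lemma dP_tmul (a : Fin (finrank ℝ F)) (f : c.Coeff) (A : FibAlg d (finrank ℝ F)) :
    c.dP a (f ⊗ₜ A) = f ⊗ₜ dPFib a A := rfl

lemma dLeft_tmul (k : Fin d ⊕ Fin (finrank ℝ F)) (f : c.Coeff) (A : FibAlg d (finrank ℝ F)) :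
    c.dLeft k (f ⊗ₜ A) = f ⊗ₜ dLeftFib k A := rfl

lemma dRight_tmul (k : Fin d ⊕ Fin (finrank ℝ F)) (f : c.Coeff) (A : FibAlg d (finrank ℝ F)) :
    c.dRight k (f ⊗ₜ A) = f ⊗ₜ dRightFib k A := rfl

lemma dX_tmul [IsManifold (𝓡 d) ∞ M] (i : Fin d) (f : c.Coeff) (A : FibAlg d (finrank ℝ F)) :
    c.dX i (f ⊗ₜ A) = c.pd i f ⊗ₜ A := rfl

lemma dX_gForm [IsManifold (𝓡 d) ∞ M] (i : Fin d)
    (A : κ → (Fin n → Fin (finrank ℝ F)) → c.Coeff) :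
    c.dX i (c.gForm g A) = c.gForm g fun k l => c.pd i (A k l) := by
  simp [gForm, dX_tmul]

lemma dX_qForm [IsManifold (𝓡 d) ∞ M] (i : Fin d) (w : (Fin n → Fin (finrank ℝ F)) → c.Coeff) :
    c.dX i (c.qForm w) = c.qForm fun l => c.pd i (w l) := by
  simp [qForm, dX_tmul]

lemma dP_qForm (a : Fin (finrank ℝ F)) (w : (Fin n → Fin (finrank ℝ F)) → c.Coeff) :
    c.dP a (c.qForm w) = 0 := by
  simp [qForm, dP_tmul]

lemma dP_xiForm (a : Fin (finrank ℝ F)) (A : Fin d → (Fin n → Fin (finrank ℝ F)) → c.Coeff) :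
    c.dP a (c.xiForm A) = 0 := by
  simp [xiForm, gForm, dP_tmul, dPFib_mul]

lemma dP_pForm (a : Fin (finrank ℝ F))
    (B : Fin (finrank ℝ F) → (Fin n → Fin (finrank ℝ F)) → c.Coeff) :
    c.dP a (c.pForm B) = c.qForm (B a) := by
  simp only [pForm, gForm, map_sum, dP_tmul, dPFib_mul, dPFib_pFib, dPFib_qm, mul_zero, add_zero,
    ite_mul, one_mul, zero_mul, qForm]
  rw [Finset.sum_comm]
  refine Finset.sum_congr rfl fun l _ => ?_
  rw [Finset.sum_eq_single a (fun b _ hb => by simp [hb.symm]) (by simp)]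
  simp

lemma dLeft_xi_xiForm (i : Fin d) (A : Fin d → (Fin n → Fin (finrank ℝ F)) → c.Coeff) :
    c.dLeft (Sum.inl i) (c.xiForm A) = c.qForm (A i) := by
  simp only [xiForm, gForm, map_sum, dLeft_tmul, dLeftFib_oddFib_mul, dLeftFib_xi_qm, mul_zero,
    sub_zero, qForm]
  rw [Finset.sum_comm]
  refine Finset.sum_congr rfl fun l _ => ?_
  rw [Finset.sum_eq_single i (fun b _ hb => by simp [hb.symm]) (by simp)]
  simp

lemma dLeft_xi_pForm (i : Fin d)
    (B : Fin (finrank ℝ F) → (Fin n → Fin (finrank ℝ F)) → c.Coeff) :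
    c.dLeft (Sum.inl i) (c.pForm B) = 0 := by
  simp [pForm, gForm, dLeft_tmul, dLeftFib_pFib_mul]

lemma dLeft_xi_qForm (i : Fin d) (w : (Fin n → Fin (finrank ℝ F)) → c.Coeff) :
    c.dLeft (Sum.inl i) (c.qForm w) = 0 := by
  simp [qForm, dLeft_tmul]

lemma dRight_xi_pForm (i : Fin d)
    (B : Fin (finrank ℝ F) → (Fin n → Fin (finrank ℝ F)) → c.Coeff) :
    c.dRight (Sum.inl i) (c.pForm B) = 0 := by
  simp [pForm, gForm, dRight_tmul, dRightFib_pFib_mul]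

lemma dRight_xi_qForm (i : Fin d) (w : (Fin n → Fin (finrank ℝ F)) → c.Coeff) :
    c.dRight (Sum.inl i) (c.qForm w) = 0 := by
  simp [qForm, dRight_tmul]

lemma dRight_xi_xiForm (i : Fin d) (A : Fin d → (Fin n → Fin (finrank ℝ F)) → c.Coeff) :
    c.dRight (Sum.inl i) (c.xiForm A) = (-1 : ℝ) ^ n • c.qForm (A i) := by
  simp only [xiForm, gForm, map_sum, dRight_tmul, oddFib_mul_qm, map_smul, dRightFib_mul_oddFib,
    dRightFib_xi_qm, zero_mul, sub_zero, qForm]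
  rw [Finset.sum_comm, Finset.smul_sum]
  refine Finset.sum_congr rfl fun l _ => ?_
  rw [Finset.sum_eq_single i (fun b _ hb => by simp [hb.symm]) (by simp)]
  simp

/-- All `n + 1` positions contribute equally: the sign `(-1)^(n+j)` of the derivative and the sign
`(-1)^j` of moving the index `k` to the front combine to `(-1)^n`. -/
lemma dRight_q_qForm (k : Fin (finrank ℝ F)) {w : (Fin (n + 1) → Fin (finrank ℝ F)) → c.Coeff}
    (hw : IsSkew w) :
    c.dRight (Sum.inr k) (c.qForm w) =
      ((-1 : ℝ) ^ n * (n + 1)) • c.qForm fun l => w (Fin.cons k l) := by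
  simp only [qForm, map_sum, dRight_tmul, dRightFib_qm, TensorProduct.tmul_sum]
  rw [Finset.sum_comm]
  have : ∀ j : Fin (n + 1), ∑ l, w l ⊗ₜ[ℝ] ((if k = l j then (-1 : ℝ) ^ (n + (j : ℕ)) else 0) •
      (qm (l ∘ j.succAbove) : FibAlg d (finrank ℝ F))) =
      (-1 : ℝ) ^ n • ∑ l, w (Fin.cons k l) ⊗ₜ[ℝ] (qm l : FibAlg d (finrank ℝ F)) := by
    intro j
    rw [sum_insertNth j, Finset.sum_eq_single k _ (by simp), Finset.smul_sum]
    · refine Finset.sum_congr rfl fun l _ => ?_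
      have h1 : (Fin.insertNth j k l : Fin (n + 1) → Fin (finrank ℝ F)) ∘ j.succAbove = l := by
        funext s; simp
      rw [h1, hw.insertNth]
      simp only [Fin.insertNth_apply_same, if_true]
      rw [TensorProduct.smul_tmul, smul_smul, TensorProduct.tmul_smul]
      congr 1
      rw [pow_add, mul_comm, mul_assoc, ← mul_pow]
      simp
    · intro b _ hb
      simp [hb.symm]
  simp only [this, Finset.sum_const, Finset.card_univ, Fintype.card_fin]
  rw [← Nat.cast_smul_eq_nsmul ℝ, smul_smul, mul_comm]
  push_cast
  rfl

lemma dLeft_q_qForm_eq (k : Fin (finrank ℝ F)) (w : (Fin n → Fin (finrank ℝ F)) → c.Coeff) :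
    c.dLeft (Sum.inr k) (c.qForm w) =
      (-1 : ℝ) ^ (n + 1) • c.dRight (Sum.inr k) (c.qForm w) := by
  simp [qForm, dLeft_tmul, dRight_tmul, dLeftFib_qm, Finset.smul_sum]

lemma dRight_q_pForm (k : Fin (finrank ℝ F))
    (B : Fin (finrank ℝ F) → (Fin (n + 1) → Fin (finrank ℝ F)) → c.Coeff)
    (hB : ∀ a, IsSkew (B a)) :
    c.dRight (Sum.inr k) (c.pForm B) =
      ((-1 : ℝ) ^ n * (n + 1)) • c.pForm fun a l => B a (Fin.cons k l) := by
  have h : ∀ (m : ℕ) (B : Fin (finrank ℝ F) → (Fin m → Fin (finrank ℝ F)) → c.Coeff),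
      c.pForm B = ∑ a, c.p a * c.qForm (B a) := by
    intro m B
    simp [pForm, gForm, p, qForm, Finset.mul_sum]
  have h' : ∀ a (G : c.Loc), c.dRight (Sum.inr k) (c.p a * G) = c.p a * c.dRight (Sum.inr k) G := by
    intro a G
    induction G using TensorProduct.induction_on with
    | zero => simp
    | add x y hx hy => rw [mul_add, map_add, hx, hy, map_add, mul_add]
    | tmul f A => rw [p, tmul_mul_tmul, dRight_tmul, dRightFib_pFib_mul, dRight_tmul, tmul_mul_tmul]
  rw [h, h, map_sum, Finset.smul_sum]
  refine Finset.sum_congr rfl fun a _ => ?_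
  rw [h', dRight_q_qForm _ _ (hB a), mul_smul_comm]

/-- There is no sign because `q` is already the last factor. -/
lemma dRight_q_xiForm_one (k : Fin (finrank ℝ F))
    (A : Fin d → (Fin 1 → Fin (finrank ℝ F)) → c.Coeff) :
    c.dRight (Sum.inr k) (c.xiForm A) = c.xiForm (n := 0) fun i _ => A i ![k] := by
  simp only [xiForm, gForm, sum_fun_one, sum_fun_zero, qm_zero, qm_one, map_sum, dRight_tmul,
    dRightFib_mul_oddFib]
  refine Finset.sum_congr rfl fun i _ => ?_
  rw [Finset.sum_eq_single k (fun b _ hb => by simp [hb.symm]) (by simp)]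
  simp

end Forms

end NatChart

end QP3
end

noncomputable section

namespace QP3

/-! ### Alternating sums, central elements and vanishing criteria for local forms -/

section AltSum

variable {ι R R' : Type*} [AddCommGroup R] [Module ℝ R] [AddCommGroup R'] [Module ℝ R'] {n : ℕ}

lemma altSum_add (v w : (Fin n → ι) → R) (l : Fin n → ι) :
    altSum (fun l => v l + w l) l = altSum v l + altSum w l := by
  simp [altSum, Finset.sum_add_distrib]

lemma altSum_map (φ : R →ₗ[ℝ] R') (w : (Fin n → ι) → R) (l : Fin n → ι) :
    altSum (fun l => φ (w l)) l = φ (altSum w l) := by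
  simp [altSum]

lemma altSum_smul (k : ℝ) (w : (Fin n → ι) → R) (l : Fin n → ι) :
    altSum (fun l => k • w l) l = k • altSum w l :=
  altSum_map (LinearMap.lsmul ℝ R k) w l

lemma altSum_neg (w : (Fin n → ι) → R) (l : Fin n → ι) :
    altSum (fun l => -w l) l = -altSum w l :=
  altSum_map (-LinearMap.id) w l

/-- Reindexing by right multiplication with `τ` multiplies every sign by `sgn τ`. -/
lemma altSum_comp_perm (w : (Fin n → ι) → R) (τ : Equiv.Perm (Fin n)) (l : Fin n → ι) :
    altSum (fun l => w (l ∘ τ)) l = ((Equiv.Perm.sign τ : ℤ) : ℝ) • altSum w l := by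
  simp only [altSum, Finset.smul_sum, smul_smul]
  rw [← Equiv.sum_comp (Equiv.mulRight τ) fun σ : Equiv.Perm (Fin n) =>
    (((Equiv.Perm.sign τ : ℤ) : ℝ) * ((Equiv.Perm.sign σ : ℤ) : ℝ)) • w (l ∘ σ)]
  refine Finset.sum_congr rfl fun σ _ => ?_
  have h1 : (((Equiv.Perm.sign τ : ℤ) : ℝ) * ((Equiv.Perm.sign τ : ℤ) : ℝ)) = 1 := by
    norm_cast
    simp
  simp only [Equiv.coe_mulRight, Equiv.Perm.sign_mul, Equiv.Perm.coe_mul, ← Function.comp_assoc]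
  push_cast
  rw [mul_left_comm, h1, mul_one]

lemma altSum_two (w : (Fin 2 → ι) → R) (l : Fin 2 → ι) :
    altSum w l = w l - w ![l 1, l 0] := by
  have h : (Finset.univ : Finset (Equiv.Perm (Fin 2))) = {1, Equiv.swap 0 1} := by decide
  rw [altSum, h, Finset.sum_pair (by decide)]
  have h2 : l ∘ (Equiv.swap 0 1 : Equiv.Perm (Fin 2)) = ![l 1, l 0] := by
    funext s; fin_cases s <;> simp
  rw [h2]
  simp [sub_eq_add_neg]

end AltSum

section Center

variable {d r : ℕ}

/-- A product of two odd generators is even: passing another odd element changes the sign twice.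
Even factors occurring in brackets may therefore be reordered freely. -/
lemma oddFib_mul_oddFib_comm (k m : Fin d ⊕ Fin r) (A : FibAlg d r) :
    oddFib k * oddFib m * A = A * (oddFib k * oddFib m) := by
  have h1 : ∀ v : Fin d ⊕ Fin r → ℝ, mk 1 (ExteriorAlgebra.ι ℝ v) * (oddFib k * oddFib m) =
      oddFib k * oddFib m * (mk 1 (ExteriorAlgebra.ι ℝ v) : FibAlg d r) := by
    intro v
    have h2 : ∀ k, (oddFib k : FibAlg d r) * mk 1 (ExteriorAlgebra.ι ℝ v) =
        -(mk 1 (ExteriorAlgebra.ι ℝ v) * oddFib k) := by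
      intro k
      rw [eq_neg_iff_add_eq_zero]
      simp only [oddFib_eq, mk_mul_mk, ← mk_add, ExteriorAlgebra.ι_add_mul_swap, mk_zero]
    rw [mul_assoc, h2, mul_neg, ← mul_assoc (oddFib k), h2, neg_mul, neg_neg, mul_assoc]
  have h3 : ∀ w : ExteriorAlgebra ℝ (Fin d ⊕ Fin r → ℝ),
      oddFib k * oddFib m * mk 1 w = mk 1 w * (oddFib k * oddFib m : FibAlg d r) := by
    intro w
    induction w using ExteriorAlgebra.induction with
    | algebraMap t =>
      rw [Algebra.algebraMap_eq_smul_one, mk_smul, mk_one]; simp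
    | ι v => exact (h1 v).symm
    | mul a b ha hb =>
      have : (mk 1 (a * b) : FibAlg d r) = mk 1 a * mk 1 b := by rw [mk_mul_mk, one_mul]
      rw [this, ← mul_assoc, ha, mul_assoc, hb, mul_assoc]
    | add a b ha hb => rw [mk_add, mul_add, add_mul, ha, hb]
  induction A using fib_induction with
  | zero => simp
  | add A B hA hB => rw [mul_add, add_mul, hA, hB]
  | tmul P w =>
    have h4 : (mk P w : FibAlg d r) = mk P 1 * mk 1 w := by rw [mk_mul_mk, mul_one, one_mul]
    have h5 : ∀ B : FibAlg d r, mk P 1 * B = B * mk P 1 := fun B => commute_even P B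
    rw [h4, ← mul_assoc, ← h5, mul_assoc, h3, mul_assoc]

lemma oddFib_mul_oddFib_mem_center (k m : Fin d ⊕ Fin r) :
    oddFib k * oddFib m ∈ Subalgebra.center ℝ (FibAlg d r) :=
  Subalgebra.mem_center_iff.mpr fun A => (oddFib_mul_oddFib_comm k m A).symm

lemma pFib_mem_center (a : Fin r) : pFib a ∈ Subalgebra.center ℝ (FibAlg d r) :=
  Subalgebra.mem_center_iff.mpr fun A => (pFib_mul_comm a A).symm

lemma qm_two_mem_center (l : Fin 2 → Fin r) : qm l ∈ Subalgebra.center ℝ (FibAlg d r) := by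
  rw [qm_succ, qm_one]
  exact oddFib_mul_oddFib_mem_center _ _

lemma qm_four_mem_center (l : Fin 4 → Fin r) : qm l ∈ Subalgebra.center ℝ (FibAlg d r) := by
  rw [qm_succ, qm_succ, ← mul_assoc]
  exact mul_mem (oddFib_mul_oddFib_mem_center _ _) (qm_two_mem_center _)

end Center

variable {d : ℕ} {M : Type*} [TopologicalSpace M] [ChartedSpace (EuclideanSpace ℝ (Fin d)) M]
variable {F : Type*} [NormedAddCommGroup F] [NormedSpace ℝ F]
variable {E : M → Type*} [TopologicalSpace (TotalSpace F E)] [∀ x, TopologicalSpace (E x)]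
  [∀ x, AddCommGroup (E x)] [∀ x, Module ℝ (E x)] [FiberBundle F E]

namespace NatChart

variable (c : NatChart (d := d) F E)

lemma tmul_mem_center (f : c.Coeff) {A : FibAlg d (finrank ℝ F)}
    (hA : A ∈ Subalgebra.center ℝ (FibAlg d (finrank ℝ F))) :
    (f ⊗ₜ A : c.Loc) ∈ Subalgebra.center ℝ c.Loc := by
  rw [Subalgebra.mem_center_iff] at hA ⊢
  intro G
  induction G using TensorProduct.induction_on with
  | zero => simp
  | add x y hx hy => rw [add_mul, mul_add, hx, hy]
  | tmul g B => rw [tmul_mul_tmul, tmul_mul_tmul, hA, mul_comm]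

lemma gForm_mem_center {κ : Type*} [Fintype κ] {n : ℕ} (g : κ → FibAlg d (finrank ℝ F))
    (A : κ → (Fin n → Fin (finrank ℝ F)) → c.Coeff)
    (h : ∀ k (l : Fin n → Fin (finrank ℝ F)),
      g k * qm l ∈ Subalgebra.center ℝ (FibAlg d (finrank ℝ F))) :
    c.gForm g A ∈ Subalgebra.center ℝ c.Loc :=
  sum_mem fun k _ => sum_mem fun l _ => c.tmul_mem_center _ (h k l)

lemma eval_gForm {κ : Type*} [Fintype κ] {n : ℕ} (g : κ → FibAlg d (finrank ℝ F))
    (A : κ → (Fin n → Fin (finrank ℝ F)) → c.Coeff) (x : c.dom) :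
    c.eval x (c.gForm g A) = ∑ k, ∑ l, (A k l x) • (g k * qm l) := by
  simp [gForm, eval_tmul]

lemma eval_qForm {n : ℕ} (w : (Fin n → Fin (finrank ℝ F)) → c.Coeff) (x : c.dom) :
    c.eval x (c.qForm w) = ∑ l, (w l x) • qm l := by
  simp [qForm, eval_tmul]

lemma altSum_eval {n : ℕ} (w : (Fin n → Fin (finrank ℝ F)) → c.Coeff) (x : c.dom)
    (l : Fin n → Fin (finrank ℝ F)) : altSum (fun l => w l x) l = altSum w l x :=
  altSum_map (c.evalCoeff x).toLinearMap w l

lemma qForm_eq_zero_iff {n : ℕ} (w : (Fin n → Fin (finrank ℝ F)) → c.Coeff) :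
    c.qForm w = 0 ↔ ∀ l, altSum w l = 0 := by
  rw [eq_zero_iff_eval]
  simp only [eval_qForm, sum_smul_qm_eq_zero_iff, altSum_eval]
  exact ⟨fun h l => by ext x; exact h x l, fun h x l => by rw [h l]; rfl⟩

lemma xiForm_add_pForm_eq_zero_iff {n m : ℕ}
    (A : Fin d → (Fin n → Fin (finrank ℝ F)) → c.Coeff)
    (B : Fin (finrank ℝ F) → (Fin m → Fin (finrank ℝ F)) → c.Coeff) :
    c.xiForm A + c.pForm B = 0 ↔
      (∀ i l, altSum (A i) l = 0) ∧ ∀ a l, altSum (B a) l = 0 := by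
  rw [eq_zero_iff_eval]
  simp only [xiForm, pForm, map_add, eval_gForm, sum_xi_add_sum_p_eq_zero_iff, altSum_eval]
  exact ⟨fun h => ⟨fun i l => by ext x; exact (h x).1 i l, fun i l => by ext x; exact (h x).2 i l⟩,
    fun h x => ⟨fun i l => by rw [h.1]; rfl, fun a l => by rw [h.2]; rfl⟩⟩

/-- The form `∑ g_{ab} p_a p_b`. -/
def ppForm (g : Fin (finrank ℝ F) → Fin (finrank ℝ F) → c.Coeff) : c.Loc :=
  ∑ a, ∑ b, g a b ⊗ₜ (pFib a * pFib b)

/-- The form `∑ A_{ia} ξ_i p_a`. -/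
def xpForm (A : Fin d → Fin (finrank ℝ F) → c.Coeff) : c.Loc :=
  ∑ i, ∑ a, A i a ⊗ₜ (oddFib (Sum.inl i) * pFib a)

/-- The form `∑ B_{abm} p_a p_b q^m`. -/
def ppqForm (B : Fin (finrank ℝ F) → Fin (finrank ℝ F) → Fin (finrank ℝ F) → c.Coeff) : c.Loc :=
  ∑ a, ∑ b, ∑ m, B a b m ⊗ₜ (pFib a * pFib b * oddFib (Sum.inr m))

lemma ppForm_eq_zero_iff (g : Fin (finrank ℝ F) → Fin (finrank ℝ F) → c.Coeff) :
    c.ppForm g = 0 ↔ ∀ a b, g a b + g b a = 0 := by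
  rw [eq_zero_iff_eval]
  simp only [ppForm, map_sum, eval_tmul, sum_pp_eq_zero_iff]
  exact ⟨fun h a b => by ext x; exact h x a b, fun h x a b => congrArg (fun f : c.Coeff => f x) (h a b)⟩

lemma xpForm_add_ppqForm_eq_zero_iff (A : Fin d → Fin (finrank ℝ F) → c.Coeff)
    (B : Fin (finrank ℝ F) → Fin (finrank ℝ F) → Fin (finrank ℝ F) → c.Coeff) :
    c.xpForm A + c.ppqForm B = 0 ↔
      (∀ i a, A i a = 0) ∧ ∀ a b m, B a b m + B b a m = 0 := by
  rw [eq_zero_iff_eval]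
  simp only [xpForm, ppqForm, map_add, map_sum, eval_tmul, sum_xip_add_sum_ppq_eq_zero_iff]
  exact ⟨fun h => ⟨fun i l => by ext x; exact (h x).1 i l,
      fun i l m => by ext x; exact (h x).2 i l m⟩,
    fun h x => ⟨fun i l => by rw [h.1]; rfl, fun a b m =>
      congrArg (fun f : c.Coeff => f x) (h.2 a b m)⟩⟩

end NatChart

namespace StrFun

variable {c : NatChart (d := d) F E} (f : StrFun c)

lemma theta2_eq : f.theta2 = c.ppForm ((1 / 2 : ℝ) • f.f₂) := by
  simp [theta2, NatChart.ppForm, NatChart.coef, NatChart.p,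
    Finset.smul_sum, TensorProduct.smul_tmul']

/-- `f₃` as a function of a vector of lower indices. -/
def F3 (a : Fin (finrank ℝ F)) (l : Fin 2 → Fin (finrank ℝ F)) : c.Coeff := f.f₃ a (l 0) (l 1)

/-- `f₄` as a function of the vector of indices. -/
def F4 (l : Fin 4 → Fin (finrank ℝ F)) : c.Coeff := f.f₄ (l 0) (l 1) (l 2) (l 3)

lemma F3_skew (a : Fin (finrank ℝ F)) : IsSkew (f.F3 a) := by
  refine IsSkew.of_adjacent fun l i => ?_
  fin_cases i
  exact f.f₃_skew a _ _

lemma F4_skew : IsSkew f.F4 := by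
  refine IsSkew.of_adjacent fun l i => ?_
  fin_cases i
  · exact f.f₄_skew₁ _ _ _ _
  · exact f.f₄_skew₂ _ _ _ _
  · exact f.f₄_skew₃ _ _ _ _

lemma theta13_eq : f.theta13 = c.xiForm (n := 1) (fun i l => f.f₁ i (l 0)) +
    c.pForm ((1 / 2 : ℝ) • f.F3) := by
  rw [theta13]
  congr 1
  · simp [NatChart.xiForm, NatChart.gForm, sum_fun_one, qm_one, NatChart.coef, NatChart.xi,
      NatChart.q]
  · rw [NatChart.pForm, NatChart.gForm_smul, NatChart.gForm]
    simp [sum_cons, qm_succ, qm_zero, NatChart.coef, NatChart.p, F3,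
      NatChart.q, mul_assoc]

lemma theta4_eq : f.theta4 = c.qForm ((1 / 24 : ℝ) • f.F4) := by
  have h : c.qForm ((1 / 24 : ℝ) • f.F4) = (1 / 24 : ℝ) • c.qForm f.F4 := by
    simp [NatChart.qForm, TensorProduct.smul_tmul', Finset.smul_sum]
  rw [theta4, h, NatChart.qForm]
  simp [sum_cons, qm_succ, qm_zero, NatChart.coef, F4,
      NatChart.q, mul_assoc]
  rfl

end StrFun

end QP3
end

/-! ### The brackets of the three components in coordinates -/

noncomputable section

namespace QP3

variable {d : ℕ} {M : Type*} [TopologicalSpace M] [ChartedSpace (EuclideanSpace ℝ (Fin d)) M]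
variable {F : Type*} [NormedAddCommGroup F] [NormedSpace ℝ F]
variable {E : M → Type*} [TopologicalSpace (TotalSpace F E)] [∀ x, TopologicalSpace (E x)]
  [∀ x, AddCommGroup (E x)] [∀ x, Module ℝ (E x)] [FiberBundle F E]

namespace NatChart

variable (c : NatChart (d := d) F E)

lemma loc_neg_mul (G H : c.Loc) : -G * H = -(G * H) := neg_mul G H

lemma loc_mul_neg (G H : c.Loc) : G * -H = -(G * H) := mul_neg G H

lemma loc_neg_smul (k : ℝ) (G : c.Loc) : -k • G = -(k • G) := neg_smul k G

lemma loc_neg_one_smul (G : c.Loc) : (-1 : ℝ) • G = -G := neg_one_smul ℝ G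

lemma xiForm_add {n : ℕ} (A B : Fin d → (Fin n → Fin (finrank ℝ F)) → c.Coeff) :
    c.xiForm (A + B) = c.xiForm A + c.xiForm B := c.gForm_add _ A B

lemma pForm_add {n : ℕ} (A B : Fin (finrank ℝ F) → (Fin n → Fin (finrank ℝ F)) → c.Coeff) :
    c.pForm (A + B) = c.pForm A + c.pForm B := c.gForm_add _ A B

lemma xiForm_sum {n : ℕ} {ι : Type*} (s : Finset ι)
    (A : ι → Fin d → (Fin n → Fin (finrank ℝ F)) → c.Coeff) :
    c.xiForm (∑ i ∈ s, A i) = ∑ i ∈ s, c.xiForm (A i) := c.gForm_sum _ s A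

lemma pForm_sum {n : ℕ} {ι : Type*} (s : Finset ι)
    (A : ι → Fin (finrank ℝ F) → (Fin n → Fin (finrank ℝ F)) → c.Coeff) :
    c.pForm (∑ i ∈ s, A i) = ∑ i ∈ s, c.pForm (A i) := c.gForm_sum _ s A

lemma xiForm_smul {n : ℕ} (k : ℝ) (A : Fin d → (Fin n → Fin (finrank ℝ F)) → c.Coeff) :
    c.xiForm (k • A) = k • c.xiForm A := c.gForm_smul _ k A

lemma pForm_smul {n : ℕ} (k : ℝ)
    (A : Fin (finrank ℝ F) → (Fin n → Fin (finrank ℝ F)) → c.Coeff) :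
    c.pForm (k • A) = k • c.pForm A := c.gForm_smul _ k A

lemma qForm_smul {n : ℕ} (k : ℝ) (w : (Fin n → Fin (finrank ℝ F)) → c.Coeff) :
    c.qForm (k • w) = k • c.qForm w := by
  simp only [qForm_eq_gForm]; exact c.gForm_smul _ k fun _ => w

lemma qForm_add {n : ℕ} (v w : (Fin n → Fin (finrank ℝ F)) → c.Coeff) :
    c.qForm (v + w) = c.qForm v + c.qForm w := by
  simp only [qForm_eq_gForm]; exact c.gForm_add _ (fun _ => v) fun _ => w

lemma qForm_sum {n : ℕ} {ι : Type*} (s : Finset ι)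
    (w : ι → (Fin n → Fin (finrank ℝ F)) → c.Coeff) :
    c.qForm (∑ i ∈ s, w i) = ∑ i ∈ s, c.qForm (w i) := by
  simp only [qForm_eq_gForm]; rw [← c.gForm_sum]
  congr 1
  funext _
  simp

lemma xiForm_mem_center (A : Fin d → (Fin 1 → Fin (finrank ℝ F)) → c.Coeff) :
    c.xiForm A ∈ Subalgebra.center ℝ c.Loc :=
  c.gForm_mem_center _ _ fun k l => by rw [qm_one]; exact oddFib_mul_oddFib_mem_center _ _

lemma pForm_zero_mem_center (A : Fin (finrank ℝ F) → (Fin 0 → Fin (finrank ℝ F)) → c.Coeff) :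
    c.pForm A ∈ Subalgebra.center ℝ c.Loc :=
  c.gForm_mem_center _ _ fun k l => by rw [qm_zero, mul_one]; exact pFib_mem_center k

lemma pForm_two_mem_center (A : Fin (finrank ℝ F) → (Fin 2 → Fin (finrank ℝ F)) → c.Coeff) :
    c.pForm A ∈ Subalgebra.center ℝ c.Loc :=
  c.gForm_mem_center _ _ fun k l => mul_mem (pFib_mem_center k) (qm_two_mem_center l)

lemma qForm_two_mem_center (w : (Fin 2 → Fin (finrank ℝ F)) → c.Coeff) :
    c.qForm w ∈ Subalgebra.center ℝ c.Loc :=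
  sum_mem fun l _ => c.tmul_mem_center _ (qm_two_mem_center l)

lemma qForm_four_mem_center (w : (Fin 4 → Fin (finrank ℝ F)) → c.Coeff) :
    c.qForm w ∈ Subalgebra.center ℝ c.Loc :=
  sum_mem fun l _ => c.tmul_mem_center _ (qm_four_mem_center l)

lemma ppForm_mem_center (g : Fin (finrank ℝ F) → Fin (finrank ℝ F) → c.Coeff) :
    c.ppForm g ∈ Subalgebra.center ℝ c.Loc :=
  sum_mem fun a _ => sum_mem fun b _ => c.tmul_mem_center _
    (mul_mem (pFib_mem_center a) (pFib_mem_center b))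

lemma mul_comm_of_mem_center {G : c.Loc} (hG : G ∈ Subalgebra.center ℝ c.Loc) (H : c.Loc) :
    G * H = H * G := (Subalgebra.mem_center_iff.mp hG H).symm

lemma dX_ppForm [IsManifold (𝓡 d) ∞ M] (i : Fin d)
    (g : Fin (finrank ℝ F) → Fin (finrank ℝ F) → c.Coeff) :
    c.dX i (c.ppForm g) = c.ppForm fun a b => c.pd i (g a b) := by
  simp [ppForm, dX_tmul]

lemma dLeft_ppForm (k : Fin d ⊕ Fin (finrank ℝ F))
    (g : Fin (finrank ℝ F) → Fin (finrank ℝ F) → c.Coeff) : c.dLeft k (c.ppForm g) = 0 := by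
  simp [ppForm, dLeft_tmul, dLeftFib_pFib_mul]

lemma dRight_ppForm (k : Fin d ⊕ Fin (finrank ℝ F))
    (g : Fin (finrank ℝ F) → Fin (finrank ℝ F) → c.Coeff) : c.dRight k (c.ppForm g) = 0 := by
  simp [ppForm, dRight_tmul, dRightFib_pFib_mul]

lemma dP_ppForm (m : Fin (finrank ℝ F))
    (g : Fin (finrank ℝ F) → Fin (finrank ℝ F) → c.Coeff) :
    c.dP m (c.ppForm g) = c.pForm (n := 0) fun b _ => g m b + g b m := by
  simp only [ppForm, map_sum, dP_tmul, dPFib_mul, dPFib_pFib, pForm, gForm, sum_fun_zero, qm_zero,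
    TensorProduct.tmul_add, TensorProduct.add_tmul, Finset.sum_add_distrib, mul_one, ite_mul,
    mul_ite, one_mul, zero_mul, mul_zero]
  congr 1
  · rw [Finset.sum_eq_single m (fun a _ ha => by simp [ha.symm]) (by simp)]
    simp
  · refine Finset.sum_congr rfl fun a _ => ?_
    rw [Finset.sum_eq_single m (fun a _ ha => by simp [ha.symm]) (by simp)]
    simp

end NatChart

namespace StrFun

variable {c : NatChart (d := d) F E} (f : StrFun c)

/-! ### Derivatives of `θ₂`, `θ₁₃`, `θ₄` -/

lemma dP_theta2 (a : Fin (finrank ℝ F)) :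
    c.dP a f.theta2 = c.pForm (n := 0) fun b _ => f.f₂ a b := by
  rw [theta2_eq, NatChart.dP_ppForm]
  congr 1
  funext b _
  simp only [Pi.smul_apply, f.f₂_symm b a, ← add_smul]
  norm_num

lemma dP_theta13 (a : Fin (finrank ℝ F)) :
    c.dP a f.theta13 = c.qForm ((1 / 2 : ℝ) • f.F3 a) := by
  rw [theta13_eq, map_add, NatChart.dP_xiForm, NatChart.dP_pForm, zero_add]
  rfl

lemma dP_theta4 (a : Fin (finrank ℝ F)) : c.dP a f.theta4 = 0 := by
  rw [theta4_eq, NatChart.dP_qForm]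

lemma dLeft_theta2 (k : Fin d ⊕ Fin (finrank ℝ F)) : c.dLeft k f.theta2 = 0 := by
  rw [theta2_eq, NatChart.dLeft_ppForm]

lemma dRight_theta2 (k : Fin d ⊕ Fin (finrank ℝ F)) : c.dRight k f.theta2 = 0 := by
  rw [theta2_eq, NatChart.dRight_ppForm]

lemma dLeft_xi_theta13 (i : Fin d) :
    c.dLeft (Sum.inl i) f.theta13 = c.qForm (n := 1) fun l => f.f₁ i (l 0) := by
  rw [theta13_eq, map_add, NatChart.dLeft_xi_xiForm, NatChart.dLeft_xi_pForm, add_zero]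

lemma dRight_xi_theta13 (i : Fin d) :
    c.dRight (Sum.inl i) f.theta13 = -c.qForm (n := 1) fun l => f.f₁ i (l 0) := by
  rw [theta13_eq, map_add, NatChart.dRight_xi_xiForm, NatChart.dRight_xi_pForm, add_zero, pow_one,
    NatChart.loc_neg_one_smul]

lemma dLeft_xi_theta4 (i : Fin d) : c.dLeft (Sum.inl i) f.theta4 = 0 := by
  rw [theta4_eq, NatChart.dLeft_xi_qForm]

lemma dRight_xi_theta4 (i : Fin d) : c.dRight (Sum.inl i) f.theta4 = 0 := by
  rw [theta4_eq, NatChart.dRight_xi_qForm]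

/-- The factor `-2` from differentiating two skew indices cancels the `1/2`; the remaining sign is
absorbed by the order of the lower indices of `f₃`. -/
lemma dRight_q_theta13 (k : Fin (finrank ℝ F)) :
    c.dRight (Sum.inr k) f.theta13 = c.xiForm (n := 0) (fun i _ => f.f₁ i k) +
      c.pForm (n := 1) fun a l => f.f₃ a (l 0) k := by
  rw [theta13_eq, map_add, NatChart.dRight_q_xiForm_one, NatChart.pForm_smul, map_smul,
    NatChart.dRight_q_pForm _ _ _ f.F3_skew, smul_smul, ← NatChart.pForm_smul]
  congr 2
  funext a l
  have : f.F3 a (Fin.cons k l) = -f.f₃ a (l 0) k := f.f₃_skew _ _ _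
  simp only [Pi.smul_apply, this]
  norm_num

/-- Left and right derivatives of an even function in an odd variable are opposite; every term of
`θ₁₃` has two odd factors. -/
lemma dLeft_q_theta13 (k : Fin (finrank ℝ F)) :
    c.dLeft (Sum.inr k) f.theta13 = -c.dRight (Sum.inr k) f.theta13 := by
  have h1 : ∀ (k m : Fin (finrank ℝ F)) (i : Fin d),
      dLeftFib (Sum.inr k) (oddFib (Sum.inl i) * oddFib (Sum.inr m) : FibAlg d (finrank ℝ F)) =
      -dRightFib (Sum.inr k) (oddFib (Sum.inl i) * oddFib (Sum.inr m)) := by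
    intro k m i
    rw [dLeftFib_oddFib_mul, dRightFib_mul_oddFib]
    simp
  have h2 : ∀ (a : Fin (finrank ℝ F)) (l : Fin 2 → Fin (finrank ℝ F)),
      dLeftFib (Sum.inr k) (pFib a * qm l : FibAlg d (finrank ℝ F)) =
      -dRightFib (Sum.inr k) (pFib a * qm l) := by
    intro a l
    rw [dLeftFib_pFib_mul, dRightFib_pFib_mul, dLeftFib_qm]
    norm_num
  simp only [theta13_eq, NatChart.xiForm, NatChart.pForm, NatChart.gForm, map_add, map_sum,
    NatChart.dLeft_tmul, NatChart.dRight_tmul, qm_one, h1, h2, TensorProduct.tmul_neg,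
    Finset.sum_neg_distrib, neg_add]

/-- Four skew indices give the factor `(-1)^3 * 4`, and `4 / 24 = 1 / 6`. -/
lemma dRight_q_theta4 (k : Fin (finrank ℝ F)) :
    c.dRight (Sum.inr k) f.theta4 = -c.qForm ((1 / 6 : ℝ) • fun l => f.F4 (Fin.cons k l)) := by
  rw [theta4_eq, NatChart.qForm_smul, map_smul, NatChart.dRight_q_qForm _ _ f.F4_skew, smul_smul,
    NatChart.qForm_smul, ← NatChart.loc_neg_smul]
  norm_num
  exact (c.loc_neg_smul _ _).symm

lemma dLeft_q_theta4 (k : Fin (finrank ℝ F)) :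
    c.dLeft (Sum.inr k) f.theta4 = -c.dRight (Sum.inr k) f.theta4 := by
  rw [theta4_eq, NatChart.dLeft_q_qForm_eq, ← NatChart.loc_neg_one_smul]
  norm_num

variable [IsManifold (𝓡 d) ∞ M]

lemma dX_theta2 (i : Fin d) :
    c.dX i f.theta2 = c.ppForm fun a b => (1 / 2 : ℝ) • c.pd i (f.f₂ a b) := by
  rw [theta2_eq, NatChart.dX_ppForm]
  simp

lemma dX_theta13 (i : Fin d) :
    c.dX i f.theta13 = c.xiForm (n := 1) (fun j l => c.pd i (f.f₁ j (l 0))) +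
      c.pForm fun a l => (1 / 2 : ℝ) • c.pd i (f.F3 a l) := by
  rw [theta13_eq, map_add]
  simp only [NatChart.xiForm, NatChart.pForm, NatChart.dX_gForm, Pi.smul_apply, map_smul]

lemma dX_theta4 (i : Fin d) :
    c.dX i f.theta4 = c.qForm fun l => (1 / 24 : ℝ) • c.pd i (f.F4 l) := by
  rw [theta4_eq, NatChart.dX_qForm]
  simp

lemma dX_theta13_mem_center (i : Fin d) : c.dX i f.theta13 ∈ Subalgebra.center ℝ c.Loc := by
  rw [dX_theta13]
  exact add_mem (c.xiForm_mem_center _) (c.pForm_two_mem_center _)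

/-! ### The brackets of `θ₂`, `θ₁₃`, `θ₄` -/

lemma bracket_theta2_theta2 : c.bracket f.theta2 f.theta2 = 0 := by
  simp [NatChart.bracket, dLeft_theta2, dRight_theta2]

lemma bracket_theta4_theta4 : c.bracket f.theta4 f.theta4 = 0 := by
  simp [NatChart.bracket, dLeft_xi_theta4, dRight_xi_theta4, dP_theta4]

/-- The bracket has odd degree and is therefore symmetric on functions of even degree. The mixed
cases that are needed, here and in the next two lemmas, are verified directly: left and right
derivatives differ by signs, and the even factors are central. -/
lemma bracket_theta2_theta13 : c.bracket f.theta2 f.theta13 = c.bracket f.theta13 f.theta2 := by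
  simp only [NatChart.bracket, dLeft_theta2, dRight_theta2, dX_theta2, dP_theta2, dLeft_xi_theta13,
    dRight_xi_theta13, dLeft_q_theta13, zero_mul, mul_zero, sub_zero, zero_sub, NatChart.loc_neg_mul, NatChart.loc_mul_neg,
    neg_neg]
  congr 1 <;> refine Finset.sum_congr rfl fun i _ => ?_
  · exact c.mul_comm_of_mem_center (c.ppForm_mem_center _) _
  · exact c.mul_comm_of_mem_center (c.pForm_zero_mem_center _) _

lemma bracket_theta4_theta2 : c.bracket f.theta4 f.theta2 = c.bracket f.theta2 f.theta4 := by
  simp only [NatChart.bracket, dLeft_theta2, dRight_theta2, dP_theta2, dLeft_xi_theta4,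
    dRight_xi_theta4, dLeft_q_theta4, zero_mul, mul_zero, sub_zero, zero_sub, NatChart.loc_mul_neg,
    neg_neg]
  congr 1
  refine Finset.sum_congr rfl fun i _ => ?_
  exact (c.mul_comm_of_mem_center (c.pForm_zero_mem_center _) _).symm

lemma bracket_theta4_theta13 : c.bracket f.theta4 f.theta13 = c.bracket f.theta13 f.theta4 := by
  simp only [NatChart.bracket, dLeft_xi_theta13, dRight_xi_theta13, dLeft_q_theta13, dP_theta13,
    dLeft_xi_theta4, dRight_xi_theta4, dLeft_q_theta4, dP_theta4, dX_theta4, zero_mul, mul_zero,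
    sub_zero, zero_sub, NatChart.loc_mul_neg, NatChart.loc_neg_mul, neg_neg]
  congr 1 <;> refine Finset.sum_congr rfl fun i _ => ?_
  · exact c.mul_comm_of_mem_center (c.qForm_four_mem_center _) _
  · exact (c.mul_comm_of_mem_center (c.qForm_two_mem_center _) _).symm

/-- The `x`-`ξ` part of the bracket differentiates `f₂`; the `q`-`p` part produces `f₁ f₂` with a
factor `ξ` and `f₃ f₂` without. The coefficients of `p_a p_b q^m` are left unsymmetrised. -/
lemma bracket_theta13_theta2 : c.bracket f.theta13 f.theta2 =
    c.xpForm (fun i a => ∑ b, f.f₁ i b * f.f₂ b a) +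
    c.ppqForm fun a b m => (1 / 2 : ℝ) • ∑ k, f.f₁ k m * c.pd k (f.f₂ a b) +
      ∑ n, f.f₃ b m n * f.f₂ n a := by
  have h1 : ∀ i, c.dX i f.theta13 * c.dLeft (Sum.inl i) f.theta2 -
      c.dRight (Sum.inl i) f.theta13 * c.dX i f.theta2 =
      c.ppqForm fun a b m => (1 / 2 : ℝ) • (f.f₁ i m * c.pd i (f.f₂ a b)) := by
    intro i
    rw [dLeft_theta2, mul_zero, zero_sub, dRight_xi_theta13, NatChart.loc_neg_mul, neg_neg, dX_theta2,
      ← c.mul_comm_of_mem_center (c.ppForm_mem_center _)]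
    simp only [NatChart.ppForm, NatChart.qForm, sum_fun_one, qm_one, Finset.sum_mul,
      NatChart.ppqForm]
    refine Finset.sum_congr rfl fun a _ => Finset.sum_congr rfl fun b _ => ?_
    rw [Finset.mul_sum]
    refine Finset.sum_congr rfl fun m _ => ?_
    rw [NatChart.tmul_mul_tmul, smul_mul_assoc, mul_comm (c.pd i _)]
    rfl
  have h2 : ∀ n, c.dRight (Sum.inr n) f.theta13 * c.dP n f.theta2 -
      c.dP n f.theta13 * c.dLeft (Sum.inr n) f.theta2 =
      c.xpForm (fun i a => f.f₁ i n * f.f₂ n a) + c.ppqForm fun a b m => f.f₃ b m n * f.f₂ n a := by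
    intro n
    rw [dLeft_theta2, mul_zero, sub_zero, dRight_q_theta13, add_mul, dP_theta2]
    congr 1
    · simp only [NatChart.xiForm, NatChart.pForm, NatChart.gForm, sum_fun_zero, qm_zero, mul_one,
        Finset.sum_mul_sum, NatChart.tmul_mul_tmul, NatChart.xpForm]
    · rw [← c.mul_comm_of_mem_center (c.pForm_zero_mem_center _)]
      simp only [NatChart.pForm, NatChart.gForm, sum_fun_zero, sum_fun_one, qm_zero, qm_one,
        mul_one, NatChart.ppqForm]
      rw [Finset.sum_mul_sum]
      refine Finset.sum_congr rfl fun a _ => Finset.sum_congr rfl fun b _ => ?_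
      rw [Finset.mul_sum]
      refine Finset.sum_congr rfl fun m _ => ?_
      rw [NatChart.tmul_mul_tmul, mul_comm (f.f₂ n a), mul_assoc]
      rfl
  have h3 : ∀ A : Fin (finrank ℝ F) → Fin d → Fin (finrank ℝ F) → c.Coeff,
      ∑ n, c.xpForm (A n) = c.xpForm fun i a => ∑ n, A n i a := by
    intro A
    simp only [NatChart.xpForm, TensorProduct.sum_tmul]
    rw [Finset.sum_comm]
    exact Finset.sum_congr rfl fun i _ => Finset.sum_comm
  have h4 : ∀ (κ : Type) [Fintype κ]
      (B : κ → Fin (finrank ℝ F) → Fin (finrank ℝ F) → Fin (finrank ℝ F) → c.Coeff),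
      ∑ n, c.ppqForm (B n) = c.ppqForm fun a b m => ∑ n, B n a b m := by
    intro κ _ B
    simp only [NatChart.ppqForm, TensorProduct.sum_tmul]
    rw [Finset.sum_comm]
    refine Finset.sum_congr rfl fun i _ => ?_
    rw [Finset.sum_comm]
    exact Finset.sum_congr rfl fun i _ => Finset.sum_comm
  rw [NatChart.bracket, Finset.sum_congr rfl fun i _ => h1 i, Finset.sum_congr rfl fun n _ => h2 n,
    Finset.sum_add_distrib, h3, h4, h4, add_left_comm]
  congr 1
  simp only [NatChart.ppqForm, TensorProduct.add_tmul, Finset.sum_add_distrib, Finset.smul_sum]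

/-- The coefficients are not antisymmetrised at this stage; the vanishing criterion takes care of
that. -/
lemma half_bracket_theta13_theta13_add : (1 / 2 : ℝ) • c.bracket f.theta13 f.theta13 +
      c.bracket f.theta2 f.theta4 =
    c.xiForm (n := 2) (fun i l => -∑ k, f.f₁ k (l 0) * c.pd k (f.f₁ i (l 1)) +
      (1 / 2 : ℝ) • ∑ m, f.f₁ i m * f.f₃ m (l 0) (l 1)) +
    c.pForm (n := 3) fun b l => (1 / 2 : ℝ) • ∑ k, f.f₁ k (l 0) * c.pd k (f.f₃ b (l 1) (l 2)) +
      (1 / 2 : ℝ) • ∑ m, f.f₃ b (l 0) m * f.f₃ m (l 1) (l 2) -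
      (1 / 6 : ℝ) • ∑ m, f.f₂ m b * f.F4 (Fin.cons m l) := by
  -- The two products in the bracket are equal, since the left and right `ξ_i`-derivatives are
  -- opposite and `∂θ₁₃/∂x^i` is central. The factor `2` cancels the `1/2` in front; the `q`-`p`
  -- part in `h2` behaves in the same way.
  have h1 : ∀ i, c.dX i f.theta13 * c.dLeft (Sum.inl i) f.theta13 -
      c.dRight (Sum.inl i) f.theta13 * c.dX i f.theta13 =
      (2 : ℝ) • (c.xiForm (n := 2) (fun j l => -(f.f₁ i (l 0) * c.pd i (f.f₁ j (l 1)))) +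
        c.pForm (n := 3) fun b l => (1 / 2 : ℝ) • (f.f₁ i (l 0) * c.pd i (f.f₃ b (l 1) (l 2)))) := by
    intro i
    rw [c.mul_comm_of_mem_center (f.dX_theta13_mem_center i), dLeft_xi_theta13, dRight_xi_theta13,
      NatChart.loc_neg_mul, sub_neg_eq_add, ← two_smul ℝ, dX_theta13, mul_add, NatChart.qForm_mul_xiForm,
      NatChart.qForm_mul_pForm, pow_one, ← NatChart.xiForm_smul]
    congr 3
    · funext j l
      simp only [Pi.smul_apply, neg_smul, one_smul]
      rfl
    · funext b l
      rw [mul_smul_comm]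
      rfl
  have h2 : ∀ n, c.dRight (Sum.inr n) f.theta13 * c.dP n f.theta13 -
      c.dP n f.theta13 * c.dLeft (Sum.inr n) f.theta13 =
      (2 : ℝ) • (c.xiForm (n := 2) (fun i l => (1 / 2 : ℝ) • (f.f₁ i n * f.f₃ n (l 0) (l 1))) +
        c.pForm (n := 3) fun b l => (1 / 2 : ℝ) • (f.f₃ b (l 0) n * f.f₃ n (l 1) (l 2))) := by
    intro n
    rw [dLeft_q_theta13, dP_theta13, c.mul_comm_of_mem_center (c.qForm_two_mem_center _),
      NatChart.loc_neg_mul,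
      sub_neg_eq_add, ← two_smul ℝ, dRight_q_theta13, add_mul, NatChart.xiForm, NatChart.pForm,
      NatChart.gForm_mul_qForm, NatChart.gForm_mul_qForm]
    congr 2
    · rw [NatChart.xiForm]
      congr 1
      funext j l
      rw [Pi.smul_apply, mul_smul_comm]
      rfl
    · rw [NatChart.pForm]
      congr 1
      funext j l
      rw [Pi.smul_apply, mul_smul_comm]
      rfl
  have h3 : c.bracket f.theta2 f.theta4 =
      -c.pForm (n := 3) fun b l => (1 / 6 : ℝ) • ∑ m, f.f₂ m b * f.F4 (Fin.cons m l) := by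
    simp only [NatChart.bracket, dLeft_xi_theta4, dRight_theta2, zero_mul, mul_zero, sub_zero,
      Finset.sum_const_zero, zero_add, zero_sub, dLeft_q_theta4, dRight_q_theta4, neg_neg,
      Finset.sum_neg_distrib, dP_theta2, neg_inj]
    simp only [NatChart.pForm, NatChart.gForm_mul_qForm]
    rw [← NatChart.gForm_sum]
    congr 1
    funext b l
    simp only [Finset.sum_apply, Finset.smul_sum, Pi.smul_apply, mul_smul_comm]
    rfl
  rw [h3, NatChart.bracket, Finset.sum_congr rfl fun i _ => h1 i,
    Finset.sum_congr rfl fun n _ => h2 n, ← Finset.smul_sum, ← Finset.smul_sum, ← smul_add,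
    smul_smul]
  norm_num only [one_smul, one_div, inv_mul_cancel₀]
  rw [Finset.sum_add_distrib, Finset.sum_add_distrib, ← NatChart.xiForm_sum, ← NatChart.xiForm_sum,
    ← NatChart.pForm_sum, ← NatChart.pForm_sum, add_add_add_comm, ← NatChart.xiForm_add,
    ← NatChart.pForm_add, add_assoc, NatChart.pForm, NatChart.pForm, ← NatChart.gForm_neg,
    ← NatChart.gForm_add]
  congr 2
  · funext i l
    simp [Finset.smul_sum]
  · funext b l
    simp [Finset.smul_sum, sub_eq_add_neg]

lemma bracket_theta13_theta4 : c.bracket f.theta13 f.theta4 =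
    c.qForm (n := 5) fun l => (1 / 24 : ℝ) • ∑ k, f.f₁ k (l 0) * c.pd k (f.f₄ (l 1) (l 2) (l 3) (l 4)) +
      (1 / 12 : ℝ) • ∑ m, f.f₃ m (l 0) (l 1) * f.f₄ (l 2) (l 3) (l 4) m := by
  have h1 : ∀ i, c.dX i f.theta13 * c.dLeft (Sum.inl i) f.theta4 -
      c.dRight (Sum.inl i) f.theta13 * c.dX i f.theta4 =
      c.qForm (n := 5) fun l =>
        (1 / 24 : ℝ) • (f.f₁ i (l 0) * c.pd i (f.f₄ (l 1) (l 2) (l 3) (l 4))) := by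
    intro i
    rw [dLeft_xi_theta4, mul_zero, zero_sub, dRight_xi_theta13, NatChart.loc_neg_mul, neg_neg, dX_theta4,
      NatChart.qForm_mul_qForm]
    congr 1
    funext l
    rw [mul_smul_comm]
    rfl
  have h2 : ∀ n, c.dRight (Sum.inr n) f.theta13 * c.dP n f.theta4 -
      c.dP n f.theta13 * c.dLeft (Sum.inr n) f.theta4 =
      c.qForm (n := 5) fun l => (1 / 12 : ℝ) • (f.f₃ n (l 0) (l 1) * f.f₄ (l 2) (l 3) (l 4) n) := by
    intro n
    rw [dP_theta4, mul_zero, zero_sub, dP_theta13, dLeft_q_theta4, dRight_q_theta4, neg_neg,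
      NatChart.qForm_mul_qForm, ← NatChart.loc_neg_one_smul, ← NatChart.qForm_smul]
    congr 1
    funext l
    -- Three adjacent transpositions carry the leading index to the last place.
    have h4 : ∀ a b a' b', f.f₄ a b a' b' = -f.f₄ b a' b' a := fun a b a' b' => by
      rw [f.f₄_skew₁, f.f₄_skew₂, f.f₄_skew₃, neg_neg]
    have h5 : f.F4 (Fin.cons n (l ∘ Fin.natAdd 2)) = -f.f₄ (l 2) (l 3) (l 4) n := h4 _ _ _ _
    simp only [Pi.smul_apply, h5, smul_mul_assoc, mul_smul_comm, smul_smul, mul_neg, smul_neg]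
    norm_num
    rfl
  rw [NatChart.bracket, Finset.sum_congr rfl fun i _ => h1 i, Finset.sum_congr rfl fun n _ => h2 n,
    ← NatChart.qForm_sum, ← NatChart.qForm_sum, ← NatChart.qForm_add]
  congr 1
  funext l
  simp [Finset.smul_sum]

end StrFun

end QP3
end

/-! ### The structure equations; existence and uniqueness of structure functions -/

noncomputable section

namespace QP3

variable {d : ℕ} {M : Type*} [TopologicalSpace M] [ChartedSpace (EuclideanSpace ℝ (Fin d)) M]
variable {F : Type*} [NormedAddCommGroup F] [NormedSpace ℝ F]
variable {E : M → Type*} [TopologicalSpace (TotalSpace F E)] [∀ x, TopologicalSpace (E x)]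
  [∀ x, AddCommGroup (E x)] [∀ x, Module ℝ (E x)] [FiberBundle F E]

namespace NatChart

variable (c : NatChart (d := d) F E)

lemma xiForm_neg {n : ℕ} (A : Fin d → (Fin n → Fin (finrank ℝ F)) → c.Coeff) :
    c.xiForm (-A) = -c.xiForm A := c.gForm_neg _ A

lemma pForm_neg {n : ℕ} (A : Fin (finrank ℝ F) → (Fin n → Fin (finrank ℝ F)) → c.Coeff) :
    c.pForm (-A) = -c.pForm A := c.gForm_neg _ A

end NatChart

namespace StrFun

variable {c : NatChart (d := d) F E} (f : StrFun c)

section MasterEquation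

variable [IsManifold (𝓡 d) ∞ M]

/-- Adding the coefficients for `(a, b)` and `(b, a)` doubles the half derivative term and supplies
both `f₂ f₃` terms of `FC2`. -/
theorem bracket_theta13_theta2_eq_zero_iff :
    c.bracket f.theta13 f.theta2 = 0 ↔ f.FC1 ∧ f.FC2 := by
  rw [bracket_theta13_theta2, NatChart.xpForm_add_ppqForm_eq_zero_iff]
  refine and_congr Iff.rfl (forall_congr' fun a => forall_congr' fun b => forall_congr' fun m => ?_)
  simp only [f.f₂_symm b a]
  rw [add_add_add_comm, ← add_smul, Finset.sum_add_distrib,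
    add_comm (∑ n, f.f₂ n a * f.f₃ b m n)]
  norm_num
  simp only [mul_comm, add_comm]

/-- The alternating sum of the `ξ q q` coefficients over two indices is the left-hand side of `FC3`,
that of the `p q q q` coefficients over three indices the left-hand side of `FC4`. -/
theorem half_bracket_theta13_theta13_add_eq_zero_iff :
    (1 / 2 : ℝ) • c.bracket f.theta13 f.theta13 + c.bracket f.theta2 f.theta4 = 0 ↔
      f.FC3 ∧ f.FC4 := by
  rw [half_bracket_theta13_theta13_add, NatChart.xiForm_add_pForm_eq_zero_iff]
  refine and_congr (forall_congr' fun i => ?_) (forall_congr' fun b => forall_congr' fun l => ?_)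
  · have h : ∀ a b : Fin (finrank ℝ F), altSum (fun l : Fin 2 → Fin (finrank ℝ F) =>
        -∑ k, f.f₁ k (l 0) * c.pd k (f.f₁ i (l 1)) +
        (1 / 2 : ℝ) • ∑ m, f.f₁ i m * f.f₃ m (l 0) (l 1)) ![a, b] =
        ∑ k, (f.f₁ k b * c.pd k (f.f₁ i a) - f.f₁ k a * c.pd k (f.f₁ i b)) +
        ∑ m, f.f₁ i m * f.f₃ m a b := by
      intro a b
      simp only [altSum_two, Matrix.cons_val_zero, Matrix.cons_val_one, f.f₃_skew _ b a, mul_neg,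
        Finset.sum_neg_distrib, smul_neg, Finset.sum_sub_distrib]
      module
    constructor
    · intro H a b; rw [← h, H]
    · intro H l
      rw [show l = ![l 0, l 1] by funext s; fin_cases s <;> rfl, h, H]
  -- A rotation of three indices is even, so the index of the derivation may move from the first to
  -- the last place.
  · have h1 : altSum (fun l : Fin 3 → Fin (finrank ℝ F) =>
        ∑ k, f.f₁ k (l 0) * c.pd k (f.f₃ b (l 1) (l 2))) l =
        altSum (fun l => ∑ k, f.f₁ k (l 2) * c.pd k (f.f₃ b (l 0) (l 1))) l := by
      have := altSum_comp_perm (fun l : Fin 3 → Fin (finrank ℝ F) =>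
        ∑ k, f.f₁ k (l 0) * c.pd k (f.f₃ b (l 1) (l 2))) (finRotate 3)⁻¹ l
      rw [Equiv.Perm.sign_inv, sign_finRotate] at this
      norm_num at this
      rw [← this]
      rfl
    have h2 : ∀ l : Fin 3 → Fin (finrank ℝ F), ∑ m, f.f₃ b (l 0) m * f.f₃ m (l 1) (l 2) =
        -∑ m, f.f₃ b m (l 0) * f.f₃ m (l 1) (l 2) := by
      intro l
      rw [← Finset.sum_neg_distrib]
      exact Finset.sum_congr rfl fun m _ => by rw [f.f₃_skew b (l 0) m, neg_mul]
    have h3 : ∀ l : Fin 3 → Fin (finrank ℝ F), ∑ m, f.f₂ m b * f.F4 (Fin.cons m l) =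
        -∑ m, f.f₂ b m * f.f₄ (l 0) (l 1) (l 2) m := by
      intro l
      rw [← Finset.sum_neg_distrib]
      refine Finset.sum_congr rfl fun m _ => ?_
      have h4 : f.F4 (Fin.cons m l) = f.f₄ m (l 0) (l 1) (l 2) := rfl
      rw [h4, f.f₄_skew₁, f.f₄_skew₂, f.f₄_skew₃, neg_neg, mul_neg, f.f₂_symm m b]
    -- The term `f₂ f₄` is already skew; its alternating sum is `3! = 6` times itself, which cancels
    -- the `1/6`.
    have h5 : IsSkew fun l : Fin 3 → Fin (finrank ℝ F) =>
        ∑ m, f.f₂ b m * f.f₄ (l 0) (l 1) (l 2) m := by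
      refine IsSkew.of_adjacent fun l i => ?_
      rw [← Finset.sum_neg_distrib]
      refine Finset.sum_congr rfl fun m _ => ?_
      rw [← mul_neg]
      fin_cases i
      · exact congrArg _ (f.f₄_skew₁ _ _ _ _)
      · exact congrArg _ (f.f₄_skew₂ _ _ _ _)
    have h6 := h5.altSum l
    simp only [h2, h3, sub_eq_add_neg, altSum_add, altSum_smul, altSum_neg, smul_neg, neg_neg, h1,
      h6]
    rw [show ((Nat.factorial 3 : ℕ) : ℝ) = 6 by norm_num [Nat.factorial], smul_smul]
    norm_num
    rw [add_right_comm]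

theorem bracket_theta13_theta4_eq_zero_iff : c.bracket f.theta13 f.theta4 = 0 ↔ f.FC5 := by
  rw [bracket_theta13_theta4, NatChart.qForm_eq_zero_iff]
  refine forall_congr' fun l => ?_
  rw [altSum_add, altSum_smul, altSum_smul]

end MasterEquation

/-! ### Existence and uniqueness of the structure functions -/

@[ext] lemma ext' {f g : StrFun c} (h₁ : ∀ i a, f.f₁ i a = g.f₁ i a)
    (h₂ : ∀ a b, f.f₂ a b = g.f₂ a b) (h₃ : ∀ a b b', f.f₃ a b b' = g.f₃ a b b')
    (h₄ : ∀ a b a' b', f.f₄ a b a' b' = g.f₄ a b a' b') : f = g := by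
  cases f; cases g
  simp only [StrFun.mk.injEq]
  exact ⟨funext₂ h₁, funext₂ h₂, by funext a b b'; exact h₃ a b b',
    by funext a b a' b'; exact h₄ a b a' b'⟩

lemma f₂_eq_of_theta2_eq {f g : StrFun c} (h : f.theta2 = g.theta2) (a b : Fin (finrank ℝ F)) :
    f.f₂ a b = g.f₂ a b := by
  have h1 := (c.ppForm_eq_zero_iff ((1 / 2 : ℝ) • f.f₂ - (1 / 2 : ℝ) • g.f₂)).mp (by
    have : ∀ u v : Fin (finrank ℝ F) → Fin (finrank ℝ F) → c.Coeff,
        c.ppForm (u - v) = c.ppForm u - c.ppForm v := by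
      intro u v
      simp [NatChart.ppForm, TensorProduct.sub_tmul]
    rw [this, ← theta2_eq, ← theta2_eq, h, sub_self]) a b
  simp only [Pi.sub_apply, Pi.smul_apply, f.f₂_symm b a, g.f₂_symm b a] at h1
  rw [← sub_eq_zero, ← h1]
  module

/-- The differences of the coefficients have vanishing alternating sums. For `f₁` there is one index
and nothing to alternate; for `f₃` the difference is skew, so its alternating sum is a nonzero
multiple of it. -/
lemma f₁_f₃_eq_of_theta13_eq {f g : StrFun c} (h : f.theta13 = g.theta13) :
    (∀ i a, f.f₁ i a = g.f₁ i a) ∧ ∀ a b b', f.f₃ a b b' = g.f₃ a b b' := by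
  have h1 := (c.xiForm_add_pForm_eq_zero_iff
      ((fun i l => f.f₁ i (l 0)) + -fun i (l : Fin 1 → Fin (finrank ℝ F)) => g.f₁ i (l 0))
      ((1 / 2 : ℝ) • f.F3 + -((1 / 2 : ℝ) • g.F3))).mp (by
    rw [NatChart.xiForm_add, NatChart.pForm_add, add_add_add_comm, ← theta13_eq, h, theta13_eq,
      c.xiForm_neg, c.pForm_neg]
    abel)
  refine ⟨fun i a => ?_, fun a b b' => ?_⟩
  · have h2 := h1.1 i ![a]
    have h3 : ∀ w : (Fin 1 → Fin (finrank ℝ F)) → c.Coeff, ∀ l, altSum w l = w l := by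
      intro w l
      rw [altSum, Fintype.sum_unique]
      have : (default : Equiv.Perm (Fin 1)) = 1 := Subsingleton.elim _ _
      rw [this]
      simp
    rw [h3] at h2
    exact sub_eq_zero.mp (by rw [← h2]; rfl)
  · have h2 := h1.2 a ![b, b']
    have h3 : IsSkew (((1 / 2 : ℝ) • f.F3 + -((1 / 2 : ℝ) • g.F3)) a) := by
      intro l σ
      simp only [Pi.add_apply, Pi.neg_apply, Pi.smul_apply, f.F3_skew a l σ, g.F3_skew a l σ]
      module
    rw [h3.altSum] at h2
    have h4 : (1 / 2 : ℝ) • f.f₃ a b b' + -((1 / 2 : ℝ) • g.f₃ a b b') = 0 :=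
      (smul_eq_zero.mp h2).resolve_left (Nat.cast_ne_zero.mpr (Nat.factorial_ne_zero 2))
    rw [← sub_eq_add_neg, ← smul_sub] at h4
    exact sub_eq_zero.mp ((smul_eq_zero.mp h4).resolve_left (by norm_num))

lemma f₄_eq_of_theta4_eq {f g : StrFun c} (h : f.theta4 = g.theta4)
    (a b a' b' : Fin (finrank ℝ F)) : f.f₄ a b a' b' = g.f₄ a b a' b' := by
  have h1 := (c.qForm_eq_zero_iff ((1 / 24 : ℝ) • f.F4 + (-1 / 24 : ℝ) • g.F4)).mp (by
    rw [NatChart.qForm_add, ← theta4_eq, h, theta4_eq, NatChart.qForm_smul, NatChart.qForm_smul,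
      ← add_smul]
    norm_num) ![a, b, a', b']
  have h3 : IsSkew ((1 / 24 : ℝ) • f.F4 + (-1 / 24 : ℝ) • g.F4) := by
    intro l σ
    simp only [Pi.add_apply, Pi.smul_apply, f.F4_skew l σ, g.F4_skew l σ]
    module
  rw [h3.altSum] at h1
  have h4 : (1 / 24 : ℝ) • f.f₄ a b a' b' + (-1 / 24 : ℝ) • g.f₄ a b a' b' = 0 :=
    (smul_eq_zero.mp h1).resolve_left (Nat.cast_ne_zero.mpr (Nat.factorial_ne_zero 4))
  have h5 : (1 / 24 : ℝ) • (f.f₄ a b a' b' - g.f₄ a b a' b') = 0 := by rw [← h4]; module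
  exact sub_eq_zero.mp ((smul_eq_zero.mp h5).resolve_left (by norm_num))

lemma eq_of_theta_eq {f g : StrFun c} (h₂ : f.theta2 = g.theta2) (h₁₃ : f.theta13 = g.theta13)
    (h₄ : f.theta4 = g.theta4) : f = g :=
  ext' (f₁_f₃_eq_of_theta13_eq h₁₃).1 (f₂_eq_of_theta2_eq h₂) (f₁_f₃_eq_of_theta13_eq h₁₃).2
    (f₄_eq_of_theta4_eq h₄)

end StrFun

namespace NatChart

variable (c : NatChart (d := d) F E)

lemma monomials_eq (i j k : ℕ) (G : c.Loc) (hG : G ∈ c.monomials i j k) :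
    ∃ (f : c.Coeff) (l : Fin i → Fin d) (m : Fin j → Fin (finrank ℝ F))
      (n : Fin k → Fin (finrank ℝ F)),
      G = f ⊗ₜ ((List.ofFn fun s => oddFib (Sum.inl (l s))).prod *
        (List.ofFn fun s => pFib (m s)).prod * (List.ofFn fun s => oddFib (Sum.inr (n s))).prod) := by
  obtain ⟨f, l, m, n, rfl⟩ := hG
  have h : ∀ {N : ℕ} (g : Fin N → FibAlg d (finrank ℝ F)),
      (List.ofFn fun s => (1 ⊗ₜ g s : c.Loc)).prod = 1 ⊗ₜ (List.ofFn g).prod := by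
    intro N g
    induction N with
    | zero => simp [Algebra.TensorProduct.one_def]
    | succ N ih => rw [List.ofFn_succ, List.ofFn_succ, List.prod_cons, List.prod_cons, ih,
        tmul_mul_tmul, one_mul]
  refine ⟨f, l, m, n, ?_⟩
  simp only [xi, p, q, h, coef, tmul_mul_tmul, one_mul, mul_one]

lemma exists_of_mem_bidegree_four_zero {G : c.Loc} (hG : G ∈ c.bidegree 4 0) :
    ∃ g, G = c.ppForm g := by
  induction hG using Submodule.span_induction with
  | mem G hG =>
    obtain ⟨i, j, k, h1, h2, hG⟩ := hG
    obtain ⟨rfl, rfl, rfl⟩ : i = 0 ∧ j = 2 ∧ k = 0 := by omega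
    obtain ⟨f, l, m, n, rfl⟩ := c.monomials_eq _ _ _ _ hG
    refine ⟨fun a b => if a = m 0 ∧ b = m 1 then f else 0, ?_⟩
    rw [ppForm, Finset.sum_eq_single (m 0) (fun a _ ha => by simp [ha]) (by simp),
      Finset.sum_eq_single (m 1) (fun a _ ha => by simp [ha]) (by simp)]
    simp
  | zero => exact ⟨0, by simp [ppForm]⟩
  | add x y _ _ hx hy =>
    obtain ⟨g, rfl⟩ := hx
    obtain ⟨h, rfl⟩ := hy
    exact ⟨g + h, by simp [ppForm, TensorProduct.add_tmul, Finset.sum_add_distrib]⟩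
  | smul t x _ hx =>
    obtain ⟨g, rfl⟩ := hx
    exact ⟨t • g, by simp [ppForm, TensorProduct.smul_tmul', Finset.smul_sum]⟩

lemma exists_of_mem_bidegree_two_two {G : c.Loc} (hG : G ∈ c.bidegree 2 2) :
    ∃ (A : Fin d → (Fin 1 → Fin (finrank ℝ F)) → c.Coeff)
      (B : Fin (finrank ℝ F) → (Fin 2 → Fin (finrank ℝ F)) → c.Coeff),
      G = c.xiForm A + c.pForm B := by
  have h0 : ∀ {n : ℕ} {κ : Type} [Fintype κ] (g : κ → FibAlg d (finrank ℝ F)),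
      c.gForm (n := n) g 0 = 0 := by
    intro n κ _ g; simp [gForm]
  -- A single monomial is the form whose coefficients are supported at one multi-index.
  have hs : ∀ {n : ℕ} {κ : Type} [Fintype κ] [DecidableEq κ] (g : κ → FibAlg d (finrank ℝ F))
      (f : c.Coeff) (k : κ) (l : Fin n → Fin (finrank ℝ F)),
      c.gForm g (fun k' l' => if k' = k ∧ l' = l then f else 0) = f ⊗ₜ (g k * qm l) := by
    intro n κ _ _ g f k l
    rw [gForm, Finset.sum_eq_single k (fun a _ ha => by simp [ha]) (by simp),
      Finset.sum_eq_single l (fun a _ ha => by simp [ha]) (by simp)]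
    simp
  induction hG using Submodule.span_induction with
  | mem G hG =>
    obtain ⟨i, j, k, h1, h2, hG⟩ := hG
    obtain ⟨f, l, m, n, rfl⟩ := c.monomials_eq _ _ _ _ hG
    obtain ⟨rfl, rfl, rfl⟩ | ⟨rfl, rfl, rfl⟩ : i = 1 ∧ j = 0 ∧ k = 1 ∨ i = 0 ∧ j = 1 ∧ k = 2 := by
      omega
    · refine ⟨fun k' l' => if k' = l 0 ∧ l' = n then f else 0, 0, ?_⟩
      rw [pForm, h0, add_zero, xiForm, hs, qm_one]
      simp
    · refine ⟨0, fun k' l' => if k' = m 0 ∧ l' = n then f else 0, ?_⟩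
      rw [xiForm, h0, zero_add, pForm, hs, qm_succ, qm_one]
      simp [Fin.tail]
  | zero => exact ⟨0, 0, by rw [xiForm, pForm, h0, h0, add_zero]⟩
  | add x y _ _ hx hy =>
    obtain ⟨A, B, rfl⟩ := hx
    obtain ⟨A', B', rfl⟩ := hy
    exact ⟨A + A', B + B', by rw [xiForm_add, pForm_add]; abel⟩
  | smul t x _ hx =>
    obtain ⟨A, B, rfl⟩ := hx
    exact ⟨t • A, t • B, by rw [xiForm_smul, pForm_smul, smul_add]⟩

lemma exists_of_mem_bidegree_zero_four {G : c.Loc} (hG : G ∈ c.bidegree 0 4) :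
    ∃ w : (Fin 4 → Fin (finrank ℝ F)) → c.Coeff, G = c.qForm w := by
  induction hG using Submodule.span_induction with
  | mem G hG =>
    obtain ⟨i, j, k, h1, h2, hG⟩ := hG
    obtain ⟨rfl, rfl, rfl⟩ : i = 0 ∧ j = 0 ∧ k = 4 := by omega
    obtain ⟨f, l, m, n, rfl⟩ := c.monomials_eq _ _ _ _ hG
    refine ⟨fun l' => if l' = n then f else 0, ?_⟩
    rw [qForm, Finset.sum_eq_single n (fun a _ ha => by simp [ha]) (by simp)]
    simp [qm_succ, qm_zero, Fin.tail]
  | zero => exact ⟨0, by simp [qForm]⟩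
  | add x y _ _ hx hy =>
    obtain ⟨A, rfl⟩ := hx
    obtain ⟨A', rfl⟩ := hy
    exact ⟨A + A', by rw [qForm_add]⟩
  | smul t x _ hx =>
    obtain ⟨A, rfl⟩ := hx
    exact ⟨t • A, by rw [qForm_smul]⟩

lemma qForm_eq_altSum {n : ℕ} (w : (Fin n → Fin (finrank ℝ F)) → c.Coeff) :
    c.qForm w = ((n.factorial : ℝ)⁻¹) • c.qForm (altSum w) := by
  refine c.eval_ext fun x => ?_
  rw [map_smul, eval_qForm, eval_qForm,
    eq_inv_smul_iff₀ (Nat.cast_ne_zero.mpr n.factorial_ne_zero), altSum_smul_qm]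
  simp only [altSum_eval]

lemma pForm_eq_altSum {n : ℕ} (B : Fin (finrank ℝ F) → (Fin n → Fin (finrank ℝ F)) → c.Coeff) :
    c.pForm B = ((n.factorial : ℝ)⁻¹) • c.pForm fun a => altSum (B a) := by
  have h : ∀ B : Fin (finrank ℝ F) → (Fin n → Fin (finrank ℝ F)) → c.Coeff,
      c.pForm B = ∑ a, c.p a * c.qForm (B a) := by
    intro B
    simp [pForm, gForm, p, qForm, Finset.mul_sum]
  rw [h, h, Finset.smul_sum]
  exact Finset.sum_congr rfl fun a _ => by rw [qForm_eq_altSum, mul_smul_comm]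

end NatChart

lemma altSum_isSkew {ι R : Type*} [AddCommGroup R] [Module ℝ R] {n : ℕ} (w : (Fin n → ι) → R) :
    IsSkew (altSum w) := by
  intro l σ
  simp only [altSum, Finset.smul_sum, smul_smul]
  rw [← Equiv.sum_comp (Equiv.mulLeft σ) fun τ : Equiv.Perm (Fin n) =>
    (((Equiv.Perm.sign σ : ℤ) : ℝ) * ((Equiv.Perm.sign τ : ℤ) : ℝ)) • w (l ∘ τ)]
  refine Finset.sum_congr rfl fun τ _ => ?_
  have h1 : (((Equiv.Perm.sign σ : ℤ) : ℝ) * ((Equiv.Perm.sign σ : ℤ) : ℝ)) = 1 := by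
    norm_cast
    simp
  simp only [Equiv.coe_mulLeft, Equiv.Perm.sign_mul, Equiv.Perm.coe_mul, Function.comp_assoc]
  push_cast
  rw [← mul_assoc, h1, one_mul]

lemma IsSkew.swap {ι R : Type*} [AddCommGroup R] [Module ℝ R] {n : ℕ} {w : (Fin n → ι) → R}
    (h : IsSkew w) (l : Fin n → ι) {i j : Fin n} (hij : i ≠ j) :
    w (l ∘ Equiv.swap i j) = -w l := by
  rw [h, Equiv.Perm.sign_swap hij]
  simp

/-- The structure functions of `θ₂`, `θ₁₃`, `θ₄` exist and are unique. -/
theorem existsUnique_strFun (c : NatChart (d := d) F E) {G₂ G₁₃ G₄ : c.Loc}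
    (h₂ : G₂ ∈ c.bidegree 4 0) (h₁₃ : G₁₃ ∈ c.bidegree 2 2) (h₄ : G₄ ∈ c.bidegree 0 4) :
    ∃! f : StrFun c, G₂ = f.theta2 ∧ G₁₃ = f.theta13 ∧ G₄ = f.theta4 := by
  obtain ⟨g, rfl⟩ := c.exists_of_mem_bidegree_four_zero h₂
  obtain ⟨A, B, rfl⟩ := c.exists_of_mem_bidegree_two_two h₁₃
  obtain ⟨w, rfl⟩ := c.exists_of_mem_bidegree_zero_four h₄
  have sk : ∀ {n : ℕ} (w : (Fin n → Fin (finrank ℝ F)) → c.Coeff) (l l' : Fin n → Fin (finrank ℝ F))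
      {i j : Fin n} (_ : i ≠ j) (_ : l = l' ∘ Equiv.swap i j), altSum w l = -altSum w l' := by
    rintro n w l l' i j hij rfl
    exact (altSum_isSkew w).swap l' hij
  -- Arbitrary coefficients are symmetrised, respectively antisymmetrised. This multiplies the forms
  -- by `2`, `2!` and `4!`, which the factors `1/2`, `1/2` and `1/24` in `θ₂`, `θ₁₃` and `θ₄` undo.
  let f : StrFun c :=
    { f₁ := fun i a => A i ![a]
      f₂ := fun a b => g a b + g b a
      f₃ := fun a b b' => altSum (B a) ![b, b']
      f₄ := fun a b a' b' => altSum w ![a, b, a', b']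
      f₂_symm := fun a b => add_comm _ _
      f₃_skew := fun a b b' => sk _ _ _ (i := 0) (j := 1) (by decide)
        (by funext s; fin_cases s <;> rfl)
      f₄_skew₁ := fun a b a' b' => sk _ _ _ (i := 0) (j := 1) (by decide)
        (by funext s; fin_cases s <;> rfl)
      f₄_skew₂ := fun a b a' b' => sk _ _ _ (i := 1) (j := 2) (by decide)
        (by funext s; fin_cases s <;> rfl)
      f₄_skew₃ := fun a b a' b' => sk _ _ _ (i := 2) (j := 3) (by decide)
        (by funext s; fin_cases s <;> rfl) }
  have hf : c.ppForm g = f.theta2 ∧ c.xiForm A + c.pForm B = f.theta13 ∧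
      c.qForm w = f.theta4 := by
    refine ⟨?_, ?_, ?_⟩
    · have h : c.ppForm (fun a b => g b a) = c.ppForm g := by
        rw [NatChart.ppForm, Finset.sum_comm]
        exact Finset.sum_congr rfl fun a _ => Finset.sum_congr rfl fun b _ => by rw [pFib_mul_comm]
      have h2 : c.ppForm ((1 / 2 : ℝ) • f.f₂) = (1 / 2 : ℝ) • (c.ppForm g + c.ppForm fun a b => g b a) := by
        simp only [NatChart.ppForm, ← Finset.sum_add_distrib, ← TensorProduct.add_tmul,
          Finset.smul_sum, TensorProduct.smul_tmul']
        rfl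
      rw [f.theta2_eq, h2, h, ← two_smul ℝ, smul_smul]
      norm_num
    · rw [f.theta13_eq, NatChart.pForm_smul, c.pForm_eq_altSum B]
      congr 2
      · funext i l
        change A i l = A i ![l 0]
        congr 1
        funext s; fin_cases s; rfl
      · norm_num
      · congr 1
        funext a l
        change altSum (B a) l = altSum (B a) ![l 0, l 1]
        congr 1
        funext s; fin_cases s <;> rfl
    · rw [f.theta4_eq, NatChart.qForm_smul, c.qForm_eq_altSum w]
      congr 2
      · norm_num [Nat.factorial]
      · funext l
        change altSum w l = altSum w ![l 0, l 1, l 2, l 3]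
        congr 1
        funext s; fin_cases s <;> rfl
  exact ⟨f, hf, fun f' hf' => StrFun.eq_of_theta_eq (hf'.1.symm.trans hf.1)
    (hf'.2.1.symm.trans hf.2.1) (hf'.2.2.symm.trans hf.2.2)⟩

end QP3
end

/-! ### Weights and the decomposition by bidegree -/

noncomputable section

namespace QP3

section Substitution

variable {d r : ℕ}

lemma fib_algHom_ext {A : Type*} [Semiring A] [Algebra ℝ A] {φ ψ : FibAlg d r →ₐ[ℝ] A}
    (hp : ∀ a, φ (pFib a) = ψ (pFib a)) (ho : ∀ k, φ (oddFib k) = ψ (oddFib k)) : φ = ψ := by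
  refine Algebra.TensorProduct.ext (A := MvPolynomial (Fin r) ℝ)
    (B := ExteriorAlgebra ℝ (Fin d ⊕ Fin r → ℝ)) (MvPolynomial.algHom_ext hp) ?_
  refine ExteriorAlgebra.hom_ext (LinearMap.pi_ext' fun k => LinearMap.ext_ring (ho k))

variable (u t : Fin r → Fin r → ℝ) (J : Fin d → Fin d → ℝ) (B : Fin d → Fin r → Fin r → ℝ)

lemma subst_pFib (a : Fin r) : subst u t J B (pFib a) = ∑ b, u b a • pFib b := by
  change (substTensor u t J B ((MvPolynomial.X a : MvPolynomial (Fin r) ℝ) ⊗ₜ[ℝ]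
    (1 : ExteriorAlgebra ℝ (Fin d ⊕ Fin r → ℝ))) : FibTensor d r) =
    ∑ b, u b a • ((MvPolynomial.X b ⊗ₜ 1 : FibTensor d r))
  refine (Algebra.TensorProduct.lift_tmul _ _ _ _ _).trans ?_
  simp only [AlgHom.comp_apply, MvPolynomial.aeval_X, map_one, mul_one, map_sum, map_smul]
  rfl

lemma subst_oddFib (k : Fin d ⊕ Fin r) : subst u t J B (oddFib k) =
    Sum.elim (fun i => ∑ j, J i j • oddFib (Sum.inl j) +
        ∑ b, ∑ c, B i b c • (pFib b * oddFib (Sum.inr c)))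
      (fun a => ∑ b, t a b • oddFib (Sum.inr b)) k := by
  change (substTensor u t J B ((1 : MvPolynomial (Fin r) ℝ) ⊗ₜ[ℝ]
    ExteriorAlgebra.ι ℝ (Pi.single k 1)) : FibTensor d r) = _
  refine (Algebra.TensorProduct.lift_tmul _ _ _ _ _).trans ?_
  rw [map_one, one_mul, ExteriorAlgebra.lift_ι_apply,
    LinearMap.comp_apply, Fintype.linearCombination_apply_single, one_smul]
  have h : ∀ (P : MvPolynomial (Fin r) ℝ) (v : Fin d ⊕ Fin r → ℝ),
      (oddIncl d r (P ⊗ₜ v) : FibAlg d r) = mk P (ExteriorAlgebra.ι ℝ v) := fun P v => rfl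
  cases k with
  | inl i =>
    simp only [Sum.elim_inl, map_add, map_sum, map_smul, pFib_eq, oddFib_eq, mk_mul_mk, mul_one,
      one_mul]
    rfl
  | inr a =>
    simp only [Sum.elim_inr, map_sum, map_smul, oddFib_eq]
    rfl

lemma subst_q (a : Fin r) : subst u t J B (oddFib (Sum.inr a)) = ∑ b, t a b • oddFib (Sum.inr b) :=
  subst_oddFib u t J B (Sum.inr a)

lemma subst_xi (i : Fin d) : subst u t J B (oddFib (Sum.inl i)) =
    ∑ j, J i j • oddFib (Sum.inl j) + ∑ b, ∑ c, B i b c • (pFib b * oddFib (Sum.inr c)) :=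
  subst_oddFib u t J B (Sum.inl i)

/-- The endomorphism `p ↦ s p`, `ξ ↦ s ξ`, `q ↦ q`. -/
def scale (s : ℝ) : FibAlg d r →ₐ[ℝ] FibAlg d r :=
  subst (fun b a => if b = a then s else 0) (fun a b => if a = b then 1 else 0)
    (fun i j => if i = j then s else 0) 0

lemma scale_pFib (s : ℝ) (a : Fin r) : scale s (pFib a : FibAlg d r) = s • pFib a := by
  simp [scale, subst_pFib]

lemma scale_q (s : ℝ) (a : Fin r) :
    scale s (oddFib (Sum.inr a) : FibAlg d r) = oddFib (Sum.inr a) := by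
  simp [scale, subst_q]

lemma scale_xi (s : ℝ) (i : Fin d) :
    scale s (oddFib (Sum.inl i) : FibAlg d r) = s • oddFib (Sum.inl i) := by
  simp [scale, subst_xi]

lemma scale_qm (s : ℝ) {n : ℕ} (l : Fin n → Fin r) : scale s (qm l : FibAlg d r) = qm l := by
  induction n with
  | zero => simp [qm_zero]
  | succ n ih => rw [qm_succ, map_mul, scale_q, ih]

/-- The new `ξ'_i` involves `ξ_j` and `p_b q^c`, both of weight one. The total weight in `(p, ξ)` is
thus independent of the coordinates, although the number of factors `ξ` is not. -/
lemma subst_scale (s : ℝ) (A : FibAlg d r) :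
    subst u t J B (scale s A) = scale s (subst u t J B A) := by
  have : (subst u t J B).comp (scale s) = (scale s).comp (subst u t J B) := by
    refine fib_algHom_ext (fun a => ?_) fun k => ?_
    · simp only [AlgHom.comp_apply, scale_pFib, map_smul, subst_pFib, map_sum, Finset.smul_sum,
        smul_comm s]
    · cases k with
      | inl i =>
        simp only [AlgHom.comp_apply, scale_xi, map_smul, subst_xi, map_add, map_sum, map_mul,
          scale_q, scale_pFib, smul_add, Finset.smul_sum, smul_comm s, smul_mul_assoc]
      | inr a => simp only [AlgHom.comp_apply, scale_q, map_smul, subst_q, map_sum]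
  exact congrArg (fun φ : FibAlg d r →ₐ[ℝ] FibAlg d r => φ A) this

end Substitution

variable {d : ℕ} {M : Type*} [TopologicalSpace M] [ChartedSpace (EuclideanSpace ℝ (Fin d)) M]
variable {F : Type*} [NormedAddCommGroup F] [NormedSpace ℝ F]
variable {E : M → Type*} [TopologicalSpace (TotalSpace F E)] [∀ x, TopologicalSpace (E x)]
  [∀ x, AddCommGroup (E x)] [∀ x, Module ℝ (E x)] [FiberBundle F E]

namespace NatChart

variable (c : NatChart (d := d) F E)

/-- The endomorphism `p ↦ s p`, `ξ ↦ s ξ`, `q ↦ q` of the local functions. -/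
def sc (s : ℝ) : c.Loc →ₗ[ℝ] c.Loc := LinearMap.lTensor _ (scale s).toLinearMap

lemma sc_tmul (s : ℝ) (f : c.Coeff) (A : FibAlg d (finrank ℝ F)) :
    c.sc s (f ⊗ₜ A) = f ⊗ₜ scale s A := rfl

lemma eval_sc (s : ℝ) (x : c.dom) (G : c.Loc) : c.eval x (c.sc s G) = scale s (c.eval x G) := by
  induction G using TensorProduct.induction_on with
  | zero => simp
  | add A B hA hB => simp only [map_add, hA, hB]
  | tmul f A => rw [sc_tmul, eval_tmul, eval_tmul, map_smul]

lemma sc_ppForm (s : ℝ) (g : Fin (finrank ℝ F) → Fin (finrank ℝ F) → c.Coeff) :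
    c.sc s (c.ppForm g) = s ^ 2 • c.ppForm g := by
  simp only [ppForm, map_sum, sc_tmul, map_mul, scale_pFib, smul_mul_smul, TensorProduct.tmul_smul,
    Finset.smul_sum, pow_two]

lemma sc_xpForm (s : ℝ) (g : Fin d → Fin (finrank ℝ F) → c.Coeff) :
    c.sc s (c.xpForm g) = s ^ 2 • c.xpForm g := by
  simp only [xpForm, map_sum, sc_tmul, map_mul, scale_pFib, scale_xi, smul_mul_smul,
    TensorProduct.tmul_smul, Finset.smul_sum, pow_two]

lemma sc_ppqForm (s : ℝ)
    (g : Fin (finrank ℝ F) → Fin (finrank ℝ F) → Fin (finrank ℝ F) → c.Coeff) :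
    c.sc s (c.ppqForm g) = s ^ 2 • c.ppqForm g := by
  simp only [ppqForm, map_sum, sc_tmul, map_mul, scale_pFib, scale_q, mul_smul_comm,
    smul_mul_assoc, smul_smul, TensorProduct.tmul_smul, Finset.smul_sum, pow_two]

lemma sc_qForm (s : ℝ) {n : ℕ} (w : (Fin n → Fin (finrank ℝ F)) → c.Coeff) :
    c.sc s (c.qForm w) = c.qForm w := by
  simp only [qForm, map_sum, sc_tmul, scale_qm]

lemma sc_xiForm (s : ℝ) {n : ℕ} (A : Fin d → (Fin n → Fin (finrank ℝ F)) → c.Coeff) :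
    c.sc s (c.xiForm A) = s • c.xiForm A := by
  simp only [xiForm, gForm, map_sum, sc_tmul, map_mul, scale_qm, scale_xi, smul_mul_assoc,
    TensorProduct.tmul_smul, Finset.smul_sum]

lemma sc_pForm (s : ℝ) {n : ℕ} (A : Fin (finrank ℝ F) → (Fin n → Fin (finrank ℝ F)) → c.Coeff) :
    c.sc s (c.pForm A) = s • c.pForm A := by
  simp only [pForm, gForm, map_sum, sc_tmul, map_mul, scale_qm, scale_pFib, smul_mul_assoc,
    TensorProduct.tmul_smul, Finset.smul_sum]

lemma sc_of_mem_bidegree_four_zero {G : c.Loc} (hG : G ∈ c.bidegree 4 0) (s : ℝ) :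
    c.sc s G = s ^ 2 • G := by
  obtain ⟨g, rfl⟩ := c.exists_of_mem_bidegree_four_zero hG
  exact c.sc_ppForm s g

lemma sc_of_mem_bidegree_two_two {G : c.Loc} (hG : G ∈ c.bidegree 2 2) (s : ℝ) :
    c.sc s G = s • G := by
  obtain ⟨A, B, rfl⟩ := c.exists_of_mem_bidegree_two_two hG
  rw [map_add, sc_xiForm, sc_pForm, smul_add]

lemma sc_of_mem_bidegree_zero_four {G : c.Loc} (hG : G ∈ c.bidegree 0 4) (s : ℝ) :
    c.sc s G = G := by
  obtain ⟨w, rfl⟩ := c.exists_of_mem_bidegree_zero_four hG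
  exact c.sc_qForm s w

/-- The projections of a sum of three components of weights `2`, `1`, `0` onto the components. -/
lemma components_of_sc {A B C : c.Loc} (hA : ∀ s, c.sc s A = s ^ 2 • A)
    (hB : ∀ s, c.sc s B = s • B) (hC : ∀ s, c.sc s C = C) :
    A = (1 / 2 : ℝ) • (c.sc 1 (A + B + C) + c.sc (-1) (A + B + C)) - c.sc 0 (A + B + C) ∧
    B = (1 / 2 : ℝ) • (c.sc 1 (A + B + C) - c.sc (-1) (A + B + C)) ∧
    C = c.sc 0 (A + B + C) := by
  -- The scaled sum is `s ^ 2 A + s B + C`; interpolation at `s = 1, -1, 0` recovers `A`, `B`, `C`.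
  simp only [map_add, hA, hB, hC]
  refine ⟨?_, ?_, ?_⟩ <;> module

lemma eq_zero_of_sum_eq_zero {A B C : c.Loc} (hA : ∀ s, c.sc s A = s ^ 2 • A)
    (hB : ∀ s, c.sc s B = s • B) (hC : ∀ s, c.sc s C = C) (h : A + B + C = 0) :
    A = 0 ∧ B = 0 ∧ C = 0 := by
  have := c.components_of_sc hA hB hC
  rw [h] at this
  simpa using this

/-- The degree `3 i + 2 j + k` is the sum of the two entries of the bidegree, and the first entry is
even; for degree `4` only these three bidegrees remain. -/
lemma mem_degree_four_iff {G : c.Loc} : G ∈ c.degree 4 ↔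
    ∃ A ∈ c.bidegree 4 0, ∃ B ∈ c.bidegree 2 2, ∃ C ∈ c.bidegree 0 4, G = A + B + C := by
  constructor
  · intro hG
    induction hG using Submodule.span_induction with
    | mem G hG =>
      obtain ⟨i, j, k, h, hG⟩ := hG
      have hb : ∀ m n, 2 * (i + j) = m → i + k = n → G ∈ c.bidegree m n :=
        fun m n h1 h2 => Submodule.subset_span ⟨i, j, k, h1, h2, hG⟩
      obtain h' | h' | h' : (2 * (i + j) = 4 ∧ i + k = 0) ∨ (2 * (i + j) = 2 ∧ i + k = 2) ∨
        (2 * (i + j) = 0 ∧ i + k = 4) := by omega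
      · exact ⟨G, hb _ _ h'.1 h'.2, 0, zero_mem _, 0, zero_mem _, by simp⟩
      · exact ⟨0, zero_mem _, G, hb _ _ h'.1 h'.2, 0, zero_mem _, by simp⟩
      · exact ⟨0, zero_mem _, 0, zero_mem _, G, hb _ _ h'.1 h'.2, by simp⟩
    | zero => exact ⟨0, zero_mem _, 0, zero_mem _, 0, zero_mem _, by simp⟩
    | add x y _ _ hx hy =>
      obtain ⟨A, hA, B, hB, C, hC, rfl⟩ := hx
      obtain ⟨A', hA', B', hB', C', hC', rfl⟩ := hy
      exact ⟨A + A', add_mem hA hA', B + B', add_mem hB hB', C + C', add_mem hC hC', by abel⟩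
    | smul t x _ hx =>
      obtain ⟨A, hA, B, hB, C, hC, rfl⟩ := hx
      exact ⟨t • A, Submodule.smul_mem _ t hA, t • B, Submodule.smul_mem _ t hB, t • C,
        Submodule.smul_mem _ t hC, by rw [smul_add, smul_add]⟩
  · have hle : ∀ m n, m + n = 4 → c.bidegree m n ≤ c.degree 4 := by
      intro m n hmn
      refine Submodule.span_mono ?_
      rintro G ⟨i, j, k, h1, h2, hG⟩
      exact ⟨i, j, k, by omega, hG⟩
    rintro ⟨A, hA, B, hB, C, hC, rfl⟩
    exact add_mem (add_mem (hle 4 0 rfl hA) (hle 2 2 rfl hB)) (hle 0 4 rfl hC)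

end NatChart

lemma mem_bidegreePart_iff {m n : ℕ} {G : Families (d := d) F E} :
    G ∈ bidegreePart F E m n ↔ G ∈ functions F E ∧ ∀ c, G c ∈ c.bidegree m n := by
  rw [bidegreePart, Submodule.mem_inf, Submodule.mem_pi]
  simp

lemma mem_degreePart_iff {n : ℕ} {G : Families (d := d) F E} :
    G ∈ degreePart F E n ↔ G ∈ functions F E ∧ ∀ c, G c ∈ c.degree n := by
  rw [degreePart, Submodule.mem_inf, Submodule.mem_pi]
  simp

lemma sc_mem_functions {G : Families (d := d) F E} (hG : G ∈ functions F E) (s : ℝ) :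
    (fun c => c.sc s (G c)) ∈ functions F E := by
  intro c c' x h h'
  simp only [NatChart.eval_sc]
  rw [NatChart.transition, subst_scale, ← hG c c' x h h', NatChart.transition]

/-- Each local component is a fixed linear combination of rescalings of `Θ`. Rescaling respects
changes of coordinates, so the local components patch together. -/
theorem mem_degreePart_four_iff (Θ : Families (d := d) F E) : Θ ∈ degreePart F E 4 ↔
    ∃ θ₂ ∈ bidegreePart F E 4 0, ∃ θ₁₃ ∈ bidegreePart F E 2 2, ∃ θ₄ ∈ bidegreePart F E 0 4,
      Θ = θ₂ + θ₁₃ + θ₄ := by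
  constructor
  · intro h
    obtain ⟨h, h'⟩ := mem_degreePart_iff.mp h
    have hs := fun s => sc_mem_functions h s
    have key : ∀ c : NatChart (d := d) F E,
        (1 / 2 : ℝ) • (c.sc 1 (Θ c) + c.sc (-1) (Θ c)) - c.sc 0 (Θ c) ∈ c.bidegree 4 0 ∧
        (1 / 2 : ℝ) • (c.sc 1 (Θ c) - c.sc (-1) (Θ c)) ∈ c.bidegree 2 2 ∧
        c.sc 0 (Θ c) ∈ c.bidegree 0 4 ∧
        Θ c = (1 / 2 : ℝ) • (c.sc 1 (Θ c) + c.sc (-1) (Θ c)) - c.sc 0 (Θ c) +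
          (1 / 2 : ℝ) • (c.sc 1 (Θ c) - c.sc (-1) (Θ c)) + c.sc 0 (Θ c) := fun c => by
      obtain ⟨A, hA, B, hB, C, hC, hΘ⟩ := c.mem_degree_four_iff.mp (h' c)
      have := c.components_of_sc (c.sc_of_mem_bidegree_four_zero hA)
        (c.sc_of_mem_bidegree_two_two hB) (c.sc_of_mem_bidegree_zero_four hC)
      rw [← hΘ] at this
      rw [this.1] at hA
      rw [this.2.1] at hB
      rw [this.2.2] at hC
      refine And.intro hA (And.intro hB (And.intro hC ?_))
      rw [← this.1, ← this.2.1, ← this.2.2, hΘ]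
    refine ⟨fun c => (1 / 2 : ℝ) • (c.sc 1 (Θ c) + c.sc (-1) (Θ c)) - c.sc 0 (Θ c),
      mem_bidegreePart_iff.mpr ⟨?_, fun c => (key c).1⟩,
      fun c => (1 / 2 : ℝ) • (c.sc 1 (Θ c) - c.sc (-1) (Θ c)),
      mem_bidegreePart_iff.mpr ⟨?_, fun c => (key c).2.1⟩,
      fun c => c.sc 0 (Θ c), mem_bidegreePart_iff.mpr ⟨hs 0, fun c => (key c).2.2.1⟩,
      funext fun c => ?_⟩
    · exact sub_mem (Subalgebra.smul_mem _ (add_mem (hs 1) (hs (-1))) (1 / 2 : ℝ)) (hs 0)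
    · exact Subalgebra.smul_mem _ (sub_mem (hs 1) (hs (-1))) (1 / 2 : ℝ)
    · rw [Pi.add_apply, Pi.add_apply]
      exact (key c).2.2.2
  · rintro ⟨θ₂, h₂, θ₁₃, h₁₃, θ₄, h₄, rfl⟩
    rw [mem_bidegreePart_iff] at h₂ h₁₃ h₄
    exact mem_degreePart_iff.mpr ⟨add_mem (add_mem h₂.1 h₁₃.1) h₄.1, fun c =>
      c.mem_degree_four_iff.mpr ⟨_, h₂.2 c, _, h₁₃.2 c, _, h₄.2 c, rfl⟩⟩

theorem components_unique {θ₂ θ₁₃ θ₄ θ₂' θ₁₃' θ₄' : Families (d := d) F E}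
    (h₂ : θ₂ ∈ bidegreePart F E 4 0) (h₁₃ : θ₁₃ ∈ bidegreePart F E 2 2)
    (h₄ : θ₄ ∈ bidegreePart F E 0 4) (h₂' : θ₂' ∈ bidegreePart F E 4 0)
    (h₁₃' : θ₁₃' ∈ bidegreePart F E 2 2) (h₄' : θ₄' ∈ bidegreePart F E 0 4)
    (h : θ₂ + θ₁₃ + θ₄ = θ₂' + θ₁₃' + θ₄') : θ₂ = θ₂' ∧ θ₁₃ = θ₁₃' ∧ θ₄ = θ₄' := by
  rw [mem_bidegreePart_iff] at h₂ h₁₃ h₄ h₂' h₁₃' h₄'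
  have key : ∀ c : NatChart (d := d) F E, θ₂ c = θ₂' c ∧ θ₁₃ c = θ₁₃' c ∧ θ₄ c = θ₄' c :=
      fun c => by
    have h1 := c.components_of_sc (c.sc_of_mem_bidegree_four_zero (h₂.2 c))
      (c.sc_of_mem_bidegree_two_two (h₁₃.2 c)) (c.sc_of_mem_bidegree_zero_four (h₄.2 c))
    have h2 := c.components_of_sc (c.sc_of_mem_bidegree_four_zero (h₂'.2 c))
      (c.sc_of_mem_bidegree_two_two (h₁₃'.2 c)) (c.sc_of_mem_bidegree_zero_four (h₄'.2 c))
    have h3 : θ₂ c + θ₁₃ c + θ₄ c = θ₂' c + θ₁₃' c + θ₄' c := congrFun h c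
    rw [h3] at h1
    exact And.intro (h1.1.trans h2.1.symm)
      (And.intro (h1.2.1.trans h2.2.1.symm) (h1.2.2.trans h2.2.2.symm))
  exact ⟨funext fun c => (key c).1, funext fun c => (key c).2.1, funext fun c => (key c).2.2⟩

variable [IsManifold (𝓡 d) ∞ M]

namespace NatChart

variable (c : NatChart (d := d) F E)

lemma bracket_add_left (G G' H : c.Loc) :
    c.bracket (G + G') H = c.bracket G H + c.bracket G' H := by
  simp only [bracket, map_add, add_mul]
  rw [add_add_add_comm, ← Finset.sum_add_distrib, ← Finset.sum_add_distrib]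
  congr 1 <;> refine Finset.sum_congr rfl fun i _ => ?_ <;> abel

lemma bracket_add_right (G H H' : c.Loc) :
    c.bracket G (H + H') = c.bracket G H + c.bracket G H' := by
  simp only [bracket, map_add, mul_add]
  rw [add_add_add_comm, ← Finset.sum_add_distrib, ← Finset.sum_add_distrib]
  congr 1 <;> refine Finset.sum_congr rfl fun i _ => ?_ <;> abel

end NatChart

namespace StrFun

variable {c : NatChart (d := d) F E} (f : StrFun c)

/-- `{θ₂, θ₂}` and `{θ₄, θ₄}` are zero, and the remaining three groups of brackets have weights `2`,
`1`, `0` in `(p, ξ)`, so their sum vanishes only if each of them does. -/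
theorem bracket_self_eq_zero_iff :
    c.bracket (f.theta2 + f.theta13 + f.theta4) (f.theta2 + f.theta13 + f.theta4) = 0 ↔
      c.bracket f.theta13 f.theta2 = 0 ∧
      (1 / 2 : ℝ) • c.bracket f.theta13 f.theta13 + c.bracket f.theta2 f.theta4 = 0 ∧
      c.bracket f.theta13 f.theta4 = 0 := by
  have h : c.bracket (f.theta2 + f.theta13 + f.theta4) (f.theta2 + f.theta13 + f.theta4) =
      (2 : ℝ) • (c.bracket f.theta13 f.theta2 +
        ((1 / 2 : ℝ) • c.bracket f.theta13 f.theta13 + c.bracket f.theta2 f.theta4) +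
        c.bracket f.theta13 f.theta4) := by
    simp only [NatChart.bracket_add_left, NatChart.bracket_add_right, bracket_theta2_theta2,
      bracket_theta4_theta4, bracket_theta2_theta13, bracket_theta4_theta2, bracket_theta4_theta13]
    module
  rw [h]
  constructor
  · intro h
    refine c.eq_zero_of_sum_eq_zero ?_ ?_ ?_ ((smul_eq_zero.mp h).resolve_left two_ne_zero)
    · intro s
      rw [bracket_theta13_theta2, map_add, NatChart.sc_xpForm, NatChart.sc_ppqForm, smul_add]
    · intro s
      rw [half_bracket_theta13_theta13_add, map_add, NatChart.sc_xiForm, NatChart.sc_pForm,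
        smul_add]
    · intro s
      rw [bracket_theta13_theta4, NatChart.sc_qForm]
  · rintro ⟨h1, h2, h3⟩
    rw [h1, h2, h3]
    simp

end StrFun

end QP3
end

/-! ### Iterated brackets with sections: the derived operations in coordinates -/

noncomputable section

namespace QP3

section Contraction

variable {d r : ℕ}

lemma dRightFib_comm (k m : Fin d ⊕ Fin r) (A : FibAlg d r) :
    dRightFib k (dRightFib m A) = -dRightFib m (dRightFib k A) := by
  induction A using fib_induction with
  | zero => simp
  | add A A' h h' => simp only [map_add, h, h', neg_add]
  | tmul P v =>
    rw [dRightFib_mk, dRightFib_mk, dRightFib_mk, dRightFib_mk, CliffordAlgebra.contractRight_comm]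
    exact TensorProduct.tmul_neg _ _

/-- Reindexing moves each permutation of the determinant from the vectors to the coefficients. -/
lemma sum_mul_det_eq_sum_altSum {n : ℕ} (w : (Fin n → Fin r) → ℝ) (v : Fin n → Fin r → ℝ) :
    ∑ l, w l * (Matrix.of fun i j => v i (l j)).det = ∑ l, altSum w l * ∏ i, v i (l i) := by
  simp only [Matrix.det_apply', Finset.mul_sum, altSum, Finset.sum_mul, smul_eq_mul]
  rw [Finset.sum_comm, Finset.sum_comm (s := (Finset.univ : Finset (Fin n → Fin r)))]
  refine Finset.sum_congr rfl fun σ _ => ?_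
  rw [← (Equiv.arrowCongr σ.symm (Equiv.refl (Fin r))).sum_comp]
  refine Finset.sum_congr rfl fun l _ => ?_
  have h1 : (Equiv.arrowCongr σ.symm (Equiv.refl (Fin r))) l = l ∘ σ := by
    funext s; simp [Equiv.arrowCongr]
  rw [h1, ← Equiv.prod_comp σ fun i => v i (l i), mul_left_comm, mul_assoc]
  rfl

lemma IsSkew.sum_mul_det {n : ℕ} {w : (Fin n → Fin r) → ℝ} (hw : IsSkew w)
    (v : Fin n → Fin r → ℝ) :
    ∑ l, w l * (Matrix.of fun i j => v i (l j)).det =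
      n.factorial * ∑ l, w l * ∏ i, v i (l i) := by
  rw [sum_mul_det_eq_sum_altSum, Finset.mul_sum]
  exact Finset.sum_congr rfl fun l _ => by rw [hw.altSum, smul_eq_mul, mul_assoc]

end Contraction

variable {d : ℕ} {M : Type*} [TopologicalSpace M] [ChartedSpace (EuclideanSpace ℝ (Fin d)) M]
variable {F : Type*} [NormedAddCommGroup F] [NormedSpace ℝ F]
variable {E : M → Type*} [TopologicalSpace (TotalSpace F E)] [∀ x, TopologicalSpace (E x)]
  [∀ x, AddCommGroup (E x)] [∀ x, Module ℝ (E x)] [FiberBundle F E]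

namespace NatChart

variable (c : NatChart (d := d) F E)

/-- The local function `∑ g^a p_a`. -/
def secForm (g : Fin (finrank ℝ F) → c.Coeff) : c.Loc := c.pForm (n := 0) fun a _ => g a

/-- The local function `∑ α_a q^a`. -/
def covForm (α : Fin (finrank ℝ F) → c.Coeff) : c.Loc := c.qForm (n := 1) fun l => α (l 0)

lemma coef_eq_qForm (g : c.Coeff) : c.coef g = c.qForm (n := 0) fun _ => g := by
  rw [qForm, sum_fun_zero, qm_zero, coef]

lemma secForm_eq (g : Fin (finrank ℝ F) → c.Coeff) : c.secForm g = ∑ a, c.coef (g a) * c.p a := by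
  simp [secForm, pForm, gForm, qm_zero, coef, p]

lemma covForm_eq (α : Fin (finrank ℝ F) → c.Coeff) : c.covForm α = ∑ a, c.coef (α a) * c.q a := by
  simp [covForm, qForm, sum_fun_one, qm_one, coef, q]

lemma gForm_mul_coef {κ : Type*} [Fintype κ] {n : ℕ} (b : κ → FibAlg d (finrank ℝ F))
    (A : κ → (Fin n → Fin (finrank ℝ F)) → c.Coeff) (g : c.Coeff) :
    c.gForm b A * c.coef g = c.gForm b fun k l => A k l * g := by
  simp only [gForm, coef, Finset.sum_mul, tmul_mul_tmul, mul_one]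

lemma coef_mul_coef (g h : c.Coeff) : c.coef g * c.coef h = c.coef (g * h) := by
  simp only [coef, tmul_mul_tmul, mul_one]

lemma coef_sum {ι : Type*} (s : Finset ι) (g : ι → c.Coeff) :
    c.coef (∑ i ∈ s, g i) = ∑ i ∈ s, c.coef (g i) := TensorProduct.sum_tmul _ _ _

lemma coef_neg (g : c.Coeff) : c.coef (-g) = -c.coef g := TensorProduct.neg_tmul _ _

lemma eval_coef (x : c.dom) (g : c.Coeff) : c.eval x (c.coef g) = algebraMap ℝ _ (g x) := by
  rw [coef, eval_tmul, Algebra.algebraMap_eq_smul_one]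

lemma coef_mul_pForm {n : ℕ} (g : c.Coeff)
    (B : Fin (finrank ℝ F) → (Fin n → Fin (finrank ℝ F)) → c.Coeff) :
    c.coef g * c.pForm B = c.pForm fun b l => g * B b l := by
  simp only [pForm, gForm, coef, Finset.mul_sum, tmul_mul_tmul, one_mul]

lemma coef_mul_qForm {n : ℕ} (g : c.Coeff) (w : (Fin n → Fin (finrank ℝ F)) → c.Coeff) :
    c.coef g * c.qForm w = c.qForm fun l => g * w l := by
  simp only [qForm, coef, Finset.mul_sum, tmul_mul_tmul, one_mul]

lemma qForm_mul_coef {n : ℕ} (g : c.Coeff) (w : (Fin n → Fin (finrank ℝ F)) → c.Coeff) :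
    c.qForm w * c.coef g = c.qForm fun l => w l * g := by
  simp only [qForm, coef, Finset.sum_mul, tmul_mul_tmul, mul_one]

lemma secForm_injective : Function.Injective c.secForm := by
  intro g h hgh
  funext a
  have h1 := congrArg (c.dP a) hgh
  rw [secForm, secForm, dP_pForm, dP_pForm] at h1
  ext x
  have h2 := congrArg (c.eval x) h1
  rw [eval_qForm, eval_qForm, sum_fun_zero, sum_fun_zero, qm_zero,
    ← Algebra.algebraMap_eq_smul_one, ← Algebra.algebraMap_eq_smul_one] at h2
  exact algebraMap_fib_injective h2

lemma dRight_xi_secForm (k : Fin d ⊕ Fin (finrank ℝ F)) (g : Fin (finrank ℝ F) → c.Coeff) :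
    c.dRight k (c.secForm g) = 0 := by
  simp [secForm, pForm, gForm, dRight_tmul, qm_zero, dRightFib_pFib]

lemma dLeft_secForm (k : Fin d ⊕ Fin (finrank ℝ F)) (g : Fin (finrank ℝ F) → c.Coeff) :
    c.dLeft k (c.secForm g) = 0 := by
  simp [secForm, pForm, gForm, dLeft_tmul, qm_zero]

lemma dP_secForm (a : Fin (finrank ℝ F)) (g : Fin (finrank ℝ F) → c.Coeff) :
    c.dP a (c.secForm g) = c.coef (g a) := by
  rw [secForm, dP_pForm, coef_eq_qForm]

lemma dP_covForm (a : Fin (finrank ℝ F)) (α : Fin (finrank ℝ F) → c.Coeff) :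
    c.dP a (c.covForm α) = 0 := c.dP_qForm a _

lemma dRight_xi_covForm (i : Fin d) (α : Fin (finrank ℝ F) → c.Coeff) :
    c.dRight (Sum.inl i) (c.covForm α) = 0 := c.dRight_xi_qForm i _

lemma dLeft_xi_covForm (i : Fin d) (α : Fin (finrank ℝ F) → c.Coeff) :
    c.dLeft (Sum.inl i) (c.covForm α) = 0 := c.dLeft_xi_qForm i _

lemma dRight_q_covForm (a : Fin (finrank ℝ F)) (α : Fin (finrank ℝ F) → c.Coeff) :
    c.dRight (Sum.inr a) (c.covForm α) = c.coef (α a) := by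
  simp only [covForm, qForm, sum_fun_one, qm_one, map_sum, dRight_tmul, dRightFib_oddFib, coef]
  rw [Finset.sum_eq_single a (fun b _ hb => by simp [hb.symm]) (by simp)]
  simp

lemma dLeft_q_covForm (a : Fin (finrank ℝ F)) (α : Fin (finrank ℝ F) → c.Coeff) :
    c.dLeft (Sum.inr a) (c.covForm α) = c.coef (α a) := by
  rw [covForm, dLeft_q_qForm_eq]
  norm_num
  exact c.dRight_q_covForm a α

lemma dRight_q_xiForm_zero (a : Fin (finrank ℝ F))
    (A : Fin d → (Fin 0 → Fin (finrank ℝ F)) → c.Coeff) :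
    c.dRight (Sum.inr a) (c.xiForm A) = 0 := by
  simp [xiForm, gForm, dRight_tmul, qm_zero]

lemma dRight_q_pForm_one (a : Fin (finrank ℝ F))
    (B : Fin (finrank ℝ F) → (Fin 1 → Fin (finrank ℝ F)) → c.Coeff) :
    c.dRight (Sum.inr a) (c.pForm B) = c.secForm fun b => B b ![a] := by
  simp only [secForm, pForm, gForm, sum_fun_one, sum_fun_zero, qm_one, qm_zero, map_sum,
    dRight_tmul, dRightFib_pFib_mul, dRightFib_oddFib]
  refine Finset.sum_congr rfl fun b _ => ?_
  rw [Finset.sum_eq_single a (fun b _ hb => by simp [hb.symm]) (by simp)]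
  simp

lemma dRight_mul_coef (k : Fin d ⊕ Fin (finrank ℝ F)) (G : c.Loc) (g : c.Coeff) :
    c.dRight k (G * c.coef g) = c.dRight k G * c.coef g := by
  induction G using TensorProduct.induction_on with
  | zero => simp
  | add x y hx hy => simp only [add_mul, map_add, hx, hy]
  | tmul f A => simp only [coef, tmul_mul_tmul, dRight_tmul, mul_one]

lemma dRight_comm (k m : Fin d ⊕ Fin (finrank ℝ F)) (G : c.Loc) :
    c.dRight k (c.dRight m G) = -c.dRight m (c.dRight k G) := by
  induction G using TensorProduct.induction_on with
  | zero => simp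
  | add x y hx hy => simp only [map_add, hx, hy, neg_add]
  | tmul f A =>
    simp only [dRight_tmul]
    rw [dRightFib_comm, TensorProduct.tmul_neg]

lemma eval_dRight (x : c.dom) (k : Fin d ⊕ Fin (finrank ℝ F)) (G : c.Loc) :
    c.eval x (c.dRight k G) = dRightFib k (c.eval x G) := by
  induction G using TensorProduct.induction_on with
  | zero => simp
  | add x y hx hy => simp only [map_add, hx, hy]
  | tmul f A => rw [dRight_tmul, eval_tmul, eval_tmul, map_smul]

variable [IsManifold (𝓡 d) ∞ M]

lemma dX_secForm (i : Fin d) (g : Fin (finrank ℝ F) → c.Coeff) :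
    c.dX i (c.secForm g) = c.secForm fun a => c.pd i (g a) := by
  rw [secForm, pForm, dX_gForm, secForm, pForm]

lemma dX_covForm (i : Fin d) (α : Fin (finrank ℝ F) → c.Coeff) :
    c.dX i (c.covForm α) = c.covForm fun a => c.pd i (α a) := by
  rw [covForm, dX_qForm, covForm]

/-- The Poisson bracket with a section of `E`. -/
lemma bracket_secForm (G : c.Loc) (h : Fin (finrank ℝ F) → c.Coeff) :
    c.bracket G (c.secForm h) =
      ∑ a, c.dRight (Sum.inr a) G * c.coef (h a) -
        ∑ i, c.dRight (Sum.inl i) G * c.secForm fun a => c.pd i (h a) := by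
  simp only [bracket, dLeft_secForm, dP_secForm, dX_secForm, mul_zero, zero_sub, sub_zero,
    Finset.sum_neg_distrib]
  abel

/-- The Poisson bracket with a function on the base. -/
lemma bracket_coef (G : c.Loc) (g : c.Coeff) :
    c.bracket G (c.coef g) = -∑ i, c.dRight (Sum.inl i) G * c.coef (c.pd i g) := by
  have h1 : ∀ k, c.dLeft k (c.coef g) = 0 := fun k => by simp [coef, dLeft_tmul]
  have h2 : ∀ a, c.dP a (c.coef g) = 0 := fun k => by simp [coef, dP_tmul]
  have h3 : ∀ i, c.dX i (c.coef g) = c.coef (c.pd i g) := fun i => rfl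
  simp only [bracket, h1, h2, h3, mul_zero, zero_sub, sub_zero, Finset.sum_neg_distrib,
    Finset.sum_const_zero, add_zero]

/-- The Poisson bracket with a section of `E*`. -/
lemma bracket_covForm (G : c.Loc) (α : Fin (finrank ℝ F) → c.Coeff) :
    c.bracket G (c.covForm α) = -∑ i, c.dRight (Sum.inl i) G * c.covForm (fun a => c.pd i (α a)) -
      ∑ a, c.dP a G * c.coef (α a) := by
  simp only [bracket, dLeft_xi_covForm, dLeft_q_covForm, dX_covForm, dP_covForm, mul_zero,
    zero_sub, Finset.sum_neg_distrib]
  abel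

lemma bracket_secForm_covForm (g α : Fin (finrank ℝ F) → c.Coeff) :
    c.bracket (c.secForm g) (c.covForm α) = c.coef (-∑ a, g a * α a) := by
  simp only [bracket_covForm, dRight_xi_secForm, zero_mul, Finset.sum_const_zero, neg_zero,
    zero_sub, dP_secForm, coef_mul_coef, coef_neg, coef_sum]

lemma bracket_covForm_secForm (α g : Fin (finrank ℝ F) → c.Coeff) :
    c.bracket (c.covForm α) (c.secForm g) = c.coef (∑ a, α a * g a) := by
  simp only [bracket_secForm, dRight_xi_covForm, zero_mul, Finset.sum_const_zero,
    sub_zero, dRight_q_covForm, coef_mul_coef, coef_sum]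

/-- The shape `X^i ξ_i + Y^b_m p_b q^m` is that of `{θ₁₃, e}`. This lemma and the next two compute
the second bracket with a section, a function and a covector. -/
lemma bracket_xiForm_add_pForm_secForm (X : Fin d → c.Coeff)
    (Y : Fin (finrank ℝ F) → Fin (finrank ℝ F) → c.Coeff) (h : Fin (finrank ℝ F) → c.Coeff) :
    c.bracket (c.xiForm (n := 0) (fun i _ => X i) + c.pForm (n := 1) fun b l => Y b (l 0))
      (c.secForm h) = c.secForm fun b => ∑ a, Y b a * h a - ∑ i, X i * c.pd i (h b) := by
  simp only [bracket_secForm, map_add, dRight_xi_xiForm, dRight_xi_pForm, dRight_q_xiForm_zero,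
    dRight_q_pForm_one, pow_zero, one_smul, add_zero, zero_add, ← coef_eq_qForm]
  simp only [secForm, coef_mul_pForm]
  simp only [pForm, gForm_mul_coef, ← gForm_sum, sub_eq_add_neg, ← gForm_neg, ← gForm_add]
  congr 1
  funext b l
  simp

lemma bracket_xiForm_add_pForm_coef (X : Fin d → c.Coeff)
    (Y : Fin (finrank ℝ F) → Fin (finrank ℝ F) → c.Coeff) (g : c.Coeff) :
    c.bracket (c.xiForm (n := 0) (fun i _ => X i) + c.pForm (n := 1) fun b l => Y b (l 0))
      (c.coef g) = c.coef (-∑ i, X i * c.pd i g) := by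
  simp only [bracket_coef, map_add, dRight_xi_xiForm, dRight_xi_pForm,
    pow_zero, one_smul, add_zero, ← coef_eq_qForm, coef_mul_coef, coef_neg, coef_sum]

lemma bracket_xiForm_add_pForm_covForm (X : Fin d → c.Coeff)
    (Y : Fin (finrank ℝ F) → Fin (finrank ℝ F) → c.Coeff) (α : Fin (finrank ℝ F) → c.Coeff) :
    c.bracket (c.xiForm (n := 0) (fun i _ => X i) + c.pForm (n := 1) fun b l => Y b (l 0))
      (c.covForm α) = c.covForm fun m => -∑ i, X i * c.pd i (α m) - ∑ a, Y a m * α a := by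
  simp only [bracket_covForm, map_add, dRight_xi_xiForm, dRight_xi_pForm, dP_xiForm, dP_pForm,
    pow_zero, one_smul, add_zero, zero_add, ← coef_eq_qForm]
  simp only [covForm, coef_mul_qForm, qForm_mul_coef, ← qForm_sum]
  rw [← loc_neg_one_smul, ← qForm_smul, sub_eq_add_neg, ← loc_neg_one_smul, ← qForm_smul,
    ← qForm_add]
  congr 1
  funext l
  simp [sub_eq_add_neg]

/-- Without `ξ` the derivatives of the components of the section drop out and the bracket is a right
contraction. The hypothesis passes to the result, so the statement can be iterated. -/
lemma bracket_secForm_of_dRight_xi {G : c.Loc} (hG : ∀ i, c.dRight (Sum.inl i) G = 0)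
    (h : Fin (finrank ℝ F) → c.Coeff) :
    (∀ i, c.dRight (Sum.inl i) (c.bracket G (c.secForm h)) = 0) ∧
    ∀ x, c.eval x (c.bracket G (c.secForm h)) = contr (fun a => h a x) (c.eval x G) := by
  have h1 : c.bracket G (c.secForm h) = ∑ a, c.dRight (Sum.inr a) G * c.coef (h a) := by
    simp only [bracket_secForm, hG, zero_mul, Finset.sum_const_zero, sub_zero]
  rw [h1]
  refine ⟨fun i => ?_, fun x => ?_⟩
  · rw [map_sum]
    refine Finset.sum_eq_zero fun a _ => ?_
    rw [dRight_mul_coef, dRight_comm, hG, map_zero, neg_zero, zero_mul]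
  · rw [map_sum, contr_apply]
    refine Finset.sum_congr rfl fun a _ => ?_
    rw [map_mul, eval_coef, eval_dRight, ← Algebra.commutes, ← Algebra.smul_def]

/-- The successive Poisson brackets of a local function with sections of `E`. -/
def brackets : (n : ℕ) → (Fin n → Fin (finrank ℝ F) → c.Coeff) → c.Loc → c.Loc
  | 0, _, G => G
  | n + 1, h, G => brackets n (Fin.tail h) (c.bracket G (c.secForm (h 0)))

lemma eval_brackets {n : ℕ} (h : Fin n → Fin (finrank ℝ F) → c.Coeff) {G : c.Loc}
    (hG : ∀ i, c.dRight (Sum.inl i) G = 0) (x : c.dom) :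
    c.eval x (c.brackets n h G) = contrs n (fun i a => h i a x) (c.eval x G) := by
  induction n generalizing G with
  | zero => rfl
  | succ n ih =>
    rw [brackets, ih _ (c.bracket_secForm_of_dRight_xi hG (h 0)).1,
      (c.bracket_secForm_of_dRight_xi hG (h 0)).2]
    rfl

lemma eval_brackets_qForm {n : ℕ} (h : Fin n → Fin (finrank ℝ F) → c.Coeff)
    (w : (Fin n → Fin (finrank ℝ F)) → c.Coeff) (x : c.dom) :
    c.eval x (c.brackets n h (c.qForm w)) = algebraMap ℝ _
      ((-1) ^ (n * (n - 1) / 2) * ∑ l, w l x * (Matrix.of fun i j => h i (l j) x).det) := by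
  rw [c.eval_brackets h (fun i => c.dRight_xi_qForm i w), eval_qForm, map_sum]
  simp only [map_smul, contrs_qm, smul_smul, ← Finset.sum_smul]
  rw [Algebra.algebraMap_eq_smul_one, Finset.mul_sum]
  congr 1
  refine Finset.sum_congr rfl fun l _ => ?_
  ring

end NatChart

namespace StrFun

variable {c : NatChart (d := d) F E} (f : StrFun c) [IsManifold (𝓡 d) ∞ M]

/-- The derivative of the function `u` along the anchor of the section with coefficients `g`. -/
def act (g : Fin (finrank ℝ F) → c.Coeff) (u : c.Coeff) : c.Coeff :=
  -∑ i, (∑ a, f.f₁ i a * g a) * c.pd i u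

/-- The coefficients of the bracket of the sections with coefficients `g` and `h`. -/
def brk (g h : Fin (finrank ℝ F) → c.Coeff) : Fin (finrank ℝ F) → c.Coeff := fun b =>
  f.act g (h b) - f.act h (g b) + ∑ m, ∑ a, f.f₃ b m a * g a * h m

lemma bracket_theta13_secForm (g : Fin (finrank ℝ F) → c.Coeff) :
    c.bracket f.theta13 (c.secForm g) =
      c.xiForm (n := 0) (fun i _ => ∑ a, f.f₁ i a * g a) +
      c.pForm (n := 1) fun b l => ∑ a, f.f₃ b (l 0) a * g a + ∑ i, f.f₁ i (l 0) * c.pd i (g b) := by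
  simp only [NatChart.bracket_secForm, dRight_xi_theta13, dRight_q_theta13, add_mul,
    NatChart.loc_neg_mul, Finset.sum_neg_distrib, sub_neg_eq_add]
  simp only [NatChart.secForm, NatChart.qForm_mul_pForm]
  simp only [NatChart.xiForm, NatChart.pForm, NatChart.gForm_mul_coef, Finset.sum_add_distrib,
    ← NatChart.gForm_sum, add_assoc, ← NatChart.gForm_add]
  congr 2
  · funext i l
    simp
  · funext b l
    simp only [Pi.add_apply, Finset.sum_apply]
    rfl

/-- The derivatives of `h` come from the `ξ`-part of `{θ₁₃, e}` and those of `g` from its `p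
q`-part; together they are the two anchor terms of `brk`. -/
theorem bracket_bracket_theta13_secForm (g h : Fin (finrank ℝ F) → c.Coeff) :
    c.bracket (c.bracket f.theta13 (c.secForm g)) (c.secForm h) = c.secForm (f.brk g h) := by
  rw [bracket_theta13_secForm, c.bracket_xiForm_add_pForm_secForm (fun i => ∑ a, f.f₁ i a * g a)
    (fun b m => ∑ a, f.f₃ b m a * g a + ∑ i, f.f₁ i m * c.pd i (g b))]
  congr 1
  funext b
  simp only [brk, act, add_mul, Finset.sum_add_distrib, Finset.sum_mul]
  rw [Finset.sum_comm (f := fun i j => f.f₁ i j * h j * c.pd i (g b))]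
  simp only [mul_right_comm (f.f₁ _ _) (h _)]
  ring

theorem bracket_bracket_theta13_coef (g : Fin (finrank ℝ F) → c.Coeff) (u : c.Coeff) :
    c.bracket (c.bracket f.theta13 (c.secForm g)) (c.coef u) = c.coef (f.act g u) := by
  rw [bracket_theta13_secForm, c.bracket_xiForm_add_pForm_coef (fun i => ∑ a, f.f₁ i a * g a)
    (fun b m => ∑ a, f.f₃ b m a * g a + ∑ i, f.f₁ i m * c.pd i (g b)), act]

theorem bracket_bracket_theta13_covForm_secForm (g α h : Fin (finrank ℝ F) → c.Coeff) :
    c.bracket (c.bracket (c.bracket f.theta13 (c.secForm g)) (c.covForm α)) (c.secForm h) =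
      c.coef (∑ m, (f.act g (α m) -
        ∑ b, (∑ a, f.f₃ b m a * g a + ∑ i, f.f₁ i m * c.pd i (g b)) * α b) * h m) := by
  rw [bracket_theta13_secForm, c.bracket_xiForm_add_pForm_covForm (fun i => ∑ a, f.f₁ i a * g a)
    (fun b m => ∑ a, f.f₃ b m a * g a + ∑ i, f.f₁ i m * c.pd i (g b)),
    NatChart.bracket_covForm_secForm]
  rfl

theorem bracket_bracket_theta2_covForm (α β : Fin (finrank ℝ F) → c.Coeff) :
    c.bracket (c.bracket f.theta2 (c.covForm α)) (c.covForm β) =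
      c.coef (∑ b, (∑ a, f.f₂ a b * α a) * β b) := by
  have h : c.bracket f.theta2 (c.covForm α) = c.secForm fun b => -∑ a, f.f₂ a b * α a := by
    simp only [NatChart.bracket_covForm, dRight_theta2, zero_mul, Finset.sum_const_zero, neg_zero,
      zero_sub, dP_theta2, NatChart.pForm, NatChart.gForm_mul_coef, ← NatChart.gForm_sum,
      ← NatChart.gForm_neg, NatChart.secForm]
    congr 1
    funext b l
    simp
  rw [h, NatChart.bracket_secForm_covForm]
  simp

theorem eval_brackets_theta4 (h : Fin 4 → Fin (finrank ℝ F) → c.Coeff) (x : c.dom) :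
    c.eval x (c.brackets 4 h f.theta4) =
      algebraMap ℝ _ (∑ l, f.F4 l x * ∏ i, h i (l i) x) := by
  have hs : IsSkew fun l => f.F4 l x := fun l σ => by
    have := congrArg (fun u : c.Coeff => u x) (f.F4_skew l σ)
    exact this
  rw [theta4_eq, NatChart.eval_brackets_qForm]
  congr 1
  have h1 := hs.sum_mul_det fun i a => h i a x
  have h2 : ∀ l, ((1 / 24 : ℝ) • f.F4) l x = 1 / 24 * f.F4 l x := fun l => rfl
  simp only [h2, mul_assoc, ← Finset.mul_sum, h1]
  -- The `4!` from the determinants cancels `1/24`, and the reversal sign is `(-1)^6 = 1`.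
  norm_num [Nat.factorial]
  ring

end StrFun

end QP3
end

/-! ### Frame coefficients, partial derivatives and tangent vectors in coordinates -/

noncomputable section

namespace QP3

variable {d : ℕ} {M : Type*} [TopologicalSpace M] [ChartedSpace (EuclideanSpace ℝ (Fin d)) M]
variable {F : Type*} [NormedAddCommGroup F] [NormedSpace ℝ F]
variable {E : M → Type*} [TopologicalSpace (TotalSpace F E)] [∀ x, TopologicalSpace (E x)]
  [∀ x, AddCommGroup (E x)] [∀ x, Module ℝ (E x)] [FiberBundle F E]

lemma sum_ofLp_mul_map_stdVec (L : EuclideanSpace ℝ (Fin d) →L[ℝ] ℝ) (w : EuclideanSpace ℝ (Fin d)) :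
    L w = ∑ i, w i * L (stdVec i) := by
  have h : w = ∑ i, w i • stdVec i := by
    ext j
    simp [stdVec, Pi.single_apply]
  conv_lhs => rw [h, map_sum]
  simp

lemma sum_ofLp_smul_map_stdVec {A B : EuclideanSpace ℝ (Fin d) →L[ℝ] EuclideanSpace ℝ (Fin d)}
    (h : A.comp B = ContinuousLinearMap.id ℝ _) (v : EuclideanSpace ℝ (Fin d)) :
    ∑ i, B v i • A (stdVec i) = v := by
  have h1 : B v = ∑ i, B v i • stdVec i := by
    ext j
    simp [stdVec, Pi.single_apply]
  have h2 := congrArg (fun L : EuclideanSpace ℝ (Fin d) →L[ℝ] EuclideanSpace ℝ (Fin d) => L v) h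
  simp only [ContinuousLinearMap.comp_apply, ContinuousLinearMap.id_apply] at h2
  conv_rhs => rw [← h2, h1, map_sum]
  simp

namespace NatChart

variable (c : NatChart (d := d) F E)

/-! ### Coefficients in a frame -/

lemma coeff_eq_coord {x : M} (hx : x ∈ c.chart.source) (a : Fin (finrank ℝ F)) :
    c.isFrame.coeff a x = (c.isFrame.toBasisAt hx).coord a := dif_pos hx

lemma coeff_frame {x : M} (hx : x ∈ c.chart.source) (a b : Fin (finrank ℝ F)) :
    c.isFrame.coeff a x (c.frame b x) = if a = b then 1 else 0 := by
  rw [c.coeff_eq_coord hx, ← c.isFrame.toBasisAt_coe hx b, Basis.coord_apply, Basis.repr_self,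
    Finsupp.single_apply]
  exact if_congr eq_comm rfl rfl

lemma sum_coeff_smul {x : M} (hx : x ∈ c.chart.source) (v : E x) :
    ∑ a, c.isFrame.coeff a x v • c.frame a x = v := by
  conv_rhs => rw [← (c.isFrame.toBasisAt hx).sum_repr v]
  exact Finset.sum_congr rfl fun a _ => by
    rw [c.coeff_eq_coord hx, c.isFrame.toBasisAt_coe hx, Basis.coord_apply]

lemma ext_of_coeff {x : M} (hx : x ∈ c.chart.source) {v w : E x}
    (h : ∀ a, c.isFrame.coeff a x v = c.isFrame.coeff a x w) : v = w := by
  rw [← c.sum_coeff_smul hx v, ← c.sum_coeff_smul hx w]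
  exact Finset.sum_congr rfl fun a _ => by rw [h a]

lemma sum_apply_frame_mul_coeff {x : M} (hx : x ∈ c.chart.source) (α : Module.Dual ℝ (E x))
    (v : E x) : ∑ a, α (c.frame a x) * c.isFrame.coeff a x v = α v := by
  conv_rhs => rw [← c.sum_coeff_smul hx v, map_sum]
  exact Finset.sum_congr rfl fun a _ => by rw [map_smul, smul_eq_mul, mul_comm]

/-! ### Partial derivatives -/

/-- The partial derivative of a function on `M` in the chart. -/
def D (i : Fin d) (g : M → ℝ) (x : M) : ℝ :=
  fderiv ℝ (g ∘ c.chart.symm) (c.chart x) (stdVec i)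

lemma pd_apply [IsManifold (𝓡 d) ∞ M] (i : Fin d) (f : c.Coeff) (x : c.dom) :
    c.pd i f x = c.D i (ext f) x := rfl

lemma D_congr {x : M} (hx : x ∈ c.chart.source) {g g' : M → ℝ} (h : g =ᶠ[nhds x] g') (i : Fin d) :
    c.D i g x = c.D i g' x := by
  have h1 : Filter.Tendsto c.chart.symm (nhds (c.chart x)) (nhds x) := by
    simpa only [c.chart.left_inv hx] using
      (c.chart.continuousAt_symm (c.chart.map_source hx)).tendsto
  rw [D, D, (h.comp_tendsto h1).fderiv_eq]

lemma ext_restr_eventuallyEq {x : M} (hx : x ∈ c.chart.source) (g : M → ℝ)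
    (hg : ContMDiffOn (𝓡 d) 𝓘(ℝ, ℝ) ∞ g c.chart.source) :
    ext (c.restr g hg) =ᶠ[nhds x] g := by
  filter_upwards [c.chart.open_source.mem_nhds hx] with y hy
  exact ext_apply (c.restr g hg) ⟨y, hy⟩

lemma pd_restr_apply [IsManifold (𝓡 d) ∞ M] (i : Fin d) (x : c.dom) (g : M → ℝ)
    (hg : ContMDiffOn (𝓡 d) 𝓘(ℝ, ℝ) ∞ g c.chart.source) :
    c.pd i (c.restr g hg) x = c.D i g x :=
  c.D_congr x.2 (c.ext_restr_eventuallyEq x.2 g hg) i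

lemma pd_congr [IsManifold (𝓡 d) ∞ M] {x : c.dom} {f g : c.Coeff}
    (h : ext f =ᶠ[nhds (x : M)] ext g) (i : Fin d) : c.pd i f x = c.pd i g x :=
  c.D_congr x.2 h i

lemma differentiableAt_comp_symm {x : M} (hx : x ∈ c.chart.source) {g : M → ℝ}
    (hg : MDifferentiableAt (𝓡 d) 𝓘(ℝ, ℝ) g x) :
    DifferentiableAt ℝ (g ∘ c.chart.symm) (c.chart x) := by
  rw [← mdifferentiableAt_iff_differentiableAt]
  refine MDifferentiableAt.comp (I' := 𝓡 d) _ (by rwa [c.chart.left_inv hx]) ?_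
  exact mdifferentiableAt_symm_of_mem_maximalAtlas
    (IsManifold.maximalAtlas_subset_of_le (by simp) c.mem_atlas) (c.chart.map_source hx)

lemma mdifferentiable_chart : c.chart.MDifferentiable (𝓡 d) (𝓡 d) :=
  ⟨fun x hx => ((contMDiffOn_of_mem_maximalAtlas c.mem_atlas).mdifferentiableOn (by simp)) x hx,
   fun x hx => ((contMDiffOn_symm_of_mem_maximalAtlas c.mem_atlas).mdifferentiableOn (by simp)) x hx⟩

lemma mdifferentiableAt_ext (f : c.Coeff) (x : c.dom) :
    MDifferentiableAt (𝓡 d) 𝓘(ℝ, ℝ) (ext f) x :=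
  ((ext_contMDiffOn f).contMDiffAt (c.chart.open_source.mem_nhds x.2)).mdifferentiableAt (by simp)

lemma D_mul {x : M} (hx : x ∈ c.chart.source) {g h : M → ℝ}
    (hg : MDifferentiableAt (𝓡 d) 𝓘(ℝ, ℝ) g x) (hh : MDifferentiableAt (𝓡 d) 𝓘(ℝ, ℝ) h x)
    (i : Fin d) : c.D i (fun y => g y * h y) x = c.D i g x * h x + g x * c.D i h x := by
  have e : (fun y => g y * h y) ∘ c.chart.symm = (g ∘ c.chart.symm) * (h ∘ c.chart.symm) := rfl
  rw [D, e, fderiv_mul (c.differentiableAt_comp_symm hx hg) (c.differentiableAt_comp_symm hx hh)]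
  simp only [D, add_apply, smul_apply, smul_eq_mul,
    Function.comp_apply, c.chart.left_inv hx]
  ring

lemma ext_mul (f g : c.Coeff) : ext (f * g) = fun y => ext f y * ext g y := by
  funext y
  by_cases hy : y ∈ c.dom
  · exact (ext_apply (f * g) ⟨y, hy⟩).trans
      (congrArg₂ (· * ·) (ext_apply f ⟨y, hy⟩).symm (ext_apply g ⟨y, hy⟩).symm)
  · have hn : ¬ ∃ a : c.dom, (a : M) = y := by rintro ⟨a, rfl⟩; exact hy a.2
    simp [ext, Function.extend_apply' _ _ _ hn]

section

variable [IsManifold (𝓡 d) ∞ M]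

lemma pd_mul (i : Fin d) (f g : c.Coeff) : c.pd i (f * g) = c.pd i f * g + f * c.pd i g := by
  ext x
  rw [pd_apply, ext_mul, c.D_mul x.2 (c.mdifferentiableAt_ext f x) (c.mdifferentiableAt_ext g x),
    ext_apply, ext_apply]
  rfl

/-- Symmetry of the second derivative of the coordinate representative. It cancels the second-order
terms in `curv_eq`. -/
lemma pd_comm (i j : Fin d) (f : c.Coeff) : c.pd i (c.pd j f) = c.pd j (c.pd i f) := by
  ext x
  have hx := c.chart.map_source x.2
  have hs := (ext_contDiffOn f).contDiffAt (c.chart.open_target.mem_nhds hx)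
  have h1 : ∀ j, ext (c.pd j f) ∘ c.chart.symm =ᶠ[nhds (c.chart x)]
      fun y => fderiv ℝ (ext f ∘ c.chart.symm) y (stdVec j) := by
    intro j
    filter_upwards [c.chart.open_target.mem_nhds hx] with y hy
    have := ext_apply (c.pd j f) ⟨c.chart.symm y, c.chart.map_target hy⟩
    rw [pd_apply, D] at this
    rw [Function.comp_apply, this]
    congr 2
    exact c.chart.right_inv hy
  have h2 : DifferentiableAt ℝ (fderiv ℝ (ext f ∘ c.chart.symm)) (c.chart x) :=
    (hs.fderiv_right (m := 1) (WithTop.coe_le_coe.2 (le_top (a := (1 + 1 : ℕ∞))))).differentiableAt (by simp)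
  have h3 : ∀ i j, c.pd i (c.pd j f) x =
      fderiv ℝ (fderiv ℝ (ext f ∘ c.chart.symm)) (c.chart x) (stdVec i) (stdVec j) := by
    intro i j
    rw [pd_apply, D, (h1 j).fderiv_eq, fderiv_clm_apply h2 (differentiableAt_const _)]
    simp
  rw [h3, h3]
  have h4 : minSmoothness ℝ 2 ≤ (∞ : WithTop ℕ∞) := by
    rw [minSmoothness_of_isRCLikeNormedField]
    exact WithTop.coe_le_coe.2 (le_top (a := (2 : ℕ∞)))
  exact (hs.isSymmSndFDerivAt h4) _ _

end

/-! ### Components of tangent vectors -/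

/-- The components of a tangent vector in the chart. -/
def vcoord (x : M) (i : Fin d) : TangentSpace (𝓡 d) x →ₗ[ℝ] ℝ :=
  (EuclideanSpace.proj (𝕜 := ℝ) i).toLinearMap ∘ₗ
    (mfderiv (𝓡 d) (𝓡 d) c.chart x).toLinearMap

/-- The coordinate vector fields of the chart. -/
def cvec (x : M) (i : Fin d) : TangentSpace (𝓡 d) x :=
  mfderiv (𝓡 d) (𝓡 d) c.chart.symm (c.chart x) (stdVec i)

lemma vcoord_cvec {x : M} (hx : x ∈ c.chart.source) (i j : Fin d) :
    c.vcoord x i (c.cvec x j) = if i = j then 1 else 0 := by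
  have h := c.mdifferentiable_chart.comp_symm_deriv (c.chart.map_source hx)
  rw [c.chart.left_inv hx] at h
  have h1 : mfderiv (𝓡 d) (𝓡 d) c.chart x (c.cvec x j) = stdVec j :=
    congrArg (fun L : EuclideanSpace ℝ (Fin d) →L[ℝ] EuclideanSpace ℝ (Fin d) => L (stdVec j)) h
  refine (congrArg (fun w : EuclideanSpace ℝ (Fin d) => w i) h1).trans ?_
  simp [stdVec]

lemma sum_vcoord_smul {x : M} (hx : x ∈ c.chart.source) (v : TangentSpace (𝓡 d) x) :
    ∑ i, c.vcoord x i v • c.cvec x i = v :=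
  sum_ofLp_smul_map_stdVec (c.mdifferentiable_chart.symm_comp_deriv hx) v

lemma ext_of_vcoord {x : M} (hx : x ∈ c.chart.source) {v w : TangentSpace (𝓡 d) x}
    (h : ∀ i, c.vcoord x i v = c.vcoord x i w) : v = w := by
  rw [← c.sum_vcoord_smul hx v, ← c.sum_vcoord_smul hx w]
  exact Finset.sum_congr rfl fun a _ => by rw [h a]

/-- Chain rule for the factorisation of `g` through the chart near `x`. -/
lemma mfderiv_apply_eq {x : M} (hx : x ∈ c.chart.source) {g : M → ℝ}
    (hg : MDifferentiableAt (𝓡 d) 𝓘(ℝ, ℝ) g x) (v : TangentSpace (𝓡 d) x) :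
    (mfderiv (𝓡 d) 𝓘(ℝ, ℝ) g x v : ℝ) = ∑ i, c.vcoord x i v * c.D i g x := by
  have h1 : g =ᶠ[nhds x] (g ∘ c.chart.symm) ∘ c.chart := by
    filter_upwards [c.chart.open_source.mem_nhds hx] with y hy
    simp [c.chart.left_inv hy]
  have h2 : MDifferentiableAt (𝓡 d) 𝓘(ℝ, ℝ) (g ∘ c.chart.symm) (c.chart x) :=
    (c.differentiableAt_comp_symm hx hg).mdifferentiableAt
  have h3 := mfderiv_comp x h2 (c.mdifferentiable_chart.mdifferentiableAt hx)
  rw [h1.mfderiv_eq, h3, mfderiv_eq_fderiv]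
  exact sum_ofLp_mul_map_stdVec (fderiv ℝ (g ∘ c.chart.symm) (c.chart x)) _

end NatChart

end QP3
end

/-! ### Restriction, extension and change of coordinates -/

noncomputable section

namespace QP3

variable {d : ℕ} {M : Type*} [TopologicalSpace M] [ChartedSpace (EuclideanSpace ℝ (Fin d)) M]
variable {F : Type*} [NormedAddCommGroup F] [NormedSpace ℝ F]
variable {E : M → Type*} [TopologicalSpace (TotalSpace F E)] [∀ x, TopologicalSpace (E x)]
  [∀ x, AddCommGroup (E x)] [∀ x, Module ℝ (E x)] [FiberBundle F E]

namespace NatChart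

/-! ### Existence and restriction of natural coordinates -/

/-- The restriction of natural coordinates to an open set. -/
def restrict (c : NatChart (d := d) F E) (U : Set M) (hU : IsOpen U) : NatChart (d := d) F E where
  chart := c.chart.restr U
  mem_atlas := restr_mem_maximalAtlas (contDiffGroupoid ∞ (𝓡 d)) c.mem_atlas hU
  frame := c.frame
  isFrame := c.isFrame.mono (by
    rw [c.chart.restr_source' U hU]
    exact Set.inter_subset_left)

lemma restrict_source (c : NatChart (d := d) F E) (U : Set M) (hU : IsOpen U) :
    (c.restrict U hU).chart.source = c.chart.source ∩ U := c.chart.restr_source' U hU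

lemma coeff_restrict (c : NatChart (d := d) F E) (U : Set M) (hU : IsOpen U) {x : M}
    (hx : x ∈ c.chart.source) (hxU : x ∈ U) (a : Fin (finrank ℝ F)) (v : E x) :
    (c.restrict U hU).isFrame.coeff a x v = c.isFrame.coeff a x v := by
  have hx' : x ∈ (c.restrict U hU).chart.source := by
    rw [restrict_source]
    exact ⟨hx, hxU⟩
  conv_rhs => rw [← (c.restrict U hU).sum_coeff_smul hx' v, map_sum]
  rw [Finset.sum_eq_single a]
  · rw [map_smul]
    have : c.isFrame.coeff a x ((c.restrict U hU).frame a x) = 1 :=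
      (c.coeff_frame hx a a).trans (if_pos rfl)
    rw [this, smul_eq_mul, mul_one]
  · intro b _ hb
    rw [map_smul]
    have : c.isFrame.coeff a x ((c.restrict U hU).frame b x) = 0 :=
      (c.coeff_frame hx a b).trans (if_neg hb.symm)
    rw [this, smul_zero]
  · simp

section

variable [VectorBundle ℝ F E] [FiniteDimensional ℝ F] [ContMDiffVectorBundle ∞ F E (𝓡 d)]

/-- `coeff_smooth` asks for smoothness on the whole coordinate domain, so it is applied to the
coordinates restricted to `U`. -/
lemma coeff_contMDiffOn (c : NatChart (d := d) F E) {U : Set M} (hU : IsOpen U) {s : ∀ x, E x}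
    (hs : SmoothSecOn (d := d) F E s U) (a : Fin (finrank ℝ F)) :
    ContMDiffOn (𝓡 d) 𝓘(ℝ, ℝ) ∞ (fun x => c.isFrame.coeff a x (s x)) (c.chart.source ∩ U) := by
  have h := (c.restrict U hU).coeff_smooth s (by
    rw [restrict_source]
    exact ContMDiffOn.mono hs Set.inter_subset_right) a
  rw [← c.restrict_source U hU]
  refine h.congr fun x hx => ?_
  rw [restrict_source] at hx
  exact (c.coeff_restrict U hU hx.1 hx.2 a (s x)).symm

variable [IsManifold (𝓡 d) ∞ M]

variable (F E) in
-- The preferred chart at `x` is cut down to the base set of a trivialization, whose local frame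
-- serves as `e_a`.
lemma exists_mem_source (x : M) : ∃ c : NatChart (d := d) F E, x ∈ c.chart.source := by
  let e := trivializationAt F E x
  refine ⟨⟨(chartAt (EuclideanSpace ℝ (Fin d)) x).restr e.baseSet,
    restr_mem_maximalAtlas (contDiffGroupoid ∞ (𝓡 d)) (IsManifold.chart_mem_maximalAtlas x)
      e.open_baseSet, e.localFrame (finBasis ℝ F),
      (e.isLocalFrameOn_localFrame_baseSet (𝓡 d) ∞ (finBasis ℝ F)).mono ?_⟩, ?_⟩
  · rw [OpenPartialHomeomorph.restr_source' _ _ e.open_baseSet]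
    exact Set.inter_subset_right
  · change x ∈ ((chartAt (EuclideanSpace ℝ (Fin d)) x).restr e.baseSet).source
    rw [OpenPartialHomeomorph.restr_source' _ _ e.open_baseSet]
    exact ⟨mem_chart_source _ x, FiberBundle.mem_baseSet_trivializationAt' x⟩

end

/-! ### Components of global objects -/

variable (c : NatChart (d := d) F E)

/-- The components of a section of `E*`. -/
def dual (α : DualSec (d := d) F E) (a : Fin (finrank ℝ F)) : c.Coeff :=
  c.restr (fun x => α.toFun x (c.frame a x))
    (α.smooth _ _ c.chart.open_source (c.isFrame.contMDiffOn a))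

/-- The restriction of a function to the domain of the coordinates. -/
def fn (u : C^∞⟮𝓡 d, M; 𝓘(ℝ, ℝ), ℝ⟯) : c.Coeff := c.restr u u.contMDiff.contMDiffOn

lemma ofDual_apply (α : DualSec (d := d) F E) : ofDual α c = c.covForm (c.dual α) :=
  (c.covForm_eq _).symm

lemma ofFun_apply (u : C^∞⟮𝓡 d, M; 𝓘(ℝ, ℝ), ℝ⟯) : ofFun u c = c.coef (c.fn u) := rfl

section

variable [VectorBundle ℝ F E] [FiniteDimensional ℝ F] [ContMDiffVectorBundle ∞ F E (𝓡 d)]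

/-- The components of a section of `E`. -/
def sec (e : Cₛ^∞⟮𝓡 d; F, E⟯) (a : Fin (finrank ℝ F)) : c.Coeff :=
  c.restr (fun x => c.isFrame.coeff a x (e x))
    (c.coeff_smooth e e.contMDiff.contMDiffOn a)

lemma sec_apply (e : Cₛ^∞⟮𝓡 d; F, E⟯) (a : Fin (finrank ℝ F)) (x : c.dom) :
    c.sec e a x = c.isFrame.coeff a x (e x) := rfl

lemma ofSec_apply (e : Cₛ^∞⟮𝓡 d; F, E⟯) : ofSec e c = c.secForm (c.sec e) :=
  (c.secForm_eq _).symm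

end

/-! ### Extension of local objects -/

/-- `M` is locally compact, Hausdorff and σ-compact. Choosing a closed neighbourhood of `x` inside
the domain keeps the closed support of `χ` inside it as well. -/
lemma exists_bump [IsManifold (𝓡 d) ∞ M] [T2Space M] [SigmaCompactSpace M] (x : c.dom) :
    ∃ χ : C^∞⟮𝓡 d, M; 𝓘(ℝ, ℝ), ℝ⟯, (∀ᶠ y in nhds (x : M), χ y = 1) ∧
      tsupport χ ⊆ c.chart.source := by
  have : LocallyCompactSpace M := Manifold.locallyCompact_of_finiteDimensional (𝓡 d)
  obtain ⟨K, ⟨hK, hKc⟩, hKs⟩ := (closed_nhds_basis (x : M)).mem_iff.mp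
    (c.chart.open_source.mem_nhds x.2)
  obtain ⟨χ, h1, h0, -⟩ := exists_contMDiffMap_one_nhds_of_subset_interior (n := ⊤) (𝓡 d)
    (isClosed_singleton (x := (x : M))) (Set.singleton_subset_iff.mpr (mem_interior_iff_mem_nhds.mpr hK))
  refine ⟨χ, by simpa [nhdsSet_singleton] using h1, ?_⟩
  refine (closure_minimal (fun y hy => ?_) hKc).trans hKs
  by_contra h
  exact hy (h0 y h)

/-- Outside the coordinate domain, where nothing is known about `g`, the product vanishes near the
point because the closed support of `χ` lies in the domain. -/
lemma contMDiff_bump_mul {χ : M → ℝ} (hχ : ContMDiff (𝓡 d) 𝓘(ℝ, ℝ) ∞ χ)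
    (hs : tsupport χ ⊆ c.chart.source) {g : M → ℝ}
    {U : Set M} (hU : IsOpen U) (hg : ContMDiffOn (𝓡 d) 𝓘(ℝ, ℝ) ∞ g (c.chart.source ∩ U)) :
    ContMDiffOn (𝓡 d) 𝓘(ℝ, ℝ) ∞ (fun y => χ y * g y) U := by
  intro y hy
  by_cases h : y ∈ c.chart.source
  · exact (hχ.contMDiffAt.mul (hg.contMDiffAt
      ((c.chart.open_source.inter hU).mem_nhds ⟨h, hy⟩))).contMDiffWithinAt
  · have h1 : ∀ᶠ z in nhds y, χ z * g z = 0 := by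
      filter_upwards [(isClosed_tsupport χ).isOpen_compl.mem_nhds fun h' => h (hs h')] with z hz
      rw [image_eq_zero_of_notMem_tsupport hz, zero_mul]
    exact ((contMDiffAt_const (c := (0 : ℝ))).congr_of_eventuallyEq h1).contMDiffWithinAt

section

variable [IsManifold (𝓡 d) ∞ M] [T2Space M] [SigmaCompactSpace M]

/-- Germs extend to `M`: multiplication by a bump function changes nothing near `x`. The lemmas
`exists_sec` and `exists_dual` do the same for `E` and `E*`. -/
lemma exists_fn (x : c.dom) (g : c.Coeff) :
    ∃ u : C^∞⟮𝓡 d, M; 𝓘(ℝ, ℝ), ℝ⟯, ext (c.fn u) =ᶠ[nhds (x : M)] ext g := by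
  obtain ⟨χ, h1, hs⟩ := c.exists_bump x
  refine ⟨⟨fun y => χ y * ext g y, contMDiffOn_univ.mp
    (c.contMDiff_bump_mul χ.contMDiff hs isOpen_univ
      ((ext_contMDiffOn g).mono Set.inter_subset_left))⟩, ?_⟩
  filter_upwards [h1, c.ext_restr_eventuallyEq x.2 (fun y => χ y * ext g y)
    ((c.contMDiff_bump_mul χ.contMDiff hs isOpen_univ
      ((ext_contMDiffOn g).mono Set.inter_subset_left)).mono (Set.subset_univ _))] with y hy h2
  refine h2.trans ?_
  rw [hy, one_mul]

variable [VectorBundle ℝ F E] [FiniteDimensional ℝ F] [ContMDiffVectorBundle ∞ F E (𝓡 d)]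

lemma exists_sec (x : c.dom) (g : Fin (finrank ℝ F) → c.Coeff) :
    ∃ e : Cₛ^∞⟮𝓡 d; F, E⟯, ∀ a, ext (c.sec e a) =ᶠ[nhds (x : M)] ext (g a) := by
  obtain ⟨χ, h1, hs⟩ := c.exists_bump x
  have hsm : ∀ a, ContMDiff (𝓡 d) ((𝓡 d).prod 𝓘(ℝ, F)) ∞ (fun y => TotalSpace.mk' F y
      (((fun y => χ y * ext (g a) y) • c.frame a) y)) := by
    intro a
    refine ContMDiffOn.smul_section_of_tsupport (u := c.chart.source) ?_ c.chart.open_source ?_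
      (c.isFrame.contMDiffOn a)
    · exact χ.contMDiff.contMDiffOn.mul (ext_contMDiffOn (g a))
    · exact (closure_mono (Function.support_mul_subset_left _ _)).trans hs
  refine ⟨⟨fun y => ∑ a, ((fun y => χ y * ext (g a) y) • c.frame a) y,
    ContMDiff.sum_section fun a _ => hsm a⟩, fun a => ?_⟩
  filter_upwards [h1, c.chart.open_source.mem_nhds x.2] with y hy hys
  refine (ext_apply _ ⟨y, hys⟩).trans ?_
  change c.isFrame.coeff a y (∑ b, (χ y * ext (g b) y) • c.frame b y) = ext (g a) y
  simp only [map_sum, map_smul, c.coeff_frame hys, hy, one_mul, smul_eq_mul, mul_ite, mul_one,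
    mul_zero, Finset.sum_ite_eq, Finset.mem_univ, if_true]

lemma exists_dual (x : c.dom) (g : Fin (finrank ℝ F) → c.Coeff) :
    ∃ α : DualSec (d := d) F E, ∀ a, ext (c.dual α a) =ᶠ[nhds (x : M)] ext (g a) := by
  obtain ⟨χ, h1, hs⟩ := c.exists_bump x
  refine ⟨⟨fun y => ∑ a, (χ y * ext (g a) y) • c.isFrame.coeff a y, fun U s hU hsm => ?_⟩,
    fun a => ?_⟩
  · simp only [LinearMap.sum_apply, LinearMap.smul_apply, smul_eq_mul, mul_assoc]
    refine contMDiffOn_finsetSum fun a _ => c.contMDiff_bump_mul χ.contMDiff hs hU ?_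
    exact ((ext_contMDiffOn (g a)).mono Set.inter_subset_left).mul (c.coeff_contMDiffOn hU hsm a)
  · filter_upwards [h1, c.chart.open_source.mem_nhds x.2] with y hy hys
    refine (ext_apply _ ⟨y, hys⟩).trans ?_
    change (∑ b, (χ y * ext (g b) y) • c.isFrame.coeff b y) (c.frame a y) = ext (g a) y
    simp only [LinearMap.sum_apply, LinearMap.smul_apply, c.coeff_frame hys, hy, one_mul,
      smul_eq_mul, mul_ite, mul_one, mul_zero, Finset.sum_ite_eq', Finset.mem_univ, if_true]

/-- A section with prescribed components at a point. -/
lemma exists_sec_apply (x : c.dom) (v : Fin (finrank ℝ F) → ℝ) :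
    ∃ e : Cₛ^∞⟮𝓡 d; F, E⟯, (∀ a, c.sec e a x = v a) ∧ ∀ a i, c.pd i (c.sec e a) x = 0 := by
  obtain ⟨e, he⟩ := c.exists_sec x fun a => algebraMap ℝ _ (v a)
  refine ⟨e, fun a => ?_, fun a i => ?_⟩
  · rw [← ext_apply, (he a).eq_of_nhds, ext_apply]
    rfl
  · rw [c.pd_congr (he a), pd_apply, D]
    have : ext (algebraMap ℝ c.Coeff (v a)) =ᶠ[nhds (x : M)] fun _ => v a := by
      filter_upwards [c.chart.open_source.mem_nhds x.2] with y hy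
      exact ext_apply _ ⟨y, hy⟩
    have h2 := c.D_congr x.2 this i
    rw [D] at h2
    rw [h2, D]
    have h3 : (fun _ : M => v a) ∘ c.chart.symm = fun _ => v a := rfl
    rw [h3, fderiv_fun_const]
    rfl

end

/-! ### The change of coordinates -/

lemma D_eq_mfderiv_cvec [IsManifold (𝓡 d) ∞ M] {x : M} (hx : x ∈ c.chart.source) {g : M → ℝ}
    (hg : MDifferentiableAt (𝓡 d) 𝓘(ℝ, ℝ) g x) (i : Fin d) :
    c.D i g x = mfderiv (𝓡 d) 𝓘(ℝ, ℝ) g x (c.cvec x i) := by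
  rw [c.mfderiv_apply_eq hx hg]
  simp only [c.vcoord_cvec hx, ite_mul, one_mul, zero_mul, Finset.sum_ite_eq', Finset.mem_univ,
    if_true]

lemma D_eq_sum_D (c' : NatChart (d := d) F E) {x : M} (hx : x ∈ c.chart.source)
    (hx' : x ∈ c'.chart.source) {g : M → ℝ} (hg : MDifferentiableAt (𝓡 d) 𝓘(ℝ, ℝ) g x)
    [IsManifold (𝓡 d) ∞ M] (i : Fin d) :
    c'.D i g x = ∑ j, c.vcoord x j (c'.cvec x i) * c.D j g x := by
  rw [c'.D_eq_mfderiv_cvec hx' hg, c.mfderiv_apply_eq hx hg]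

/-- The Jacobian of the chart change is expressed through components of coordinate vectors, so that
it can be compared with the transformation of the anchor. -/
lemma transition_eq (c' : NatChart (d := d) F E) {x : M} (hx : x ∈ c.chart.source)
    (hx' : x ∈ c'.chart.source) : c.transition c' x = subst
      (fun b a => c.isFrame.coeff b x (c'.frame a x))
      (fun a b => c'.isFrame.coeff a x (c.frame b x))
      (fun i j => c.vcoord x j (c'.cvec x i))
      (fun i b k => ∑ a, c'.D i (fun y => c.isFrame.coeff b y (c'.frame a y)) x *
        c'.isFrame.coeff a x (c.frame k x)) := by
  have h : (fun i j => fderiv ℝ (c.chart ∘ c'.chart.symm) (c'.chart x) (stdVec i) j) =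
      fun i j => c.vcoord x j (c'.cvec x i) := by
    funext i j
    have h1 : MDifferentiableAt (𝓡 d) (𝓡 d) c.chart (c'.chart.symm (c'.chart x)) := by
      rw [c'.chart.left_inv hx']
      exact c.mdifferentiable_chart.mdifferentiableAt hx
    have h2 := mfderiv_comp (c'.chart x) h1
      (c'.mdifferentiable_chart.mdifferentiableAt_symm (c'.chart.map_source hx'))
    rw [mfderiv_eq_fderiv, c'.chart.left_inv hx'] at h2
    exact congrArg (fun L : EuclideanSpace ℝ (Fin d) →L[ℝ] EuclideanSpace ℝ (Fin d) =>
      L (stdVec i) j) h2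
  rw [transition, h]
  rfl

end NatChart

end QP3
end

/-! ### Operations represented by structure functions -/

noncomputable section

namespace QP3

variable {d : ℕ} {M : Type*} [TopologicalSpace M] [ChartedSpace (EuclideanSpace ℝ (Fin d)) M]
variable {F : Type*} [NormedAddCommGroup F] [NormedSpace ℝ F]
variable {E : M → Type*} [TopologicalSpace (TotalSpace F E)] [∀ x, TopologicalSpace (E x)]
  [∀ x, AddCommGroup (E x)] [∀ x, Module ℝ (E x)] [FiberBundle F E]
namespace NatChart

variable (c : NatChart (d := d) F E)

lemma coeff_sum_apply {ι : Type*} (s : Finset ι) (g : ι → c.Coeff) (x : c.dom) :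
    (∑ i ∈ s, g i) x = ∑ i ∈ s, g i x := map_sum (c.evalCoeff x) g s

variable [IsManifold (𝓡 d) ∞ M]

omit [IsManifold (𝓡 d) ∞ M] in
lemma contMDiffOn_chart_apply (i : Fin d) :
    ContMDiffOn (𝓡 d) 𝓘(ℝ, ℝ) ∞ (fun y => c.chart y i) c.chart.source := fun x hx =>
  ((EuclideanSpace.proj i : EuclideanSpace ℝ (Fin d) →L[ℝ] ℝ).contMDiff.contMDiffAt.comp x
    ((contMDiffOn_of_mem_maximalAtlas c.mem_atlas).contMDiffAt
      (c.chart.open_source.mem_nhds hx))).contMDiffWithinAt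

/-- The coordinate functions of the chart. -/
def coordFun (i : Fin d) : c.Coeff := c.restr (fun y => c.chart y i) (c.contMDiffOn_chart_apply i)

lemma pd_coordFun (i j : Fin d) (x : c.dom) :
    c.pd j (c.coordFun i) x = if i = j then 1 else 0 := by
  rw [coordFun, pd_restr_apply, D]
  have h : (fun y => c.chart y i) ∘ c.chart.symm =ᶠ[nhds (c.chart x)]
      (EuclideanSpace.proj i : EuclideanSpace ℝ (Fin d) →L[ℝ] ℝ) := by
    filter_upwards [c.chart.open_target.mem_nhds (c.chart.map_source x.2)] with y hy
    simp [c.chart.right_inv hy]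
  rw [h.fderiv_eq, ContinuousLinearMap.fderiv]
  simp [stdVec]

lemma pd_algebraMap (i : Fin d) (k : ℝ) : c.pd i (algebraMap ℝ c.Coeff k) = 0 := by
  have h := c.pd_mul i 1 1
  rw [mul_one, mul_one, one_mul, left_eq_add] at h
  rw [Algebra.algebraMap_eq_smul_one, map_smul, h, smul_zero]

variable [T2Space M] [SigmaCompactSpace M]
variable [VectorBundle ℝ F E] [FiniteDimensional ℝ F] [ContMDiffVectorBundle ∞ F E (𝓡 d)]

lemma exists_dual_apply (x : c.dom) (v : Fin (finrank ℝ F) → ℝ) :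
    ∃ α : DualSec (d := d) F E, (∀ a, c.dual α a x = v a) ∧ ∀ a i, c.pd i (c.dual α a) x = 0 := by
  obtain ⟨e, he⟩ := c.exists_dual x fun a => algebraMap ℝ _ (v a)
  refine ⟨e, fun a => ?_, fun a i => ?_⟩
  · rw [← ext_apply, (he a).eq_of_nhds, ext_apply]
    rfl
  · rw [c.pd_congr (he a), pd_algebraMap]
    rfl

omit [IsManifold (𝓡 d) ∞ M] [T2Space M] [SigmaCompactSpace M] [VectorBundle ℝ F E]
  [FiniteDimensional ℝ F] [ContMDiffVectorBundle ∞ F E (𝓡 d)] in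
lemma dual_eq_coeff {α : DualSec (d := d) F E} {x : c.dom} {a : Fin (finrank ℝ F)}
    (h : ∀ b, c.dual α b x = if a = b then 1 else 0) : α.toFun x = c.isFrame.coeff a x := by
  refine LinearMap.ext fun v => ?_
  rw [← c.sum_apply_frame_mul_coeff x.2]
  have h1 : ∀ b, α.toFun x (c.frame b x) = if a = b then 1 else 0 := h
  simp [h1]

omit [IsManifold (𝓡 d) ∞ M] [T2Space M] [SigmaCompactSpace M] in
lemma sec_eq_frame {e : Cₛ^∞⟮𝓡 d; F, E⟯} {x : c.dom} {a : Fin (finrank ℝ F)}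
    (h : ∀ b, c.sec e b x = if b = a then 1 else 0) : e x = c.frame a x :=
  c.ext_of_coeff x.2 fun b => by rw [c.coeff_frame x.2, ← h b]; rfl

end NatChart

variable [IsManifold (𝓡 d) ∞ M]

namespace Operations

variable [VectorBundle ℝ F E] [FiniteDimensional ℝ F] [ContMDiffVectorBundle ∞ F E (𝓡 d)]

/-- The operations are given by the structure functions `f` in the coordinates `c`. -/
structure Rep (D : Operations (d := d) F E) {c : NatChart (d := d) F E} (f : StrFun c) : Prop where
  brk : ∀ e₁ e₂, c.sec (D.brk e₁ e₂) = f.brk (c.sec e₁) (c.sec e₂)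
  -- The minus sign is that of the term of the Poisson bracket with a `ξ_i`-derivative of the left
  -- factor and an `x^i`-derivative of the right one.
  anchor : ∀ (x : c.dom) i a, c.vcoord x i (D.anchor x (c.frame a x)) = -f.f₁ i a x
  del : ∀ (x : c.dom) a b, c.isFrame.coeff b x (D.del x (c.isFrame.coeff a x)) = f.f₂ a b x
  Om : ∀ (x : c.dom) l, D.Om x (fun i => c.frame (l i) x) = f.F4 l x

namespace Rep

variable {D : Operations (d := d) F E} {c : NatChart (d := d) F E} {f : StrFun c} (h : D.Rep f)

include h in
lemma vcoord_anchor (x : c.dom) (i : Fin d) (v : E x) :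
    c.vcoord x i (D.anchor x v) = -∑ a, f.f₁ i a x * c.isFrame.coeff a x v := by
  conv_lhs => rw [← c.sum_coeff_smul x.2 v, map_sum, map_sum]
  rw [← Finset.sum_neg_distrib]
  refine Finset.sum_congr rfl fun a _ => ?_
  rw [map_smul, map_smul, h.anchor, smul_eq_mul]
  ring

include h in
lemma act_eq_D (x : c.dom) (e : Cₛ^∞⟮𝓡 d; F, E⟯) {u : M → ℝ}
    (hu : MDifferentiableAt (𝓡 d) 𝓘(ℝ, ℝ) u x) :
    D.act e u x = -∑ i, (∑ a, f.f₁ i a x * c.sec e a x) * c.D i u x := by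
  rw [act, c.mfderiv_apply_eq x.2 hu, ← Finset.sum_neg_distrib]
  refine Finset.sum_congr rfl fun i _ => ?_
  rw [h.vcoord_anchor, neg_mul]
  rfl

include h in
lemma act_eq (x : c.dom) (e : Cₛ^∞⟮𝓡 d; F, E⟯) (g : M → ℝ)
    (hg : ContMDiffOn (𝓡 d) 𝓘(ℝ, ℝ) ∞ g c.chart.source) :
    D.act e g x = f.act (c.sec e) (c.restr g hg) x := by
  rw [h.act_eq_D x e ((hg.contMDiffAt (c.chart.open_source.mem_nhds x.2)).mdifferentiableAt
    (by simp)), StrFun.act]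
  have h1 : ∀ i, c.pd i (c.restr g hg) x = c.D i g x := fun i => c.pd_restr_apply i x g hg
  change _ = -((∑ i, (∑ a, f.f₁ i a * c.sec e a) * c.pd i (c.restr g hg) : c.Coeff) x)
  rw [c.coeff_sum_apply]
  congr 1
  refine Finset.sum_congr rfl fun i _ => ?_
  change _ = (∑ a, f.f₁ i a * c.sec e a : c.Coeff) x * _
  rw [c.coeff_sum_apply, h1]
  rfl

include h in
lemma coeff_del (x : c.dom) (b : Fin (finrank ℝ F)) (α : Module.Dual ℝ (E x)) :
    c.isFrame.coeff b x (D.del x α) = ∑ a, f.f₂ a b x * α (c.frame a x) := by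
  have : α = ∑ a, α (c.frame a x) • c.isFrame.coeff a x := LinearMap.ext fun v => by
    rw [← c.sum_apply_frame_mul_coeff x.2 α v]
    simp
  conv_lhs => rw [this, map_sum, map_sum]
  refine Finset.sum_congr rfl fun a _ => ?_
  rw [map_smul, map_smul, h.del, smul_eq_mul, mul_comm]

include h in
lemma pairing_eq (x : c.dom) (α β : DualSec (d := d) F E) :
    D.pairing α β x = (∑ b, (∑ a, f.f₂ a b * c.dual α a) * c.dual β b : c.Coeff) x := by
  rw [pairing, ← c.sum_apply_frame_mul_coeff x.2, c.coeff_sum_apply]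
  refine Finset.sum_congr rfl fun b _ => ?_
  rw [h.coeff_del, mul_comm]
  change _ = (∑ a, f.f₂ a b * c.dual α a : c.Coeff) x * _
  rw [c.coeff_sum_apply]
  rfl

include h in
lemma Om_apply (x : c.dom) (v : Fin 4 → E x) :
    D.Om x v = ∑ l, f.F4 l x * ∏ i, c.isFrame.coeff (l i) x (v i) := by
  have hv : v = fun i => ∑ a, c.isFrame.coeff a x (v i) • c.frame a x :=
    funext fun i => (c.sum_coeff_smul x.2 (v i)).symm
  conv_lhs => rw [hv]
  rw [← AlternatingMap.coe_multilinearMap, MultilinearMap.map_sum]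
  refine Finset.sum_congr rfl fun l _ => ?_
  rw [MultilinearMap.map_smul_univ, AlternatingMap.coe_multilinearMap, h.Om, smul_eq_mul, mul_comm]

end Rep

section

variable {θ₂ θ₁₃ θ₄ : Families (d := d) F E} {f : ∀ c : NatChart (d := d) F E, StrFun c}

theorem derivedFrom_of_rep {D : Operations (d := d) F E}
    (hθ : ∀ c, θ₂ c = (f c).theta2 ∧ θ₁₃ c = (f c).theta13 ∧ θ₄ c = (f c).theta4)
    (h : ∀ c, D.Rep (f c)) : D.DerivedFrom θ₂ θ₁₃ θ₄ where
  brk_eq e₁ e₂ := by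
    funext c
    simp only [poisson, NatChart.ofSec_apply, (hθ c).2.1,
      StrFun.bracket_bracket_theta13_secForm, (h c).brk]
  anchor_eq e u c x := by
    simp only [poisson, NatChart.ofSec_apply, NatChart.ofFun_apply, (hθ c).2.1,
      StrFun.bracket_bracket_theta13_coef, NatChart.eval_coef]
    rw [(h c).act_eq x e u u.contMDiff.contMDiffOn]
    rfl
  pairing_eq α β c x := by
    simp only [poisson, NatChart.ofDual_apply, (hθ c).1,
      StrFun.bracket_bracket_theta2_covForm, NatChart.eval_coef]
    rw [(h c).pairing_eq x]
  Om_eq e c x := by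
    have h1 := (f c).eval_brackets_theta4 (fun i => c.sec (e i)) x
    simp only [poisson, NatChart.ofSec_apply, (hθ c).2.2, (h c).Om_apply x]
    exact h1

variable [T2Space M] [SigmaCompactSpace M]

/-- Testing on sections, functions and covectors with prescribed components at one point reads off
every structure function; bump functions make such test objects global. -/
theorem rep_of_derivedFrom {D : Operations (d := d) F E} {c : NatChart (d := d) F E} {f : StrFun c}
    (hθ : θ₂ c = f.theta2 ∧ θ₁₃ c = f.theta13 ∧ θ₄ c = f.theta4)
    (h : D.DerivedFrom θ₂ θ₁₃ θ₄) : D.Rep f where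
  brk e₁ e₂ := by
    have h1 := congrFun (h.brk_eq e₁ e₂) c
    simp only [poisson, NatChart.ofSec_apply, hθ.2.1,
      StrFun.bracket_bracket_theta13_secForm] at h1
    exact (c.secForm_injective h1).symm
  anchor x i a := by
    obtain ⟨e, he, -⟩ := c.exists_sec_apply x (fun b => if b = a then 1 else 0)
    -- A global function that agrees with `x^i` near `x` picks out the `i`-th component of the
    -- anchor.
    obtain ⟨u, hu⟩ := c.exists_fn x (c.coordFun i)
    have h1 := h.anchor_eq e u c x
    simp only [poisson, NatChart.ofSec_apply, NatChart.ofFun_apply, hθ.2.1,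
      StrFun.bracket_bracket_theta13_coef, NatChart.eval_coef] at h1
    have h2 := algebraMap_fib_injective h1
    have h3 : ∀ j, c.pd j (c.fn u) x = if i = j then 1 else 0 := fun j => by
      rw [c.pd_congr hu, c.pd_coordFun]
    rw [act, c.mfderiv_apply_eq x.2 (u.contMDiff.mdifferentiable (by simp) _),
      c.sec_eq_frame he] at h2
    have h4 : ∀ j, c.D j u x = if i = j then 1 else 0 := fun j => by
      rw [← h3 j, NatChart.fn, c.pd_restr_apply]
    simp only [h4, mul_ite, mul_one, mul_zero, Finset.sum_ite_eq, Finset.mem_univ, if_true] at h2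
    rw [← h2, StrFun.act]
    change -((∑ i, (∑ a, f.f₁ i a * c.sec e a) * c.pd i (c.fn u) : c.Coeff) x) = _
    rw [c.coeff_sum_apply, Finset.sum_eq_single i]
    · change -((∑ a, f.f₁ i a * c.sec e a : c.Coeff) x * c.pd i (c.fn u) x) = _
      rw [c.coeff_sum_apply, Finset.sum_eq_single a, h3, if_pos rfl, mul_one]
      · change -(f.f₁ i a x * c.sec e a x) = _
        rw [he, if_pos rfl, mul_one]
      · intro b _ hb
        change f.f₁ i b x * c.sec e b x = 0
        rw [he, if_neg hb, mul_zero]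
      · simp
    · intro j _ hj
      change _ * c.pd j (c.fn u) x = 0
      rw [h3, if_neg hj.symm, mul_zero]
    · simp
  del x a b := by
    obtain ⟨α, hα, -⟩ := c.exists_dual_apply x (fun b => if a = b then 1 else 0)
    obtain ⟨β, hβ, -⟩ := c.exists_dual_apply x (fun a => if b = a then 1 else 0)
    have h1 := h.pairing_eq α β c x
    simp only [poisson, NatChart.ofDual_apply, hθ.1,
      StrFun.bracket_bracket_theta2_covForm, NatChart.eval_coef] at h1
    have h2 := algebraMap_fib_injective h1
    rw [pairing, c.dual_eq_coeff hα, c.dual_eq_coeff hβ, c.coeff_sum_apply,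
      Finset.sum_eq_single b] at h2
    · rw [← h2]
      change (∑ a, f.f₂ a b * c.dual α a : c.Coeff) x * c.dual β b x = _
      rw [c.coeff_sum_apply, Finset.sum_eq_single a, hβ, if_pos rfl, mul_one]
      · change f.f₂ a b x * c.dual α a x = _
        rw [hα, if_pos rfl, mul_one]
      · intro m _ hm
        change f.f₂ m b x * c.dual α m x = 0
        rw [hα, if_neg hm.symm, mul_zero]
      · simp
    · intro m _ hm
      change _ * c.dual β m x = 0
      rw [hβ, if_neg hm.symm, mul_zero]
    · simp
  Om x l := by
    choose e he _ using fun i : Fin 4 => c.exists_sec_apply x (fun b => if b = l i then 1 else 0)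
    have h1 := h.Om_eq e c x
    have h2 := f.eval_brackets_theta4 (fun i => c.sec (e i)) x
    simp only [poisson, NatChart.ofSec_apply, hθ.2.2] at h1
    have h3 := algebraMap_fib_injective (h1.symm.trans h2)
    have h4 : (fun i => e i x) = fun i => c.frame (l i) x := funext fun i => c.sec_eq_frame (he i)
    rw [h4] at h3
    rw [h3, Finset.sum_eq_single l]
    · simp [he]
    · intro l' _ hl'
      obtain ⟨i, hi⟩ : ∃ i, l' i ≠ l i := by
        by_contra! h5
        exact hl' (funext h5)
      rw [Finset.prod_eq_zero (Finset.mem_univ i) (by rw [he, if_neg hi]), mul_zero]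
    · simp

end

theorem ext_of_rep {D D' : Operations (d := d) F E} {f : ∀ c : NatChart (d := d) F E, StrFun c}
    (h : ∀ c, D.Rep (f c)) (h' : ∀ c, D'.Rep (f c)) : D = D' := by
  have h1 : D.brk = D'.brk := by
    refine LinearMap.ext fun e₁ => LinearMap.ext fun e₂ => ContMDiffSection.ext fun x => ?_
    obtain ⟨c, hx⟩ := NatChart.exists_mem_source (d := d) F E x
    refine c.ext_of_coeff hx fun a => ?_
    have h2 := ((h c).brk e₁ e₂).trans ((h' c).brk e₁ e₂).symm
    exact congrArg (fun g : Fin (finrank ℝ F) → c.Coeff => g a ⟨x, hx⟩) h2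
  have h2 : D.anchor = D'.anchor := by
    refine funext fun x => LinearMap.ext fun v => ?_
    obtain ⟨c, hx⟩ := NatChart.exists_mem_source (d := d) F E x
    refine c.ext_of_vcoord hx fun i => ?_
    rw [(h c).vcoord_anchor ⟨x, hx⟩, (h' c).vcoord_anchor ⟨x, hx⟩]
  have h3 : D.del = D'.del := by
    refine funext fun x => LinearMap.ext fun α => ?_
    obtain ⟨c, hx⟩ := NatChart.exists_mem_source (d := d) F E x
    refine c.ext_of_coeff hx fun b => ?_
    rw [(h c).coeff_del ⟨x, hx⟩, (h' c).coeff_del ⟨x, hx⟩]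
  have h4 : D.Om = D'.Om := by
    refine funext fun x => AlternatingMap.ext fun v => ?_
    obtain ⟨c, hx⟩ := NatChart.exists_mem_source (d := d) F E x
    rw [(h c).Om_apply ⟨x, hx⟩, (h' c).Om_apply ⟨x, hx⟩]
  cases D
  cases D'
  simp only at h1 h2 h3 h4
  subst h1 h2 h3 h4
  rfl

end Operations

namespace StrFun

variable {c : NatChart (d := d) F E} (f : StrFun c)

lemma act_apply (g : Fin (finrank ℝ F) → c.Coeff) (u : c.Coeff) (x : c.dom) :
    f.act g u x = -∑ i, (∑ a, f.f₁ i a x * g a x) * c.pd i u x := by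
  change -((∑ i, (∑ a, f.f₁ i a * g a) * c.pd i u : c.Coeff) x) = _
  rw [c.coeff_sum_apply]
  congr 1
  refine Finset.sum_congr rfl fun i _ => ?_
  change (∑ a, f.f₁ i a * g a : c.Coeff) x * _ = _
  rw [c.coeff_sum_apply]
  rfl

lemma brk_apply (g h : Fin (finrank ℝ F) → c.Coeff) (b : Fin (finrank ℝ F)) (x : c.dom) :
    f.brk g h b x = f.act g (h b) x - f.act h (g b) x +
      ∑ m, ∑ a, f.f₃ b m a x * g a x * h m x := by
  change f.act g (h b) x - f.act h (g b) x +
    (∑ m, ∑ a, f.f₃ b m a * g a * h m : c.Coeff) x = _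
  simp only [c.coeff_sum_apply]
  rfl

/-- The bracket of sections with components constant to first order. -/
lemma brk_apply_of_pd_eq_zero {g h : Fin (finrank ℝ F) → c.Coeff} {x : c.dom}
    (hg : ∀ a i, c.pd i (g a) x = 0) (hh : ∀ a i, c.pd i (h a) x = 0) (b : Fin (finrank ℝ F)) :
    f.brk g h b x = ∑ m, ∑ a, f.f₃ b m a x * g a x * h m x := by
  simp [brk_apply, act_apply, hg, hh]

end StrFun

lemma sum_sum_mul_single {r : ℕ} (A : Fin r → Fin r → ℝ) (a m : Fin r) :
    ∑ k, ∑ b, A k b * (if b = a then 1 else 0) * (if k = m then 1 else 0) = A m a := by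
  simp

end QP3
end

/-! ### The transformation law of the structure functions -/

noncomputable section

namespace QP3

lemma sum_smul_sum_smul {ι κ V : Type*} [Fintype ι] [Fintype κ] [AddCommGroup V] [Module ℝ V]
    (g : ι → ℝ) (h : ι → κ → ℝ) (e : κ → V) :
    ∑ i, g i • ∑ k, h i k • e k = ∑ k, (∑ i, g i * h i k) • e k := by
  simp only [Finset.smul_sum, Finset.sum_smul, smul_smul]
  exact Finset.sum_comm

lemma sum_smul_sum₂_smul {ι κ μ V : Type*} [Fintype ι] [Fintype κ] [Fintype μ] [AddCommGroup V]
    [Module ℝ V] (g : ι → ℝ) (h : ι → κ → μ → ℝ) (e : κ → μ → V) :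
    ∑ i, g i • ∑ k, ∑ m, h i k m • e k m = ∑ k, ∑ m, (∑ i, g i * h i k m) • e k m := by
  have := sum_smul_sum_smul g (fun i (k : κ × μ) => h i k.1 k.2) (fun k => e k.1 k.2)
  simpa only [Fintype.sum_prod_type] using this

lemma sum₂_smul_sum₂_smul {ι ν κ μ V : Type*} [Fintype ι] [Fintype ν] [Fintype κ] [Fintype μ]
    [AddCommGroup V] [Module ℝ V] (g : ι → ν → ℝ) (h : ι → ν → κ → μ → ℝ) (e : κ → μ → V) :
    ∑ i, ∑ j, g i j • ∑ k, ∑ m, h i j k m • e k m =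
      ∑ k, ∑ m, (∑ i, ∑ j, g i j * h i j k m) • e k m := by
  have := sum_smul_sum₂_smul (fun i : ι × ν => g i.1 i.2) (fun i => h i.1 i.2) e
  simpa only [Fintype.sum_prod_type] using this

lemma isSkew_sum_prod {r n : ℕ} {w : (Fin n → Fin r) → ℝ} (hw : IsSkew w)
    (t : Fin r → Fin r → ℝ) : IsSkew fun l : Fin n → Fin r => ∑ l', w l' * ∏ i, t (l' i) (l i) := by
  intro l σ
  change ∑ l', w l' * ∏ i, t (l' i) ((l ∘ σ) i) = _ • ∑ l', w l' * ∏ i, t (l' i) (l i)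
  rw [← Equiv.sum_comp (Equiv.arrowCongr σ.symm (Equiv.refl (Fin r))), Finset.smul_sum]
  refine Finset.sum_congr rfl fun l' _ => ?_
  have h : (Equiv.arrowCongr σ.symm (Equiv.refl (Fin r))) l' = l' ∘ σ := by
    funext i
    simp [Equiv.arrowCongr]
  rw [h, hw l' σ, smul_eq_mul, smul_eq_mul, mul_assoc]
  congr 2
  exact Equiv.prod_comp σ fun i => t (l' i) (l i)

section Substitution

variable {d r : ℕ} (u t : Fin r → Fin r → ℝ) (J : Fin d → Fin d → ℝ) (B : Fin d → Fin r → Fin r → ℝ)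

lemma subst_qm {n : ℕ} (l : Fin n → Fin r) :
    subst u t J B (qm l) = ∑ l', (∏ i, t (l i) (l' i)) • (qm l' : FibAlg d r) := by
  induction n with
  | zero =>
    rw [sum_fun_zero]
    simp [qm_zero]
  | succ n ih =>
    rw [qm_succ, map_mul, subst_q, ih, sum_cons, Finset.sum_mul]
    refine Finset.sum_congr rfl fun a _ => ?_
    rw [Finset.mul_sum]
    refine Finset.sum_congr rfl fun l' _ => ?_
    rw [smul_mul_smul_comm, Fin.prod_univ_succ, qm_succ]
    rfl

lemma subst_sum_pp (g : Fin r → Fin r → ℝ) :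
    subst u t J B (∑ a, ∑ b, g a b • (pFib a * pFib b)) =
      ∑ m, ∑ n, (∑ a, ∑ b, g a b * (u m a * u n b)) • (pFib m * pFib n : FibAlg d r) := by
  rw [← sum₂_smul_sum₂_smul]
  simp only [map_sum, map_smul, map_mul, subst_pFib, Finset.sum_mul_sum, smul_mul_smul_comm]

lemma subst_sum_qm {n : ℕ} (w : (Fin n → Fin r) → ℝ) :
    subst u t J B (∑ l, w l • qm l) =
      ∑ l, (∑ l', w l' * ∏ i, t (l' i) (l i)) • (qm l : FibAlg d r) := by
  rw [← sum_smul_sum_smul]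
  simp only [map_sum, map_smul, subst_qm]

lemma subst_sum_p {n : ℕ} (g : Fin r → (Fin n → Fin r) → ℝ) :
    subst u t J B (∑ a, ∑ l, g a l • (pFib a * qm l)) =
      ∑ b, ∑ l, (∑ a, ∑ l', g a l' * (u b a * ∏ i, t (l' i) (l i))) •
        (pFib b * qm l : FibAlg d r) := by
  rw [← sum₂_smul_sum₂_smul]
  simp only [map_sum, map_smul, map_mul, subst_pFib, subst_qm, Finset.sum_mul_sum,
    smul_mul_smul_comm]

/-- The inhomogeneous part of `ξ'_i` turns `f₁^i_a ξ_i q^a` into additional terms `p_b q q`; this is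
why `f₃` does not transform as a tensor. -/
lemma subst_sum_xi (g : Fin d → Fin r → ℝ) :
    subst u t J B (∑ i, ∑ l : Fin 1 → Fin r, g i (l 0) • (oddFib (Sum.inl i) * qm l)) =
      ∑ j, ∑ l : Fin 1 → Fin r, (∑ i, ∑ a, g i a * (J i j * t a (l 0))) •
        (oddFib (Sum.inl j) * qm l) +
      ∑ b, ∑ l : Fin 2 → Fin r, (∑ i, ∑ a, g i a * (B i b (l 0) * t a (l 1))) •
        (pFib b * qm l : FibAlg d r) := by
  rw [← sum₂_smul_sum₂_smul, ← sum₂_smul_sum₂_smul, ← Finset.sum_add_distrib, map_sum]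
  refine Finset.sum_congr rfl fun i _ => ?_
  rw [← Finset.sum_add_distrib, sum_fun_one, map_sum]
  refine Finset.sum_congr rfl fun a _ => ?_
  rw [map_smul, ← smul_add, map_mul, subst_xi, qm_one, subst_q, add_mul]
  congr 2
  · simp only [Finset.sum_mul_sum, smul_mul_smul_comm, sum_fun_one, qm_one, Matrix.cons_val_zero]
  · rw [Finset.sum_mul]
    refine Finset.sum_congr rfl fun b _ => ?_
    simp only [Finset.sum_mul_sum, smul_mul_smul_comm, sum_cons, sum_fun_zero, qm_succ, qm_zero]
    simp only [mul_one, mul_assoc]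
    rfl

end Substitution

variable {d : ℕ} {M : Type*} [TopologicalSpace M] [ChartedSpace (EuclideanSpace ℝ (Fin d)) M]
variable {F : Type*} [NormedAddCommGroup F] [NormedSpace ℝ F]
variable {E : M → Type*} [TopologicalSpace (TotalSpace F E)] [∀ x, TopologicalSpace (E x)]
  [∀ x, AddCommGroup (E x)] [∀ x, Module ℝ (E x)] [FiberBundle F E]

namespace NatChart

/-- The matrix of the change of frame: `e_b = ∑ a, c.tm c' x a b e'_a`. -/
def tm (c c' : NatChart (d := d) F E) (x : M) (a b : Fin (finrank ℝ F)) : ℝ :=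
  c'.isFrame.coeff a x (c.frame b x)

/-- The Jacobian matrix `∂x^j/∂x'^i` of the change of coordinates. -/
def jac (c c' : NatChart (d := d) F E) (x : M) (i j : Fin d) : ℝ := c.vcoord x j (c'.cvec x i)

/-- The coefficient of `p_b q^k` in `ξ'_i`. -/
def xiShift (c c' : NatChart (d := d) F E) (x : M) (i : Fin d) (b k : Fin (finrank ℝ F)) : ℝ :=
  ∑ a, c'.D i (fun y => c'.tm c y b a) x * c.tm c' x a k

lemma transition_eq_subst (c c' : NatChart (d := d) F E) {x : M} (hx : x ∈ c.dom)
    (hx' : x ∈ c'.dom) :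
    c.transition c' x = subst (c'.tm c x) (c.tm c' x) (c.jac c' x) (c.xiShift c' x) :=
  c.transition_eq c' hx hx'

end NatChart

namespace StrFun

variable {c c' : NatChart (d := d) F E}

lemma eval_theta2 (f : StrFun c) (x : c.dom) : c.eval x f.theta2 =
    ∑ a, ∑ b, (1 / 2 * f.f₂ a b x) • (pFib a * pFib b : FibAlg d (finrank ℝ F)) := by
  rw [theta2_eq, NatChart.ppForm]
  simp only [map_sum, NatChart.eval_tmul]
  rfl

lemma eval_theta13 (f : StrFun c) (x : c.dom) : c.eval x f.theta13 =
    ∑ i, ∑ l : Fin 1 → Fin (finrank ℝ F), f.f₁ i (l 0) x • (oddFib (Sum.inl i) * qm l) +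
      ∑ a, ∑ l, (1 / 2 * f.F3 a l x) • (pFib a * qm l : FibAlg d (finrank ℝ F)) := by
  rw [theta13_eq, map_add, NatChart.xiForm, NatChart.pForm, c.eval_gForm, c.eval_gForm]
  rfl

lemma eval_theta4 (f : StrFun c) (x : c.dom) : c.eval x f.theta4 =
    ∑ l, (1 / 24 * f.F4 l x) • (qm l : FibAlg d (finrank ℝ F)) := by
  rw [theta4_eq, c.eval_qForm]
  rfl

lemma F4_apply_skew (f : StrFun c) (x : c.dom) : IsSkew fun l => f.F4 l x := fun l σ =>
  congrArg (c.evalCoeff x) (f.F4_skew l σ)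

variable (f : StrFun c) (f' : StrFun c') {x : M} (hx : x ∈ c.dom) (hx' : x ∈ c'.dom)

theorem transition_theta2_iff :
    c.transition c' x (c'.eval ⟨x, hx'⟩ f'.theta2) = c.eval ⟨x, hx⟩ f.theta2 ↔
      ∀ m n, f.f₂ m n ⟨x, hx⟩ =
        ∑ a, ∑ b, f'.f₂ a b ⟨x, hx'⟩ * (c'.tm c x m a * c'.tm c x n b) := by
  have hs : ∀ m n, ∑ a, ∑ b, 1 / 2 * f'.f₂ a b ⟨x, hx'⟩ * (c'.tm c x m a * c'.tm c x n b) =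
      1 / 2 * ∑ a, ∑ b, f'.f₂ a b ⟨x, hx'⟩ * (c'.tm c x m a * c'.tm c x n b) := fun m n => by
    simp only [Finset.mul_sum, mul_assoc]
  have hs' : ∀ m n, ∑ a, ∑ b, f'.f₂ a b ⟨x, hx'⟩ * (c'.tm c x m a * c'.tm c x n b) =
      ∑ a, ∑ b, f'.f₂ a b ⟨x, hx'⟩ * (c'.tm c x n a * c'.tm c x m b) := fun m n => by
    rw [Finset.sum_comm]
    refine Finset.sum_congr rfl fun a _ => Finset.sum_congr rfl fun b _ => ?_
    rw [f'.f₂_symm, mul_comm (c'.tm c x m b)]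
  rw [c.transition_eq_subst c' hx hx', eval_theta2, eval_theta2, subst_sum_pp, eq_comm,
    ← sub_eq_zero]
  simp only [← Finset.sum_sub_distrib, ← sub_smul]
  rw [sum_pp_eq_zero_iff]
  refine forall₂_congr fun m n => ?_
  rw [hs, hs, hs' n m, f.f₂_symm n m]
  constructor <;> intro h <;> linarith

theorem transition_theta4_iff :
    c.transition c' x (c'.eval ⟨x, hx'⟩ f'.theta4) = c.eval ⟨x, hx⟩ f.theta4 ↔
      ∀ l, f.F4 l ⟨x, hx⟩ = ∑ l', f'.F4 l' ⟨x, hx'⟩ * ∏ i, c.tm c' x (l' i) (l i) := by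
  rw [c.transition_eq_subst c' hx hx', eval_theta4, eval_theta4, subst_sum_qm, eq_comm,
    ← sub_eq_zero]
  simp only [← Finset.sum_sub_distrib, ← sub_smul]
  have h1 := f.F4_apply_skew ⟨x, hx⟩
  have h2 := isSkew_sum_prod (f'.F4_apply_skew ⟨x, hx'⟩) (c.tm c' x)
  have h3 : IsSkew fun l => 1 / 24 * f.F4 l ⟨x, hx⟩ -
      ∑ l', 1 / 24 * f'.F4 l' ⟨x, hx'⟩ * ∏ i, c.tm c' x (l' i) (l i) := by
    intro l σ
    have h4 := h1 l σ
    have h5 := h2 l σ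
    simp only [smul_eq_mul] at h4 h5 ⊢
    simp only [mul_assoc, ← Finset.mul_sum]
    rw [h4, h5]
    ring
  rw [sum_smul_qm_eq_zero_iff]
  refine forall_congr' fun l => ?_
  rw [h3.altSum, smul_eq_zero_iff_right (Nat.cast_ne_zero.mpr (Nat.factorial_ne_zero _))]
  simp only [mul_assoc, ← Finset.mul_sum]
  constructor <;> intro h <;> linarith

/-- The `ξ q` coefficients are compared directly. The `p q q` coefficients count only up to
antisymmetrisation, so the shift term enters skewed in `k` and `m`. -/
theorem transition_theta13_iff :
    c.transition c' x (c'.eval ⟨x, hx'⟩ f'.theta13) = c.eval ⟨x, hx⟩ f.theta13 ↔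
      (∀ j m, f.f₁ j m ⟨x, hx⟩ =
        ∑ i, ∑ a, f'.f₁ i a ⟨x, hx'⟩ * (c.jac c' x i j * c.tm c' x a m)) ∧
      ∀ b k m, f.f₃ b k m ⟨x, hx⟩ =
        ∑ i, ∑ a, f'.f₁ i a ⟨x, hx'⟩ * (c.xiShift c' x i b k * c.tm c' x a m) -
        ∑ i, ∑ a, f'.f₁ i a ⟨x, hx'⟩ * (c.xiShift c' x i b m * c.tm c' x a k) +
        ∑ n, ∑ k', ∑ m', f'.f₃ n k' m' ⟨x, hx'⟩ *
          (c'.tm c x b n * (c.tm c' x k' k * c.tm c' x m' m)) := by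
  rw [c.transition_eq_subst c' hx hx', eval_theta13, eval_theta13, map_add, subst_sum_p,
    subst_sum_xi _ _ _ _ (fun i a => f'.f₁ i a ⟨x, hx'⟩), eq_comm, ← sub_eq_zero, add_assoc,
    add_sub_add_comm]
  simp only [← Finset.sum_sub_distrib, ← Finset.sum_add_distrib, ← sub_smul, ← add_smul]
  rw [sum_xi_add_sum_p_eq_zero_iff]
  refine and_congr ?_ (forall_congr' fun b => ?_)
  · refine forall_congr' fun j => ⟨fun h m => ?_, fun h l => ?_⟩
    · have h1 := h ![m]
      rw [altSum, Fintype.sum_unique, Subsingleton.elim (default : Equiv.Perm (Fin 1)) 1] at h1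
      simpa [sub_eq_zero] using h1
    · rw [altSum, Fintype.sum_unique, Subsingleton.elim (default : Equiv.Perm (Fin 1)) 1]
      simp [h]
  · have hs : ∀ k m, ∑ a, ∑ l', 1 / 2 * f'.F3 a l' ⟨x, hx'⟩ *
          (c'.tm c x b a * ∏ i, c.tm c' x (l' i) ((![k, m] : Fin 2 → _) i)) =
        1 / 2 * ∑ n, ∑ k', ∑ m', f'.f₃ n k' m' ⟨x, hx'⟩ *
          (c'.tm c x b n * (c.tm c' x k' k * c.tm c' x m' m)) := fun k m => by
      simp only [Finset.mul_sum, mul_assoc, sum_cons, sum_fun_zero, Fin.prod_univ_two]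
      rfl
    have hk : ∀ k m, f.f₃ b k m ⟨x, hx⟩ = -f.f₃ b m k ⟨x, hx⟩ := fun k m =>
      congrArg (c.evalCoeff ⟨x, hx⟩) (f.f₃_skew b k m)
    have hk' : ∀ k m, ∑ n, ∑ k', ∑ m', f'.f₃ n k' m' ⟨x, hx'⟩ *
          (c'.tm c x b n * (c.tm c' x k' k * c.tm c' x m' m)) =
        -∑ n, ∑ k', ∑ m', f'.f₃ n k' m' ⟨x, hx'⟩ *
          (c'.tm c x b n * (c.tm c' x k' m * c.tm c' x m' k)) := fun k m => by
      rw [← Finset.sum_neg_distrib]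
      refine Finset.sum_congr rfl fun n _ => ?_
      rw [Finset.sum_comm, ← Finset.sum_neg_distrib]
      refine Finset.sum_congr rfl fun p _ => ?_
      rw [← Finset.sum_neg_distrib]
      refine Finset.sum_congr rfl fun q _ => ?_
      have : f'.f₃ n q p ⟨x, hx'⟩ = -f'.f₃ n p q ⟨x, hx'⟩ :=
        congrArg (c'.evalCoeff ⟨x, hx'⟩) (f'.f₃_skew n q p)
      rw [this]
      ring
    have hF : ∀ k m, f.F3 b ![k, m] = f.f₃ b k m := fun _ _ => rfl
    have h2 : ∀ l : Fin 2 → Fin (finrank ℝ F), l = ![l 0, l 1] := fun l => by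
      funext i; fin_cases i <;> rfl
    refine ⟨fun h k m => ?_, fun h l => ?_⟩
    · have h1 := h ![k, m]
      rw [altSum_two] at h1
      simp only [Matrix.cons_val_zero, Matrix.cons_val_one, hs, hF] at h1
      rw [hk m k, hk' m k] at h1
      simp only [Finset.sum_sub_distrib]
      linarith
    · rw [altSum_two, h2 l]
      simp only [Matrix.cons_val_zero, Matrix.cons_val_one, hs, hF]
      have := h (l 0) (l 1)
      rw [hk (l 1) (l 0), hk' (l 1) (l 0)]
      simp only [Finset.sum_sub_distrib] at this
      linarith

end StrFun

end QP3
end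

/-! ### The transformation of brackets of sections -/

noncomputable section

namespace QP3

/-- Contraction of a product of two matrices with two vectors; it recognises the transformed `f₃`
evaluated on a pair of sections. -/
lemma sum_sum_tensor₂_mul {ι κ μ : Type*} [Fintype ι] [Fintype κ] [Fintype μ] (f : ι → κ → ℝ)
    (S : ι → μ → ℝ) (t : κ → μ → ℝ) (g h : μ → ℝ) :
    ∑ k, ∑ m, (∑ i, ∑ a, f i a * (S i k * t a m)) * g m * h k =
      ∑ i, (∑ a, f i a * ∑ m, t a m * g m) * ∑ k, S i k * h k := by
  have h1 := sum₂_smul_sum₂_smul f (fun i a k m => S i k * t a m) fun k m => g m * h k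
  simp only [smul_eq_mul, ← mul_assoc] at h1 ⊢
  rw [← h1]
  refine Finset.sum_congr rfl fun i _ => ?_
  rw [Finset.sum_mul]
  refine Finset.sum_congr rfl fun a _ => ?_
  rw [mul_assoc, mul_comm (∑ m, t a m * g m), Finset.sum_mul_sum]
  congr 1
  exact Finset.sum_congr rfl fun k _ => Finset.sum_congr rfl fun m _ => by ring

lemma sum_sum_tensor₃_mul {κ μ : Type*} [Fintype κ] [Fintype μ] (f : κ → κ → κ → ℝ)
    (u : κ → ℝ) (t : κ → μ → ℝ) (g h : μ → ℝ) :
    ∑ k, ∑ m, (∑ n, ∑ k', ∑ m', f n k' m' * (u n * (t k' k * t m' m))) * g m * h k =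
      ∑ n, u n * ∑ k', ∑ m', f n k' m' * (∑ m, t m' m * g m) * ∑ k, t k' k * h k := by
  have h1 := sum_smul_sum₂_smul (fun i : κ × κ × κ => f i.1 i.2.1 i.2.2)
    (fun i k m => u i.1 * (t i.2.1 k * t i.2.2 m)) fun k m => g m * h k
  simp only [Fintype.sum_prod_type, smul_eq_mul] at h1
  simp only [← mul_assoc] at h1 ⊢
  rw [← h1]
  refine Finset.sum_congr rfl fun n _ => ?_
  rw [Finset.mul_sum]
  refine Finset.sum_congr rfl fun k' _ => ?_
  rw [Finset.mul_sum]
  refine Finset.sum_congr rfl fun m' _ => ?_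
  rw [mul_assoc (f n k' m'), mul_comm (∑ m, t m' m * g m), Finset.sum_mul_sum, mul_left_comm]
  congr 1
  rw [Finset.mul_sum]
  refine Finset.sum_congr rfl fun k _ => ?_
  rw [Finset.mul_sum]
  exact Finset.sum_congr rfl fun m _ => by ring

variable {d : ℕ} {M : Type*} [TopologicalSpace M] [ChartedSpace (EuclideanSpace ℝ (Fin d)) M]
variable {F : Type*} [NormedAddCommGroup F] [NormedSpace ℝ F]
variable {E : M → Type*} [TopologicalSpace (TotalSpace F E)] [∀ x, TopologicalSpace (E x)]
  [∀ x, AddCommGroup (E x)] [∀ x, Module ℝ (E x)] [FiberBundle F E]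

namespace NatChart

variable (c c' : NatChart (d := d) F E)

lemma coeff_eq_sum_tm {x : M} (hx : x ∈ c.chart.source) (a : Fin (finrank ℝ F)) (v : E x) :
    c'.isFrame.coeff a x v = ∑ m, c.tm c' x a m * c.isFrame.coeff m x v := by
  conv_lhs => rw [← c.sum_coeff_smul hx v, map_sum]
  exact Finset.sum_congr rfl fun m _ => by rw [map_smul, smul_eq_mul, mul_comm]; rfl

lemma sum_jac_mul_vcoord {x : M} (hx' : x ∈ c'.chart.source) (j : Fin d)
    (v : TangentSpace (𝓡 d) x) :
    c.vcoord x j v = ∑ i, c'.vcoord x i v * c.jac c' x i j := by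
  conv_lhs => rw [← c'.sum_vcoord_smul hx' v, map_sum]
  exact Finset.sum_congr rfl fun m _ => by rw [map_smul, smul_eq_mul]; rfl

lemma D_sum {ι : Type*} (s : Finset ι) {x : M} (hx : x ∈ c.chart.source) {g : ι → M → ℝ}
    (hg : ∀ k ∈ s, MDifferentiableAt (𝓡 d) 𝓘(ℝ, ℝ) (g k) x) (i : Fin d) :
    c.D i (fun y => ∑ k ∈ s, g k y) x = ∑ k ∈ s, c.D i (g k) x := by
  have e : (fun y => ∑ k ∈ s, g k y) ∘ c.chart.symm = fun y => ∑ k ∈ s, (g k ∘ c.chart.symm) y :=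
    rfl
  rw [D, e, fderiv_fun_sum fun k hk => c.differentiableAt_comp_symm hx (hg k hk)]
  simp only [D, sum_apply]

variable [VectorBundle ℝ F E] [FiniteDimensional ℝ F] [ContMDiffVectorBundle ∞ F E (𝓡 d)]

lemma mdifferentiableAt_tm {x : M} (hx : x ∈ c.chart.source) (hx' : x ∈ c'.chart.source)
    (a b : Fin (finrank ℝ F)) :
    MDifferentiableAt (𝓡 d) 𝓘(ℝ, ℝ) (fun y => c.tm c' y a b) x := by
  refine (((c'.coeff_contMDiffOn c.chart.open_source (c.isFrame.contMDiffOn b) a).contMDiffAt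
    ((c'.chart.open_source.inter c.chart.open_source).mem_nhds ⟨hx', hx⟩))).mdifferentiableAt
    (by simp)

/-- In `e^b = u^b_n e'^n` the derivative of `u` produces the same coefficients `xiShift` as the
transformation of `ξ'_i`. This coincidence makes the derived bracket independent of the coordinates.
-/
lemma D_ext_sec (e : Cₛ^∞⟮𝓡 d; F, E⟯) {x : M} (hx : x ∈ c.dom) (hx' : x ∈ c'.dom) (i : Fin d)
    (b : Fin (finrank ℝ F)) : c'.D i (ext (c.sec e b)) x =
      ∑ k, c.xiShift c' x i b k * c.sec e k ⟨x, hx⟩ +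
        ∑ n, c'.tm c x b n * c'.D i (ext (c'.sec e n)) x := by
  have h1 : ext (c.sec e b) =ᶠ[nhds x]
      fun y => ∑ n, c'.tm c y b n * ext (c'.sec e n) y := by
    filter_upwards [c.chart.open_source.mem_nhds hx, c'.chart.open_source.mem_nhds hx'] with y hy hy'
    refine (ext_apply _ ⟨y, hy⟩).trans ((c'.coeff_eq_sum_tm c hy' b (e y)).trans ?_)
    exact Finset.sum_congr rfl fun n _ => congrArg _ (ext_apply (c'.sec e n) ⟨y, hy'⟩).symm
  have h2 : ∀ n, MDifferentiableAt (𝓡 d) 𝓘(ℝ, ℝ) (fun y => c'.tm c y b n) x := fun n =>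
    c'.mdifferentiableAt_tm c hx' hx b n
  have h3 : ∀ n, MDifferentiableAt (𝓡 d) 𝓘(ℝ, ℝ) (ext (c'.sec e n)) x := fun n =>
    c'.mdifferentiableAt_ext _ ⟨x, hx'⟩
  rw [c'.D_congr hx' h1, c'.D_sum _ hx' (g := fun n y => c'.tm c y b n * ext (c'.sec e n) y)
    fun n _ => (h2 n).mul (h3 n)]
  simp only [c'.D_mul hx' (h2 _) (h3 _), Finset.sum_add_distrib]
  congr 1
  have h4 : ∀ n, ext (c'.sec e n) x = ∑ k, c.tm c' x n k * c.sec e k ⟨x, hx⟩ := fun n =>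
    (ext_apply (c'.sec e n) ⟨x, hx'⟩).trans (c.coeff_eq_sum_tm c' hx n (e x))
  simp only [h4, xiShift, Finset.mul_sum, Finset.sum_mul, mul_assoc]
  exact Finset.sum_comm

end NatChart

namespace StrFun

variable {c c' : NatChart (d := d) F E}

/-- The transformed `f₃`, at a point. -/
def f₃Trans (c : NatChart (d := d) F E) {c' : NatChart (d := d) F E} (f' : StrFun c') {x : M}
    (hx' : x ∈ c'.dom) (b k m : Fin (finrank ℝ F)) : ℝ :=
  ∑ i, ∑ a, f'.f₁ i a ⟨x, hx'⟩ * (c.xiShift c' x i b k * c.tm c' x a m) -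
    ∑ i, ∑ a, f'.f₁ i a ⟨x, hx'⟩ * (c.xiShift c' x i b m * c.tm c' x a k) +
    ∑ n, ∑ k', ∑ m', f'.f₃ n k' m' ⟨x, hx'⟩ *
      (c'.tm c x b n * (c.tm c' x k' k * c.tm c' x m' m))

/-- The structure functions `f` and `f'` are related at `x` by the change of coordinates. -/
structure Agree (f : StrFun c) (f' : StrFun c') {x : M} (hx : x ∈ c.dom) (hx' : x ∈ c'.dom) :
    Prop where
  f₁ : ∀ j m, f.f₁ j m ⟨x, hx⟩ =
    ∑ i, ∑ a, f'.f₁ i a ⟨x, hx'⟩ * (c.jac c' x i j * c.tm c' x a m)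
  f₂ : ∀ m n, f.f₂ m n ⟨x, hx⟩ =
    ∑ a, ∑ b, f'.f₂ a b ⟨x, hx'⟩ * (c'.tm c x m a * c'.tm c x n b)
  f₃ : ∀ b k m, f.f₃ b k m ⟨x, hx⟩ = f₃Trans c f' hx' b k m
  F4 : ∀ l, f.F4 l ⟨x, hx⟩ = ∑ l', f'.F4 l' ⟨x, hx'⟩ * ∏ i, c.tm c' x (l' i) (l i)

variable [IsManifold (𝓡 d) ∞ M]

variable {f : StrFun c} {f' : StrFun c'} {x : M} {hx : x ∈ c.dom} {hx' : x ∈ c'.dom}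

/-- Both sides apply the same tangent vector to `u`: the Jacobian in the law of `f₁` is absorbed by
the chain rule, the frame matrix by the coefficients of `v`. -/
lemma sum_f₁_mul_D_eq (h : ∀ j m, f.f₁ j m ⟨x, hx⟩ =
      ∑ i, ∑ a, f'.f₁ i a ⟨x, hx'⟩ * (c.jac c' x i j * c.tm c' x a m)) (v : E x) {u : M → ℝ}
    (hu : MDifferentiableAt (𝓡 d) 𝓘(ℝ, ℝ) u x) :
    ∑ j, (∑ m, f.f₁ j m ⟨x, hx⟩ * c.isFrame.coeff m x v) * c.D j u x =
      ∑ i, (∑ a, f'.f₁ i a ⟨x, hx'⟩ * c'.isFrame.coeff a x v) * c'.D i u x := by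
  have h1 : ∀ i, c'.D i u x = ∑ j, c.jac c' x i j * c.D j u x := fun i =>
    c.D_eq_sum_D c' hx hx' hu i
  simp only [h1, c.coeff_eq_sum_tm c' hx _ v, h]
  simp only [Finset.mul_sum, Finset.sum_mul]
  rw [Finset.sum_congr rfl fun j _ => Finset.sum_comm]
  rw [Finset.sum_comm]
  refine Finset.sum_congr rfl fun i _ => Finset.sum_congr rfl fun j _ => ?_
  rw [Finset.sum_comm]
  exact Finset.sum_congr rfl fun a _ => Finset.sum_congr rfl fun m _ => by ring

variable [VectorBundle ℝ F E] [FiniteDimensional ℝ F] [ContMDiffVectorBundle ∞ F E (𝓡 d)]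

lemma act_sec_apply_eq (h : ∀ j m, f.f₁ j m ⟨x, hx⟩ =
      ∑ i, ∑ a, f'.f₁ i a ⟨x, hx'⟩ * (c.jac c' x i j * c.tm c' x a m)) (e : Cₛ^∞⟮𝓡 d; F, E⟯)
    (u : c.Coeff) : f.act (c.sec e) u ⟨x, hx⟩ =
      -∑ i, (∑ a, f'.f₁ i a ⟨x, hx'⟩ * c'.sec e a ⟨x, hx'⟩) * c'.D i (NatChart.ext u) x := by
  rw [act_apply]
  exact congrArg Neg.neg (sum_f₁_mul_D_eq h (e x) (c.mdifferentiableAt_ext u ⟨x, hx⟩))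

/-- The defect of the transformation law of the bracket. -/
lemma brk_sub_sum_brk (h : ∀ j m, f.f₁ j m ⟨x, hx⟩ =
      ∑ i, ∑ a, f'.f₁ i a ⟨x, hx'⟩ * (c.jac c' x i j * c.tm c' x a m)) (e₁ e₂ : Cₛ^∞⟮𝓡 d; F, E⟯)
    (b : Fin (finrank ℝ F)) :
    f.brk (c.sec e₁) (c.sec e₂) b ⟨x, hx⟩ -
      ∑ n, c'.tm c x b n * f'.brk (c'.sec e₁) (c'.sec e₂) n ⟨x, hx'⟩ =
    ∑ k, ∑ m, (f.f₃ b k m ⟨x, hx⟩ - f₃Trans c f' hx' b k m) *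
      c.sec e₁ m ⟨x, hx⟩ * c.sec e₂ k ⟨x, hx⟩ := by
  have h4 : ∀ e : Cₛ^∞⟮𝓡 d; F, E⟯, ∀ n,
      ∑ k, c.tm c' x n k * c.sec e k ⟨x, hx⟩ = c'.sec e n ⟨x, hx'⟩ := fun e n =>
    (c.coeff_eq_sum_tm c' hx n (e x)).symm
  -- By `D_ext_sec` each anchor term of the bracket splits into a shift term without derivatives of
  -- `e'` and a term that transforms like a section.
  have h5 : ∀ e e' : Cₛ^∞⟮𝓡 d; F, E⟯, f.act (c.sec e) (c.sec e' b) ⟨x, hx⟩ =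
      -∑ i, (∑ a, f'.f₁ i a ⟨x, hx'⟩ * c'.sec e a ⟨x, hx'⟩) *
          ∑ k, c.xiShift c' x i b k * c.sec e' k ⟨x, hx⟩ +
        ∑ n, c'.tm c x b n * f'.act (c'.sec e) (c'.sec e' n) ⟨x, hx'⟩ := by
    intro e e'
    rw [act_sec_apply_eq h]
    simp only [c.D_ext_sec c' e' hx hx', act_apply, NatChart.pd_apply, mul_add,
      Finset.sum_add_distrib, neg_add, mul_neg, Finset.sum_neg_distrib]
    congr 2
    simp only [Finset.mul_sum]
    rw [Finset.sum_comm]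
    exact Finset.sum_congr rfl fun n _ => Finset.sum_congr rfl fun i _ => by ring
  have h6 := sum_sum_tensor₂_mul (fun i a => f'.f₁ i a ⟨x, hx'⟩)
    (fun i k => c.xiShift c' x i b k) (c.tm c' x) (fun m => c.sec e₁ m ⟨x, hx⟩)
    (fun m => c.sec e₂ m ⟨x, hx⟩)
  have h7 := sum_sum_tensor₂_mul (fun i a => f'.f₁ i a ⟨x, hx'⟩)
    (fun i k => c.xiShift c' x i b k) (c.tm c' x) (fun m => c.sec e₂ m ⟨x, hx⟩)
    (fun m => c.sec e₁ m ⟨x, hx⟩)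
  have h8 := sum_sum_tensor₃_mul (fun n k' m' => f'.f₃ n k' m' ⟨x, hx'⟩)
    (fun n => c'.tm c x b n) (c.tm c' x) (fun m => c.sec e₁ m ⟨x, hx⟩)
    (fun m => c.sec e₂ m ⟨x, hx⟩)
  rw [Finset.sum_comm] at h7
  simp only [h4] at h6 h7 h8
  have h9 : ∀ k m, (f.f₃ b k m ⟨x, hx⟩ - f₃Trans c f' hx' b k m) *
      c.sec e₁ m ⟨x, hx⟩ * c.sec e₂ k ⟨x, hx⟩ =
      f.f₃ b k m ⟨x, hx⟩ * c.sec e₁ m ⟨x, hx⟩ * c.sec e₂ k ⟨x, hx⟩ -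
      (∑ i, ∑ a, f'.f₁ i a ⟨x, hx'⟩ * (c.xiShift c' x i b k * c.tm c' x a m)) *
        c.sec e₁ m ⟨x, hx⟩ * c.sec e₂ k ⟨x, hx⟩ +
      (∑ i, ∑ a, f'.f₁ i a ⟨x, hx'⟩ * (c.xiShift c' x i b m * c.tm c' x a k)) *
        c.sec e₂ k ⟨x, hx⟩ * c.sec e₁ m ⟨x, hx⟩ -
      (∑ n, ∑ k', ∑ m', f'.f₃ n k' m' ⟨x, hx'⟩ *
        (c'.tm c x b n * (c.tm c' x k' k * c.tm c' x m' m))) *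
        c.sec e₁ m ⟨x, hx⟩ * c.sec e₂ k ⟨x, hx⟩ := by
    intro k m
    rw [f₃Trans]
    ring
  simp only [h9, Finset.sum_add_distrib, Finset.sum_sub_distrib, h6, h7, h8]
  simp only [brk_apply, h5, mul_add, mul_sub, Finset.sum_add_distrib, Finset.sum_sub_distrib]
  ring

end StrFun

end QP3
end

noncomputable section

namespace QP3

variable {d : ℕ} {M : Type*} [TopologicalSpace M] [ChartedSpace (EuclideanSpace ℝ (Fin d)) M]
variable {F : Type*} [NormedAddCommGroup F] [NormedSpace ℝ F]
variable {E : M → Type*} [TopologicalSpace (TotalSpace F E)] [∀ x, TopologicalSpace (E x)]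
  [∀ x, AddCommGroup (E x)] [∀ x, Module ℝ (E x)] [FiberBundle F E]

/-! ### Smooth vector fields in coordinates -/

namespace NatChart

variable (c : NatChart (d := d) F E) [IsManifold (𝓡 d) ∞ M]

/-- The components are the fibre part of the tangent map of the chart applied to `X`, and this
tangent map is smooth. -/
lemma contMDiffOn_vcoord {U : Set M} {X : ∀ x : M, TangentSpace (𝓡 d) x}
    (hX : SmoothSecOn (d := d) (EuclideanSpace ℝ (Fin d)) (fun x : M => TangentSpace (𝓡 d) x) X U)
    (i : Fin d) :
    ContMDiffOn (𝓡 d) 𝓘(ℝ, ℝ) ∞ (fun x => c.vcoord x i (X x)) (c.chart.source ∩ U) := by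
  have h1 := (contMDiffOn_of_mem_maximalAtlas c.mem_atlas).contMDiffOn_tangentMapWithin
    (m := ∞) (by simp) c.chart.open_source.uniqueMDiffOn
  have h2 : ContMDiffOn (𝓡 d) (𝓡 d).tangent ∞ (fun x => TotalSpace.mk' (EuclideanSpace ℝ (Fin d)) x
    (X x) : M → TangentBundle (𝓡 d) M) (c.chart.source ∩ U) := ContMDiffOn.mono hX Set.inter_subset_right
  have h3 := h1.comp h2 fun x hx => hx.1
  have h4 := (contMDiff_snd_tangentBundle_modelSpace (n := ∞) (EuclideanSpace ℝ (Fin d))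
    (𝓡 d)).comp_contMDiffOn h3
  have h5 := (EuclideanSpace.proj i : EuclideanSpace ℝ (Fin d) →L[ℝ] ℝ).contMDiff.comp_contMDiffOn
    (n := ∞) h4
  refine h5.congr fun x hx => ?_
  change _ = (EuclideanSpace.proj i : EuclideanSpace ℝ (Fin d) →L[ℝ] ℝ)
    (mfderivWithin (𝓡 d) (𝓡 d) c.chart c.chart.source x (X x))
  rw [mfderivWithin_of_isOpen c.chart.open_source hx.1]
  rfl

lemma contMDiffOn_cvec (i : Fin d) : SmoothSecOn (d := d) (EuclideanSpace ℝ (Fin d))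
    (fun x : M => TangentSpace (𝓡 d) x) (fun x => c.cvec x i) c.chart.source := by
  have h1 := (contMDiffOn_symm_of_mem_maximalAtlas c.mem_atlas).contMDiffOn_tangentMapWithin
    (m := ∞) (by simp) c.chart.open_target.uniqueMDiffOn
  have h2 : ContMDiff (𝓡 d) (𝓡 d).tangent ∞ (fun z : EuclideanSpace ℝ (Fin d) =>
      (TotalSpace.mk' (EuclideanSpace ℝ (Fin d)) z (stdVec i) :
        TangentBundle (𝓡 d) (EuclideanSpace ℝ (Fin d)))) :=
    contMDiff_vectorSpace_iff_contDiff.mpr contDiff_const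
  have h3 := h1.comp (h2.comp_contMDiffOn (contMDiffOn_of_mem_maximalAtlas c.mem_atlas))
    fun x hx => c.chart.map_source hx
  refine ContMDiffOn.congr h3 fun x hx => ?_
  -- The base point `c.chart.symm (c.chart x)` equals `x` only propositionally; the vector is
  -- transported along that equation.
  have h4 : ∀ y, y = x → ∀ v : EuclideanSpace ℝ (Fin d),
      (TotalSpace.mk' (EuclideanSpace ℝ (Fin d)) y v : TangentBundle (𝓡 d) M) =
        TotalSpace.mk' (EuclideanSpace ℝ (Fin d)) x v := by
    rintro y rfl v
    rfl
  change _ = (TotalSpace.mk' (EuclideanSpace ℝ (Fin d)) (c.chart.symm (c.chart x))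
    (mfderivWithin (𝓡 d) (𝓡 d) c.chart.symm c.chart.target (c.chart x) (stdVec i)) :
      TangentBundle (𝓡 d) M)
  rw [mfderivWithin_of_isOpen c.chart.open_target (c.chart.map_source hx)]
  exact (h4 _ (c.chart.left_inv hx) _).symm

lemma contMDiffOn_sum_smul_cvec {U : Set M} {g : Fin d → M → ℝ}
    (hg : ∀ i, ContMDiffOn (𝓡 d) 𝓘(ℝ, ℝ) ∞ (g i) (c.chart.source ∩ U)) :
    SmoothSecOn (d := d) (EuclideanSpace ℝ (Fin d)) (fun x : M => TangentSpace (𝓡 d) x)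
      (fun x => ∑ i, g i x • c.cvec x i) (c.chart.source ∩ U) :=
  ContMDiffOn.sum_section fun i _ => (hg i).smul_section
    (ContMDiffOn.mono (c.contMDiffOn_cvec i) Set.inter_subset_left)

end NatChart

section

variable [VectorBundle ℝ F E]

/-- A section is smooth if its components in all coordinates are. -/
lemma contMDiff_of_coeff {s : ∀ x, E x}
    (h : ∀ x, ∃ c : NatChart (d := d) F E, x ∈ c.dom ∧ ∃ g : Fin (finrank ℝ F) → c.Coeff,
      ∀ y : c.dom, s y = ∑ a, g a y • c.frame a y) :
    ContMDiff (𝓡 d) ((𝓡 d).prod 𝓘(ℝ, F)) ∞ fun x => TotalSpace.mk' F x (s x) := by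
  intro x
  obtain ⟨c, hx, g, hg⟩ := h x
  have h1 : SmoothSecOn (d := d) F E (fun y => ∑ a, NatChart.ext (g a) y • c.frame a y)
      c.chart.source := ContMDiffOn.sum_section fun a _ =>
    (NatChart.ext_contMDiffOn (g a)).smul_section (c.isFrame.contMDiffOn a)
  refine (ContMDiffOn.congr h1 fun y hy => ?_).contMDiffAt (c.chart.open_source.mem_nhds hx)
  rw [hg ⟨y, hy⟩]
  congr 1
  exact Finset.sum_congr rfl fun a _ => by rw [← NatChart.ext_apply]

end

namespace Operations.Rep

variable [IsManifold (𝓡 d) ∞ M] [VectorBundle ℝ F E] [FiniteDimensional ℝ F]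
  [ContMDiffVectorBundle ∞ F E (𝓡 d)] [T2Space M] [SigmaCompactSpace M]
  {D : Operations (d := d) F E} {c c' : NatChart (d := d) F E} {f : StrFun c} {f' : StrFun c'}

/-- `f₁`, `f₂`, `f₄` are components of the tensors `ρ`, `∂`, `Ω`, so their laws are linear algebra.
For `f₃` the defect formula `brk_sub_sum_brk` is evaluated on sections with basis values at `x`. -/
theorem agree (h : D.Rep f) (h' : D.Rep f') {x : M} (hx : x ∈ c.dom) (hx' : x ∈ c'.dom) :
    StrFun.Agree f f' hx hx' := by
  have h₁ : ∀ j m, f.f₁ j m ⟨x, hx⟩ =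
      ∑ i, ∑ a, f'.f₁ i a ⟨x, hx'⟩ * (c.jac c' x i j * c.tm c' x a m) := by
    intro j m
    have h1 := h.anchor ⟨x, hx⟩ j m
    rw [c.sum_jac_mul_vcoord c' hx' j] at h1
    simp only [h'.vcoord_anchor ⟨x, hx'⟩, neg_mul, Finset.sum_neg_distrib, neg_inj] at h1
    rw [← h1]
    refine Finset.sum_congr rfl fun i _ => ?_
    rw [Finset.sum_mul]
    exact Finset.sum_congr rfl fun a _ => by rw [NatChart.tm]; ring
  refine ⟨h₁, fun m n => ?_, fun b k m => ?_, fun l => ?_⟩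
  · rw [← h.del ⟨x, hx⟩ m n, c'.coeff_eq_sum_tm c hx']
    simp only [h'.coeff_del ⟨x, hx'⟩, Finset.mul_sum]
    rw [Finset.sum_comm]
    refine Finset.sum_congr rfl fun a _ => Finset.sum_congr rfl fun b _ => ?_
    rw [NatChart.tm, NatChart.tm]
    ring
  · obtain ⟨e₁, h1, -⟩ := c.exists_sec_apply ⟨x, hx⟩ fun a => if a = m then 1 else 0
    obtain ⟨e₂, h2, -⟩ := c.exists_sec_apply ⟨x, hx⟩ fun a => if a = k then 1 else 0
    have h3 := StrFun.brk_sub_sum_brk (f := f) (f' := f') h₁ e₁ e₂ b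
    simp only [← h.brk, ← h'.brk, h1, h2] at h3
    rw [sum_sum_mul_single (fun k m => f.f₃ b k m ⟨x, hx⟩ - StrFun.f₃Trans c f' hx' b k m)] at h3
    have h4 : c.sec (D.brk e₁ e₂) b ⟨x, hx⟩ =
        ∑ n, c'.tm c x b n * c'.sec (D.brk e₁ e₂) n ⟨x, hx'⟩ :=
      c'.coeff_eq_sum_tm c hx' b _
    rw [h4, sub_self] at h3
    exact (sub_eq_zero.mp h3.symm)
  · rw [← h.Om ⟨x, hx⟩ l, h'.Om_apply ⟨x, hx'⟩]
    rfl

end Operations.Rep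

/-! ### Operations from structure functions -/

namespace StrFun

section

variable {c : NatChart (d := d) F E} [IsManifold (𝓡 d) ∞ M] (f : StrFun c)

lemma act_add_left (g g' : Fin (finrank ℝ F) → c.Coeff) (u : c.Coeff) :
    f.act (g + g') u = f.act g u + f.act g' u := by
  simp only [act, Pi.add_apply, mul_add, Finset.sum_add_distrib, add_mul, neg_add]

lemma act_smul_left (k : ℝ) (g : Fin (finrank ℝ F) → c.Coeff) (u : c.Coeff) :
    f.act (k • g) u = k • f.act g u := by
  simp only [act, Pi.smul_apply, mul_smul_comm, ← Finset.smul_sum, smul_mul_assoc, smul_neg]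

lemma act_add_right (g : Fin (finrank ℝ F) → c.Coeff) (u v : c.Coeff) :
    f.act g (u + v) = f.act g u + f.act g v := by
  simp only [act, map_add, mul_add, Finset.sum_add_distrib, neg_add]

lemma act_smul_right (k : ℝ) (g : Fin (finrank ℝ F) → c.Coeff) (u : c.Coeff) :
    f.act g (k • u) = k • f.act g u := by
  simp only [act, map_smul, mul_smul_comm, ← Finset.smul_sum, smul_neg]

lemma brk_skew (g h : Fin (finrank ℝ F) → c.Coeff) : f.brk g h = -f.brk h g := by
  funext b
  have h1 : ∑ m, ∑ a, f.f₃ b m a * g a * h m = -∑ m, ∑ a, f.f₃ b m a * h a * g m := by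
    rw [Finset.sum_comm, ← Finset.sum_neg_distrib]
    refine Finset.sum_congr rfl fun a _ => ?_
    rw [← Finset.sum_neg_distrib]
    refine Finset.sum_congr rfl fun m _ => ?_
    rw [f.f₃_skew b m a]
    ring
  simp only [brk, Pi.neg_apply, h1]
  ring

lemma brk_add_right (g h h' : Fin (finrank ℝ F) → c.Coeff) :
    f.brk g (h + h') = f.brk g h + f.brk g h' := by
  funext b
  simp only [brk, Pi.add_apply, act_add_left, act_add_right, mul_add, Finset.sum_add_distrib]
  ring

lemma brk_smul_right (k : ℝ) (g h : Fin (finrank ℝ F) → c.Coeff) :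
    f.brk g (k • h) = k • f.brk g h := by
  funext b
  simp only [brk, Pi.smul_apply, act_smul_left, act_smul_right, mul_smul_comm, ← Finset.smul_sum,
    ← smul_add, ← smul_sub]

lemma brk_mul_right (g h : Fin (finrank ℝ F) → c.Coeff) (u : c.Coeff) :
    f.brk g (fun a => u * h a) = fun a => u * f.brk g h a + f.act g u * h a := by
  funext b
  have h1 : f.act g (u * h b) = f.act g u * h b + u * f.act g (h b) := by
    simp only [act, c.pd_mul, mul_add, Finset.sum_add_distrib, neg_add, neg_mul, Finset.sum_mul,
      mul_neg, Finset.mul_sum]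
    congr 2 <;> exact Finset.sum_congr rfl fun i _ => Finset.sum_congr rfl fun a _ => by ring
  have h2 : f.act (fun a => u * h a) (g b) = u * f.act h (g b) := by
    simp only [act, mul_neg, Finset.mul_sum, Finset.sum_mul]
    congr 1
    exact Finset.sum_congr rfl fun i _ => Finset.sum_congr rfl fun a _ => by ring
  simp only [brk, h1, h2, mul_add, mul_sub, Finset.mul_sum]
  have h3 : ∑ m, ∑ a, f.f₃ b m a * g a * (u * h m) = ∑ m, ∑ a, u * (f.f₃ b m a * g a * h m) :=
    Finset.sum_congr rfl fun m _ => Finset.sum_congr rfl fun a _ => by ring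
  rw [h3]
  ring

end

end StrFun

end QP3
end

/-! ### Gluing local structure functions to global operations -/

noncomputable section

namespace QP3

variable {d : ℕ} {M : Type*} [TopologicalSpace M] [ChartedSpace (EuclideanSpace ℝ (Fin d)) M]
variable {F : Type*} [NormedAddCommGroup F] [NormedSpace ℝ F]
variable {E : M → Type*} [TopologicalSpace (TotalSpace F E)] [∀ x, TopologicalSpace (E x)]
  [∀ x, AddCommGroup (E x)] [∀ x, Module ℝ (E x)] [FiberBundle F E]

namespace NatChart

variable (c : NatChart (d := d) F E) [VectorBundle ℝ F E] [FiniteDimensional ℝ F]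
  [ContMDiffVectorBundle ∞ F E (𝓡 d)]

lemma sec_add (e e' : Cₛ^∞⟮𝓡 d; F, E⟯) : c.sec (e + e') = c.sec e + c.sec e' := by
  funext a
  ext x
  exact map_add (c.isFrame.coeff a x) (e x) (e' x)

lemma sec_smul (k : ℝ) (e : Cₛ^∞⟮𝓡 d; F, E⟯) : c.sec (k • e) = k • c.sec e := by
  funext a
  ext x
  exact map_smul (c.isFrame.coeff a x) k (e x)

lemma sec_neg (e : Cₛ^∞⟮𝓡 d; F, E⟯) : c.sec (-e) = -c.sec e := by
  funext a
  ext x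
  exact map_neg (c.isFrame.coeff a x) (e x)

lemma sec_smulSec (u : C^∞⟮𝓡 d, M; 𝓘(ℝ, ℝ), ℝ⟯) (e : Cₛ^∞⟮𝓡 d; F, E⟯) :
    c.sec (smulSec u e) = fun a => c.fn u * c.sec e a := by
  funext a
  ext x
  exact map_smul (c.isFrame.coeff a x) (u x) (e x)

variable [IsManifold (𝓡 d) ∞ M]

variable (F E) in
/-- Some natural coordinates at a point. -/
def at_ (x : M) : NatChart (d := d) F E := (exists_mem_source F E x).choose

variable (F E) in
lemma mem_at_ (x : M) : x ∈ (at_ (d := d) F E x).dom := (exists_mem_source F E x).choose_spec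

end NatChart

namespace Operations

open NatChart

variable [VectorBundle ℝ F E] [FiniteDimensional ℝ F] [ContMDiffVectorBundle ∞ F E (𝓡 d)]
  [IsManifold (𝓡 d) ∞ M]

variable (f : ∀ c : NatChart (d := d) F E, StrFun c)

/-- The bracket given by structure functions, at a point. -/
def brkVal (e₁ e₂ : Cₛ^∞⟮𝓡 d; F, E⟯) (x : M) : E x :=
  ∑ a, (f (at_ F E x)).brk ((at_ F E x).sec e₁) ((at_ F E x).sec e₂) a ⟨x, mem_at_ F E x⟩ •
    (at_ (d := d) F E x).frame a x

/-- The anchor given by structure functions, at a point. -/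
def anchorVal (x : M) : E x →ₗ[ℝ] TangentSpace (𝓡 d) x :=
  -∑ i, ∑ a, (f (at_ F E x)).f₁ i a ⟨x, mem_at_ F E x⟩ •
    ((at_ (d := d) F E x).isFrame.coeff a x).smulRight ((at_ (d := d) F E x).cvec x i)

/-- The bundle map `∂` given by structure functions, at a point. -/
def delVal (x : M) : Module.Dual ℝ (E x) →ₗ[ℝ] E x :=
  ∑ a, ∑ b, (f (at_ F E x)).f₂ a b ⟨x, mem_at_ F E x⟩ •
    (LinearMap.applyₗ ((at_ (d := d) F E x).frame a x)).smulRight ((at_ (d := d) F E x).frame b x)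

/-- The 4-form given by structure functions, at a point. -/
def OmVal (x : M) : E x [⋀^Fin 4]→ₗ[ℝ] ℝ :=
  -- Determinants make the form alternating by construction. Since `F4` is skew, the `4!`
  -- permutations contribute equally to the sum, hence the factor `1/24`.
  (1 / 24 : ℝ) • ∑ l, (f (at_ F E x)).F4 l ⟨x, mem_at_ F E x⟩ •
    (Matrix.detRowAlternating (n := Fin 4) (R := ℝ)).compLinearMap
      (LinearMap.pi fun j => (at_ (d := d) F E x).isFrame.coeff (l j) x)

variable {f} (hf : ∀ (c c' : NatChart (d := d) F E) (x : M) (hx : x ∈ c.dom) (hx' : x ∈ c'.dom),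
  (f c).Agree (f c') hx hx')

include hf

/-- Under `Agree` the defect in `brk_sub_sum_brk` vanishes, so the coordinates selected at each
point do not matter. The formula in fixed coordinates also yields smoothness; the next three lemmas
play the same role for `ρ`, `∂` and `Ω`. -/
lemma coeff_brkVal (c : NatChart (d := d) F E) (e₁ e₂ : Cₛ^∞⟮𝓡 d; F, E⟯) (x : c.dom)
    (b : Fin (finrank ℝ F)) :
    c.isFrame.coeff b x (brkVal f e₁ e₂ x) = (f c).brk (c.sec e₁) (c.sec e₂) b x := by
  have h := hf c (at_ F E x) x x.2 (mem_at_ F E x)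
  have h1 := StrFun.brk_sub_sum_brk h.f₁ e₁ e₂ b
  simp only [h.f₃, sub_self, zero_mul, Finset.sum_const_zero] at h1
  rw [sub_eq_zero] at h1
  refine Eq.trans ?_ h1.symm
  rw [brkVal, map_sum]
  exact Finset.sum_congr rfl fun n _ => by rw [map_smul, smul_eq_mul, mul_comm]; rfl

lemma vcoord_anchorVal (c : NatChart (d := d) F E) (x : c.dom) (j : Fin d) (v : E x) :
    c.vcoord x j (anchorVal f x v) = -∑ m, (f c).f₁ j m x * c.isFrame.coeff m x v := by
  have h := hf c (at_ F E x) x x.2 (mem_at_ F E x)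
  have h1 : anchorVal f x v = -∑ i, ∑ a, (f (at_ F E x)).f₁ i a ⟨x, mem_at_ F E x⟩ •
      (at_ (d := d) F E (x : M)).isFrame.coeff a x v • (at_ (d := d) F E x).cvec x i := by
    simp [anchorVal]
  rw [h1, map_neg, neg_inj]
  simp only [map_sum, map_smul, smul_eq_mul]
  have h2 : ∀ m, (f c).f₁ j m x = _ := h.f₁ j
  symm
  simp only [h2, Finset.sum_mul]
  rw [Finset.sum_comm]
  refine Finset.sum_congr rfl fun i _ => ?_
  rw [Finset.sum_comm]
  refine Finset.sum_congr rfl fun a _ => ?_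
  rw [c.coeff_eq_sum_tm _ x.2, Finset.sum_mul, Finset.mul_sum]
  exact Finset.sum_congr rfl fun m _ => by rw [NatChart.jac]; ring

lemma coeff_delVal (c : NatChart (d := d) F E) (x : c.dom) (b : Fin (finrank ℝ F))
    (α : Module.Dual ℝ (E x)) :
    c.isFrame.coeff b x (delVal f x α) = ∑ a, (f c).f₂ a b x * α (c.frame a x) := by
  have h := hf c (at_ F E x) x x.2 (mem_at_ F E x)
  have h1 : delVal f x α = ∑ m, ∑ n, (f (at_ F E x)).f₂ m n ⟨x, mem_at_ F E x⟩ •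
      α ((at_ (d := d) F E (x : M)).frame m x) • (at_ (d := d) F E x).frame n x := by
    simp [delVal]
  have h2 : ∀ m, (f c).f₂ m b x = _ := fun m => h.f₂ m b
  have h3 : ∀ m, α ((at_ (d := d) F E (x : M)).frame m x) =
      ∑ a, α (c.frame a x) * (at_ (d := d) F E (x : M)).tm c x a m := fun m =>
    (c.sum_apply_frame_mul_coeff x.2 α _).symm
  symm
  simp only [h1, map_sum, map_smul, smul_eq_mul, h2, h3, Finset.sum_mul, Finset.mul_sum]
  rw [Finset.sum_comm]
  refine Finset.sum_congr rfl fun m _ => ?_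
  rw [Finset.sum_comm]
  exact Finset.sum_congr rfl fun n _ => Finset.sum_congr rfl fun a _ => by
    rw [NatChart.tm, NatChart.tm]; ring

lemma OmVal_apply (c : NatChart (d := d) F E) (x : c.dom) (v : Fin 4 → E x) :
    OmVal f x v = ∑ l, (f c).F4 l x * ∏ i, c.isFrame.coeff (l i) x (v i) := by
  have h := hf c (at_ F E x) x x.2 (mem_at_ F E x)
  have h1 : OmVal f x v = 1 / 24 * ∑ l, (f (at_ F E x)).F4 l ⟨x, mem_at_ F E x⟩ *
      (Matrix.of fun i j => (at_ (d := d) F E (x : M)).isFrame.coeff (l j) x (v i)).det := by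
    let ev : (E x [⋀^Fin 4]→ₗ[ℝ] ℝ) →+ ℝ := ⟨⟨fun A => A v, rfl⟩, fun _ _ => rfl⟩
    rw [OmVal, AlternatingMap.smul_apply, smul_eq_mul]
    exact congrArg _ (map_sum ev _ _)
  have h2 := ((f (at_ F E x)).F4_apply_skew ⟨x, mem_at_ F E x⟩).sum_mul_det
    fun i a => (at_ (d := d) F E (x : M)).isFrame.coeff a x (v i)
  have h3 : ((4 : ℕ).factorial : ℝ) = 24 := by norm_num [Nat.factorial]
  rw [h1, h2, h3, ← mul_assoc, one_div_mul_cancel (by norm_num), one_mul]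
  have h4 : ∀ l, (f c).F4 l x = _ := h.F4
  simp only [h4, Finset.sum_mul]
  rw [Finset.sum_comm]
  refine Finset.sum_congr rfl fun l' _ => ?_
  have h5 : ∀ i, (at_ (d := d) F E (x : M)).isFrame.coeff (l' i) x (v i) = _ := fun i =>
    c.coeff_eq_sum_tm _ x.2 (l' i) (v i)
  simp only [h5, Finset.prod_univ_sum, Fintype.piFinset_univ, Finset.mul_sum]
  exact Finset.sum_congr rfl fun l _ => by rw [Finset.prod_mul_distrib, mul_assoc]

/-- The bracket given by structure functions. -/
def brkSec (e₁ e₂ : Cₛ^∞⟮𝓡 d; F, E⟯) : Cₛ^∞⟮𝓡 d; F, E⟯ :=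
  ⟨brkVal f e₁ e₂, contMDiff_of_coeff fun x => ⟨at_ F E x, mem_at_ F E x, _, fun y => by
    rw [← (at_ (d := d) F E x).sum_coeff_smul y.2 (brkVal f e₁ e₂ y)]
    exact Finset.sum_congr rfl fun a _ => by rw [coeff_brkVal hf]⟩⟩

lemma sec_brkSec (c : NatChart (d := d) F E) (e₁ e₂ : Cₛ^∞⟮𝓡 d; F, E⟯) :
    c.sec (brkSec hf e₁ e₂) = (f c).brk (c.sec e₁) (c.sec e₂) :=
  funext fun b => ContMDiffMap.ext fun x => coeff_brkVal hf c e₁ e₂ x b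

omit hf in
lemma _root_.QP3.section_ext {e e' : Cₛ^∞⟮𝓡 d; F, E⟯}
    (h : ∀ c : NatChart (d := d) F E, c.sec e = c.sec e') : e = e' :=
  ContMDiffSection.ext fun x => (at_ (d := d) F E x).ext_of_coeff (mem_at_ F E x) fun a =>
    congrArg (fun g : Fin (finrank ℝ F) → (at_ (d := d) F E x).Coeff => g a ⟨x, mem_at_ F E x⟩)
      (h (at_ F E x))

/-- The operations given by structure functions. -/
def ofStrFun : Operations (d := d) F E where
  brk := LinearMap.mk₂ ℝ (brkSec hf)
    (fun e₁ e₂ e => section_ext fun c => by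
      rw [sec_add]
      simp only [sec_brkSec, sec_add]
      -- Linearity in the first argument follows from that in the second by skew-symmetry.
      rw [StrFun.brk_skew, StrFun.brk_add_right, neg_add, ← StrFun.brk_skew, ← StrFun.brk_skew])
    (fun k e₁ e => section_ext fun c => by
      rw [sec_smul]
      simp only [sec_brkSec, sec_smul]
      rw [StrFun.brk_skew, StrFun.brk_smul_right, ← smul_neg, ← StrFun.brk_skew])
    (fun e e₁ e₂ => section_ext fun c => by
      rw [sec_add]
      simp only [sec_brkSec, sec_add]
      rw [StrFun.brk_add_right])
    (fun k e e₂ => section_ext fun c => by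
      rw [sec_smul]
      simp only [sec_brkSec, sec_smul]
      rw [StrFun.brk_smul_right])
  brk_skew e₁ e₂ := section_ext fun c => by
    rw [sec_neg]
    simp only [LinearMap.mk₂_apply, sec_brkSec]
    rw [StrFun.brk_skew]
  anchor := anchorVal f
  anchor_smooth U s hU hs := by
    intro x hx
    -- The pointwise definition uses different coordinates at different points; smoothness near `x`
    -- is checked in those selected at `x`, kept fixed.
    let c := at_ (d := d) F E x
    have hxc : x ∈ c.chart.source := mem_at_ F E x
    have h1 : ∀ i, ContMDiffOn (𝓡 d) 𝓘(ℝ, ℝ) ∞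
        (fun y => -∑ m, ext ((f c).f₁ i m) y * c.isFrame.coeff m y (s y)) (c.chart.source ∩ U) :=
      fun i => (contMDiffOn_finsetSum fun m _ =>
        ((ext_contMDiffOn ((f c).f₁ i m)).mono Set.inter_subset_left).mul
          (c.coeff_contMDiffOn hU hs m)).neg
    refine ((ContMDiffOn.congr (c.contMDiffOn_sum_smul_cvec h1) fun y hy => ?_).contMDiffAt
      ((c.chart.open_source.inter hU).mem_nhds ⟨hxc, hx⟩)).contMDiffWithinAt
    congr 1
    change anchorVal f y (s y) = _
    rw [← c.sum_vcoord_smul hy.1 (anchorVal f y (s y))]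
    refine Finset.sum_congr rfl fun i _ => ?_
    rw [vcoord_anchorVal hf c ⟨y, hy.1⟩]
    congr 2
    exact Finset.sum_congr rfl fun m _ => by rw [← ext_apply]
  del := delVal f
  del_symm x α β := by
    let c := at_ (d := d) F E x
    have hxc : x ∈ c.dom := mem_at_ F E x
    rw [← c.sum_apply_frame_mul_coeff hxc, ← c.sum_apply_frame_mul_coeff hxc α]
    simp only [coeff_delVal hf c ⟨x, hxc⟩, Finset.mul_sum]
    rw [Finset.sum_comm]
    refine Finset.sum_congr rfl fun a _ => Finset.sum_congr rfl fun b _ => ?_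
    rw [(f c).f₂_symm]
    ring
  del_smooth α := contMDiffOn_univ.mpr (contMDiff_of_coeff fun x =>
    ⟨at_ F E x, mem_at_ F E x,
      fun b => ∑ a, (f (at_ F E x)).f₂ a b * (at_ F E x).dual α a, fun y => by
      rw [← (at_ (d := d) F E x).sum_coeff_smul y.2 (delVal f y (α.toFun y))]
      refine Finset.sum_congr rfl fun b _ => ?_
      rw [coeff_delVal hf, coeff_sum_apply]
      rfl⟩)
  Om := OmVal f
  Om_smooth U s hU hs := by
    intro x hx
    let c := at_ (d := d) F E x
    have hxc : x ∈ c.chart.source := mem_at_ F E x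
    have h1 : ContMDiffOn (𝓡 d) 𝓘(ℝ, ℝ) ∞ (fun y => ∑ l, ext ((f c).F4 l) y *
        ∏ i, c.isFrame.coeff (l i) y (s i y)) (c.chart.source ∩ U) :=
      contMDiffOn_finsetSum fun l _ =>
        ((ext_contMDiffOn ((f c).F4 l)).mono Set.inter_subset_left).mul
          (contMDiffOn_finsetProd fun i _ => c.coeff_contMDiffOn hU (hs i) (l i))
    refine ((h1.congr fun y hy => ?_).contMDiffAt
      ((c.chart.open_source.inter hU).mem_nhds ⟨hxc, hx⟩)).contMDiffWithinAt
    rw [OmVal_apply hf c ⟨y, hy.1⟩]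
    exact Finset.sum_congr rfl fun m _ => by rw [← ext_apply]

theorem rep_ofStrFun (c : NatChart (d := d) F E) : (ofStrFun hf).Rep (f c) where
  brk e₁ e₂ := sec_brkSec hf c e₁ e₂
  anchor x i a := by
    rw [ofStrFun, vcoord_anchorVal hf]
    simp [c.coeff_frame x.2]
  del x a b := by
    rw [ofStrFun, coeff_delVal hf]
    simp [c.coeff_frame x.2]
  Om x l := by
    rw [ofStrFun, OmVal_apply hf, Finset.sum_eq_single l]
    · simp [c.coeff_frame x.2]
    · intro l' _ hl'
      obtain ⟨i, hi⟩ : ∃ i, l' i ≠ l i := by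
        by_contra! h5
        exact hl' (funext h5)
      rw [Finset.prod_eq_zero (Finset.mem_univ i) (by rw [c.coeff_frame x.2, if_neg hi]), mul_zero]
    · simp

end Operations

end QP3
end

noncomputable section

namespace QP3

variable {d : ℕ} {M : Type*} [TopologicalSpace M] [ChartedSpace (EuclideanSpace ℝ (Fin d)) M]
variable {F : Type*} [NormedAddCommGroup F] [NormedSpace ℝ F]
variable {E : M → Type*} [TopologicalSpace (TotalSpace F E)] [∀ x, TopologicalSpace (E x)]
  [∀ x, AddCommGroup (E x)] [∀ x, Module ℝ (E x)] [FiberBundle F E]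

/-! ### Structure functions from operations -/

namespace NatChart

variable (c : NatChart (d := d) F E)

/-- Smoothness is local, so a function built from pointwise choices is a coefficient once it agrees
near each point with a single smooth function. -/
lemma exists_coeff_of_local {g : c.dom → ℝ} (h : ∀ x₀ : c.dom, ∃ u : M → ℝ,
    ContMDiffAt (𝓡 d) 𝓘(ℝ, ℝ) ∞ u x₀ ∧ ∀ᶠ y in nhds (x₀ : M), ∀ hy : y ∈ c.dom, g ⟨y, hy⟩ = u y) :
    ∃ G : c.Coeff, ∀ x, G x = g x := by
  have h1 : ContMDiffOn (𝓡 d) 𝓘(ℝ, ℝ) ∞ (Function.extend Subtype.val g 0) c.chart.source := by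
    intro x hx
    obtain ⟨u, hu, he⟩ := h ⟨x, hx⟩
    refine (hu.congr_of_eventuallyEq ?_).contMDiffWithinAt
    filter_upwards [he, c.chart.open_source.mem_nhds hx] with y hy hys
    rw [← hy hys]
    exact Subtype.val_injective.extend_apply g 0 ⟨y, hys⟩
  exact ⟨c.restr _ h1, fun x => Subtype.val_injective.extend_apply g 0 x⟩

variable [VectorBundle ℝ F E] [FiniteDimensional ℝ F] [ContMDiffVectorBundle ∞ F E (𝓡 d)]

/-- The section `e` agrees with `e_a` near `x`. -/
def IsExt (x : M) (a : Fin (finrank ℝ F)) (e : Cₛ^∞⟮𝓡 d; F, E⟯) : Prop :=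
  ∀ᶠ y in nhds x, e y = c.frame a y

variable {c} in
lemma IsExt.sec {x : c.dom} {a : Fin (finrank ℝ F)} {e : Cₛ^∞⟮𝓡 d; F, E⟯} (h : c.IsExt x a e)
    (b : Fin (finrank ℝ F)) :
    ext (c.sec e b) =ᶠ[nhds (x : M)] ext (algebraMap ℝ c.Coeff (if b = a then 1 else 0)) := by
  filter_upwards [h, c.chart.open_source.mem_nhds x.2] with y hy hys
  refine (ext_apply _ ⟨y, hys⟩).trans (Eq.trans ?_ (ext_apply _ ⟨y, hys⟩).symm)
  rw [sec_apply, hy, c.coeff_frame hys]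
  rfl

variable [IsManifold (𝓡 d) ∞ M] [T2Space M] [SigmaCompactSpace M]

lemma exists_isExt (x : c.dom) (a : Fin (finrank ℝ F)) : ∃ e, c.IsExt x a e := by
  obtain ⟨e, he⟩ := c.exists_sec x fun b => algebraMap ℝ _ (if b = a then 1 else 0)
  refine ⟨e, ?_⟩
  filter_upwards [Filter.eventually_all.mpr he, c.chart.open_source.mem_nhds x.2] with y hy hys
  refine c.ext_of_coeff hys fun b => ?_
  rw [c.coeff_frame hys]
  exact (ext_apply (c.sec e b) ⟨y, hys⟩).symm.trans ((hy b).trans (ext_apply _ ⟨y, hys⟩))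

/-- A bump function supported where `e` vanishes annihilates `e` although its value at `x` is `1`.
Locality of any operator with a Leibniz rule follows. -/
lemma exists_smulSec_eq_zero {x : M} {e : Cₛ^∞⟮𝓡 d; F, E⟯} (he : ∀ᶠ y in nhds x, e y = 0) :
    ∃ χ : C^∞⟮𝓡 d, M; 𝓘(ℝ, ℝ), ℝ⟯, χ x = 1 ∧ smulSec χ e = 0 := by
  obtain ⟨U, hU, hUo, hxU⟩ := eventually_nhds_iff.mp he
  let c := (at_ (d := d) F E x).restrict U hUo
  have hx : x ∈ c.dom := by
    change x ∈ ((at_ (d := d) F E x).restrict U hUo).chart.source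
    rw [restrict_source]
    exact ⟨mem_at_ F E x, hxU⟩
  obtain ⟨χ, h1, hs⟩ := c.exists_bump ⟨x, hx⟩
  refine ⟨χ, h1.self_of_nhds, ContMDiffSection.ext fun y => ?_⟩
  change χ y • e y = 0
  by_cases hy : y ∈ U
  · rw [hU y hy, smul_zero]
  · have h2 : y ∉ tsupport χ := fun h => hy (by
      have := hs h
      rw [restrict_source] at this
      exact this.2)
    rw [image_eq_zero_of_notMem_tsupport h2, zero_smul]

/-- A functional on sections that is local and linear over functions at `x` vanishes if it vanishes
on a frame. -/
lemma eq_zero_of_isExt (x : c.dom) (T : Cₛ^∞⟮𝓡 d; F, E⟯ →ₗ[ℝ] ℝ)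
    (hT : ∀ u e, T (smulSec u e) = u x * T e)
    (hE : ∀ m, ∃ e, c.IsExt x m e ∧ T e = 0) (e : Cₛ^∞⟮𝓡 d; F, E⟯) : T e = 0 := by
  choose ε hε hTε using hE
  -- `w m` extends the `m`-th component of `e`, so `e - ∑ m, w_m ε_m` vanishes near `x` and the
  -- cut-off shows that `T` sends it to zero.
  choose w hw using fun m => c.exists_fn x (c.sec e m)
  have h1 : ∀ᶠ y in nhds (x : M), (e - ∑ m, smulSec (w m) (ε m) : Cₛ^∞⟮𝓡 d; F, E⟯) y = 0 := by
    filter_upwards [Filter.eventually_all.mpr hε, Filter.eventually_all.mpr hw,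
      c.chart.open_source.mem_nhds x.2] with y h2 h3 hy
    rw [ContMDiffSection.coe_sub, Pi.sub_apply, sub_eq_zero, ← c.sum_coeff_smul hy (e y)]
    have h4 : (∑ m, smulSec (w m) (ε m) : Cₛ^∞⟮𝓡 d; F, E⟯) y = ∑ m, w m y • ε m y := by
      let ev : Cₛ^∞⟮𝓡 d; F, E⟯ →+ E y := ⟨⟨fun e => e y, rfl⟩, fun _ _ => rfl⟩
      exact map_sum ev _ _
    rw [h4]
    refine Finset.sum_congr rfl fun m _ => ?_
    rw [h2 m]
    congr 1
    exact ((ext_apply (c.fn (w m)) ⟨y, hy⟩).symm.trans ((h3 m).trans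
      (ext_apply (c.sec e m) ⟨y, hy⟩))).symm
  obtain ⟨χ, h5, h6⟩ := exists_smulSec_eq_zero h1
  have h7 := hT χ (e - ∑ m, smulSec (w m) (ε m))
  rw [h6, map_zero, h5, one_mul, map_sub, map_sum, eq_comm, sub_eq_zero] at h7
  rw [h7]
  exact Finset.sum_eq_zero fun m _ => by rw [hT, hTε, mul_zero]

end NatChart

namespace Operations

open NatChart

variable [VectorBundle ℝ F E] [FiniteDimensional ℝ F] [ContMDiffVectorBundle ∞ F E (𝓡 d)]
  [IsManifold (𝓡 d) ∞ M]

theorem a1_of_rep {D : Operations (d := d) F E} {f : ∀ c : NatChart (d := d) F E, StrFun c}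
    (h : ∀ c, D.Rep (f c)) : D.A1 := by
  intro u e₁ e₂ x
  obtain ⟨c, hx⟩ := exists_mem_source (d := d) F E x
  refine c.ext_of_coeff hx fun b => ?_
  have h1 := (h c).brk e₁ (smulSec u e₂)
  rw [c.sec_smulSec, StrFun.brk_mul_right, ← (h c).brk] at h1
  rw [map_add, map_smul, map_smul, (h c).act_eq ⟨x, hx⟩ e₁ u u.contMDiff.contMDiffOn]
  exact congrArg (fun g : Fin (finrank ℝ F) → c.Coeff => g b ⟨x, hx⟩) h1

variable [T2Space M] [SigmaCompactSpace M]

variable {D : Operations (d := d) F E} (hD : D.A1)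

include hD

/-- Apply (A1) to `0 = χ e₂`: the derivative term drops out because `e₂ x = 0`. -/
lemma brk_eq_zero_of_eventually {x : M} (e₁ : Cₛ^∞⟮𝓡 d; F, E⟯) {e₂ : Cₛ^∞⟮𝓡 d; F, E⟯}
    (h : ∀ᶠ y in nhds x, e₂ y = 0) : D.brk e₁ e₂ x = 0 := by
  obtain ⟨χ, h5, h6⟩ := exists_smulSec_eq_zero h
  have h1 := hD χ e₁ e₂ x
  rw [h6, map_zero, h5, one_smul, h.self_of_nhds, smul_zero, add_zero] at h1
  exact h1.symm

lemma brk_congr_right {x : M} (e₁ : Cₛ^∞⟮𝓡 d; F, E⟯) {e₂ e₂' : Cₛ^∞⟮𝓡 d; F, E⟯}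
    (h : ∀ᶠ y in nhds x, e₂ y = e₂' y) : D.brk e₁ e₂ x = D.brk e₁ e₂' x := by
  rw [← sub_eq_zero]
  have := brk_eq_zero_of_eventually hD e₁ (x := x) (e₂ := e₂ - e₂')
    (h.mono fun y hy => sub_eq_zero.mpr hy)
  rwa [map_sub] at this

lemma brk_congr {x : M} {e₁ e₁' e₂ e₂' : Cₛ^∞⟮𝓡 d; F, E⟯} (h₁ : ∀ᶠ y in nhds x, e₁ y = e₁' y)
    (h₂ : ∀ᶠ y in nhds x, e₂ y = e₂' y) : D.brk e₁ e₂ x = D.brk e₁' e₂' x := by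
  have h3 := congrArg Neg.neg (brk_congr_right hD e₂' h₁)
  have h4 : ∀ a b, D.brk a b x = -D.brk b a x := fun a b => by
    rw [D.brk_skew]
    rfl
  rw [brk_congr_right hD e₁ h₂, h4, h3, ← h4]

/-- `f₃` is read off from brackets of extensions of the frame sections. Locality makes the value
independent of the extensions, and one pair of extensions serves all points near `x₀`, whence
smoothness. As in `brk`, the index `m` belongs to the second section. -/
lemma exists_f₃ (c : NatChart (d := d) F E) (b m a : Fin (finrank ℝ F)) : ∃ G : c.Coeff,
    ∀ (x : c.dom) e e', c.IsExt x a e → c.IsExt x m e' →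
      c.isFrame.coeff b x (D.brk e e' x) = G x := by
  choose ε hε using fun x : c.dom => c.exists_isExt x
  obtain ⟨G, hG⟩ := c.exists_coeff_of_local
    (g := fun x => c.isFrame.coeff b x (D.brk (ε x a) (ε x m) x)) (fun x₀ => by
    refine ⟨fun y => c.isFrame.coeff b y (D.brk (ε x₀ a) (ε x₀ m) y),
      (c.coeff_smooth _ (D.brk (ε x₀ a) (ε x₀ m)).contMDiff.contMDiffOn b).contMDiffAt
        (c.chart.open_source.mem_nhds x₀.2), ?_⟩
    filter_upwards [(hε x₀ a).eventually_nhds, (hε x₀ m).eventually_nhds] with y h1 h2 hy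
    change c.isFrame.coeff b y (D.brk (ε ⟨y, hy⟩ a) (ε ⟨y, hy⟩ m) y) = _
    rw [brk_congr hD (e₁' := ε x₀ a) (e₂' := ε x₀ m)]
    · filter_upwards [hε ⟨y, hy⟩ a, h1] with z h3 h4
      rw [h3, h4]
    · filter_upwards [hε ⟨y, hy⟩ m, h2] with z h3 h4
      rw [h3, h4])
  refine ⟨G, fun x e e' he he' => ?_⟩
  rw [hG, brk_congr hD (e₁' := ε x a) (e₂' := ε x m)]
  · filter_upwards [hε x a, he] with z h3 h4
    rw [h3, h4]
  · filter_upwards [hε x m, he'] with z h3 h4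
    rw [h3, h4]

omit hD in
lemma exists_f₂ (D : Operations (d := d) F E) (c : NatChart (d := d) F E)
    (a b : Fin (finrank ℝ F)) : ∃ G : c.Coeff, ∀ x : c.dom,
      c.isFrame.coeff b x (D.del x (c.isFrame.coeff a x)) = G x := by
  obtain ⟨G, hG⟩ := c.exists_coeff_of_local
    (g := fun x => c.isFrame.coeff b x (D.del x (c.isFrame.coeff a x))) (fun x₀ => by
    obtain ⟨α, hα⟩ := c.exists_dual x₀ fun b => algebraMap ℝ _ (if a = b then 1 else 0)
    refine ⟨fun y => c.isFrame.coeff b y (D.delSec α y),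
      (c.coeff_smooth _ (D.delSec α).contMDiff.contMDiffOn b).contMDiffAt
        (c.chart.open_source.mem_nhds x₀.2), ?_⟩
    filter_upwards [Filter.eventually_all.mpr hα] with y h1 hy
    have h2 : α.toFun y = c.isFrame.coeff a y := c.dual_eq_coeff (x := ⟨y, hy⟩) fun b =>
      (ext_apply (c.dual α b) ⟨y, hy⟩).symm.trans ((h1 b).trans (ext_apply _ ⟨y, hy⟩))
    rw [← h2]
    rfl)
  exact ⟨G, fun x => (hG x).symm⟩

/-- `f₁`, `f₂`, `f₄` are the components of `ρ`, `∂`, `Ω`, and `f₃` those of brackets of frame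
sections. The given bracket and the coordinate bracket obey the Leibniz rule with the same anchor,
so their difference is bilinear over functions, and it vanishes on the frame. -/
theorem exists_rep (c : NatChart (d := d) F E) : ∃ f : StrFun c, D.Rep f := by
  choose f₃ hf₃ using exists_f₃ hD c
  choose f₂ hf₂ using exists_f₂ D c
  have hs₁ : ∀ i a, ContMDiffOn (𝓡 d) 𝓘(ℝ, ℝ) ∞
      (fun x => -c.vcoord x i (D.anchor x (c.frame a x))) c.chart.source := fun i a => by
    have h1 := c.contMDiffOn_vcoord (D.anchor_smooth _ _ c.chart.open_source
      (c.isFrame.contMDiffOn a)) i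
    rw [Set.inter_self] at h1
    exact h1.neg
  have hs₄ : ∀ l : Fin 4 → Fin (finrank ℝ F), ContMDiffOn (𝓡 d) 𝓘(ℝ, ℝ) ∞
      (fun x => D.Om x fun i => c.frame (l i) x) c.chart.source := fun l =>
    D.Om_smooth _ _ c.chart.open_source fun i => c.isFrame.contMDiffOn (l i)
  have hO : ∀ (x : M) (l : Fin 4 → Fin (finrank ℝ F)) (i j : Fin 4), i ≠ j →
      (D.Om x fun k => c.frame (l (Equiv.swap i j k)) x) = -D.Om x fun k => c.frame (l k) x :=
    fun x l i j hij => (D.Om x).map_swap (fun k => c.frame (l k) x) hij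
  have hv : ∀ a b a' b' a₁ b₁ a₁' b₁' : Fin (finrank ℝ F), ∀ i j : Fin 4, i ≠ j →
      ![a, b, a', b'] = ![a₁, b₁, a₁', b₁'] ∘ Equiv.swap i j →
      c.restr _ (hs₄ ![a, b, a', b']) = -c.restr _ (hs₄ ![a₁, b₁, a₁', b₁']) := by
    intro a b a' b' a₁ b₁ a₁' b₁' i j hij h
    ext x
    change (D.Om x fun k => c.frame (![a, b, a', b'] k) x) = _
    rw [h]
    exact hO x ![a₁, b₁, a₁', b₁'] i j hij
  let f : StrFun c :=
    { f₁ := fun i a => c.restr _ (hs₁ i a)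
      f₂ := f₂
      f₃ := f₃
      f₄ := fun a b a' b' => c.restr _ (hs₄ ![a, b, a', b'])
      f₂_symm := fun a b => ContMDiffMap.ext fun x => by
        rw [← hf₂, ← hf₂, D.del_symm]
      f₃_skew := fun a b b' => ContMDiffMap.ext fun x => by
        obtain ⟨e, he⟩ := c.exists_isExt x b
        obtain ⟨e', he'⟩ := c.exists_isExt x b'
        rw [← hf₃ a b b' x e' e he' he, D.brk_skew]
        change _ = -f₃ a b' b x
        rw [← hf₃ a b' b x e e' he he']
        exact map_neg (c.isFrame.coeff a x) _
      f₄_skew₁ := fun a b a' b' => hv _ _ _ _ _ _ _ _ 0 1 (by decide) (by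
        funext k; fin_cases k <;> rfl)
      f₄_skew₂ := fun a b a' b' => hv _ _ _ _ _ _ _ _ 1 2 (by decide) (by
        funext k; fin_cases k <;> rfl)
      f₄_skew₃ := fun a b a' b' => hv _ _ _ _ _ _ _ _ 2 3 (by decide) (by
        funext k; fin_cases k <;> rfl) }
  have hanc : ∀ (x : c.dom) i a, c.vcoord x i (D.anchor x (c.frame a x)) = -f.f₁ i a x :=
    fun x i a => (neg_neg _).symm
  have hOm : ∀ (x : c.dom) l, D.Om x (fun i => c.frame (l i) x) = f.F4 l x := fun x l => by
    change _ = D.Om x fun i => c.frame (![l 0, l 1, l 2, l 3] i) x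
    congr 1
    funext i
    fin_cases i <;> rfl
  refine ⟨f, ⟨fun e₁ e₂ => ?_, hanc, fun x a b => hf₂ a b x, hOm⟩⟩
  have hact : ∀ (x : c.dom) (e : Cₛ^∞⟮𝓡 d; F, E⟯) (u : C^∞⟮𝓡 d, M; 𝓘(ℝ, ℝ), ℝ⟯),
      D.act e u x = f.act (c.sec e) (c.fn u) x := by
    intro x e u
    rw [act, c.mfderiv_apply_eq x.2 (u.contMDiff.mdifferentiable (by simp) _), f.act_apply,
      ← Finset.sum_neg_distrib]
    refine Finset.sum_congr rfl fun i _ => ?_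
    rw [fn, c.pd_restr_apply, ← neg_mul]
    congr 1
    conv_lhs => rw [← c.sum_coeff_smul x.2 (e x), map_sum, map_sum]
    rw [← Finset.sum_neg_distrib]
    refine Finset.sum_congr rfl fun a _ => ?_
    rw [map_smul, map_smul, hanc, smul_eq_mul, sec_apply]
    ring
  funext b
  ext x
  -- The `b`-component at `x` of the difference of the two brackets.
  let T : Cₛ^∞⟮𝓡 d; F, E⟯ → Cₛ^∞⟮𝓡 d; F, E⟯ →ₗ[ℝ] ℝ := fun e₁ =>
    { toFun := fun e₂ => c.sec (D.brk e₁ e₂) b x - f.brk (c.sec e₁) (c.sec e₂) b x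
      map_add' := fun e e' => by
        rw [map_add, c.sec_add, c.sec_add, f.brk_add_right]
        exact add_sub_add_comm _ _ _ _
      map_smul' := fun k e => by
        rw [map_smul, c.sec_smul, c.sec_smul, f.brk_smul_right]
        exact (mul_sub _ _ _).symm }
  -- The derivative terms of the two Leibniz rules cancel by `hact`.
  have hT : ∀ e u e', T e (smulSec u e') = u x * T e e' := by
    intro e u e'
    change c.isFrame.coeff b x (D.brk e (smulSec u e') x) - f.brk (c.sec e) (c.sec _) b x =
      u x * (c.isFrame.coeff b x (D.brk e e' x) - f.brk (c.sec e) (c.sec e') b x)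
    rw [hD, map_add, map_smul, map_smul, c.sec_smulSec, f.brk_mul_right, hact]
    change _ - (c.fn u x * _ + _) = _
    rw [smul_eq_mul, smul_eq_mul]
    change u x * _ + _ * c.sec e' b x - (u x * _ + f.act (c.sec e) (c.fn u) x * c.sec e' b x) = _
    ring
  have hskew : ∀ e e', T e e' = -T e' e := by
    intro e e'
    change c.sec (D.brk e e') b x - f.brk (c.sec e) (c.sec e') b x =
      -(c.sec (D.brk e' e) b x - f.brk (c.sec e') (c.sec e) b x)
    rw [D.brk_skew, f.brk_skew, c.sec_neg]
    change -_ - -_ = _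
    ring
  have hbase : ∀ a m e e', c.IsExt x a e → c.IsExt x m e' → T e e' = 0 := by
    intro a m e e' he he'
    change c.isFrame.coeff b x (D.brk e e' x) - f.brk (c.sec e) (c.sec e') b x = 0
    have h1 : ∀ {a e}, c.IsExt x a e → ∀ k, c.sec e k x = if k = a then 1 else 0 := by
      intro a e he k
      rw [← ext_apply, (he.sec k).eq_of_nhds, ext_apply]
      rfl
    have h2 : ∀ {a e}, c.IsExt x a e → ∀ k i, c.pd i (c.sec e k) x = 0 := by
      intro a e he k i
      rw [c.pd_congr (he.sec k), c.pd_algebraMap]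
      rfl
    rw [hf₃ b m a x e e' he he', f.brk_apply_of_pd_eq_zero (h2 he) (h2 he')]
    simp only [h1 he, h1 he']
    rw [sum_sum_mul_single (fun k a => f.f₃ b k a x)]
    exact sub_self _
  -- Reduction to extensions of frame sections in the second argument; skewness then gives the same
  -- reduction in the first.
  refine sub_eq_zero.mp (c.eq_zero_of_isExt x (T e₁) (hT e₁) (fun m => ?_) e₂)
  obtain ⟨e', he'⟩ := c.exists_isExt x m
  refine ⟨e', he', ?_⟩
  rw [hskew, neg_eq_zero]
  refine c.eq_zero_of_isExt x (T e') (hT e') (fun a => ?_) e₁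
  obtain ⟨e, he⟩ := c.exists_isExt x a
  exact ⟨e, he, hbase m a e' e he' he⟩

end Operations

end QP3
end

noncomputable section

namespace QP3

variable {d : ℕ} {M : Type*} [TopologicalSpace M] [ChartedSpace (EuclideanSpace ℝ (Fin d)) M]
variable {F : Type*} [NormedAddCommGroup F] [NormedSpace ℝ F]
variable {E : M → Type*} [TopologicalSpace (TotalSpace F E)] [∀ x, TopologicalSpace (E x)]
  [∀ x, AddCommGroup (E x)] [∀ x, Module ℝ (E x)] [FiberBundle F E]

/-! ### Functions of degree 4 and operations -/

namespace StrFun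

variable {c c' : NatChart (d := d) F E}

lemma theta2_mem (f : StrFun c) : f.theta2 ∈ c.bidegree 4 0 := by
  refine Submodule.smul_mem _ _ (Submodule.sum_mem _ fun a _ => Submodule.sum_mem _ fun b _ =>
    Submodule.subset_span ⟨0, 2, 0, rfl, rfl, f.f₂ a b, ![], ![a, b], ![], ?_⟩)
  simp [mul_assoc]

lemma theta13_mem (f : StrFun c) : f.theta13 ∈ c.bidegree 2 2 := by
  refine Submodule.add_mem _ (Submodule.sum_mem _ fun i _ => Submodule.sum_mem _ fun a _ =>
      Submodule.subset_span ⟨1, 0, 1, rfl, rfl, f.f₁ i a, ![i], ![], ![a], ?_⟩)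
    (Submodule.smul_mem _ _ (Submodule.sum_mem _ fun a _ => Submodule.sum_mem _ fun b _ =>
      Submodule.sum_mem _ fun b' _ =>
      Submodule.subset_span ⟨0, 1, 2, rfl, rfl, f.f₃ a b b', ![], ![a], ![b, b'], ?_⟩))
  · simp [mul_assoc]
  · simp [mul_assoc]

lemma theta4_mem (f : StrFun c) : f.theta4 ∈ c.bidegree 0 4 := by
  refine Submodule.smul_mem _ _ (Submodule.sum_mem _ fun a _ => Submodule.sum_mem _ fun b _ =>
    Submodule.sum_mem _ fun a' _ => Submodule.sum_mem _ fun b' _ =>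
    Submodule.subset_span ⟨0, 0, 4, rfl, rfl, f.f₄ a b a' b', ![], ![], ![a, b, a', b'], ?_⟩)
  simp [mul_assoc]

/-- The transformation law of structure functions is the patching condition for the `θ`'s. Through
`Rep` it is also the law satisfied by the components of operations, and this double role carries the
correspondence. -/
lemma agree_iff (f : StrFun c) (f' : StrFun c') {x : M} (hx : x ∈ c.dom) (hx' : x ∈ c'.dom) :
    Agree f f' hx hx' ↔
      c.transition c' x (c'.eval ⟨x, hx'⟩ f'.theta2) = c.eval ⟨x, hx⟩ f.theta2 ∧
      c.transition c' x (c'.eval ⟨x, hx'⟩ f'.theta13) = c.eval ⟨x, hx⟩ f.theta13 ∧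
      c.transition c' x (c'.eval ⟨x, hx'⟩ f'.theta4) = c.eval ⟨x, hx⟩ f.theta4 := by
  rw [transition_theta2_iff, transition_theta13_iff, transition_theta4_iff]
  exact ⟨fun h => ⟨h.f₂, ⟨h.f₁, h.f₃⟩, h.F4⟩, fun h => ⟨h.2.1.1, h.1, h.2.1.2, h.2.2⟩⟩

end StrFun

variable [IsManifold (𝓡 d) ∞ M] [T2Space M] [SigmaCompactSpace M] [VectorBundle ℝ F E]
  [FiniteDimensional ℝ F] [ContMDiffVectorBundle ∞ F E (𝓡 d)]

namespace Operations

theorem Rep.unique {D : Operations (d := d) F E} {c : NatChart (d := d) F E} {f g : StrFun c}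
    (h : D.Rep f) (h' : D.Rep g) : f = g := by
  refine StrFun.ext' (fun i a => ContMDiffMap.ext fun x => ?_)
    (fun a b => ContMDiffMap.ext fun x => (h.del x a b).symm.trans (h'.del x a b))
    (fun b k m => ContMDiffMap.ext fun x => ?_) (fun a b a' b' => ContMDiffMap.ext fun x =>
    (h.Om x ![a, b, a', b']).symm.trans (h'.Om x ![a, b, a', b']))
  · exact neg_injective ((h.anchor x i a).symm.trans (h'.anchor x i a))
  · obtain ⟨e₁, h1, h1'⟩ := c.exists_sec_apply x fun a => if a = m then 1 else 0
    obtain ⟨e₂, h2, h2'⟩ := c.exists_sec_apply x fun a => if a = k then 1 else 0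
    have h3 := (h.brk e₁ e₂).symm.trans (h'.brk e₁ e₂)
    have h4 := congrArg (fun g : Fin (finrank ℝ F) → c.Coeff => g b x) h3
    simp only [StrFun.brk_apply_of_pd_eq_zero _ h1' h2', h1, h2] at h4
    rwa [sum_sum_mul_single (fun k m => f.f₃ b k m x),
      sum_sum_mul_single (fun k m => g.f₃ b k m x)] at h4

variable {θ₂ θ₁₃ θ₄ θ₂' θ₁₃' θ₄' : Families (d := d) F E}

omit [IsManifold (𝓡 d) ∞ M] [T2Space M] [SigmaCompactSpace M] [VectorBundle ℝ F E]
  [FiniteDimensional ℝ F] [ContMDiffVectorBundle ∞ F E (𝓡 d)] in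
lemma _root_.QP3.existsUnique_strFun_of_mem (h₂ : θ₂ ∈ bidegreePart F E 4 0)
    (h₁₃ : θ₁₃ ∈ bidegreePart F E 2 2) (h₄ : θ₄ ∈ bidegreePart F E 0 4)
    (c : NatChart (d := d) F E) :
    ∃! f : StrFun c, θ₂ c = f.theta2 ∧ θ₁₃ c = f.theta13 ∧ θ₄ c = f.theta4 :=
  existsUnique_strFun c ((mem_bidegreePart_iff.mp h₂).2 c) ((mem_bidegreePart_iff.mp h₁₃).2 c)
    ((mem_bidegreePart_iff.mp h₄).2 c)

omit [T2Space M] [SigmaCompactSpace M] in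
theorem exists_derivedFrom (h₂ : θ₂ ∈ bidegreePart F E 4 0)
    (h₁₃ : θ₁₃ ∈ bidegreePart F E 2 2) (h₄ : θ₄ ∈ bidegreePart F E 0 4) :
    ∃ D : Operations (d := d) F E, D.DerivedFrom θ₂ θ₁₃ θ₄ := by
  choose f hf _ using existsUnique_strFun_of_mem h₂ h₁₃ h₄
  have h : ∀ (c c' : NatChart (d := d) F E) (x : M) (hx : x ∈ c.dom) (hx' : x ∈ c'.dom),
      (f c).Agree (f c') hx hx' := fun c c' x hx hx' => by
    rw [StrFun.agree_iff]
    simp only [← (hf _).1, ← (hf _).2.1, ← (hf _).2.2]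
    exact ⟨(mem_bidegreePart_iff.mp h₂).1 c c' x hx hx',
      (mem_bidegreePart_iff.mp h₁₃).1 c c' x hx hx', (mem_bidegreePart_iff.mp h₄).1 c c' x hx hx'⟩
  exact ⟨ofStrFun h, derivedFrom_of_rep hf (rep_ofStrFun h)⟩

theorem DerivedFrom.unique {D D' : Operations (d := d) F E} (h₂ : θ₂ ∈ bidegreePart F E 4 0)
    (h₁₃ : θ₁₃ ∈ bidegreePart F E 2 2) (h₄ : θ₄ ∈ bidegreePart F E 0 4)
    (h : D.DerivedFrom θ₂ θ₁₃ θ₄) (h' : D'.DerivedFrom θ₂ θ₁₃ θ₄) : D = D' := by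
  choose f hf _ using existsUnique_strFun_of_mem h₂ h₁₃ h₄
  exact ext_of_rep (fun c => rep_of_derivedFrom (hf c) h) fun c => rep_of_derivedFrom (hf c) h'

theorem DerivedFrom.theta_unique {D : Operations (d := d) F E} (h₂ : θ₂ ∈ bidegreePart F E 4 0)
    (h₁₃ : θ₁₃ ∈ bidegreePart F E 2 2) (h₄ : θ₄ ∈ bidegreePart F E 0 4)
    (h₂' : θ₂' ∈ bidegreePart F E 4 0) (h₁₃' : θ₁₃' ∈ bidegreePart F E 2 2)
    (h₄' : θ₄' ∈ bidegreePart F E 0 4) (h : D.DerivedFrom θ₂ θ₁₃ θ₄)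
    (h' : D.DerivedFrom θ₂' θ₁₃' θ₄') : θ₂ = θ₂' ∧ θ₁₃ = θ₁₃' ∧ θ₄ = θ₄' := by
  choose f hf _ using existsUnique_strFun_of_mem h₂ h₁₃ h₄
  choose g hg _ using existsUnique_strFun_of_mem h₂' h₁₃' h₄'
  have hfg : ∀ c, f c = g c := fun c =>
    (rep_of_derivedFrom (hf c) h).unique (rep_of_derivedFrom (hg c) h')
  refine ⟨funext fun c => ?_, funext fun c => ?_, funext fun c => ?_⟩
  · rw [(hf c).1, (hg c).1, hfg]
  · rw [(hf c).2.1, (hg c).2.1, hfg]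
  · rw [(hf c).2.2, (hg c).2.2, hfg]

/-- Only (A1) is needed here: the remaining axioms restrict the functions, not the correspondence
between functions and operations. -/
theorem exists_theta {D : Operations (d := d) F E} (hD : D.A1) :
    ∃ θ₂ ∈ bidegreePart F E 4 0, ∃ θ₁₃ ∈ bidegreePart F E 2 2, ∃ θ₄ ∈ bidegreePart F E 0 4,
      D.DerivedFrom θ₂ θ₁₃ θ₄ := by
  choose f hf using exists_rep hD
  have h := fun (c c' : NatChart (d := d) F E) (x : M) (hx : x ∈ c.dom) (hx' : x ∈ c'.dom) =>
    (StrFun.agree_iff _ _ _ _).mp ((hf c).agree (hf c') hx hx')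
  refine ⟨fun c => (f c).theta2, mem_bidegreePart_iff.mpr
      ⟨fun c c' x hx hx' => (h c c' x hx hx').1, fun c => (f c).theta2_mem⟩,
    fun c => (f c).theta13, mem_bidegreePart_iff.mpr
      ⟨fun c c' x hx hx' => (h c c' x hx hx').2.1, fun c => (f c).theta13_mem⟩,
    fun c => (f c).theta4, mem_bidegreePart_iff.mpr
      ⟨fun c c' x hx hx' => (h c c' x hx hx').2.2, fun c => (f c).theta4_mem⟩,
    derivedFrom_of_rep (fun c => ⟨rfl, rfl, rfl⟩) hf⟩

end Operations

end QP3
end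

noncomputable section

namespace QP3

variable {d : ℕ} {M : Type*} [TopologicalSpace M] [ChartedSpace (EuclideanSpace ℝ (Fin d)) M]
variable {F : Type*} [NormedAddCommGroup F] [NormedSpace ℝ F]
variable {E : M → Type*} [TopologicalSpace (TotalSpace F E)] [∀ x, TopologicalSpace (E x)]
  [∀ x, AddCommGroup (E x)] [∀ x, Module ℝ (E x)] [FiberBundle F E]

/-! ### The identities between the local operations -/

namespace StrFun

variable {c : NatChart (d := d) F E} [IsManifold (𝓡 d) ∞ M] (f : StrFun c)

lemma act_mul (g : Fin (finrank ℝ F) → c.Coeff) (u v : c.Coeff) :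
    f.act g (u * v) = f.act g u * v + u * f.act g v := by
  simp only [act, c.pd_mul, mul_add, Finset.sum_add_distrib, neg_add, neg_mul, Finset.sum_mul,
    mul_neg, Finset.mul_sum]
  congr 2 <;> exact Finset.sum_congr rfl fun i _ => Finset.sum_congr rfl fun a _ => by ring

lemma act_sum {κ : Type*} (s : Finset κ) (g : Fin (finrank ℝ F) → c.Coeff) (u : κ → c.Coeff) :
    f.act g (∑ k ∈ s, u k) = ∑ k ∈ s, f.act g (u k) := by
  classical
  induction s using Finset.induction_on with
  | empty => simp [act]
  | insert a s ha ih => rw [Finset.sum_insert ha, Finset.sum_insert ha, act_add_right, ih]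

lemma act_neg_right (g : Fin (finrank ℝ F) → c.Coeff) (u : c.Coeff) :
    f.act g (-u) = -f.act g u := by
  simp only [act, map_neg, mul_neg, Finset.sum_neg_distrib]

lemma act_sub_right (g : Fin (finrank ℝ F) → c.Coeff) (u v : c.Coeff) :
    f.act g (u - v) = f.act g u - f.act g v := by
  rw [sub_eq_add_neg, act_add_right, act_neg_right, ← sub_eq_add_neg]

/-- The part of the bracket of sections that is bilinear over the functions. -/
def tor (g h : Fin (finrank ℝ F) → c.Coeff) : Fin (finrank ℝ F) → c.Coeff := fun b =>
  ∑ m, ∑ a, f.f₃ b m a * g a * h m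

lemma brk_eq (g h : Fin (finrank ℝ F) → c.Coeff) :
    f.brk g h = (fun b => f.act g (h b)) - (fun b => f.act h (g b)) + f.tor g h := rfl

omit [IsManifold (𝓡 d) ∞ M] in
lemma tor_add_left (g g' h : Fin (finrank ℝ F) → c.Coeff) :
    f.tor (g + g') h = f.tor g h + f.tor g' h := by
  funext b
  simp only [tor, Pi.add_apply, mul_add, add_mul, Finset.sum_add_distrib]

omit [IsManifold (𝓡 d) ∞ M] in
lemma tor_sub_left (g g' h : Fin (finrank ℝ F) → c.Coeff) :
    f.tor (g - g') h = f.tor g h - f.tor g' h := by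
  funext b
  simp only [tor, Pi.sub_apply, mul_sub, sub_mul, Finset.sum_sub_distrib]

omit [IsManifold (𝓡 d) ∞ M] in
lemma tor_skew (g h : Fin (finrank ℝ F) → c.Coeff) : f.tor g h = -f.tor h g := by
  funext b
  simp only [tor, Pi.neg_apply]
  rw [Finset.sum_comm, ← Finset.sum_neg_distrib]
  refine Finset.sum_congr rfl fun a _ => ?_
  rw [← Finset.sum_neg_distrib]
  refine Finset.sum_congr rfl fun m _ => ?_
  rw [f.f₃_skew b m a]
  ring

lemma act_tor (g h k : Fin (finrank ℝ F) → c.Coeff) (b : Fin (finrank ℝ F)) :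
    f.act k (f.tor g h b) = ∑ m, ∑ a, f.act k (f.f₃ b m a) * g a * h m +
      f.tor (fun a => f.act k (g a)) h b + f.tor g (fun a => f.act k (h a)) b := by
  simp only [tor, act_sum, act_mul, add_mul, Finset.sum_add_distrib]

/-- The failure of the anchor to be compatible with the bracket of two sections. -/
def curv (g h : Fin (finrank ℝ F) → c.Coeff) (u : c.Coeff) : c.Coeff :=
  f.act (f.brk g h) u - (f.act g (f.act h u) - f.act h (f.act g u))

/-- The part of the Jacobiator that is multilinear over the functions, before summing over the
cyclic permutations. -/
def torTor (g h k : Fin (finrank ℝ F) → c.Coeff) (b : Fin (finrank ℝ F)) : c.Coeff :=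
  f.tor (f.tor g h) k b - ∑ m, ∑ a, f.act k (f.f₃ b m a) * g a * h m

/-- In the cyclic sum the terms where an anchor differentiates an argument of `tor` cancel in pairs.
What remains is the curvature of the anchor acting on the third section and a part without
derivatives of the sections. -/
lemma brk_brk (g h k : Fin (finrank ℝ F) → c.Coeff) (b : Fin (finrank ℝ F)) :
    f.brk (f.brk g h) k b + f.brk (f.brk h k) g b + f.brk (f.brk k g) h b =
      (f.curv g h (k b) + f.curv h k (g b) + f.curv k g (h b)) +
      (f.torTor g h k b + f.torTor h k g b + f.torTor k g h b) := by
  have h1 : ∀ g h k : Fin (finrank ℝ F) → c.Coeff, f.brk (f.brk g h) k b =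
      f.act (f.brk g h) (k b) - (f.act k (f.act g (h b)) - f.act k (f.act h (g b))) +
        f.torTor g h k b + f.tor (fun b => f.act g (h b)) k b - f.tor (fun b => f.act h (g b)) k b -
        f.tor (fun a => f.act k (g a)) h b + f.tor (fun a => f.act k (h a)) g b := by
    intro g h k
    have e1 : f.brk (f.brk g h) k b = f.act (f.brk g h) (k b) - f.act k (f.brk g h b) +
      f.tor (f.brk g h) k b := rfl
    have e2 : f.brk g h b = f.act g (h b) - f.act h (g b) + f.tor g h b := rfl
    have e3 : f.tor (f.brk g h) k b = f.tor (fun b => f.act g (h b)) k b -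
        f.tor (fun b => f.act h (g b)) k b + f.tor (f.tor g h) k b := by
      rw [brk_eq, tor_add_left, tor_sub_left]
      rfl
    have e4 : f.tor g (fun a => f.act k (h a)) b = -f.tor (fun a => f.act k (h a)) g b := by
      rw [tor_skew]
      rfl
    rw [e1, e3, e2, act_add_right, act_sub_right, act_tor, e4, torTor]
    ring
  rw [h1 g h k, h1 h k g, h1 k g h]
  simp only [curv]
  ring

/-- The left-hand side of `FC3`. -/
def fc3 (i : Fin d) (a b : Fin (finrank ℝ F)) : c.Coeff :=
  ∑ k, (f.f₁ k b * c.pd k (f.f₁ i a) - f.f₁ k a * c.pd k (f.f₁ i b)) + ∑ m, f.f₁ i m * f.f₃ m a b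

lemma sum_mul_f₁ (g : Fin (finrank ℝ F) → c.Coeff) (u : c.Coeff) :
    f.act g u = -∑ a, ∑ k, f.f₁ k a * g a * c.pd k u := by
  rw [act, Finset.sum_comm]
  simp only [Finset.sum_mul]

/-- Up to sign this is the `j`-th component of `[ρ(e₁), ρ(e₂)] - ρ[e₁, e₂]`; the derivatives of `g`
and `h` cancel and `fc3` is left. -/
lemma act_sub_act_sub_sum_brk (g h : Fin (finrank ℝ F) → c.Coeff) (j : Fin d) :
    f.act g (∑ b, f.f₁ j b * h b) - f.act h (∑ b, f.f₁ j b * g b) - ∑ b, f.f₁ j b * f.brk g h b =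
      ∑ a, ∑ b, f.fc3 j a b * g a * h b := by
  have e2 : ∀ b, f.brk g h b = f.act g (h b) - f.act h (g b) + f.tor g h b := fun b => rfl
  have e3 : ∀ g h : Fin (finrank ℝ F) → c.Coeff, ∑ b, f.act g (f.f₁ j b) * h b =
      -∑ a, ∑ b, (∑ k, f.f₁ k a * c.pd k (f.f₁ j b)) * g a * h b := by
    intro g h
    rw [Finset.sum_comm, ← Finset.sum_neg_distrib]
    refine Finset.sum_congr rfl fun b _ => ?_
    rw [sum_mul_f₁, neg_mul, Finset.sum_mul]
    congr 1
    refine Finset.sum_congr rfl fun a _ => ?_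
    rw [Finset.sum_mul, Finset.sum_mul, Finset.sum_mul]
    exact Finset.sum_congr rfl fun k _ => by ring
  have e4 : ∑ b, f.f₁ j b * f.tor g h b =
      -∑ a, ∑ b, (∑ m, f.f₁ j m * f.f₃ m a b) * g a * h b := by
    simp only [tor, Finset.mul_sum, Finset.sum_mul]
    rw [Finset.sum_congr rfl fun m _ => Finset.sum_comm, Finset.sum_comm, ← Finset.sum_neg_distrib]
    refine Finset.sum_congr rfl fun a _ => ?_
    rw [Finset.sum_comm, ← Finset.sum_neg_distrib]
    refine Finset.sum_congr rfl fun b _ => ?_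
    rw [← Finset.sum_neg_distrib]
    refine Finset.sum_congr rfl fun m _ => ?_
    rw [f.f₃_skew m b a]
    ring
  have e5 : ∑ a, ∑ b, (∑ k, f.f₁ k a * c.pd k (f.f₁ j b)) * h a * g b =
      ∑ a, ∑ b, (∑ k, f.f₁ k b * c.pd k (f.f₁ j a)) * g a * h b := by
    rw [Finset.sum_comm]
    exact Finset.sum_congr rfl fun _ _ => Finset.sum_congr rfl fun _ _ => by ring
  simp only [act_sum, act_mul, Finset.sum_add_distrib, e2, mul_add, mul_sub,
    Finset.sum_sub_distrib, e3 g h, e3 h g, e4, e5, fc3, add_mul, sub_mul]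
  ring

/-- The second derivatives of `u` cancel because partial derivatives commute, so the curvature is a
first-order operator in `u`. -/
lemma curv_eq (g h : Fin (finrank ℝ F) → c.Coeff) (u : c.Coeff) :
    f.curv g h u = ∑ i, (∑ a, ∑ b, f.fc3 i a b * g a * h b) * c.pd i u := by
  have hact : ∀ (g h : Fin (finrank ℝ F) → c.Coeff), f.act g (f.act h u) =
      -∑ j, f.act g (∑ b, f.f₁ j b * h b) * c.pd j u +
        ∑ j, ∑ i, (∑ b, f.f₁ j b * h b) * (∑ a, f.f₁ i a * g a) * c.pd i (c.pd j u) := by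
    intro g h
    have e : f.act h u = -∑ j, (∑ b, f.f₁ j b * h b) * c.pd j u := rfl
    rw [e, act_neg_right, act_sum]
    simp only [act_mul, Finset.sum_add_distrib, neg_add]
    congr 1
    rw [← Finset.sum_neg_distrib]
    refine Finset.sum_congr rfl fun j _ => ?_
    rw [act, mul_neg, neg_neg, Finset.mul_sum]
    exact Finset.sum_congr rfl fun i _ => by ring
  have hcomm : ∑ j, ∑ i, (∑ b, f.f₁ j b * h b) * (∑ a, f.f₁ i a * g a) * c.pd i (c.pd j u) =
      ∑ j, ∑ i, (∑ b, f.f₁ j b * g b) * (∑ a, f.f₁ i a * h a) * c.pd i (c.pd j u) := by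
    rw [Finset.sum_comm]
    refine Finset.sum_congr rfl fun j _ => Finset.sum_congr rfl fun i _ => ?_
    rw [c.pd_comm]
    ring
  have h0 : f.act (f.brk g h) u = -∑ j, (∑ b, f.f₁ j b * f.brk g h b) * c.pd j u := rfl
  rw [curv, h0, hact g h, hact h g, hcomm]
  simp only [← act_sub_act_sub_sum_brk, sub_mul, Finset.sum_sub_distrib]
  ring

/-- The coefficients of the multilinear part of the Jacobiator, before summing over the cyclic
permutations. -/
def fc4Aux (b a m p : Fin (finrank ℝ F)) : c.Coeff :=
  ∑ i, f.f₁ i p * c.pd i (f.f₃ b m a) + ∑ n, f.f₃ b p n * f.f₃ n m a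

lemma torTor_eq (g h k : Fin (finrank ℝ F) → c.Coeff) (b : Fin (finrank ℝ F)) :
    f.torTor g h k b = ∑ a, ∑ m, ∑ p, f.fc4Aux b a m p * g a * h m * k p := by
  have h1 : f.tor (f.tor g h) k b =
      ∑ a, ∑ m, ∑ p, (∑ n, f.f₃ b p n * f.f₃ n m a) * g a * h m * k p := by
    simp only [tor, Finset.mul_sum, Finset.sum_mul]
    symm
    rw [Finset.sum_comm]
    rw [Finset.sum_congr rfl fun m _ => Finset.sum_comm]
    rw [Finset.sum_comm]
    refine Finset.sum_congr rfl fun p _ => ?_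
    rw [Finset.sum_congr rfl fun m _ => Finset.sum_comm]
    rw [Finset.sum_comm]
    exact Finset.sum_congr rfl fun n _ => Finset.sum_congr rfl fun m _ =>
      Finset.sum_congr rfl fun a _ => by ring
  have h2 : ∑ m, ∑ a, f.act k (f.f₃ b m a) * g a * h m =
      -∑ a, ∑ m, ∑ p, (∑ i, f.f₁ i p * c.pd i (f.f₃ b m a)) * g a * h m * k p := by
    rw [Finset.sum_comm, ← Finset.sum_neg_distrib]
    refine Finset.sum_congr rfl fun a _ => ?_
    rw [← Finset.sum_neg_distrib]
    refine Finset.sum_congr rfl fun m _ => ?_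
    rw [sum_mul_f₁, neg_mul, neg_mul, Finset.sum_mul, Finset.sum_mul]
    congr 1
    refine Finset.sum_congr rfl fun p _ => ?_
    simp only [Finset.sum_mul]
    exact Finset.sum_congr rfl fun i _ => by ring
  rw [torTor, h1, h2, sub_neg_eq_add]
  simp only [fc4Aux, add_mul, Finset.sum_add_distrib]
  ring

/-- The left-hand side of `FC4`. -/
def fc4 (a : Fin (finrank ℝ F)) (l : Fin 3 → Fin (finrank ℝ F)) : c.Coeff :=
  (1 / 2 : ℝ) • altSum (fun l => ∑ k, f.f₁ k (l 2) * c.pd k (f.f₃ a (l 0) (l 1))) l +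
    ∑ m, f.f₂ a m * f.f₄ (l 0) (l 1) (l 2) m -
    (1 / 2 : ℝ) • altSum (fun l => ∑ m, f.f₃ a m (l 0) * f.f₃ m (l 1) (l 2)) l

end StrFun

lemma altSum_three {ι R : Type*} [AddCommGroup R] [Module ℝ R] (T : (Fin 3 → ι) → R) (a b c : ι) :
    altSum T ![a, b, c] = T ![a, b, c] + T ![b, c, a] + T ![c, a, b] -
      (T ![b, a, c] + T ![a, c, b] + T ![c, b, a]) := by
  have h1 : (Finset.univ : Finset (Equiv.Perm (Fin 3))) = {1, Equiv.swap 0 1, Equiv.swap 0 2,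
    Equiv.swap 1 2, finRotate 3, (finRotate 3)⁻¹} := by decide
  have e1 : ![a, b, c] ∘ (1 : Equiv.Perm (Fin 3)) = ![a, b, c] := rfl
  have e2 : ![a, b, c] ∘ (Equiv.swap 0 1 : Equiv.Perm (Fin 3)) = ![b, a, c] := by
    funext i; fin_cases i <;> rfl
  have e3 : ![a, b, c] ∘ (Equiv.swap 0 2 : Equiv.Perm (Fin 3)) = ![c, b, a] := by
    funext i; fin_cases i <;> rfl
  have e4 : ![a, b, c] ∘ (Equiv.swap 1 2 : Equiv.Perm (Fin 3)) = ![a, c, b] := by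
    funext i; fin_cases i <;> rfl
  have e5 : ![a, b, c] ∘ (finRotate 3 : Equiv.Perm (Fin 3)) = ![b, c, a] := by
    funext i; fin_cases i <;> rfl
  have e6 : ![a, b, c] ∘ ((finRotate 3)⁻¹ : Equiv.Perm (Fin 3)) = ![c, a, b] := by
    funext i; fin_cases i <;> rfl
  have s2 : Equiv.Perm.sign (Equiv.swap 0 1 : Equiv.Perm (Fin 3)) = -1 := by decide
  have s3 : Equiv.Perm.sign (Equiv.swap 0 2 : Equiv.Perm (Fin 3)) = -1 := by decide
  have s4 : Equiv.Perm.sign (Equiv.swap 1 2 : Equiv.Perm (Fin 3)) = -1 := by decide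
  have s5 : Equiv.Perm.sign (finRotate 3 : Equiv.Perm (Fin 3)) = 1 := by decide
  have s6 : Equiv.Perm.sign ((finRotate 3)⁻¹ : Equiv.Perm (Fin 3)) = 1 := by decide
  rw [altSum, h1, Finset.sum_insert (by decide), Finset.sum_insert (by decide),
    Finset.sum_insert (by decide), Finset.sum_insert (by decide), Finset.sum_insert (by decide),
    Finset.sum_singleton, e1, e2, e3, e4, e5, e6, s2, s3, s4, s5, s6, Equiv.Perm.sign_one]
  simp only [Units.val_one, Int.cast_one, one_smul, Units.val_neg, Int.cast_neg, neg_smul]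
  abel

/-- An alternating sum over three indices of a function that is skew in the first two. -/
lemma half_altSum_three_of_skew_left {ι R : Type*} [AddCommGroup R] [Module ℝ R]
    {T : (Fin 3 → ι) → R} (hT : ∀ a b c, T ![b, a, c] = -T ![a, b, c]) (a b c : ι) :
    (1 / 2 : ℝ) • altSum T ![a, b, c] = T ![a, b, c] + T ![b, c, a] + T ![c, a, b] := by
  rw [altSum_three, hT a b c, hT c a b, hT b c a]
  module

/-- An alternating sum over three indices of a function that is skew in the last two. -/
lemma half_altSum_three_of_skew_right {ι R : Type*} [AddCommGroup R] [Module ℝ R]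
    {T : (Fin 3 → ι) → R} (hT : ∀ a b c, T ![a, c, b] = -T ![a, b, c]) (a b c : ι) :
    (1 / 2 : ℝ) • altSum T ![a, b, c] = T ![a, b, c] + T ![b, c, a] + T ![c, a, b] := by
  rw [altSum_three, hT a b c, hT b c a, hT c a b]
  module

namespace StrFun

variable {c : NatChart (d := d) F E} [IsManifold (𝓡 d) ∞ M] (f : StrFun c)

/-- Each summand is already skew in two of its three indices, so one half of the alternating sum is
a cyclic sum; the signs then come from the skewness of `f₃`. -/
lemma fc4_eq (b a m p : Fin (finrank ℝ F)) :
    f.fc4 b ![a, m, p] = ∑ n, f.f₂ b n * f.f₄ a m p n -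
      (f.fc4Aux b a m p + f.fc4Aux b m p a + f.fc4Aux b p a m) := by
  rw [fc4, half_altSum_three_of_skew_left, half_altSum_three_of_skew_right]
  · have h1 : ∀ a m p, f.fc4Aux b a m p = -∑ k, f.f₁ k p * c.pd k (f.f₃ b a m) +
        ∑ n, f.f₃ b n p * f.f₃ n a m := by
      intro a m p
      rw [fc4Aux, ← Finset.sum_neg_distrib]
      congr 1
      · refine Finset.sum_congr rfl fun k _ => ?_
        rw [f.f₃_skew b m a, map_neg, mul_neg]
      · refine Finset.sum_congr rfl fun n _ => ?_
        rw [f.f₃_skew b p n, f.f₃_skew n m a]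
        ring
    rw [h1, h1, h1]
    simp only [Matrix.cons_val_zero, Matrix.cons_val_one, Matrix.cons_val]
    ring
  · intro a p m
    simp only [Matrix.cons_val_zero, Matrix.cons_val_one, Matrix.cons_val, ← Finset.sum_neg_distrib]
    refine Finset.sum_congr rfl fun n _ => ?_
    rw [f.f₃_skew n m p]
    ring
  · intro a m p
    simp only [Matrix.cons_val_zero, Matrix.cons_val_one, Matrix.cons_val, ← Finset.sum_neg_distrib]
    refine Finset.sum_congr rfl fun n _ => ?_
    rw [f.f₃_skew b m a, map_neg]
    ring

/-- Relabelling the summation indices cyclically puts the three terms over the same product of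
components, where `fc4_eq` applies. -/
lemma torTor_cyclic (g h k : Fin (finrank ℝ F) → c.Coeff) (b : Fin (finrank ℝ F)) :
    f.torTor g h k b + f.torTor h k g b + f.torTor k g h b =
      ∑ a, ∑ m, ∑ p, (∑ n, f.f₂ b n * f.f₄ a m p n - f.fc4 b ![a, m, p]) * g a * h m * k p := by
  have h1 : f.torTor h k g b = ∑ a, ∑ m, ∑ p, f.fc4Aux b m p a * g a * h m * k p := by
    rw [torTor_eq]
    symm
    rw [Finset.sum_comm]
    refine Finset.sum_congr rfl fun m _ => ?_
    rw [Finset.sum_comm]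
    exact Finset.sum_congr rfl fun p _ => Finset.sum_congr rfl fun a _ => by ring
  have h2 : f.torTor k g h b = ∑ a, ∑ m, ∑ p, f.fc4Aux b p a m * g a * h m * k p := by
    rw [torTor_eq]
    rw [Finset.sum_comm]
    refine Finset.sum_congr rfl fun a _ => ?_
    rw [Finset.sum_comm]
    exact Finset.sum_congr rfl fun p _ => Finset.sum_congr rfl fun m _ => by ring
  rw [h1, h2, torTor_eq]
  simp only [← Finset.sum_add_distrib, fc4_eq]
  exact Finset.sum_congr rfl fun a _ => Finset.sum_congr rfl fun m _ =>
    Finset.sum_congr rfl fun p _ => by ring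

/-- The left-hand side of `FC1`. -/
def fc1 (i : Fin d) (a : Fin (finrank ℝ F)) : c.Coeff := ∑ b, f.f₁ i b * f.f₂ b a

/-- The left-hand side of `FC2`. -/
def fc2 (a b m : Fin (finrank ℝ F)) : c.Coeff :=
  ∑ k, f.f₁ k m * c.pd k (f.f₂ a b) + ∑ n, (f.f₂ n a * f.f₃ b m n + f.f₂ n b * f.f₃ a m n)

/-- The coefficients of the Lie derivative of a section of the dual bundle. -/
def lie (g α : Fin (finrank ℝ F) → c.Coeff) (m : Fin (finrank ℝ F)) : c.Coeff :=
  f.act g (α m) - ∑ b, (∑ a, f.f₃ b m a * g a + ∑ i, f.f₁ i m * c.pd i (g b)) * α b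

/-- The derivatives of `h` cancel, so the defining formula of the Lie derivative is linear over
functions in `h`, with coefficients `lie`. -/
lemma act_sum_mul_sub (g α h : Fin (finrank ℝ F) → c.Coeff) :
    f.act g (∑ m, α m * h m) - ∑ b, α b * f.brk g h b = ∑ m, f.lie g α m * h m := by
  have h1 : ∑ b, α b * f.brk g h b = ∑ b, α b * f.act g (h b) +
      ∑ m, (∑ b, (∑ a, f.f₃ b m a * g a + ∑ i, f.f₁ i m * c.pd i (g b)) * α b) * h m := by
    have h2 : ∑ m, (∑ b, (∑ a, f.f₃ b m a * g a + ∑ i, f.f₁ i m * c.pd i (g b)) * α b) * h m =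
        ∑ b, α b * (f.tor g h b - f.act h (g b)) := by
      simp only [sum_mul_f₁, tor, sub_neg_eq_add, ← Finset.sum_add_distrib, Finset.mul_sum,
        Finset.sum_mul]
      rw [Finset.sum_comm]
      refine Finset.sum_congr rfl fun b _ => Finset.sum_congr rfl fun m _ => ?_
      rw [add_mul, add_mul, mul_add, Finset.mul_sum, Finset.mul_sum, Finset.sum_mul, Finset.sum_mul,
        Finset.sum_mul, Finset.sum_mul]
      congr 1 <;> exact Finset.sum_congr rfl fun _ _ => by ring
    rw [h2, ← Finset.sum_add_distrib]
    refine Finset.sum_congr rfl fun b _ => ?_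
    have e2 : f.brk g h b = f.act g (h b) - f.act h (g b) + f.tor g h b := rfl
    rw [e2]
    ring
  rw [h1, act_sum]
  simp only [act_mul, lie, sub_mul, Finset.sum_sub_distrib, Finset.sum_add_distrib]
  ring

/-- The pairing of sections of the dual bundle. -/
def pair (α β : Fin (finrank ℝ F) → c.Coeff) : c.Coeff := ∑ b, (∑ a, f.f₂ a b * α a) * β b

/-- The defect of (A4) contains derivatives of `g` with coefficients `fc1`. For this reason (A4) is
matched with `FC2` only in conjunction with (A3). -/
lemma act_pair_sub (g α β : Fin (finrank ℝ F) → c.Coeff) :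
    f.act g (f.pair α β) - (∑ m, f.lie g α m * (∑ a, f.f₂ a m * β a) +
      ∑ m, f.lie g β m * (∑ a, f.f₂ a m * α a)) =
    ∑ a, ∑ b, (-∑ k, g k * f.fc2 a b k +
      ∑ i, (f.fc1 i b * c.pd i (g a) + f.fc1 i a * c.pd i (g b))) * α a * β b := by
  have h0 : f.pair α β = ∑ a, ∑ b, f.f₂ a b * α a * β b := by
    rw [pair, Finset.sum_comm]
    simp only [Finset.sum_mul]
  set P : Fin (finrank ℝ F) → Fin (finrank ℝ F) → c.Coeff := fun b m =>
    ∑ a, f.f₃ b m a * g a + ∑ i, f.f₁ i m * c.pd i (g b) with hP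
  have h1 : ∀ α β : Fin (finrank ℝ F) → c.Coeff, ∑ m, f.lie g α m * (∑ a, f.f₂ a m * β a) =
      ∑ a, ∑ b, f.f₂ a b * f.act g (α a) * β b - ∑ a, ∑ b, (∑ m, P a m * f.f₂ b m) * α a * β b := by
    intro α β
    have e : ∀ m, f.lie g α m = f.act g (α m) - ∑ b, P b m * α b := fun m => rfl
    simp only [e, sub_mul, Finset.sum_sub_distrib, Finset.mul_sum, Finset.sum_mul]
    congr 1
    · refine Finset.sum_congr rfl fun a _ => Finset.sum_congr rfl fun b _ => ?_
      rw [f.f₂_symm b a]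
      ring
    · symm
      rw [Finset.sum_congr rfl fun a _ => Finset.sum_comm, Finset.sum_comm]
      refine Finset.sum_congr rfl fun m _ => ?_
      rw [Finset.sum_comm]
      exact Finset.sum_congr rfl fun b _ => Finset.sum_congr rfl fun a _ => by ring
  have h2 : ∑ a, ∑ b, f.f₂ a b * f.act g (β a) * α b = ∑ a, ∑ b, f.f₂ a b * α a * f.act g (β b) := by
    rw [Finset.sum_comm]
    refine Finset.sum_congr rfl fun a _ => Finset.sum_congr rfl fun b _ => ?_
    rw [f.f₂_symm b a]
    ring
  have h3 : ∑ a, ∑ b, (∑ m, P a m * f.f₂ b m) * β a * α b =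
      ∑ a, ∑ b, (∑ m, P b m * f.f₂ a m) * α a * β b := by
    rw [Finset.sum_comm]
    exact Finset.sum_congr rfl fun a _ => Finset.sum_congr rfl fun b _ => by ring
  have h4 : ∀ a b, ∑ m, P a m * f.f₂ b m =
      -∑ k, g k * (∑ n, f.f₂ n b * f.f₃ a k n) + ∑ i, f.fc1 i b * c.pd i (g a) := by
    intro a b
    simp only [hP, add_mul, Finset.sum_add_distrib, fc1, Finset.sum_mul, Finset.mul_sum]
    congr 1
    · rw [Finset.sum_comm, ← Finset.sum_neg_distrib]
      refine Finset.sum_congr rfl fun k _ => ?_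
      rw [← Finset.sum_neg_distrib]
      refine Finset.sum_congr rfl fun n _ => ?_
      rw [f.f₃_skew a n k, f.f₂_symm b n]
      ring
    · rw [Finset.sum_comm]
      refine Finset.sum_congr rfl fun k _ => Finset.sum_congr rfl fun n _ => ?_
      rw [f.f₂_symm b n]
      ring
  have h5 : ∀ a b, f.act g (f.f₂ a b) = -∑ k, g k * (∑ i, f.f₁ i k * c.pd i (f.f₂ a b)) := by
    intro a b
    rw [sum_mul_f₁]
    congr 1
    refine Finset.sum_congr rfl fun k _ => ?_
    rw [Finset.mul_sum]
    exact Finset.sum_congr rfl fun i _ => by ring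
  have h6 : ∀ a b, -∑ k, g k * f.fc2 a b k +
      ∑ i, (f.fc1 i b * c.pd i (g a) + f.fc1 i a * c.pd i (g b)) =
      f.act g (f.f₂ a b) + ∑ m, P a m * f.f₂ b m + ∑ m, P b m * f.f₂ a m := by
    intro a b
    rw [h4, h4, h5]
    simp only [fc2, mul_add, Finset.sum_add_distrib]
    ring
  rw [h0, h1, h1, h2, h3]
  simp only [h6]
  simp only [act_sum, act_mul, add_mul, Finset.sum_add_distrib]
  ring

end StrFun

end QP3

end

noncomputable section

namespace QP3

variable {d : ℕ} {M : Type*} [TopologicalSpace M] [ChartedSpace (EuclideanSpace ℝ (Fin d)) M]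
variable {F : Type*} [NormedAddCommGroup F] [NormedSpace ℝ F]
variable {E : M → Type*} [TopologicalSpace (TotalSpace F E)] [∀ x, TopologicalSpace (E x)]
  [∀ x, AddCommGroup (E x)] [∀ x, Module ℝ (E x)] [FiberBundle F E]

/-! ### The axioms in terms of the structure functions -/

lemma NatChart.evalCoeff_apply (c : NatChart (d := d) F E) (x : c.dom) (u : c.Coeff) :
    c.evalCoeff x u = u x := rfl

/-- The Lie bracket of vector fields in coordinates. -/
lemma NatChart.vcoord_mlieBracket [IsManifold (𝓡 d) ∞ M] (c : NatChart (d := d) F E) {x : M}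
    (hx : x ∈ c.chart.source) {X Y : ∀ x : M, TangentSpace (𝓡 d) x}
    (hX : SmoothSecOn (d := d) (EuclideanSpace ℝ (Fin d)) (fun x : M => TangentSpace (𝓡 d) x) X
      c.chart.source)
    (hY : SmoothSecOn (d := d) (EuclideanSpace ℝ (Fin d)) (fun x : M => TangentSpace (𝓡 d) x) Y
      c.chart.source) (i : Fin d) :
    c.vcoord x i (VectorField.mlieBracket (𝓡 d) X Y x) =
      ∑ j, (c.vcoord x j (X x) * c.D j (fun y => c.vcoord y i (Y y)) x -
        c.vcoord x j (Y x) * c.D j (fun y => c.vcoord y i (X y)) x) := by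
  -- `V X` is the field `X` transported to the model space by the chart, where the Lie bracket is
  -- the usual one.
  let V : (∀ x : M, TangentSpace (𝓡 d) x) → EuclideanSpace ℝ (Fin d) → EuclideanSpace ℝ (Fin d) :=
    fun X w => mfderiv (𝓡 d) (𝓡 d) c.chart (c.chart.symm w) (X (c.chart.symm w))
  have hz := c.chart.map_source hx
  have hn : minSmoothness ℝ 2 ≤ (∞ : ℕ∞ω) := by
    rw [minSmoothness_of_isRCLikeNormedField]
    exact WithTop.coe_le_coe.2 (le_top (a := (2 : ℕ∞)))
  have : IsManifold (𝓡 d) (minSmoothness ℝ 2) M := IsManifold.of_le hn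
  have hinv : ∀ w ∈ c.chart.target, (mfderiv (𝓡 d) (𝓡 d) c.chart.symm w).inverse =
      mfderiv (𝓡 d) (𝓡 d) c.chart (c.chart.symm w) := by
    intro w hw
    refine ContinuousLinearMap.inverse_eq ?_ ?_
    · have h1 := c.mdifferentiable_chart.symm_comp_deriv (c.chart.map_target hw)
      rwa [c.chart.right_inv hw] at h1
    · exact c.mdifferentiable_chart.comp_symm_deriv hw
  have hpull : ∀ X : ∀ x : M, TangentSpace (𝓡 d) x, ∀ w ∈ c.chart.target,
      VectorField.mpullback (𝓡 d) (𝓡 d) c.chart.symm X w = V X w := by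
    intro X w hw
    rw [VectorField.mpullback_apply, hinv w hw]
    rfl
  have hev : ∀ X : ∀ x : M, TangentSpace (𝓡 d) x,
      VectorField.mpullback (𝓡 d) (𝓡 d) c.chart.symm X =ᶠ[nhds (c.chart x)] V X := by
    intro X
    filter_upwards [c.chart.open_target.mem_nhds hz] with w hw
    exact hpull X w hw
  have hmd : ∀ X : ∀ x : M, TangentSpace (𝓡 d) x, SmoothSecOn (d := d) (EuclideanSpace ℝ (Fin d))
      (fun x : M => TangentSpace (𝓡 d) x) X c.chart.source →
      MDifferentiableAt (𝓡 d) (𝓡 d).tangent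
        (fun x => (TotalSpace.mk' (EuclideanSpace ℝ (Fin d)) x (X x) : TangentBundle (𝓡 d) M))
        (c.chart.symm (c.chart x)) := by
    intro X hX
    rw [c.chart.left_inv hx]
    exact (hX.contMDiffAt (c.chart.open_source.mem_nhds hx)).mdifferentiableAt (by simp)
  have hdiff : ∀ X : ∀ x : M, TangentSpace (𝓡 d) x, SmoothSecOn (d := d) (EuclideanSpace ℝ (Fin d))
      (fun x : M => TangentSpace (𝓡 d) x) X c.chart.source →
      DifferentiableAt ℝ (V X) (c.chart x) := by
    intro X hX
    refine differentiableAt_euclidean.mpr fun k => ?_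
    have h1 : ContMDiffOn (𝓡 d) 𝓘(ℝ, ℝ) ∞ (fun w => V X w k) c.chart.target :=
      ((c.contMDiffOn_vcoord hX k).mono fun y hy => ⟨hy, hy⟩).comp
        (contMDiffOn_symm_of_mem_maximalAtlas c.mem_atlas) fun w hw => c.chart.map_target hw
    exact ((contMDiffOn_iff_contDiffOn.mp h1).differentiableOn (by simp)).differentiableAt
      (c.chart.open_target.mem_nhds hz)
  -- Naturality of the Lie bracket under pullback by the inverse chart.
  have h1 := VectorField.mpullback_mlieBracket (n := ∞) (hmd X hX) (hmd Y hY)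
    ((contMDiffOn_symm_of_mem_maximalAtlas c.mem_atlas).contMDiffAt
      (c.chart.open_target.mem_nhds hz)) hn
  have h6 : VectorField.mlieBracket (𝓡 d) (V X) (V Y) (c.chart x) =
      VectorField.lieBracket ℝ (V X) (V Y) (c.chart x) := by
    have h7 : ∀ A B : ∀ w : EuclideanSpace ℝ (Fin d), TangentSpace (𝓡 d) w,
        VectorField.mlieBracket (𝓡 d) A B = VectorField.lieBracket ℝ A B := fun A B => by
      rw [← VectorField.mlieBracketWithin_univ, VectorField.mlieBracketWithin_eq_lieBracketWithin]
      exact VectorField.lieBracketWithin_univ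
    exact congrFun (h7 (V X) (V Y)) (c.chart x)
  rw [hpull _ _ hz, (hev X).mlieBracket_vectorField_eq (hev Y), h6] at h1
  have h2 : ∀ Z : ∀ x : M, TangentSpace (𝓡 d) x, ∀ k, V Z (c.chart x) k = c.vcoord x k (Z x) := by
    intro Z k
    change c.vcoord (c.chart.symm (c.chart x)) k (Z (c.chart.symm (c.chart x))) = _
    rw [c.chart.left_inv hx]
  have h3 : ∀ X Y : ∀ x : M, TangentSpace (𝓡 d) x, DifferentiableAt ℝ (V Y) (c.chart x) →
      fderiv ℝ (V Y) (c.chart x) (V X (c.chart x)) i =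
        ∑ j, c.vcoord x j (X x) * c.D j (fun y => c.vcoord y i (Y y)) x := by
    intro X Y hY
    have h4 : ∀ v, fderiv ℝ (V Y) (c.chart x) v i = fderiv ℝ (fun w => V Y w i) (c.chart x) v :=
      fun v => by
        have := ((EuclideanSpace.proj (𝕜 := ℝ) i).hasFDerivAt.comp (c.chart x)
          hY.hasFDerivAt).fderiv
        exact (congrArg (fun L : EuclideanSpace ℝ (Fin d) →L[ℝ] ℝ => L v) this).symm
    have h5 : V X (c.chart x) = ∑ j, c.vcoord x j (X x) • stdVec j := by
      ext k
      rw [h2]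
      simp [stdVec, Pi.single_apply]
    rw [h4, h5, map_sum]
    exact Finset.sum_congr rfl fun j _ => by rw [map_smul]; rfl
  rw [Finset.sum_sub_distrib, ← h3 X Y (hdiff Y hY), ← h3 Y X (hdiff X hX), ← h2]
  exact congrArg (fun v : EuclideanSpace ℝ (Fin d) => v i) h1

namespace Operations

variable [VectorBundle ℝ F E] [FiniteDimensional ℝ F] [ContMDiffVectorBundle ∞ F E (𝓡 d)]
  [IsManifold (𝓡 d) ∞ M]

namespace Rep

variable {D : Operations (d := d) F E} {c : NatChart (d := d) F E} {f : StrFun c} (h : D.Rep f)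

include h

theorem lieDeriv_eq (e : Cₛ^∞⟮𝓡 d; F, E⟯) (α : DualSec (d := d) F E) (e' : Cₛ^∞⟮𝓡 d; F, E⟯)
    (x : c.dom) :
    D.lieDeriv e α e' x = (∑ m, f.lie (c.sec e) (c.dual α) m * c.sec e' m : c.Coeff) x := by
  have hsm := (α.smooth Set.univ e' isOpen_univ e'.contMDiff.contMDiffOn).mono
    (Set.subset_univ c.chart.source)
  have h1 : c.restr (fun y => α.toFun y (e' y)) hsm = ∑ m, c.dual α m * c.sec e' m := by
    ext y
    rw [c.coeff_sum_apply]
    exact (c.sum_apply_frame_mul_coeff y.2 (α.toFun y) (e' y)).symm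
  have h2 : α.toFun x (D.brk e e' x) =
      (∑ b, c.dual α b * f.brk (c.sec e) (c.sec e') b : c.Coeff) x := by
    rw [c.coeff_sum_apply, ← h.brk]
    exact (c.sum_apply_frame_mul_coeff x.2 (α.toFun x) (D.brk e e' x)).symm
  rw [lieDeriv, h.act_eq x e _ hsm, h1, h2, ← f.act_sum_mul_sub]
  rfl

lemma sec_delSec (α : DualSec (d := d) F E) (b : Fin (finrank ℝ F)) :
    c.sec (D.delSec α) b = ∑ a, f.f₂ a b * c.dual α a := by
  ext x
  rw [c.coeff_sum_apply]
  exact h.coeff_del x b (α.toFun x)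

lemma act_pairing (e : Cₛ^∞⟮𝓡 d; F, E⟯) (α β : DualSec (d := d) F E) (x : c.dom) :
    D.act e (D.pairing α β) x = f.act (c.sec e) (f.pair (c.dual α) (c.dual β)) x := by
  have hsm : ContMDiffOn (𝓡 d) 𝓘(ℝ, ℝ) ∞ (D.pairing α β) c.chart.source :=
    (β.smooth Set.univ _ isOpen_univ (D.del_smooth α)).mono (Set.subset_univ _)
  have h1 : c.restr (D.pairing α β) hsm = f.pair (c.dual α) (c.dual β) := by
    ext y
    exact h.pairing_eq y α β
  rw [h.act_eq x e _ hsm, h1]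

theorem act_pairing_sub (e : Cₛ^∞⟮𝓡 d; F, E⟯) (α β : DualSec (d := d) F E) (x : c.dom) :
    D.act e (D.pairing α β) x - (D.lieDeriv e α (D.delSec β) x + D.lieDeriv e β (D.delSec α) x) =
      ∑ a, ∑ b, (-∑ k, c.sec e k x * f.fc2 a b k x +
        ∑ i, (f.fc1 i b x * c.pd i (c.sec e a) x + f.fc1 i a x * c.pd i (c.sec e b) x)) *
          c.dual α a x * c.dual β b x := by
  have h1 := congrArg (c.evalCoeff x) (f.act_pair_sub (c.sec e) (c.dual α) (c.dual β))
  rw [map_sub, map_add] at h1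
  rw [h.act_pairing, h.lieDeriv_eq, h.lieDeriv_eq]
  simp only [h.sec_delSec]
  refine h1.trans ?_
  simp only [map_sum, map_mul, map_add, map_neg]
  rfl

theorem vcoord_anchor_del (x : c.dom) (i : Fin d) (α : Module.Dual ℝ (E x)) :
    c.vcoord x i (D.anchor x (D.del x α)) = -∑ a, f.fc1 i a x * α (c.frame a x) := by
  rw [h.vcoord_anchor]
  congr 1
  simp only [h.coeff_del, Finset.mul_sum]
  rw [Finset.sum_comm]
  refine Finset.sum_congr rfl fun a _ => ?_
  rw [← c.evalCoeff_apply x (f.fc1 i a), StrFun.fc1, map_sum, Finset.sum_mul]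
  refine Finset.sum_congr rfl fun b _ => ?_
  rw [map_mul, c.evalCoeff_apply, c.evalCoeff_apply, f.f₂_symm b a, mul_assoc]

theorem anchor_del_eq_zero_iff :
    (∀ x : c.dom, D.anchor x ∘ₗ D.del x = 0) ↔ f.FC1 := by
  refine ⟨fun h0 i a => ContMDiffMap.ext fun x => ?_, fun h1 x => ?_⟩
  · have h2 := h.vcoord_anchor_del x i (c.isFrame.coeff a x)
    have h3 : D.anchor x (D.del x (c.isFrame.coeff a x)) = 0 :=
      LinearMap.congr_fun (h0 x) (c.isFrame.coeff a x)
    rw [h3, map_zero, Finset.sum_eq_single a, c.coeff_frame x.2, if_pos rfl, mul_one, eq_comm,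
      neg_eq_zero] at h2
    · exact h2
    · intro b _ hb
      rw [c.coeff_frame x.2, if_neg hb.symm, mul_zero]
    · exact fun ha => absurd (Finset.mem_univ a) ha
  · refine LinearMap.ext fun α => c.ext_of_vcoord x.2 fun i => ?_
    have h4 : ∀ a, f.fc1 i a = 0 := h1 i
    refine (h.vcoord_anchor_del x i α).trans ?_
    rw [LinearMap.zero_apply, map_zero]
    simp only [h4]
    exact neg_eq_zero.mpr (Finset.sum_eq_zero fun a _ => zero_mul _)

/-- The coefficients of `∂Ω(e₁, e₂, e₃)`. -/
lemma coeff_del_contraction (e₁ e₂ e₃ : Cₛ^∞⟮𝓡 d; F, E⟯) (x : c.dom) (b : Fin (finrank ℝ F)) :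
    c.isFrame.coeff b x (D.del x (D.contraction e₁ e₂ e₃ x)) =
      ∑ a, ∑ m, ∑ p, (∑ n, f.f₂ b n x * f.f₄ a m p n x) *
        c.sec e₁ a x * c.sec e₂ m x * c.sec e₃ p x := by
  rw [h.coeff_del]
  have h1 : ∀ n, D.contraction e₁ e₂ e₃ x (c.frame n x) =
      ∑ a, ∑ m, ∑ p, f.f₄ a m p n x * c.sec e₁ a x * c.sec e₂ m x * c.sec e₃ p x := by
    intro n
    have e0 : D.contraction e₁ e₂ e₃ x (c.frame n x) =
        D.Om x ![e₁ x, e₂ x, e₃ x, c.frame n x] := by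
      have : Function.update ![e₁ x, e₂ x, e₃ x, 0] 3 (c.frame n x) =
          ![e₁ x, e₂ x, e₃ x, c.frame n x] := by
        funext i
        fin_cases i <;> rfl
      exact congrArg (D.Om x) this
    rw [e0, h.Om_apply, sum_cons]
    refine Finset.sum_congr rfl fun a _ => ?_
    rw [sum_cons]
    refine Finset.sum_congr rfl fun m _ => ?_
    rw [sum_cons]
    refine Finset.sum_congr rfl fun p _ => ?_
    rw [sum_fun_one, Finset.sum_eq_single n]
    · rw [Fin.prod_univ_four]
      have e1 : c.isFrame.coeff n x (c.frame n x) = 1 := by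
        rw [c.coeff_frame x.2, if_pos rfl]
      change f.f₄ a m p n x * (c.isFrame.coeff a x (e₁ x) * c.isFrame.coeff m x (e₂ x) *
        c.isFrame.coeff p x (e₃ x) * c.isFrame.coeff n x (c.frame n x)) = f.f₄ a m p n x *
          c.isFrame.coeff a x (e₁ x) * c.isFrame.coeff m x (e₂ x) * c.isFrame.coeff p x (e₃ x)
      rw [e1]
      ring
    · intro n' _ hn
      rw [Fin.prod_univ_four]
      have e1 : c.isFrame.coeff n' x (c.frame n x) = 0 := by
        rw [c.coeff_frame x.2, if_neg hn]
      change _ * (_ * c.isFrame.coeff n' x (c.frame n x)) = _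
      rw [e1, mul_zero, mul_zero]
    · exact fun hn => absurd (Finset.mem_univ n) hn
  simp only [h1, Finset.mul_sum, Finset.sum_mul]
  rw [Finset.sum_comm]
  refine Finset.sum_congr rfl fun a _ => ?_
  rw [Finset.sum_comm]
  refine Finset.sum_congr rfl fun m _ => ?_
  rw [Finset.sum_comm]
  refine Finset.sum_congr rfl fun p _ => Finset.sum_congr rfl fun n _ => ?_
  rw [f.f₂_symm b n]
  ring

/-- The coefficients of the defect in the Jacobi identity. -/
theorem coeff_jacobi (e₁ e₂ e₃ : Cₛ^∞⟮𝓡 d; F, E⟯) (x : c.dom) (b : Fin (finrank ℝ F)) :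
    c.isFrame.coeff b x (D.brk (D.brk e₁ e₂) e₃ x + D.brk (D.brk e₂ e₃) e₁ x +
      D.brk (D.brk e₃ e₁) e₂ x) - c.isFrame.coeff b x (D.del x (D.contraction e₁ e₂ e₃ x)) =
    ∑ i, (∑ a, ∑ m, f.fc3 i a m x * c.sec e₁ a x * c.sec e₂ m x) * c.pd i (c.sec e₃ b) x +
    ∑ i, (∑ a, ∑ m, f.fc3 i a m x * c.sec e₂ a x * c.sec e₃ m x) * c.pd i (c.sec e₁ b) x +
    ∑ i, (∑ a, ∑ m, f.fc3 i a m x * c.sec e₃ a x * c.sec e₁ m x) * c.pd i (c.sec e₂ b) x -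
    ∑ a, ∑ m, ∑ p, f.fc4 b ![a, m, p] x * c.sec e₁ a x * c.sec e₂ m x * c.sec e₃ p x := by
  have h1 : ∀ e₁ e₂ e₃ : Cₛ^∞⟮𝓡 d; F, E⟯, c.isFrame.coeff b x (D.brk (D.brk e₁ e₂) e₃ x) =
      c.evalCoeff x (f.brk (f.brk (c.sec e₁) (c.sec e₂)) (c.sec e₃) b) := by
    intro e₁ e₂ e₃
    rw [← h.brk, ← h.brk]
    rfl
  rw [map_add, map_add, h1, h1, h1, ← map_add, ← map_add, StrFun.brk_brk, StrFun.torTor_cyclic,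
    h.coeff_del_contraction]
  simp only [StrFun.curv_eq, map_sum, map_mul, map_add, map_sub, sub_mul, Finset.sum_sub_distrib]
  simp only [c.evalCoeff_apply]
  ring

/-- The anchor is compatible with the brackets if the structure functions satisfy `FC3`. -/
lemma vcoord_anchor_brk (h3 : f.FC3) (e₁ e₂ : Cₛ^∞⟮𝓡 d; F, E⟯) (x : c.dom) (i : Fin d) :
    c.vcoord x i (D.anchor x (D.brk e₁ e₂ x)) =
      -(f.act (c.sec e₁) (∑ a, f.f₁ i a * c.sec e₂ a) -
        f.act (c.sec e₂) (∑ a, f.f₁ i a * c.sec e₁ a) : c.Coeff) x := by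
  have h1 := f.act_sub_act_sub_sum_brk (c.sec e₁) (c.sec e₂) i
  have h2 : ∀ a m, f.fc3 i a m = 0 := h3 i
  simp only [h2, zero_mul, Finset.sum_const_zero] at h1
  rw [h.vcoord_anchor, sub_eq_zero.mp h1, c.coeff_sum_apply, ← h.brk]
  rfl

end Rep

section

variable [T2Space M] [SigmaCompactSpace M]

variable {D : Operations (d := d) F E} {f : ∀ c : NatChart (d := d) F E, StrFun c}
  (h : ∀ c, D.Rep (f c))

include h in
omit [T2Space M] [SigmaCompactSpace M] in
theorem a3_iff : D.A3 ↔ ∀ c, (f c).FC1 := by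
  simp only [← (h _).anchor_del_eq_zero_iff]
  refine ⟨fun h0 c x => h0 x, fun h0 x => ?_⟩
  obtain ⟨c, hx⟩ := NatChart.exists_mem_source (d := d) F E x
  exact h0 c ⟨x, hx⟩

include h in
theorem a3_and_a4_iff : D.A3 ∧ D.A4 ↔ ∀ c, (f c).FC1 ∧ (f c).FC2 := by
  rw [a3_iff h, forall_and]
  refine and_congr_right fun h1 => ⟨fun h4 c a b m => ContMDiffMap.ext fun x => ?_,
    fun h2 e α β x => ?_⟩
  -- First derivatives of `e` vanish at `x`, which removes the `fc1` terms; basis values of `e`,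
  -- `α`, `β` isolate one `fc2`.
  · obtain ⟨e, he, he'⟩ := c.exists_sec_apply x fun k => if k = m then 1 else 0
    obtain ⟨α, hα, -⟩ := c.exists_dual_apply x fun k => if k = a then 1 else 0
    obtain ⟨β, hβ, -⟩ := c.exists_dual_apply x fun k => if k = b then 1 else 0
    have h3 := (h c).act_pairing_sub e α β x
    rw [h4 e α β x, sub_self] at h3
    simp only [he, he', hα, hβ, mul_zero, add_zero, Finset.sum_const_zero, mul_ite, mul_one,
      ite_mul, one_mul, zero_mul, Finset.sum_ite_eq', Finset.mem_univ, if_true] at h3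
    exact neg_eq_zero.mp h3.symm
  · obtain ⟨c, hx⟩ := NatChart.exists_mem_source (d := d) F E x
    have h3 := (h c).act_pairing_sub e α β ⟨x, hx⟩
    have h5 : ∀ i a, (f c).fc1 i a = 0 := h1 c
    have h6 : ∀ a b m, (f c).fc2 a b m = 0 := h2 c
    have h7 : (0 : c.Coeff) ⟨x, hx⟩ = 0 := rfl
    simp only [h5, h6, h7, mul_zero, zero_mul, add_zero, neg_zero, Finset.sum_const_zero] at h3
    exact sub_eq_zero.mp h3

include h in
omit [T2Space M] [SigmaCompactSpace M] in
-- With `FC3` the components of `ρ[e₁, e₂]` are anchor derivatives of the components of `ρ(e₂)` and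
-- `ρ(e₁)`, which is the coordinate formula for the Lie bracket.
theorem a0_of_fc3 (h3 : ∀ c, (f c).FC3) : D.A0 := by
  intro e₁ e₂ x
  obtain ⟨c, hx⟩ := NatChart.exists_mem_source (d := d) F E x
  have hsm : ∀ e : Cₛ^∞⟮𝓡 d; F, E⟯, SmoothSecOn (d := d) (EuclideanSpace ℝ (Fin d))
      (fun x : M => TangentSpace (𝓡 d) x) (fun y => D.anchor y (e y)) c.chart.source := fun e =>
    D.anchor_smooth _ e c.chart.open_source e.contMDiff.contMDiffOn
  refine c.ext_of_vcoord hx fun i => ?_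
  have h1 := (h c).vcoord_anchor_brk (h3 c) e₁ e₂ ⟨x, hx⟩ i
  refine h1.trans ?_
  rw [c.vcoord_mlieBracket hx (hsm e₁) (hsm e₂)]
  have h2 : ∀ (e : Cₛ^∞⟮𝓡 d; F, E⟯) j, c.vcoord x j (D.anchor x (e x)) =
      -(∑ a, (f c).f₁ j a ⟨x, hx⟩ * c.sec e a ⟨x, hx⟩) := fun e j =>
    (h c).vcoord_anchor ⟨x, hx⟩ j (e x)
  have h4 : ∀ (e : Cₛ^∞⟮𝓡 d; F, E⟯) j, c.D j (fun y => c.vcoord y i (D.anchor y (e y))) x =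
      -c.pd j (∑ a, (f c).f₁ i a * c.sec e a) ⟨x, hx⟩ := by
    intro e j
    have h5 : (fun y => c.vcoord y i (D.anchor y (e y))) =ᶠ[nhds x]
        NatChart.ext (-∑ a, (f c).f₁ i a * c.sec e a) := by
      filter_upwards [c.chart.open_source.mem_nhds hx] with y hy
      refine Eq.trans ?_ (NatChart.ext_apply _ ⟨y, hy⟩).symm
      refine ((h c).vcoord_anchor ⟨y, hy⟩ i (e y)).trans ?_
      change _ = -((∑ a, (f c).f₁ i a * c.sec e a : c.Coeff) ⟨y, hy⟩)
      rw [c.coeff_sum_apply]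
      rfl
    rw [c.D_congr hx h5, ← c.pd_apply j _ ⟨x, hx⟩, map_neg]
    rfl
  have h6 : ∀ e e' : Cₛ^∞⟮𝓡 d; F, E⟯, (f c).act (c.sec e) (∑ a, (f c).f₁ i a * c.sec e' a) ⟨x, hx⟩ =
      -∑ j, (∑ a, (f c).f₁ j a ⟨x, hx⟩ * c.sec e a ⟨x, hx⟩) *
        c.pd j (∑ a, (f c).f₁ i a * c.sec e' a) ⟨x, hx⟩ := fun e e' => (f c).act_apply _ _ _
  change -((f c).act (c.sec e₁) (∑ a, (f c).f₁ i a * c.sec e₂ a) ⟨x, hx⟩ -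
    (f c).act (c.sec e₂) (∑ a, (f c).f₁ i a * c.sec e₁ a) ⟨x, hx⟩) = _
  rw [h6, h6]
  simp only [h2, h4, neg_mul_neg, Finset.sum_sub_distrib]
  ring

include h in
-- The Jacobi defect depends on values and first derivatives of the sections: the terms with
-- derivatives have coefficients `fc3`, those without have `fc4`. Sections with prescribed
-- first-order data separate the two.
theorem a2_iff : D.A2 ↔ ∀ c, (f c).FC3 ∧ (f c).FC4 := by
  refine ⟨fun h2 c => ⟨fun i a m => ContMDiffMap.ext fun x => ?_, fun b l =>
    ContMDiffMap.ext fun x => ?_⟩, fun h2 e₁ e₂ e₃ x => ?_⟩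
  · obtain ⟨e₁, he₁, he₁'⟩ := c.exists_sec_apply x fun k => if k = a then 1 else 0
    obtain ⟨e₂, he₂, he₂'⟩ := c.exists_sec_apply x fun k => if k = m then 1 else 0
    -- All components of `e₃` equal `x^i - x^i(x)` near the point: they vanish there and only their
    -- `i`-th derivative is nonzero, so a single `fc3` survives. The component index `a` used below
    -- is just some available index.
    obtain ⟨e₃, he₃⟩ := c.exists_sec x fun _ =>
      c.coordFun i - algebraMap ℝ c.Coeff (c.coordFun i x)
    have h3 : ∀ b, c.sec e₃ b x = 0 := fun b => by
      rw [← NatChart.ext_apply, (he₃ b).eq_of_nhds, NatChart.ext_apply]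
      exact sub_self _
    have h4 : ∀ b j, c.pd j (c.sec e₃ b) x = if i = j then 1 else 0 := fun b j => by
      rw [c.pd_congr (he₃ b), map_sub, c.pd_algebraMap, sub_zero, c.pd_coordFun]
    have h5 := (h c).coeff_jacobi e₁ e₂ e₃ x a
    rw [h2 e₁ e₂ e₃ x, sub_self] at h5
    simp only [h3, h4, he₁, he₁', he₂, he₂', mul_zero, add_zero, sub_zero, Finset.sum_const_zero,
      mul_ite, mul_one, Finset.sum_ite_eq, Finset.sum_ite_eq', Finset.mem_univ, if_true] at h5
    exact h5.symm
  -- Basis values with vanishing first derivatives leave only the `fc4` term.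
  · choose e he he' using fun j => c.exists_sec_apply x fun k => if k = l j then 1 else 0
    have h5 := (h c).coeff_jacobi (e 0) (e 1) (e 2) x b
    rw [h2, sub_self] at h5
    simp only [he, he', mul_zero, add_zero, Finset.sum_const_zero, zero_sub,
      mul_ite, mul_one, Finset.sum_ite_eq', Finset.mem_univ, if_true] at h5
    have h6 : ![l 0, l 1, l 2] = l := by
      funext j
      fin_cases j <;> rfl
    rw [h6] at h5
    exact neg_eq_zero.mp h5.symm
  · obtain ⟨c, hx⟩ := NatChart.exists_mem_source (d := d) F E x
    refine c.ext_of_coeff hx fun b => ?_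
    have h3 := (h c).coeff_jacobi e₁ e₂ e₃ ⟨x, hx⟩ b
    have h5 : ∀ i a b, (f c).fc3 i a b = 0 := (h2 c).1
    have h6 : ∀ b l, (f c).fc4 b l = 0 := (h2 c).2
    have h7 : (0 : c.Coeff) ⟨x, hx⟩ = 0 := rfl
    simp only [h5, h6, h7, zero_mul, add_zero, sub_zero, Finset.sum_const_zero] at h3
    exact sub_eq_zero.mp h3

end

end Operations

end QP3

end

noncomputable section

namespace QP3

variable {d : ℕ} {M : Type*} [TopologicalSpace M] [ChartedSpace (EuclideanSpace ℝ (Fin d)) M]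
variable {F : Type*} [NormedAddCommGroup F] [NormedSpace ℝ F]
variable {E : M → Type*} [TopologicalSpace (TotalSpace F E)] [∀ x, TopologicalSpace (E x)]
  [∀ x, AddCommGroup (E x)] [∀ x, Module ℝ (E x)] [FiberBundle F E]

/-! ### The differential of the 4-form -/

/-- Removing two indices in either order: a sum over ordered pairs of distinct indices, folded. -/
lemma sum_sum_eq_sum_ite {N : Type*} [AddCommMonoid N] (A : Fin 5 → Fin 4 → N) :
    ∑ i, ∑ p, A i p = ∑ i : Fin 5, ∑ p : Fin 4, if (i : ℕ) ≤ p then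
      A i p + A (i.succAbove p) (p.predAbove i) else 0 := by
  -- The map `(i, p) ↦ (i.succAbove p, p.predAbove i)` exchanges the two removed indices. It is an
  -- involution that interchanges the pairs with `i ≤ p` and those without.
  have h1 : ∀ i : Fin 5, ∀ p : Fin 4,
      (((i.succAbove p).succAbove (p.predAbove i) : Fin 5) = i ∧
        (p.predAbove i).predAbove (i.succAbove p) = p) ∧
      (((i.succAbove p : Fin 5) : ℕ) ≤ p.predAbove i ↔ ¬ (i : ℕ) ≤ p) := by decide
  rw [← Fintype.sum_prod_type', ← Fintype.sum_prod_type', ← Finset.sum_filter,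
    Finset.sum_add_distrib,
    ← Finset.sum_filter_add_sum_filter_not Finset.univ (fun x : Fin 5 × Fin 4 => (x.1 : ℕ) ≤ x.2)]
  congr 1
  refine Finset.sum_nbij' (fun x => (x.1.succAbove x.2, x.2.predAbove x.1))
    (fun x => (x.1.succAbove x.2, x.2.predAbove x.1)) ?_ ?_ ?_ ?_ ?_
  · intro x hx
    rw [Finset.mem_filter] at hx ⊢
    exact ⟨Finset.mem_univ _, (h1 x.1 x.2).2.mpr hx.2⟩
  · intro x hx
    rw [Finset.mem_filter] at hx ⊢
    exact ⟨Finset.mem_univ _, fun h => (h1 x.1 x.2).2.mp h hx.2⟩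
  · exact fun x _ => Prod.ext (h1 x.1 x.2).1.1 (h1 x.1 x.2).1.2
  · exact fun x _ => Prod.ext (h1 x.1 x.2).1.1 (h1 x.1 x.2).1.2
  · intro x _
    exact (congrArg₂ A (h1 x.1 x.2).1.1 (h1 x.1 x.2).1.2).symm

lemma neg_one_pow_succAbove_add_predAbove {R : Type*} [Ring R] (i : Fin 5) (p : Fin 4) :
    (-1 : R) ^ (((i.succAbove p : Fin 5) : ℕ) + (p.predAbove i : ℕ)) = -(-1) ^ ((i : ℕ) + p) := by
  have h1 : ∀ i : Fin 5, ∀ p : Fin 4,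
      (((i.succAbove p : Fin 5) : ℕ) + (p.predAbove i : ℕ)) % 2 = ((i : ℕ) + p + 1) % 2 := by decide
  rw [neg_one_pow_eq_pow_mod_two, h1, ← neg_one_pow_eq_pow_mod_two, pow_succ, mul_neg_one]

lemma succAbove_succAbove_predAbove_fin_five (i : Fin 5) (p : Fin 4) :
    (i.succAbove p).succAbove (p.predAbove i) = i := by
  revert i p
  decide

lemma succAbove_of_le_fin_five {i : Fin 5} {p : Fin 4} (h : (i : ℕ) ≤ p) :
    i.succAbove p = p.succ := Fin.succAbove_of_le_castSucc i p h

namespace StrFun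

variable {c : NatChart (d := d) F E} (f : StrFun c)

/-- The 4-form in coordinates. -/
def om (v : Fin 4 → Fin (finrank ℝ F) → c.Coeff) : c.Coeff := ∑ l, f.F4 l * ∏ i, v i (l i)

lemma om_cons (u : Fin (finrank ℝ F) → c.Coeff) (v : Fin 3 → Fin (finrank ℝ F) → c.Coeff) :
    f.om (Fin.cons u v) = ∑ m, u m * ∑ l, f.F4 (Fin.cons m l) * ∏ i, v i (l i) := by
  rw [om, sum_cons]
  refine Finset.sum_congr rfl fun m _ => ?_
  rw [Finset.mul_sum]
  refine Finset.sum_congr rfl fun l _ => ?_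
  rw [Fin.prod_univ_succ]
  simp only [Fin.cons_zero, Fin.cons_succ]
  ring

lemma om_cons_add (u u' : Fin (finrank ℝ F) → c.Coeff)
    (v : Fin 3 → Fin (finrank ℝ F) → c.Coeff) :
    f.om (Fin.cons (u + u') v) = f.om (Fin.cons u v) + f.om (Fin.cons u' v) := by
  simp only [om_cons, Pi.add_apply, add_mul, Finset.sum_add_distrib]

lemma om_cons_sub (u u' : Fin (finrank ℝ F) → c.Coeff)
    (v : Fin 3 → Fin (finrank ℝ F) → c.Coeff) :
    f.om (Fin.cons (u - u') v) = f.om (Fin.cons u v) - f.om (Fin.cons u' v) := by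
  simp only [om_cons, Pi.sub_apply, sub_mul, Finset.sum_sub_distrib]

lemma om_cons_neg (u : Fin (finrank ℝ F) → c.Coeff)
    (v : Fin 3 → Fin (finrank ℝ F) → c.Coeff) :
    f.om (Fin.cons (-u) v) = -f.om (Fin.cons u v) := by
  simp only [om_cons, Pi.neg_apply, neg_mul, Finset.sum_neg_distrib]

lemma om_insertNth (p : Fin 4) (u : Fin (finrank ℝ F) → c.Coeff)
    (v : Fin 3 → Fin (finrank ℝ F) → c.Coeff) :
    f.om (Fin.insertNth p u v) = (-1 : c.Coeff) ^ (p : ℕ) * f.om (Fin.cons u v) := by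
  rw [om_cons, om, sum_insertNth p, Finset.mul_sum]
  refine Finset.sum_congr rfl fun m _ => ?_
  rw [Finset.mul_sum, Finset.mul_sum]
  refine Finset.sum_congr rfl fun l _ => ?_
  rw [Fin.prod_univ_succAbove _ p, f.F4_skew.insertNth]
  simp only [Fin.insertNth_apply_same, Fin.insertNth_apply_succAbove]
  have h1 : ∀ u : c.Coeff, (-1 : ℝ) ^ (p : ℕ) • u = (-1 : c.Coeff) ^ (p : ℕ) * u := fun u => by
    rw [Algebra.smul_def, map_pow, map_neg, map_one]
  rw [h1]
  ring

variable [IsManifold (𝓡 d) ∞ M]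

lemma act_prod (g : Fin (finrank ℝ F) → c.Coeff) : ∀ {n : ℕ} (u : Fin (n + 1) → c.Coeff),
    f.act g (∏ i, u i) = ∑ p, f.act g (u p) * ∏ k, u (p.succAbove k)
  | 0, u => by simp
  | n + 1, u => by
    rw [Fin.prod_univ_succ, act_mul, act_prod g fun i => u i.succ, Fin.sum_univ_succ (n := n + 1),
      Finset.mul_sum]
    congr 1
    refine Finset.sum_congr rfl fun p _ => ?_
    rw [Fin.prod_univ_succ]
    simp only [Fin.succ_succAbove_zero, Fin.succ_succAbove_succ]
    ring

/-- Leibniz rule over the coefficients and the four arguments; bringing the differentiated argument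
to the first slot costs `(-1)^p`. -/
lemma act_om (g : Fin (finrank ℝ F) → c.Coeff) (v : Fin 4 → Fin (finrank ℝ F) → c.Coeff) :
    f.act g (f.om v) = ∑ l, f.act g (f.F4 l) * ∏ i, v i (l i) +
      ∑ p : Fin 4, (-1 : c.Coeff) ^ (p : ℕ) *
        f.om (Fin.cons (fun a => f.act g (v p a)) fun k => v (p.succAbove k)) := by
  simp only [← om_insertNth]
  rw [om, act_sum]
  simp only [act_mul, act_prod, Finset.sum_add_distrib, Finset.mul_sum]
  congr 1
  rw [Finset.sum_comm]
  refine Finset.sum_congr rfl fun p _ => ?_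
  rw [om]
  refine Finset.sum_congr rfl fun l _ => ?_
  rw [Fin.prod_univ_succAbove _ p]
  simp only [Fin.insertNth_apply_same, Fin.insertNth_apply_succAbove]

/-- The differential of the 4-form in coordinates. -/
def delta (g : Fin 5 → Fin (finrank ℝ F) → c.Coeff) : c.Coeff :=
  -(∑ i : Fin 5, (-1) ^ (i : ℕ) * f.act (g i) (f.om fun k => g (i.succAbove k)) +
    ∑ i : Fin 5, ∑ j : Fin 4, if (i : ℕ) ≤ j then
      (-1) ^ ((i : ℕ) + (j + 1)) * f.om (Fin.cons (f.brk (g i) (g j.succ))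
        fun k => g (i.succAbove (j.succAbove k))) else 0)

/-- In the Koszul formula the terms where an anchor differentiates a section cancel against the
anchor terms of the brackets. Derivatives of the coefficients of `Ω` and the bilinear part `tor` of
the brackets remain. -/
lemma delta_eq (g : Fin 5 → Fin (finrank ℝ F) → c.Coeff) :
    f.delta g = -∑ i : Fin 5, (-1) ^ (i : ℕ) *
        ∑ l, f.act (g i) (f.F4 l) * ∏ k, g (i.succAbove k) (l k) +
      (1 / 2 : ℝ) • ∑ i : Fin 5, ∑ p : Fin 4, (-1) ^ ((i : ℕ) + p) *
        f.om (Fin.cons (f.tor (g i) (g (i.succAbove p)))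
          fun k => g (i.succAbove (p.succAbove k))) := by
  let A : Fin 5 → Fin 4 → c.Coeff := fun i p => (-1) ^ ((i : ℕ) + p) *
    f.om (Fin.cons (fun a => f.act (g i) (g (i.succAbove p) a))
      fun k => g (i.succAbove (p.succAbove k)))
  let B : Fin 5 → Fin 4 → c.Coeff := fun i p => (-1) ^ ((i : ℕ) + p) *
    f.om (Fin.cons (f.tor (g i) (g (i.succAbove p))) fun k => g (i.succAbove (p.succAbove k)))
  have h1 : ∀ i : Fin 5, (-1) ^ (i : ℕ) * f.act (g i) (f.om fun k => g (i.succAbove k)) =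
      (-1) ^ (i : ℕ) * ∑ l, f.act (g i) (f.F4 l) * ∏ k, g (i.succAbove k) (l k) + ∑ p, A i p := by
    intro i
    rw [act_om, mul_add]
    refine (add_right_inj _).mpr ?_
    rw [Finset.mul_sum]
    refine Finset.sum_congr rfl fun p _ => ?_
    rw [← mul_assoc, ← pow_add]
  have hA : ∀ (i : Fin 5) (p : Fin 4), A (i.succAbove p) (p.predAbove i) = -((-1) ^ ((i : ℕ) + p) *
      f.om (Fin.cons (fun a => f.act (g (i.succAbove p)) (g i a))
        fun k => g (i.succAbove (p.succAbove k)))) := by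
    intro i p
    simp only [A, neg_one_pow_succAbove_add_predAbove, succAbove_succAbove_predAbove_fin_five,
      Fin.succAbove_succAbove_succAbove_predAbove, neg_mul]
  have hB : ∀ (i : Fin 5) (p : Fin 4), B (i.succAbove p) (p.predAbove i) = B i p := by
    intro i p
    simp only [B, neg_one_pow_succAbove_add_predAbove, succAbove_succAbove_predAbove_fin_five,
      Fin.succAbove_succAbove_succAbove_predAbove, neg_mul]
    rw [tor_skew, om_cons_neg, mul_neg, neg_neg]
  -- For `i ≤ p` the two orders of removal combine and cancel the anchor terms of `brk`, leaving `-B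
  -- i p`. The terms `B` are invariant under the exchange, so the sum over all ordered pairs counts
  -- each twice; hence `1/2`.
  have h2 : ∑ i, ∑ p, A i p + ∑ i : Fin 5, ∑ j : Fin 4, (if (i : ℕ) ≤ j then
      (-1) ^ ((i : ℕ) + (j + 1)) * f.om (Fin.cons (f.brk (g i) (g j.succ))
        fun k => g (i.succAbove (j.succAbove k))) else 0) = -((1 / 2 : ℝ) • ∑ i, ∑ p, B i p) := by
    rw [sum_sum_eq_sum_ite A, sum_sum_eq_sum_ite B, Finset.smul_sum, ← Finset.sum_add_distrib,
      ← Finset.sum_neg_distrib]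
    refine Finset.sum_congr rfl fun i _ => ?_
    rw [Finset.smul_sum, ← Finset.sum_add_distrib, ← Finset.sum_neg_distrib]
    refine Finset.sum_congr rfl fun p _ => ?_
    split_ifs with hip
    · rw [hA, hB, ← two_smul ℝ (B i p), smul_smul, one_div, inv_mul_cancel₀ two_ne_zero, one_smul,
        brk_eq, om_cons_add, om_cons_sub, ← succAbove_of_le_fin_five hip, ← add_assoc, pow_succ]
      simp only [A, B]
      ring
    · simp
  rw [delta, Finset.sum_congr rfl fun i _ => h1 i, Finset.sum_add_distrib, add_assoc, h2]
  simp only [B]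
  ring

omit [IsManifold (𝓡 d) ∞ M] in
lemma det_apply {n : ℕ} (v : Fin n → Fin (finrank ℝ F) → c.Coeff) (l : Fin n → Fin (finrank ℝ F))
    (x : c.dom) : (Matrix.of fun i j => v i (l j)).det x =
      (Matrix.of fun i j => v i (l j) x).det :=
  (c.evalCoeff x).map_det (Matrix.of fun i j => v i (l j))

omit [IsManifold (𝓡 d) ∞ M] in
lemma coeff_sum_mul_det {n : ℕ} {w : (Fin n → Fin (finrank ℝ F)) → c.Coeff} (hw : IsSkew w)
    (v : Fin n → Fin (finrank ℝ F) → c.Coeff) :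
    ∑ l, w l * (Matrix.of fun i j => v i (l j)).det =
      (n.factorial : ℝ) • ∑ l, w l * ∏ i, v i (l i) := by
  ext x
  have h1 : IsSkew fun l => w l x := fun l σ => congrArg (c.evalCoeff x) (hw l σ)
  have h2 := h1.sum_mul_det fun i a => v i a x
  refine Eq.trans ?_ (h2.trans ?_)
  · rw [c.coeff_sum_apply]
    refine Finset.sum_congr rfl fun l _ => ?_
    refine congrArg (w l x * ·) ?_
    exact det_apply v l x
  · change _ = (n.factorial : ℝ) * (∑ l, w l * ∏ i, v i (l i) : c.Coeff) x
    rw [c.coeff_sum_apply]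
    refine congrArg _ (Finset.sum_congr rfl fun l _ => congrArg (w l x * ·) ?_)
    exact (map_prod (c.evalCoeff x) _ _).symm

omit [IsManifold (𝓡 d) ∞ M] in
/-- The expansion of an alternating sum in its first index. -/
lemma sum_cons_mul_det {n : ℕ} (W : Fin (finrank ℝ F) → (Fin n → Fin (finrank ℝ F)) → c.Coeff)
    (g : Fin (n + 1) → Fin (finrank ℝ F) → c.Coeff) :
    ∑ a, ∑ l, W a l * (Matrix.of fun i j => g i ((Fin.cons a l : Fin (n + 1) → _) j)).det =
      ∑ i : Fin (n + 1), (-1) ^ (i : ℕ) * ∑ l, (∑ a, W a l * g i a) *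
        (Matrix.of fun k j => g (i.succAbove k) (l j)).det := by
  have h1 : ∀ a l, (Matrix.of fun i j => g i ((Fin.cons a l : Fin (n + 1) → _) j)).det =
      ∑ i : Fin (n + 1), (-1) ^ (i : ℕ) * g i a *
        (Matrix.of fun k j => g (i.succAbove k) (l j)).det := by
    intro a l
    rw [Matrix.det_succ_column_zero]
    rfl
  simp only [h1, Finset.mul_sum, Finset.sum_mul]
  symm
  rw [Finset.sum_comm, Finset.sum_congr rfl fun l _ => Finset.sum_comm, Finset.sum_comm]
  refine Finset.sum_congr rfl fun a _ => Finset.sum_congr rfl fun l _ =>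
    Finset.sum_congr rfl fun i _ => ?_
  ring

/-- The coefficients of `{θ₁₃, θ₄}`. -/
def fc5 (l : Fin 5 → Fin (finrank ℝ F)) : c.Coeff :=
  (1 / 24 : ℝ) • ∑ k, f.f₁ k (l 0) * c.pd k (f.f₄ (l 1) (l 2) (l 3) (l 4)) +
    (1 / 12 : ℝ) • ∑ m, f.f₃ m (l 0) (l 1) * f.f₄ (l 2) (l 3) (l 4) m

/-- Expanding the determinant once leaves size `4`, expanding it twice leaves size `3`; on skew
coefficients these contribute `4! = 24` and `3! = 6`. With the weights `1/24` and `1/12` the two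
parts of `delta_eq` get the factors `1` and `1/2`. -/
theorem sum_fc5_mul_det (g : Fin 5 → Fin (finrank ℝ F) → c.Coeff) :
    ∑ l, f.fc5 l * (Matrix.of fun i j => g i (l j)).det = f.delta g := by
  have hfirst : ∑ l : Fin 5 → Fin (finrank ℝ F),
      (∑ k, f.f₁ k (l 0) * c.pd k (f.f₄ (l 1) (l 2) (l 3) (l 4))) *
        (Matrix.of fun i j => g i (l j)).det = (24 : ℝ) • -∑ i : Fin 5, (-1) ^ (i : ℕ) *
        ∑ l, f.act (g i) (f.F4 l) * ∏ k, g (i.succAbove k) (l k) := by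
    have hc : ∀ (a : Fin (finrank ℝ F)) (l : Fin 4 → Fin (finrank ℝ F)),
        ∑ k, f.f₁ k ((Fin.cons a l : Fin 5 → Fin (finrank ℝ F)) 0) *
          c.pd k (f.f₄ ((Fin.cons a l : Fin 5 → Fin (finrank ℝ F)) 1)
            ((Fin.cons a l : Fin 5 → Fin (finrank ℝ F)) 2)
            ((Fin.cons a l : Fin 5 → Fin (finrank ℝ F)) 3)
            ((Fin.cons a l : Fin 5 → Fin (finrank ℝ F)) 4)) =
        ∑ k, f.f₁ k a * c.pd k (f.F4 l) := fun _ _ => rfl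
    rw [sum_cons]
    simp only [hc]
    rw [sum_cons_mul_det fun a l => ∑ k, f.f₁ k a * c.pd k (f.F4 l)]
    rw [← Finset.sum_neg_distrib, Finset.smul_sum]
    refine Finset.sum_congr rfl fun i _ => ?_
    have h1 : ∀ l, ∑ a, (∑ k, f.f₁ k a * c.pd k (f.F4 l)) * g i a = -f.act (g i) (f.F4 l) := by
      intro l
      rw [sum_mul_f₁, neg_neg]
      refine Finset.sum_congr rfl fun a _ => ?_
      rw [Finset.sum_mul]
      exact Finset.sum_congr rfl fun k _ => by ring
    have h2 : IsSkew fun l => f.act (g i) (f.F4 l) := fun l σ => by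
      simp only [f.F4_skew l σ, act_smul_right]
    simp only [h1, neg_mul, Finset.sum_neg_distrib, mul_neg, smul_neg]
    rw [coeff_sum_mul_det h2, mul_smul_comm]
    norm_num [Nat.factorial]
  have hsecond : ∑ l : Fin 5 → Fin (finrank ℝ F),
      (∑ m, f.f₃ m (l 0) (l 1) * f.f₄ (l 2) (l 3) (l 4) m) *
        (Matrix.of fun i j => g i (l j)).det =
      (6 : ℝ) • ∑ i : Fin 5, ∑ p : Fin 4, (-1) ^ ((i : ℕ) + p) *
        f.om (Fin.cons (f.tor (g i) (g (i.succAbove p)))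
          fun k => g (i.succAbove (p.succAbove k))) := by
    have h4 : ∀ l : Fin 3 → Fin (finrank ℝ F), ∀ m,
        f.f₄ (l 0) (l 1) (l 2) m = -f.F4 (Fin.cons m l) := by
      intro l m
      change _ = -f.f₄ m (l 0) (l 1) (l 2)
      rw [f.f₄_skew₁ m, f.f₄_skew₂ _ m, f.f₄_skew₃ _ _ m]
      ring
    have hc : ∀ (a : Fin (finrank ℝ F)) (l : Fin 4 → Fin (finrank ℝ F)),
        ∑ m, f.f₃ m ((Fin.cons a l : Fin 5 → Fin (finrank ℝ F)) 0)
          ((Fin.cons a l : Fin 5 → Fin (finrank ℝ F)) 1) *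
          f.f₄ ((Fin.cons a l : Fin 5 → Fin (finrank ℝ F)) 2)
            ((Fin.cons a l : Fin 5 → Fin (finrank ℝ F)) 3)
            ((Fin.cons a l : Fin 5 → Fin (finrank ℝ F)) 4) m =
        ∑ m, f.f₃ m a (l 0) * f.f₄ (l 1) (l 2) (l 3) m := fun _ _ => rfl
    have hc' : ∀ (a b : Fin (finrank ℝ F)) (l : Fin 3 → Fin (finrank ℝ F)),
        ∑ m, f.f₃ m a ((Fin.cons b l : Fin 4 → Fin (finrank ℝ F)) 0) *
          f.f₄ ((Fin.cons b l : Fin 4 → Fin (finrank ℝ F)) 1)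
            ((Fin.cons b l : Fin 4 → Fin (finrank ℝ F)) 2)
            ((Fin.cons b l : Fin 4 → Fin (finrank ℝ F)) 3) m =
        ∑ m, f.f₃ m a b * f.f₄ (l 0) (l 1) (l 2) m := fun _ _ _ => rfl
    rw [sum_cons]
    simp only [hc]
    rw [sum_cons_mul_det fun a l => ∑ m, f.f₃ m a (l 0) * f.f₄ (l 1) (l 2) (l 3) m, Finset.smul_sum]
    refine Finset.sum_congr rfl fun i _ => ?_
    rw [sum_cons]
    simp only [hc']
    rw [sum_cons_mul_det (fun b l => ∑ a, (∑ m, f.f₃ m a b * f.f₄ (l 0) (l 1) (l 2) m) * g i a)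
      fun k => g (i.succAbove k)]
    rw [Finset.mul_sum, Finset.smul_sum]
    refine Finset.sum_congr rfl fun p _ => ?_
    have h5 : ∀ l : Fin 3 → Fin (finrank ℝ F), ∑ b, (∑ a, (∑ m, f.f₃ m a b *
        f.f₄ (l 0) (l 1) (l 2) m) * g i a) * g (i.succAbove p) b =
        ∑ m, f.tor (g i) (g (i.succAbove p)) m * f.F4 (Fin.cons m l) := by
      intro l
      simp only [tor, Finset.sum_mul]
      symm
      rw [Finset.sum_comm]
      refine Finset.sum_congr rfl fun b _ => ?_
      rw [Finset.sum_comm]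
      refine Finset.sum_congr rfl fun a _ => Finset.sum_congr rfl fun m _ => ?_
      rw [h4, f.f₃_skew m a b]
      ring
    have h6 : IsSkew fun l : Fin 3 → Fin (finrank ℝ F) =>
        ∑ m, f.tor (g i) (g (i.succAbove p)) m * f.F4 (Fin.cons m l) := by
      refine IsSkew.of_adjacent fun l s => ?_
      rw [← Finset.sum_neg_distrib]
      refine Finset.sum_congr rfl fun m _ => ?_
      rw [← mul_neg]
      congr 1
      fin_cases s
      · exact f.f₄_skew₂ _ _ _ _
      · exact f.f₄_skew₃ _ _ _ _
    simp only [h5]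
    rw [coeff_sum_mul_det h6, om_cons, pow_add, mul_smul_comm, mul_smul_comm, mul_assoc]
    congr 3
    simp only [Finset.sum_mul, Finset.mul_sum]
    rw [Finset.sum_comm]
    exact Finset.sum_congr rfl fun m _ => Finset.sum_congr rfl fun l _ => by ring
  rw [delta_eq]
  simp only [fc5, add_mul, smul_mul_assoc, Finset.sum_add_distrib, ← Finset.smul_sum]
  rw [hfirst, hsecond, smul_smul, smul_smul]
  norm_num

end StrFun

/-! ### The axiom on the 4-form -/

namespace Operations

variable [VectorBundle ℝ F E] [FiniteDimensional ℝ F] [ContMDiffVectorBundle ∞ F E (𝓡 d)]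
  [IsManifold (𝓡 d) ∞ M]

namespace Rep

variable {D : Operations (d := d) F E} {c : NatChart (d := d) F E} {f : StrFun c} (h : D.Rep f)

include h

lemma Om_eq_om (v : Fin 4 → Cₛ^∞⟮𝓡 d; F, E⟯) (x : c.dom) :
    D.Om x (fun k => v k x) = f.om (fun k => c.sec (v k)) x := by
  rw [h.Om_apply, StrFun.om, c.coeff_sum_apply]
  refine Finset.sum_congr rfl fun l _ => congrArg (f.F4 l x * ·) ?_
  exact (map_prod (c.evalCoeff x) (fun i => c.sec (v i) (l i)) Finset.univ).symm

theorem deltaOm_eq (e : Fin 5 → Cₛ^∞⟮𝓡 d; F, E⟯) (x : c.dom) :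
    D.deltaOm e x = f.delta (fun i => c.sec (e i)) x := by
  have h1 : ∀ i : Fin 5, D.act (e i) (fun y => D.Om y fun k => e (i.succAbove k) y) x =
      f.act (c.sec (e i)) (f.om fun k => c.sec (e (i.succAbove k))) x := by
    intro i
    have hsm := D.Om_smooth c.chart.source (fun k => e (i.succAbove k)) c.chart.open_source
      fun k => (e (i.succAbove k)).contMDiff.contMDiffOn
    have h2 : c.restr _ hsm = f.om fun k => c.sec (e (i.succAbove k)) := by
      ext y
      exact h.Om_eq_om (fun k => e (i.succAbove k)) y
    rw [h.act_eq x (e i) _ hsm, h2]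
  have h3 : ∀ (u : Cₛ^∞⟮𝓡 d; F, E⟯) (v : Fin 3 → Cₛ^∞⟮𝓡 d; F, E⟯),
      D.Om x (Matrix.vecCons (u x) fun k => v k x) =
        f.om (Fin.cons (c.sec u) fun k => c.sec (v k)) x := by
    intro u v
    have h4 : (Matrix.vecCons (u x) fun k => v k x) =
        fun k => (Fin.cons u v : Fin 4 → Cₛ^∞⟮𝓡 d; F, E⟯) k x := by
      funext k
      refine Fin.cases ?_ (fun k => ?_) k <;> rfl
    have h5 : (Fin.cons (c.sec u) fun k => c.sec (v k) : Fin 4 → Fin (finrank ℝ F) → c.Coeff) =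
        fun k => c.sec ((Fin.cons u v : Fin 4 → Cₛ^∞⟮𝓡 d; F, E⟯) k) := by
      funext k
      refine Fin.cases ?_ (fun k => ?_) k <;> rfl
    rw [h4, h5]
    exact h.Om_eq_om _ x
  have h6 : ∀ i : Fin 5, ∀ j : Fin 4, D.Om x (Matrix.vecCons (D.brk (e i) (e j.succ) x)
      fun k => e (i.succAbove (j.succAbove k)) x) =
      f.om (Fin.cons (f.brk (c.sec (e i)) (c.sec (e j.succ)))
        fun k => c.sec (e (i.succAbove (j.succAbove k)))) x := by
    intro i j
    rw [← h.brk]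
    exact h3 _ _
  have h7 : ∀ (n : ℕ) (u : c.Coeff), c.evalCoeff x ((-1) ^ n * u) = (-1) ^ n * u x := fun n u => by
    rw [map_mul, map_pow, map_neg, map_one]
    rfl
  rw [deltaOm, ← c.evalCoeff_apply x, StrFun.delta, map_neg, map_add, map_sum, map_sum]
  simp only [h1, h6, map_sum, apply_ite (c.evalCoeff x), h7, map_zero]

theorem sum_fc5_mul_det (e : Fin 5 → Cₛ^∞⟮𝓡 d; F, E⟯) (x : c.dom) :
    ∑ l : Fin 5 → Fin (finrank ℝ F),
      f.fc5 l x * (Matrix.of fun i j => c.sec (e i) (l j) x).det = D.deltaOm e x := by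
  rw [h.deltaOm_eq e x, ← StrFun.sum_fc5_mul_det, c.coeff_sum_apply]
  refine Finset.sum_congr rfl fun l _ => congrArg (f.fc5 l x * ·) ?_
  exact (StrFun.det_apply (fun i => c.sec (e i)) l x).symm

end Rep

section

variable {D : Operations (d := d) F E} {f : ∀ c : NatChart (d := d) F E, StrFun c}
  {θ₁₃ θ₄ : Families (d := d) F E} (h : ∀ c, D.Rep (f c))

include h in
theorem hasValue_deltaOm (h₁₃ : ∀ c, θ₁₃ c = (f c).theta13) (h₄ : ∀ c, θ₄ c = (f c).theta4)
    (e : Fin 5 → Cₛ^∞⟮𝓡 d; F, E⟯) :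
    HasValue (poisson (poisson (poisson (poisson (poisson (poisson θ₁₃ θ₄)
      (ofSec (e 0))) (ofSec (e 1))) (ofSec (e 2))) (ofSec (e 3))) (ofSec (e 4))) (D.deltaOm e) := by
  intro c x
  have h1 := c.eval_brackets_qForm (fun i => c.sec (e i)) (f c).fc5 x
  rw [(h c).sum_fc5_mul_det e x] at h1
  have h3 : c.bracket (θ₁₃ c) (θ₄ c) = c.qForm (f c).fc5 := by
    rw [h₁₃, h₄, StrFun.bracket_theta13_theta4]
    rfl
  simp only [poisson, NatChart.ofSec_apply, h3]
  refine Eq.trans ?_ (h1.trans ?_)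
  · rfl
  -- The reversal sign for five contractions is `(-1)^10 = 1`.
  · norm_num

variable [T2Space M] [SigmaCompactSpace M]

include h in
-- On sections with basis values at `x` the sum of `fc5` against determinants is an alternating sum
-- of `fc5`, that is, the left-hand side of `FC5`; for general sections it is a combination of these
-- alternating sums.
theorem a5_iff : D.A5 ↔ ∀ c, (f c).FC5 := by
  have h0 : ∀ c, (f c).FC5 ↔ ∀ l, altSum (f c).fc5 l = 0 := fun c => by
    refine forall_congr' fun l => ?_
    unfold StrFun.fc5
    rw [altSum_add, altSum_smul, altSum_smul]
  simp only [h0]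
  refine ⟨fun h5 c l => ContMDiffMap.ext fun x => ?_, fun h5 e x => ?_⟩
  · choose e he he' using fun j => c.exists_sec_apply x (Pi.single (l j) 1)
    have h1 := (h c).sum_fc5_mul_det e x
    rw [h5 e x] at h1
    simp only [he] at h1
    rw [sum_mul_det] at h1
    rw [← c.altSum_eval]
    exact h1
  · obtain ⟨c, hx⟩ := NatChart.exists_mem_source (d := d) F E x
    have h1 := (h c).sum_fc5_mul_det e ⟨x, hx⟩
    rw [sum_mul_det_eq_sum_altSum (fun l => (f c).fc5 l ⟨x, hx⟩)
      fun i a => c.sec (e i) a ⟨x, hx⟩] at h1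
    rw [← h1]
    refine Finset.sum_eq_zero fun l _ => ?_
    rw [c.altSum_eval, h5 c l]
    exact zero_mul _

end

end Operations

end QP3

end

noncomputable section

namespace QP3

variable {d : ℕ} {M : Type*} [TopologicalSpace M] [ChartedSpace (EuclideanSpace ℝ (Fin d)) M]
variable {F : Type*} [NormedAddCommGroup F] [NormedSpace ℝ F]
variable {E : M → Type*} [TopologicalSpace (TotalSpace F E)] [∀ x, TopologicalSpace (E x)]
  [∀ x, AddCommGroup (E x)] [∀ x, Module ℝ (E x)] [FiberBundle F E]
variable [IsManifold (𝓡 d) ∞ M]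

/-! ### The master equation -/

section

variable {θ₂ θ₁₃ θ₄ : Families (d := d) F E} {f : ∀ c : NatChart (d := d) F E, StrFun c}
  (hf : ∀ c, θ₂ c = (f c).theta2 ∧ θ₁₃ c = (f c).theta13 ∧ θ₄ c = (f c).theta4)

include hf

theorem poisson_self_eq_zero_iff :
    poisson (θ₂ + θ₁₃ + θ₄) (θ₂ + θ₁₃ + θ₄) = 0 ↔ poisson θ₁₃ θ₂ = 0 ∧
      (1 / 2 : ℝ) • poisson θ₁₃ θ₁₃ + poisson θ₂ θ₄ = 0 ∧ poisson θ₁₃ θ₄ = 0 := by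
  rw [funext_iff, funext_iff, funext_iff, funext_iff, ← forall_and, ← forall_and]
  refine forall_congr' fun c => ?_
  have h := (f c).bracket_self_eq_zero_iff
  rw [← (hf c).1, ← (hf c).2.1, ← (hf c).2.2] at h
  exact h

theorem poisson_theta13_theta2_eq_zero_iff :
    poisson θ₁₃ θ₂ = 0 ↔ ∀ c, (f c).FC1 ∧ (f c).FC2 := by
  rw [funext_iff]
  refine forall_congr' fun c => ?_
  rw [← StrFun.bracket_theta13_theta2_eq_zero_iff, ← (hf c).1, ← (hf c).2.1]
  rfl

theorem half_poisson_add_eq_zero_iff :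
    (1 / 2 : ℝ) • poisson θ₁₃ θ₁₃ + poisson θ₂ θ₄ = 0 ↔ ∀ c, (f c).FC3 ∧ (f c).FC4 := by
  rw [funext_iff]
  refine forall_congr' fun c => ?_
  rw [← StrFun.half_bracket_theta13_theta13_add_eq_zero_iff, ← (hf c).1, ← (hf c).2.1,
    ← (hf c).2.2]
  rfl

theorem poisson_theta13_theta4_eq_zero_iff : poisson θ₁₃ θ₄ = 0 ↔ ∀ c, (f c).FC5 := by
  rw [funext_iff]
  refine forall_congr' fun c => ?_
  rw [← StrFun.bracket_theta13_theta4_eq_zero_iff, ← (hf c).2.1, ← (hf c).2.2]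
  rfl

theorem poisson_self_eq_zero_iff_structure :
    poisson (θ₂ + θ₁₃ + θ₄) (θ₂ + θ₁₃ + θ₄) = 0 ↔
      ∀ c, (f c).FC1 ∧ (f c).FC2 ∧ (f c).FC3 ∧ (f c).FC4 ∧ (f c).FC5 := by
  rw [poisson_self_eq_zero_iff hf, poisson_theta13_theta2_eq_zero_iff hf,
    half_poisson_add_eq_zero_iff hf, poisson_theta13_theta4_eq_zero_iff hf, ← forall_and,
    ← forall_and]
  exact forall_congr' fun c => by tauto

end

namespace Operations

variable [VectorBundle ℝ F E] [FiniteDimensional ℝ F] [ContMDiffVectorBundle ∞ F E (𝓡 d)]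
  [T2Space M] [SigmaCompactSpace M]

variable {θ₂ θ₁₃ θ₄ : Families (d := d) F E} {f : ∀ c : NatChart (d := d) F E, StrFun c}
  (hf : ∀ c, θ₂ c = (f c).theta2 ∧ θ₁₃ c = (f c).theta13 ∧ θ₄ c = (f c).theta4)
  {D : Operations (d := d) F E}

include hf

omit [T2Space M] [SigmaCompactSpace M] in
theorem hasValue_lieDeriv (h : ∀ c, D.Rep (f c)) (e : Cₛ^∞⟮𝓡 d; F, E⟯)
    (α : DualSec (d := d) F E) (e' : Cₛ^∞⟮𝓡 d; F, E⟯) :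
    HasValue (poisson (poisson (poisson θ₁₃ (ofSec e)) (ofDual α)) (ofSec e'))
      (D.lieDeriv e α e') := by
  intro c x
  simp only [poisson, NatChart.ofSec_apply, NatChart.ofDual_apply, (hf c).2.1,
    StrFun.bracket_bracket_theta13_covForm_secForm, NatChart.eval_coef]
  rw [(h c).lieDeriv_eq]
  rfl

theorem DerivedFrom.poisson_self_eq_zero_iff_axioms (hD : D.DerivedFrom θ₂ θ₁₃ θ₄) :
    poisson (θ₂ + θ₁₃ + θ₄) (θ₂ + θ₁₃ + θ₄) = 0 ↔ D.Axioms := by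
  have h : ∀ c, D.Rep (f c) := fun c => rep_of_derivedFrom (hf c) hD
  rw [poisson_self_eq_zero_iff hf, poisson_theta13_theta2_eq_zero_iff hf,
    half_poisson_add_eq_zero_iff hf, poisson_theta13_theta4_eq_zero_iff hf, ← a3_and_a4_iff h,
    ← a2_iff h, ← a5_iff h, Axioms]
  have h1 := a1_of_rep h
  tauto

end Operations

end QP3

end

/-! ### The main theorem -/

theorem mainTheorem1 {d : ℕ} {M : Type*} [TopologicalSpace M]
    [ChartedSpace (EuclideanSpace ℝ (Fin d)) M] [IsManifold (𝓡 d) ∞ M] [T2Space M]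
    [SigmaCompactSpace M]
    (F : Type*) [NormedAddCommGroup F] [NormedSpace ℝ F] [FiniteDimensional ℝ F]
    (E : M → Type*) [TopologicalSpace (TotalSpace F E)] [∀ x, TopologicalSpace (E x)]
    [∀ x, AddCommGroup (E x)] [∀ x, Module ℝ (E x)] [FiberBundle F E] [VectorBundle ℝ F E]
    [ContMDiffVectorBundle ∞ F E (𝓡 d)] :
    -- the unique decomposition of a function of degree 4 by bidegree
    (∀ Θ : Families (d := d) F E, Θ ∈ degreePart F E 4 ↔
      ∃ θ₂ ∈ bidegreePart F E 4 0, ∃ θ₁₃ ∈ bidegreePart F E 2 2, ∃ θ₄ ∈ bidegreePart F E 0 4,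
        Θ = θ₂ + θ₁₃ + θ₄) ∧
    (∀ θ₂ ∈ bidegreePart (d := d) F E 4 0, ∀ θ₁₃ ∈ bidegreePart (d := d) F E 2 2,
      ∀ θ₄ ∈ bidegreePart (d := d) F E 0 4,
      ∀ θ₂' ∈ bidegreePart (d := d) F E 4 0, ∀ θ₁₃' ∈ bidegreePart (d := d) F E 2 2,
      ∀ θ₄' ∈ bidegreePart (d := d) F E 0 4,
      θ₂ + θ₁₃ + θ₄ = θ₂' + θ₁₃' + θ₄' → θ₂ = θ₂' ∧ θ₁₃ = θ₁₃' ∧ θ₄ = θ₄') ∧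
    (∀ θ₂ ∈ bidegreePart (d := d) F E 4 0, ∀ θ₁₃ ∈ bidegreePart (d := d) F E 2 2,
      ∀ θ₄ ∈ bidegreePart (d := d) F E 0 4,
      -- the three bidegree components of the master equation
      (poisson (θ₂ + θ₁₃ + θ₄) (θ₂ + θ₁₃ + θ₄) = 0 ↔
        poisson θ₁₃ θ₂ = 0 ∧
        (1 / 2 : ℝ) • poisson θ₁₃ θ₁₃ + poisson θ₂ θ₄ = 0 ∧
        poisson θ₁₃ θ₄ = 0) ∧
      -- the identities between the structure functions, in all natural coordinates
      (∀ c : NatChart (d := d) F E,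
        ∃! f : StrFun c, θ₂ c = f.theta2 ∧ θ₁₃ c = f.theta13 ∧ θ₄ c = f.theta4) ∧
      (∀ (c : NatChart (d := d) F E) (f : StrFun c),
        θ₂ c = f.theta2 → θ₁₃ c = f.theta13 → θ₄ c = f.theta4 →
        (poisson θ₁₃ θ₂ c = 0 ↔ f.FC1 ∧ f.FC2) ∧
        (((1 / 2 : ℝ) • poisson θ₁₃ θ₁₃ + poisson θ₂ θ₄) c = 0 ↔ f.FC3 ∧ f.FC4) ∧
        (poisson θ₁₃ θ₄ c = 0 ↔ f.FC5)) ∧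
      (poisson (θ₂ + θ₁₃ + θ₄) (θ₂ + θ₁₃ + θ₄) = 0 ↔
        ∀ (c : NatChart (d := d) F E) (f : StrFun c),
          θ₂ c = f.theta2 → θ₁₃ c = f.theta13 → θ₄ c = f.theta4 →
          f.FC1 ∧ f.FC2 ∧ f.FC3 ∧ f.FC4 ∧ f.FC5) ∧
      -- the induced operations, and the master equation in terms of them
      (∃! D : Operations (d := d) F E, D.DerivedFrom θ₂ θ₁₃ θ₄) ∧
      (∀ D : Operations (d := d) F E, D.DerivedFrom θ₂ θ₁₃ θ₄ →
        D.A1 ∧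
        (∀ e α e', HasValue (poisson (poisson (poisson θ₁₃ (ofSec e)) (ofDual α)) (ofSec e'))
          (D.lieDeriv e α e')) ∧
        (∀ e : Fin 5 → Cₛ^∞⟮𝓡 d; F, E⟯,
          HasValue (poisson (poisson (poisson (poisson (poisson (poisson θ₁₃ θ₄)
            (ofSec (e 0))) (ofSec (e 1))) (ofSec (e 2))) (ofSec (e 3))) (ofSec (e 4)))
            (D.deltaOm e)) ∧
        (poisson θ₁₃ θ₂ = 0 ↔ D.A3 ∧ D.A4) ∧
        ((1 / 2 : ℝ) • poisson θ₁₃ θ₁₃ + poisson θ₂ θ₄ = 0 ↔ D.A2) ∧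
        (poisson θ₁₃ θ₄ = 0 ↔ D.A5) ∧
        (poisson (θ₂ + θ₁₃ + θ₄) (θ₂ + θ₁₃ + θ₄) = 0 ↔ D.Axioms) ∧
        (D.Axioms → D.A0))) ∧
    -- the correspondence between Q-structures and Lie algebroids up to homotopy
    (∃ Φ : {Θ : Families (d := d) F E // Θ ∈ degreePart F E 4 ∧ poisson Θ Θ = 0} ≃
        {D : Operations (d := d) F E // D.Axioms},
      ∀ Θ, ∃ θ₂ ∈ bidegreePart F E 4 0, ∃ θ₁₃ ∈ bidegreePart F E 2 2,
        ∃ θ₄ ∈ bidegreePart F E 0 4,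
        Θ.1 = θ₂ + θ₁₃ + θ₄ ∧ (Φ Θ).1.DerivedFrom θ₂ θ₁₃ θ₄) := by
  refine ⟨mem_degreePart_four_iff, fun θ₂ h₂ θ₁₃ h₁₃ θ₄ h₄ θ₂' h₂' θ₁₃' h₁₃' θ₄' h₄' h =>
    components_unique h₂ h₁₃ h₄ h₂' h₁₃' h₄' h, fun θ₂ h₂ θ₁₃ h₁₃ θ₄ h₄ => ?_, ?_⟩
  · have hex := existsUnique_strFun_of_mem h₂ h₁₃ h₄
    choose f hf huniq using hex
    obtain ⟨D₀, hD₀⟩ := Operations.exists_derivedFrom h₂ h₁₃ h₄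
    refine ⟨poisson_self_eq_zero_iff hf, existsUnique_strFun_of_mem h₂ h₁₃ h₄,
      fun c g h2 h13 h4 => ⟨?_, ?_, ?_⟩, ?_, ⟨D₀, hD₀, fun D hD => hD.unique h₂ h₁₃ h₄ hD₀⟩,
      fun D hD => ?_⟩
    · rw [← g.bracket_theta13_theta2_eq_zero_iff, ← h2, ← h13]
      rfl
    · rw [← g.half_bracket_theta13_theta13_add_eq_zero_iff, ← h2, ← h13, ← h4]
      rfl
    · rw [← g.bracket_theta13_theta4_eq_zero_iff, ← h13, ← h4]
      rfl
    · rw [poisson_self_eq_zero_iff_structure hf]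
      refine ⟨fun h c g h2 h13 h4 => ?_, fun h c => h c (f c) (hf c).1 (hf c).2.1 (hf c).2.2⟩
      -- Uniqueness of the structure functions replaces an arbitrary representative `g` by the
      -- chosen `f c`.
      rw [huniq c g ⟨h2, h13, h4⟩]
      exact h c
    · have h : ∀ c, D.Rep (f c) := fun c => Operations.rep_of_derivedFrom (hf c) hD
      refine ⟨Operations.a1_of_rep h, Operations.hasValue_lieDeriv hf h,
        Operations.hasValue_deltaOm h (fun c => (hf c).2.1) (fun c => (hf c).2.2), ?_, ?_, ?_,
        hD.poisson_self_eq_zero_iff_axioms hf, fun hA => ?_⟩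
      · rw [poisson_theta13_theta2_eq_zero_iff hf, Operations.a3_and_a4_iff h]
      · rw [half_poisson_add_eq_zero_iff hf, Operations.a2_iff h]
      · rw [poisson_theta13_theta4_eq_zero_iff hf, Operations.a5_iff h]
      · exact Operations.a0_of_fc3 h fun c => ((Operations.a2_iff h).mp hA.2.1 c).1
  · have hdec : ∀ Θ : {Θ : Families (d := d) F E // Θ ∈ degreePart F E 4 ∧ poisson Θ Θ = 0},
        ∃ D : {D : Operations (d := d) F E // D.Axioms}, ∃ θ₂ ∈ bidegreePart F E 4 0,
          ∃ θ₁₃ ∈ bidegreePart F E 2 2, ∃ θ₄ ∈ bidegreePart F E 0 4,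
          Θ.1 = θ₂ + θ₁₃ + θ₄ ∧ D.1.DerivedFrom θ₂ θ₁₃ θ₄ := by
      rintro ⟨Θ, hΘ, h0⟩
      obtain ⟨θ₂, h₂, θ₁₃, h₁₃, θ₄, h₄, rfl⟩ := (mem_degreePart_four_iff Θ).mp hΘ
      obtain ⟨D, hD⟩ := Operations.exists_derivedFrom h₂ h₁₃ h₄
      choose f hf _ using existsUnique_strFun_of_mem h₂ h₁₃ h₄
      exact ⟨⟨D, (hD.poisson_self_eq_zero_iff_axioms hf).mp h0⟩, θ₂, h₂, θ₁₃, h₁₃, θ₄, h₄, rfl, hD⟩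
    choose Φ hΦ using hdec
    -- For injectivity, the operations determine the three components of `Θ`. For surjectivity, (A1)
    -- yields components from which `D` is derived, the axioms give the master equation for their
    -- sum, and uniqueness of the components and of the derived operations identifies the image with
    -- `D`.
    refine ⟨Equiv.ofBijective Φ ⟨fun Θ Θ' hΘ => ?_, fun D => ?_⟩, hΦ⟩
    · obtain ⟨θ₂, h₂, θ₁₃, h₁₃, θ₄, h₄, h, hD⟩ := hΦ Θ
      obtain ⟨θ₂', h₂', θ₁₃', h₁₃', θ₄', h₄', h', hD'⟩ := hΦ Θ'
      rw [hΘ] at hD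
      obtain ⟨rfl, rfl, rfl⟩ := hD.theta_unique h₂ h₁₃ h₄ h₂' h₁₃' h₄' hD'
      exact Subtype.ext (h.trans h'.symm)
    · obtain ⟨θ₂, h₂, θ₁₃, h₁₃, θ₄, h₄, hD⟩ := Operations.exists_theta D.2.1
      choose f hf _ using existsUnique_strFun_of_mem h₂ h₁₃ h₄
      let Θ : {Θ : Families (d := d) F E // Θ ∈ degreePart F E 4 ∧ poisson Θ Θ = 0} :=
        ⟨θ₂ + θ₁₃ + θ₄, (mem_degreePart_four_iff _).mpr ⟨θ₂, h₂, θ₁₃, h₁₃, θ₄, h₄, rfl⟩,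
          (hD.poisson_self_eq_zero_iff_axioms hf).mpr D.2⟩
      refine ⟨Θ, Subtype.ext ?_⟩
      obtain ⟨θ₂', h₂', θ₁₃', h₁₃', θ₄', h₄', h', hD'⟩ := hΦ Θ
      obtain ⟨rfl, rfl, rfl⟩ := components_unique h₂ h₁₃ h₄ h₂' h₁₃' h₄' h'
      exact hD'.unique h₂ h₁₃ h₄ hD
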